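/- **Setting.** A space of homogeneous type $(S,d,\mu)$ with constants $c_d,c_\mu\ge 1$ is a set $S$ with a quasi-metric $d$ (a metric, except that the triangle inequality is replaced by $d(s,t)\le c_d(d(s,u)+d(u,t))$) and a measure $\mu$ on the Borel sets of $(S,d)$ such that all balls $B(s,\rho)=\{t: d(s,t)<\rho\}$, $\rho>0$, are Borel, $0<\mu(B(s,\rho))<\infty$, and $\mu(B(s,2\rho))\le c_\mu\,\mu(B(s,\rho))$. A set or function is boundedly supported if it, respectively its support, lies in a ball. A dyadic system with parameters $c_0,C_0,\delta$ consists, for each $k\in\mathbb Z$, of a partition of $S$ into measurable cubes $Q_j^k$ with centers $z_j^k$ such that $B(z_j^k,c_0\delta^k)\subseteq Q_j^k\subseteq B(z_j^k,C_0\delta^k)$ and such that, for $k\ge l$, each cube of generation $k$ is either disjoint from or contained in any given cube of generation $l$. Dyadic systems $\mathscr D^1,\dots,\mathscr D^m$ on $S$ with the same parameters are called adjacent with constant $\gamma$ if every ball $B(s,\rho)$ is contained in some $Q\in\bigcup_j\mathscr D^j$ with $\operatorname{diam}Q\le\gamma\rho$. A collection $\mathcal S$ of cubes is $\eta$-sparse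 if there are pairwise disjoint measurable sets $E_Q\subseteq Q$, $Q\in\mathcal S$, with $\mu(E_Q)\ge\eta\,\mu(Q)$. Write $\langle g\rangle_{q,E}=\big(\frac1{\mu(E)}\int_E g^q\,d\mu\big)^{1/q}$ for $g\geq 0$. Let $X,Y$ be Banach spaces. Let $K:\{(s,t)\in S\times S: s\ne t\}\to\mathcal L(X,Y)$ be strongly measurable in the strong operator topology. It is a Dini kernel with constant $c_K\ge2$ and modulus $\omega$ if $$\|K(s,t)-K(s,t')\|\le \omega\Big(\tfrac{d(t,t')}{d(s,t)}\Big)\tfrac1{\mu(B(s,d(s,t)))},\qquad 0<d(t,t')\le\tfrac1{c_K}d(s,t),$$ $$\|K(s,t)-K(s',t)\|\le \omega\Big(\tfrac{d(s,s')}{d(s,t)}\Big)\tfrac1{\mu(B(s,d(s,t)))},\qquad 0<d(s,s')\le\tfrac1{c_K}d(s,t),$$ where $\omega:[0,1]\to[0,\infty)$ is non-decreasing and subadditive, $\omega(0)=0$, and $\|K\|_{\mathrm{Dini}}:=\int_0^1\omega(t)\frac{dt}t<\infty$. A bounded linear operator $T:L^{p_0}(S;X)\to L^{p_0,\infty}(S;Y)$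 has kernel $K$ if for every boundedly supported $f\in L^{p_0}(S;X)$ and a.e. $s\in S\setminus\overline{\operatorname{supp}f}$ one has $Tf(s)=\int_S K(s,t)f(t)\,d\mu(t)$, as a convergent Bochner integral. A weight is a measurable, locally integrable $w:S\to(0,\infty)$; for $p\in(1,\infty)$, $w\in A_p$ means $[w]_{A_p}:=\sup_B\langle w\rangle_{1,B}\langle w^{-1}\rangle_{\frac1{p-1},B}<\infty$, the supremum being over all balls $B$. **Theorem.** Let $c_d,c_\mu\ge1$. There are $m\in\mathbb N$, $0<c_0\le C_0$, $0<\delta<1$ and $\gamma\ge1$, depending only on $c_d,c_\mu$, such that every space of homogeneous type with constants $c_d,c_\mu$ has $m$ dyadic systems with parameters $c_0,C_0,\delta$ that are adjacent with constant $\gamma$, and the following holds. Let $(S,d,\mu)$ be a space of homogeneous type with constants $c_d,c_\mu$, let $X,Y$ be Banach spaces, $p_0\in[1,\infty)$, and let $T$ be a bounded linear operator from $L^{p_0}(S;X)$ to $L^{p_0,\infty}(S;Y)$ with Dini kernel $K$. Put $C_T:=\|T\|_{L^{p_0}(S;X)\to L^{p_0,\infty}(S;Y)}+\|K\|_{\mathrm{Dini}}$.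 Then: 1. The restriction of $T$ to $L^{p_0}(S;X)\cap L^1(S;X)$ extends (uniquely) to a bounded linear operator, again denoted $T$, from $L^1(S;X)$ to $L^{1,\infty}(S;Y)$. For all $m$-tuples $\mathscr D^1,\dots,\mathscr D^m$ of dyadic systems on $S$ with parameters $c_0,C_0,\delta$ that are adjacent with constant $\gamma$, and every boundedly supported $f\in L^1(S;X)$, there is an $\eta$-sparse collection of cubes $\mathcal S\subseteq\bigcup_{j}\mathscr D^j$ such that $$\|Tf(s)\|_Y\le C\,C_T\sum_{Q\in\mathcal S}\langle\|f\|_X\rangle_{1,Q}\mathbf 1_Q(s)\qquad\text{for a.e. }s\in S.$$ Here $\eta\in(0,1)$ depends only on $c_d,c_\mu,c_K$, and $C$ only on $c_d,c_\mu,c_K,p_0$. 2. For all $p\in(1,\infty)$ and $w\in A_p$ the restriction of $T$ to $L^{p_0}(S;X)\cap L^p(S,w;X)$ extends (uniquely) to a bounded linear operator from $L^p(S,w;X)$ to $L^p(S,w;Y)$ with $$\|T\|_{L^p(S,w;X)\to L^p(S,w;Y)}\le C'\,C_T\,[w]_{A_p}^{\max\{\frac1{p-1},1\}},$$ where $C'$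 depends only on $c_d,c_\mu,c_K,p_0,p$. -/

import Mathlib

open MeasureTheory Set Function
open scoped ENNReal NNReal

universe u v w x

namespace SparseDini

/-! ### Spaces of homogeneous type -/

/-- The ball `B(s, ρ) = {t : d(s, t) < ρ}`. -/
def qball {S : Type u} (d : S → S → ℝ) (s : S) (ρ : ℝ) : Set S := {t | d s t < ρ}

/-- The topology of a quasi-metric: `U` is open iff it contains a ball around each of its points. -/
@[reducible] def quasiTopology {S : Type u} (d : S → S → ℝ) : TopologicalSpace S where
  IsOpen U := ∀ s ∈ U, ∃ ρ : ℝ, 0 < ρ ∧ qball d s ρ ⊆ U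
  isOpen_univ := fun _ _ => ⟨1, one_pos, subset_univ _⟩
  isOpen_inter := by
    rintro U V hU hV s ⟨hsU, hsV⟩
    obtain ⟨a, ha, hUa⟩ := hU s hsU
    obtain ⟨b, hb, hVb⟩ := hV s hsV
    refine ⟨min a b, lt_min ha hb, fun t ht => ⟨hUa ?_, hVb ?_⟩⟩
    · exact lt_of_lt_of_le (show d s t < min a b from ht) (min_le_left _ _)
    · exact lt_of_lt_of_le (show d s t < min a b from ht) (min_le_right _ _)
  isOpen_sUnion := by
    rintro F hF s ⟨U, hU, hs⟩
    obtain ⟨ρ, hρ, h⟩ := hF U hU s hs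
    exact ⟨ρ, hρ, h.trans (subset_sUnion_of_mem hU)⟩

/-- `d` is a quasi-metric on `S` with quasi-metric constant `cd`. -/
structure IsQuasiMetric {S : Type u} (d : S → S → ℝ) (cd : ℝ) : Prop where
  nonneg : ∀ s t, 0 ≤ d s t
  eq_zero_iff : ∀ s t, d s t = 0 ↔ s = t
  symm : ∀ s t, d s t = d t s
  triangle : ∀ s t r, d s t ≤ cd * (d s r + d r t)

/-- `(S, d, μ)` is a space of homogeneous type with quasi-metric constant `cd` and doubling
constant `cμ`: `μ` is a measure on the Borel sets of `(S, d)`, balls are Borel sets with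
`0 < μ B < ∞`, and `μ` is doubling. -/
structure IsHomogeneousType {S : Type u} [mS : MeasurableSpace S] (d : S → S → ℝ)
    (μ : Measure S) (cd : ℝ) (cμ : ℝ≥0) : Prop where
  quasiMetric : IsQuasiMetric d cd
  borel : mS = @borel S (quasiTopology d)
  measurableSet_qball : ∀ s ρ, MeasurableSet (qball d s ρ)
  measure_qball_pos : ∀ s ρ, 0 < ρ → 0 < μ (qball d s ρ)
  measure_qball_lt_top : ∀ s ρ, μ (qball d s ρ) < ∞
  doubling : ∀ s ρ, 0 < ρ → μ (qball d s (2 * ρ)) ≤ cμ * μ (qball d s ρ)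

/-! ### Dyadic systems and sparse collections of cubes -/

/-- A dyadic system in `(S, d)` with parameters `c₀`, `C₀`, `δ`: for each generation `k` a partition
of `S` into measurable cubes `cube k j`, `j ∈ J k`, with centers `center k j`. -/
structure DyadicSystem {S : Type u} [MeasurableSpace S] (d : S → S → ℝ) (c₀ C₀ δ : ℝ) where
  J : ℤ → Type u
  cube : (k : ℤ) → J k → Set S
  center : (k : ℤ) → J k → S
  measurableSet_cube : ∀ k j, MeasurableSet (cube k j)
  pairwise_disjoint : ∀ k, Pairwise (Disjoint on (cube k))
  iUnion_cube : ∀ k, ⋃ j, cube k j = univ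
  nested : ∀ k l : ℤ, l ≤ k → ∀ (i : J k) (j : J l),
    Disjoint (cube k i) (cube l j) ∨ cube k i ⊆ cube l j
  qball_subset_cube : ∀ k j, qball d (center k j) (c₀ * δ ^ k) ⊆ cube k j
  cube_subset_qball : ∀ k j, cube k j ⊆ qball d (center k j) (C₀ * δ ^ k)

/-- The set `Q` is a cube of the dyadic system `D`. -/
def DyadicSystem.IsCube {S : Type u} [MeasurableSpace S] {d : S → S → ℝ} {c₀ C₀ δ : ℝ}
    (D : DyadicSystem d c₀ C₀ δ) (Q : Set S) : Prop :=
  ∃ (k : ℤ) (j : D.J k), Q = D.cube k j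

/-- The dyadic systems `D 0, …, D (m - 1)` are adjacent with constant `γ`: every ball of radius `ρ`
is contained in a cube of one of them, of diameter at most `γ * ρ`. -/
def IsAdjacent {S : Type u} [MeasurableSpace S] {d : S → S → ℝ} {c₀ C₀ δ : ℝ} {m : ℕ}
    (D : Fin m → DyadicSystem d c₀ C₀ δ) (γ : ℝ) : Prop :=
  ∀ (s : S) (ρ : ℝ), 0 < ρ → ∃ (j : Fin m) (Q : Set S), (D j).IsCube Q ∧
    qball d s ρ ⊆ Q ∧ ∀ t ∈ Q, ∀ t' ∈ Q, d t t' ≤ γ * ρ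

/-- The collection `𝒮` of sets is `η`-sparse. -/
def IsSparse {S : Type u} [MeasurableSpace S] (μ : Measure S) (η : ℝ≥0) (𝒮 : Set (Set S)) : Prop :=
  ∃ E : Set S → Set S,
    (∀ Q ∈ 𝒮, E Q ⊆ Q ∧ MeasurableSet (E Q) ∧ η * μ Q ≤ μ (E Q)) ∧ 𝒮.PairwiseDisjoint E

/-- The average `⟨g⟩_{q,E} = ((1/μ(E)) ∫_E g ^ q dμ) ^ (1/q)` of a nonnegative function. -/
noncomputable def avg {S : Type u} [MeasurableSpace S] (μ : Measure S) (g : S → ℝ≥0∞) (q : ℝ)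
    (E : Set S) : ℝ≥0∞ :=
  (⨍⁻ s in E, g s ^ q ∂μ) ^ (1 / q)

/-- The sparse operator `∑_{Q ∈ 𝒮} ⟨‖f‖⟩_{1,Q} 1_Q(s)`. -/
noncomputable def sparseOp {S : Type u} [MeasurableSpace S] {X : Type v} [NormedAddCommGroup X]
    (μ : Measure S) (𝒮 : Set (Set S)) (f : S → X) (s : S) : ℝ≥0∞ :=
  ∑' Q : 𝒮, (Q : Set S).indicator (fun _ => avg μ (fun t => ‖f t‖ₑ) 1 Q) s

/-! ### Muckenhoupt weights -/

/-- A weight: a measurable, locally integrable function with values in `(0, ∞)`. -/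
structure IsWeight {S : Type u} [MeasurableSpace S] (d : S → S → ℝ) (μ : Measure S)
    (a : S → ℝ≥0) : Prop where
  measurable : Measurable a
  pos : ∀ s, 0 < a s
  integrable_qball : ∀ s ρ, ∫⁻ t in qball d s ρ, a t ∂μ < ∞

/-- The `A_p`-characteristic `sup_B ⟨w⟩_{1,B} ⟨w⁻¹⟩_{1/(p-1),B}` of `w = a`, for `p ∈ (1, ∞)`. -/
noncomputable def apChar {S : Type u} [MeasurableSpace S] (d : S → S → ℝ) (μ : Measure S)
    (p : ℝ) (a : S → ℝ≥0) : ℝ≥0∞ :=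
  ⨆ (s : S) (ρ : ℝ) (_ : 0 < ρ),
    avg μ (fun t => (a t : ℝ≥0∞)) 1 (qball d s ρ) *
      avg μ (fun t => (a t : ℝ≥0∞)⁻¹) (1 / (p - 1)) (qball d s ρ)

/-- The measure `w dμ`; `L^p(S, w; X)` is the Bochner space `L^p` of this measure. -/
noncomputable def weighted {S : Type u} [MeasurableSpace S] (μ : Measure S) (a : S → ℝ≥0) :
    Measure S :=
  μ.withDensity fun s => (a s : ℝ≥0∞)

/-! ### Weak-type boundedness -/

/-- The weak norm `‖g‖_{L^{p,∞}} = sup_{t > 0} t μ(‖g‖ > t) ^ (1/p)`. -/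
noncomputable def weakNorm {S : Type u} [MeasurableSpace S] {Y : Type w} [NormedAddCommGroup Y]
    (p : ℝ≥0) (μ : Measure S) (g : S → Y) : ℝ≥0∞ :=
  ⨆ t : ℝ≥0, (t : ℝ≥0∞) * μ {s | (t : ℝ≥0∞) < ‖g s‖ₑ} ^ (1 / (p : ℝ))

/-- The norm `‖T‖_{L^p(S;X) → L^{p,∞}(S;Y)}`, the least constant in the weak-type estimate; it is
finite iff `T` is a bounded operator from `L^p(S;X)` to `L^{p,∞}(S;Y)`. -/
noncomputable def weakOpNorm {𝕜 : Type x} [RCLike 𝕜] {S : Type u} [MeasurableSpace S]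
    {X : Type v} [NormedAddCommGroup X] [NormedSpace 𝕜 X]
    {Y : Type w} [NormedAddCommGroup Y] [NormedSpace 𝕜 Y] {μ : Measure S} {p : ℝ≥0}
    (T : Lp X (p : ℝ≥0∞) μ →ₗ[𝕜] (S →ₘ[μ] Y)) : ℝ≥0∞ :=
  sInf {C | ∀ f : Lp X (p : ℝ≥0∞) μ, weakNorm p μ (T f) ≤ C * eLpNorm f p μ}

/-! ### Dini kernels -/

/-- The Dini norm `∫_0^1 ω(t) dt/t`. -/
noncomputable def diniNorm (ω : ℝ → ℝ≥0) : ℝ≥0∞ :=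
  ∫⁻ t in Ioc (0 : ℝ) 1, (ω t : ℝ≥0∞) / ENNReal.ofReal t

/-- `K` is a Dini kernel with modulus `ω : [0, 1] → [0, ∞)` and constant `cK`. Only the values of
`K` off the diagonal and of `ω` on `[0, 1]` matter. -/
structure IsDiniKernel {𝕜 : Type x} [RCLike 𝕜] {S : Type u} [MeasurableSpace S]
    {X : Type v} [NormedAddCommGroup X] [NormedSpace 𝕜 X]
    {Y : Type w} [NormedAddCommGroup Y] [NormedSpace 𝕜 Y] (d : S → S → ℝ) (μ : Measure S)
    (K : S → S → X →L[𝕜] Y) (ω : ℝ → ℝ≥0) (cK : ℝ) : Prop where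
  /-- strong measurability off the diagonal in the strong operator topology -/
  stronglyMeasurable : ∀ ξ : X,
    StronglyMeasurable fun z : {z : S × S // z.1 ≠ z.2} => K z.1.1 z.1.2 ξ
  two_le : 2 ≤ cK
  monotoneOn : MonotoneOn ω (Icc 0 1)
  subadditive : ∀ a b : ℝ, 0 ≤ a → 0 ≤ b → a + b ≤ 1 → ω (a + b) ≤ ω a + ω b
  map_zero : ω 0 = 0
  dini_lt_top : diniNorm ω < ∞
  smooth_right : ∀ s t t' : S, 0 < d t t' → d t t' ≤ 1 / cK * d s t →
    ‖K s t - K s t'‖ ≤ ω (d t t' / d s t) * (1 / μ.real (qball d s (d s t)))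
  smooth_left : ∀ s s' t : S, 0 < d s s' → d s s' ≤ 1 / cK * d s t →
    ‖K s t - K s' t‖ ≤ ω (d s s' / d s t) * (1 / μ.real (qball d s (d s t)))

/-- `T` has kernel `K`: for every boundedly supported `f ∈ L^p(S;X)` and a.e. `s` outside the closed
support of `f`, `T f (s) = ∫ K(s,t) f(t) dμ(t)`, as a convergent Bochner integral. -/
def HasKernel {𝕜 : Type x} [RCLike 𝕜] {S : Type u} [MeasurableSpace S]
    {X : Type v} [NormedAddCommGroup X] [NormedSpace 𝕜 X]
    {Y : Type w} [NormedAddCommGroup Y] [NormedSpace 𝕜 Y] (d : S → S → ℝ) {μ : Measure S}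
    {p : ℝ≥0} (T : Lp X (p : ℝ≥0∞) μ →ₗ[𝕜] (S →ₘ[μ] Y)) (K : S → S → X →L[𝕜] Y) : Prop :=
  letI : NormedSpace ℝ Y := NormedSpace.restrictScalars ℝ 𝕜 Y
  ∀ (f : S → X) (hf : MemLp f (p : ℝ≥0∞) μ), (∃ z ρ, support f ⊆ qball d z ρ) →
    ∀ᵐ s ∂μ, s ∉ @closure S (quasiTopology d) (support f) →
      Integrable (fun t => K s t (f t)) μ ∧ T (hf.toLp f) s = ∫ t, K s t (f t) ∂μ

end SparseDini

open SparseDini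

/-! The kernel enters through two consequences only. If `f` vanishes on a large dilate of a ball,
then `Tf` oscillates on that ball by at most a tail of `f` (`hasOscillation_of_hasKernel`,
smoothness in the first variable). If `f` is supported in a ball and has mean zero, then `Tf` decays
away from that ball (`hasAtomDecay_of_hasKernel`, smoothness in the second variable). Both tails are
sums over `k` of `ω(2^{-k-1})` times averages over balls of radius `2^{k+1}R`, and the Dini
condition makes them summable. The second property and a Calderón–Zygmund decomposition turn the
weak bound on `L^{p₀}` into a weak `(1,1)` bound (`weak_one_of_atomDecay`), so `T` extends to `L^1`
by density, with limits taken almost everywhere (`exists_weak_extension`).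

Sparse domination is a stopping-time argument. For a cube `Q` put `F = f 1_{αQ}`. By the weak
`(1,1)` bounds of `T` and of the dyadic maximal functions of the adjacent systems, `TF` and the
maximal functions of `F` exceed a large multiple of the average of `‖f‖` over `αQ` only on a small
part of `Q`. Disjoint stopping cubes `P ⊆ Q` cover this part almost as tightly as desired: they fill
at most half of `Q`, and most of each `P` is good. Outside them `TF` is bounded by the average. On
`P` write `TF = T(F - f 1_{αP}) + T(f 1_{αP})`. The first argument vanishes on `αP`, so its image is
nearly constant on `P`, and comparison with one good point bounds it by the average. Hence `‖TF‖` is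
at most a multiple of the average plus `‖T(f 1_{αP})‖`, which is the same quantity for `P`
(`exists_stopping_children`). The recursion ends almost everywhere because the generations shrink
geometrically, and each dilate `αQ` is finally replaced by an adjacent cube that contains it
(`exists_sparse_domination`).

For the weighted bound let `σ = w^{-1/(p-1)}`. By duality one bounds the sum of `∫_Q g dσ · ∫_Q h dw
/ μ(Q)` over the sparse family. For `p ≥ 2`, the `A_p` condition on `Q` and Hölder's inequality on
the disjoint sets `E_Q` bound `w(Q)σ(Q)/μ(Q)` by a multiple of `[w] σ(E_Q)^{1/p} w(E_Q)^{1/p'}`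
(`testing_le`). Hölder's inequality for sums then leaves two dyadic maximal inequalities, for `σ`
and for `w`, with constants independent of the measure (`DyadicSystem.tsum_avg_rpow_le`). The case
`p ≤ 2` is the dual one with `w` and `σ` exchanged; this is where the exponent `1/(p-1)` arises.

The dyadic systems come from nets at the scales `δ^k` with a parent map. The coarse net labels of
finer and finer approximations of a point have a limit label, and the cubes are the fibres of that
label (`LabelTree.dyadicSystem`). Colouring the nets gives finitely many parent maps such that every
ball lies deep inside a cube of one of the systems (`exists_adjacent`).

Lebesgue differentiation is never used: exceptional sets are first enlarged to open sets of almost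
the same measure, and stopping cubes cover open sets at every point. -/

namespace SparseDini

/-! ### Quasi-metric balls, topology and outer regularity -/

section Geometry

variable {S : Type u} {d : S → S → ℝ} {cd : ℝ}

theorem mem_qball {s t : S} {ρ : ℝ} : t ∈ qball d s ρ ↔ d s t < ρ := Iff.rfl

theorem qball_mono (s : S) {ρ R : ℝ} (h : ρ ≤ R) : qball d s ρ ⊆ qball d s R :=
  fun _ ht => lt_of_lt_of_le ht h

theorem IsQuasiMetric.self (hd : IsQuasiMetric d cd) (s : S) : d s s = 0 :=
  (hd.eq_zero_iff s s).2 rfl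

theorem IsQuasiMetric.mem_qball_self (hd : IsQuasiMetric d cd) (s : S) {ρ : ℝ} (h : 0 < ρ) :
    s ∈ qball d s ρ := by
  rw [mem_qball, hd.self]; exact h

theorem IsQuasiMetric.triangle_lt (hd : IsQuasiMetric d cd) (hcd : 1 ≤ cd) {s t r : S} {a b : ℝ}
    (h₁ : d s r < a) (h₂ : d r t < b) : d s t < cd * (a + b) :=
  (hd.triangle s t r).trans_lt (by gcongr)

theorem IsQuasiMetric.qball_subset_qball (hd : IsQuasiMetric d cd) (hcd : 1 ≤ cd) {s t : S}
    {a b R : ℝ} (h : d s t ≤ a) (hR : cd * (a + b) ≤ R) : qball d t b ⊆ qball d s R := by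
  intro u hu
  have hu' : d t u < b := hu
  have := hd.triangle s u t
  show d s u < R
  have h3 : cd * (d s t + d t u) < cd * (a + b) := by
    have : 0 < cd := by linarith
    exact mul_lt_mul_of_pos_left (add_lt_add_of_le_of_lt h hu') this
  linarith

/-- Each ball contains an open set around its center. -/
theorem IsQuasiMetric.exists_isOpen_subset_qball (hd : IsQuasiMetric d cd) (hcd : 1 ≤ cd) (s : S)
    {ρ : ℝ} (hρ : 0 < ρ) :
    ∃ U, @IsOpen S (quasiTopology d) U ∧ s ∈ U ∧ U ⊆ qball d s ρ := by
  -- Balls of a quasi-metric need not be open, so the interior of the ball is taken. It is open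
  -- because, by the quasi-triangle inequality, an interior point with margin `ε` has around it a
  -- ball of interior points with margin `ε / (2 * cd)`.
  refine ⟨{t | ∃ ε : ℝ, 0 < ε ∧ qball d t ε ⊆ qball d s ρ}, ?_, ⟨ρ, hρ, Subset.rfl⟩, ?_⟩
  · rintro t ⟨ε, hε, h⟩
    have hcd0 : 0 < cd := by linarith
    have h2 : 0 < ε / (2 * cd) := by positivity
    refine ⟨ε / (2 * cd), h2, fun u hu => ⟨ε / (2 * cd), h2, ?_⟩⟩
    refine (hd.qball_subset_qball hcd (le_of_lt hu) ?_).trans h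
    apply le_of_eq; field_simp; ring
  · rintro t ⟨ε, hε, h⟩
    exact h (hd.mem_qball_self t hε)

theorem IsQuasiMetric.notMem_closure (hd : IsQuasiMetric d cd) (hcd : 1 ≤ cd) {s : S} {A : Set S}
    {ρ : ℝ} (hρ : 0 < ρ) (h : Disjoint (qball d s ρ) A) :
    s ∉ @closure S (quasiTopology d) A := by
  let := quasiTopology d
  obtain ⟨U, hU, hs, hUs⟩ := hd.exists_isOpen_subset_qball hcd s hρ
  intro hcl
  obtain ⟨t, htU, htA⟩ := mem_closure_iff.1 hcl U hU hs
  exact Set.disjoint_left.1 h (hUs htU) htA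

/-- A quasi-metric induces a uniform structure with the same topology. -/
@[reducible] def IsQuasiMetric.uniformSpace (hd : IsQuasiMetric d cd) (hcd : 1 ≤ cd) :
    UniformSpace S where
  toTopologicalSpace := quasiTopology d
  uniformity := ⨅ ε ∈ Ioi (0 : ℝ), Filter.principal {p : S × S | d p.1 p.2 < ε}
  symm := by
    refine Filter.tendsto_iInf.2 fun ε => Filter.tendsto_iInf.2 fun hε => ?_
    refine Filter.tendsto_principal.2 (Filter.mem_of_superset
      (Filter.mem_iInf_of_mem ε (Filter.mem_iInf_of_mem hε (Filter.mem_principal_self _))) ?_)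
    intro p hp
    simpa [hd.symm p.2 p.1] using hp
  comp := by
    have hcd0 : 0 < cd := by linarith
    refine le_iInf fun ε => le_iInf fun hε => ?_
    have hε' : (0 : ℝ) < ε := hε
    have h2 : (0 : ℝ) < ε / (2 * cd) := by positivity
    refine Filter.le_principal_iff.2 (Filter.mem_of_superset (Filter.mem_lift'
      (Filter.mem_iInf_of_mem (ε / (2 * cd)) (Filter.mem_iInf_of_mem (mem_Ioi.2 h2)
        (Filter.mem_principal_self _)))) ?_)
    rintro ⟨s, t⟩ ⟨r, h₁, h₂⟩
    have := hd.triangle_lt hcd (s := s) (t := t) (r := r) h₁ h₂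
    show d s t < ε
    calc d s t < _ := this
      _ = ε := by field_simp; ring
  nhds_eq_comap_uniformity := by
    let := quasiTopology d
    intro s
    ext A
    rw [Filter.mem_comap]
    have hb : (⨅ ε ∈ Ioi (0 : ℝ), Filter.principal {p : S × S | d p.1 p.2 < ε}).HasBasis
        (fun ε : ℝ => ε ∈ Ioi (0 : ℝ)) (fun ε => {p : S × S | d p.1 p.2 < ε}) := by
      refine Filter.hasBasis_biInf_principal' ?_ ⟨1, mem_Ioi.2 one_pos⟩
      intro i hi j hj
      exact ⟨min i j, mem_Ioi.2 (lt_min hi hj), 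
        fun p (hp : d p.1 p.2 < _) => lt_of_lt_of_le hp (min_le_left i j),
        fun p (hp : d p.1 p.2 < _) => lt_of_lt_of_le hp (min_le_right i j)⟩
    constructor
    · intro hA
      obtain ⟨U, hUA, hU, hs⟩ := mem_nhds_iff.1 hA
      obtain ⟨ρ, hρ, hsub⟩ := hU s hs
      exact ⟨_, hb.mem_of_mem (mem_Ioi.2 hρ), fun t ht => hUA (hsub ht)⟩
    · rintro ⟨V, hV, hVA⟩
      obtain ⟨ε, hε, hsub⟩ := hb.mem_iff.1 hV
      obtain ⟨U, hU, hsU, hUs⟩ := hd.exists_isOpen_subset_qball hcd s hε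
      exact mem_nhds_iff.2 ⟨U, fun t ht => hVA (hsub (hUs ht)), hU, hsU⟩

/-- The radii `1 / (n + 1)` already generate the uniformity, and a countably generated uniformity is
pseudo-metrizable. The point of this is outer regularity of finite Borel measures. -/
theorem IsQuasiMetric.pseudoMetrizable (hd : IsQuasiMetric d cd) (hcd : 1 ≤ cd) :
    @TopologicalSpace.PseudoMetrizableSpace S (quasiTopology d) := by
  let U := hd.uniformSpace hcd
  have : (uniformity S).IsCountablyGenerated := by
    have h : (uniformity S) = ⨅ n : ℕ, Filter.principal {p : S × S | d p.1 p.2 < 1 / ((n : ℝ) + 1)} := by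
      show (⨅ ε ∈ Ioi (0 : ℝ), Filter.principal {p : S × S | d p.1 p.2 < ε}) = _
      apply le_antisymm
      · exact le_iInf fun n => iInf₂_le (1 / ((n : ℝ) + 1)) (mem_Ioi.2 (by positivity))
      · refine le_iInf fun ε => le_iInf fun hε => ?_
        obtain ⟨n, hn⟩ := exists_nat_one_div_lt (mem_Ioi.1 hε)
        exact iInf_le_of_le n (Filter.principal_mono.2 fun p hp => lt_trans hp hn)
    rw [h]
    infer_instance
  infer_instance

/-- Outer regularity on a pseudo-metrizable space. This is the substitute for the Lebesgue
differentiation theorem in both stopping-time arguments. -/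
theorem IsHomogeneousType.exists_isOpen_le [mS : MeasurableSpace S] {μ : Measure S} {cμ : ℝ≥0}
    (H : IsHomogeneousType d μ cd cμ) (hcd : 1 ≤ cd) (ν : Measure S) [IsFiniteMeasure ν]
    (A : Set S) {ε : ℝ≥0∞} (hε : ε ≠ 0) :
    ∃ U, A ⊆ U ∧ @IsOpen S (quasiTopology d) U ∧ MeasurableSet U ∧ ν U ≤ ν A + ε := by
  let := quasiTopology d
  have := H.quasiMetric.pseudoMetrizable hcd
  have : BorelSpace S := ⟨H.borel⟩
  obtain ⟨U, hAU, hU, hlt⟩ := Set.exists_isOpen_lt_add (μ := ν) A (measure_ne_top ν A) hε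
  exact ⟨U, hAU, hU, hU.measurableSet, hlt.le⟩

end Geometry

/-! ### Doubling for comparable balls -/

section Doubling

variable {S : Type u} [MeasurableSpace S] {d : S → S → ℝ} {μ : Measure S} {cd : ℝ} {cμ : ℝ≥0}

/-- A doubling constant for comparable balls, see `IsHomogeneousType.measure_qball_le`. -/
noncomputable def dbl (cd : ℝ) (cμ : ℝ≥0) (L : ℝ) : ℝ≥0 := cμ ^ ⌈2 * cd * L⌉₊

theorem one_le_dbl (hcμ : 1 ≤ cμ) (L : ℝ) : 1 ≤ dbl cd cμ L := one_le_pow₀ hcμ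

theorem IsHomogeneousType.measure_qball_two_pow (H : IsHomogeneousType d μ cd cμ) (s : S) {ρ : ℝ}
    (hρ : 0 < ρ) (n : ℕ) : μ (qball d s (2 ^ n * ρ)) ≤ cμ ^ n * μ (qball d s ρ) := by
  induction n with
  | zero => simp
  | succ n ih =>
    have h := H.doubling s (2 ^ n * ρ) (by positivity)
    rw [← mul_assoc, ← pow_succ'] at h
    refine h.trans ?_
    rw [pow_succ', mul_assoc]
    gcongr

/-- The larger ball lies in `B(s, 2 cd L ρ)`, and `x ≤ ⌈x⌉ ≤ 2 ^ ⌈x⌉` with `x = 2 cd L` turns the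
factor into `⌈x⌉` doublings. The crude exponent suffices, since only the dependence on `cd`, `cμ`,
`L` matters. -/
theorem IsHomogeneousType.measure_qball_le (H : IsHomogeneousType d μ cd cμ) (hcd : 1 ≤ cd)
    {s t : S} {ρ R L : ℝ} (hρ : 0 < ρ) (hst : d s t ≤ L * ρ) (hR : R ≤ L * ρ) :
    μ (qball d t R) ≤ dbl cd cμ L * μ (qball d s ρ) := by
  have hsub : qball d t R ⊆ qball d s (2 ^ ⌈2 * cd * L⌉₊ * ρ) := by
    refine H.quasiMetric.qball_subset_qball hcd hst ?_
    calc cd * (L * ρ + R) ≤ cd * (L * ρ + L * ρ) := by gcongr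
      _ = (2 * cd * L) * ρ := by ring
      _ ≤ 2 ^ ⌈2 * cd * L⌉₊ * ρ := by
        gcongr
        refine (Nat.le_ceil _).trans ?_
        exact_mod_cast Nat.lt_two_pow_self.le
  refine (measure_mono hsub).trans ((H.measure_qball_two_pow s hρ _).trans ?_)
  rw [dbl]; push_cast; exact le_rfl

theorem IsHomogeneousType.measure_qball_ne_top (H : IsHomogeneousType d μ cd cμ) (s : S) (ρ : ℝ) :
    μ (qball d s ρ) ≠ ∞ := (H.measure_qball_lt_top s ρ).ne

theorem iUnion_qball_nat {S : Type u} {d : S → S → ℝ} (s : S) : ⋃ n : ℕ, qball d s n = univ := by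
  refine eq_univ_of_forall fun t => mem_iUnion.2 ?_
  obtain ⟨n, hn⟩ := exists_nat_gt (d s t)
  exact ⟨n, hn⟩

theorem IsHomogeneousType.sigmaFinite (H : IsHomogeneousType d μ cd cμ) : SigmaFinite μ := by
  rcases isEmpty_or_nonempty S with h | ⟨⟨s⟩⟩
  · have : μ = 0 := Measure.eq_zero_of_isEmpty μ
    rw [this]; infer_instance
  · exact ⟨⟨{ set := fun n => qball d s n
              set_mem := fun _ => trivial
              finite := fun n => H.measure_qball_lt_top s n
              spanning := iUnion_qball_nat s }⟩⟩

end Doubling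

/-! ### Packing bounds and coloured nets -/

section Nets

variable {S : Type u} {d : S → S → ℝ} {cd : ℝ}

theorem IsQuasiMetric.disjoint_qball (hd : IsQuasiMetric d cd) (hcd : 1 ≤ cd) {y y' : S} {r : ℝ}
    (h : r ≤ d y y') : Disjoint (qball d y (r / (2 * cd))) (qball d y' (r / (2 * cd))) := by
  refine Set.disjoint_left.2 fun u hu hu' => ?_
  have h1 : d u y' < r / (2 * cd) := by rw [hd.symm]; exact hu'
  have h2 := hd.triangle_lt hcd hu h1
  have h3 : cd * (r / (2 * cd) + r / (2 * cd)) = r := by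
    have : 0 < cd := by linarith
    field_simp; ring
  linarith

/-- A bound for the number of `r`-separated points in a ball of radius `M * r`. -/
noncomputable def packing (cd : ℝ) (cμ : ℝ≥0) (M : ℝ) : ℕ :=
  ⌊dbl cd cμ (2 * cd * (cd * (M + 1)))⌋₊

/-- Volume counting: the balls of radius `r / (2 * cd)` around the points are disjoint and lie in
one large ball, whose measure is by doubling at most a constant times that of each. -/
theorem IsHomogeneousType.card_le_packing [MeasurableSpace S] {μ : Measure S} {cμ : ℝ≥0}
    (H : IsHomogeneousType d μ cd cμ) (hcd : 1 ≤ cd) {x : S} {r M : ℝ} (hr : 0 < r) (hM : 0 ≤ M)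
    (F : Finset S) (hF : ∀ y ∈ F, d x y ≤ M * r)
    (hsep : ∀ y ∈ F, ∀ y' ∈ F, y ≠ y' → r ≤ d y y') : F.card ≤ packing cd cμ M := by
  have hcd0 : 0 < cd := by linarith
  set ρ := r / (2 * cd) with hρ
  have hρ0 : 0 < ρ := by positivity
  set B := qball d x (cd * (M * r + r))
  have hB0 : μ B ≠ 0 := (H.measure_qball_pos _ _ (by positivity)).ne'
  have hBt : μ B ≠ ∞ := H.measure_qball_ne_top _ _
  have h1 : ∀ y ∈ F, μ B ≤ dbl cd cμ (2 * cd * (cd * (M + 1))) * μ (qball d y ρ) := by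
    intro y hy
    have h0 : 2 * cd * (cd * (M + 1)) * ρ = cd * (M * r + r) := by rw [hρ]; field_simp
    refine H.measure_qball_le hcd hρ0 ?_ ?_
    · rw [h0, H.quasiMetric.symm]
      refine (hF y hy).trans ?_
      nlinarith [mul_nonneg hM hr.le]
    · rw [h0]
  have h2 : ∑ y ∈ F, μ (qball d y ρ) ≤ μ B := by
    rw [← measure_biUnion_finset]
    · refine measure_mono (iUnion₂_subset fun y hy => ?_)
      refine H.quasiMetric.qball_subset_qball hcd (hF y hy) ?_
      have : ρ ≤ r := by
        rw [hρ]; exact div_le_self hr.le (by linarith)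
      gcongr
    · intro y hy y' hy' hne
      exact H.quasiMetric.disjoint_qball hcd (hsep y hy y' hy' hne)
    · exact fun y _ => H.measurableSet_qball _ _
  have h3 : (F.card : ℝ≥0∞) * μ B ≤ dbl cd cμ (2 * cd * (cd * (M + 1))) * μ B := by
    calc (F.card : ℝ≥0∞) * μ B = ∑ y ∈ F, μ B := by simp
      _ ≤ ∑ y ∈ F, dbl cd cμ (2 * cd * (cd * (M + 1))) * μ (qball d y ρ) := Finset.sum_le_sum h1
      _ ≤ _ := by rw [← Finset.mul_sum]; gcongr
  have h4 := (ENNReal.mul_le_mul_iff_left hB0 hBt).1 h3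
  exact Nat.le_floor (by exact_mod_cast h4)

/-- Greedy colouring of the natural numbers: no two related numbers get the same colour. -/
noncomputable def greedyColor (r : ℕ → ℕ → Prop) : ℕ → ℕ
  | i => sInf {a | ∀ j : Fin i, r i j → greedyColor r j ≠ a}
termination_by i => i
decreasing_by exact j.2

/-- At stage `i` at most `P` earlier neighbours have been coloured, so one of the `P + 1` colours
`0, …, P` is still free, and the least free colour is at most `P`. -/
theorem greedyColor_spec (r : ℕ → ℕ → Prop) (i P : ℕ)
    (hP : ∀ F : Finset ℕ, (∀ j ∈ F, j < i ∧ r i j) → F.card ≤ P) :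
    greedyColor r i ≤ P ∧ ∀ j < i, r i j → greedyColor r j ≠ greedyColor r i := by
  classical
  set A := {a | ∀ j : Fin i, r i j → greedyColor r j ≠ a} with hA
  have hc : greedyColor r i = sInf A := by rw [greedyColor]
  set F := ((Finset.range i).filter (r i))
  have hF : F.card ≤ P := hP F fun j hj => by simpa [F] using hj
  obtain ⟨a, ha, haF⟩ : ∃ a ∈ Finset.range (P + 1), a ∉ F.image (greedyColor r) := by
    by_contra! hcon
    have h1 := Finset.card_le_card (fun a ha => hcon a ha : Finset.range (P + 1) ⊆ _)
    have h2 := Finset.card_image_le (s := F) (f := greedyColor r)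
    simp at h1
    omega
  have haA : a ∈ A := by
    intro j hj heq
    exact haF (Finset.mem_image.2 ⟨j, by simp [F, hj], heq⟩)
  have hm : sInf A ∈ A := Nat.sInf_mem ⟨a, haA⟩
  refine ⟨?_, fun j hj hr => ?_⟩
  · rw [hc]
    have := Nat.sInf_le haA
    simp at ha
    omega
  · rw [hc]; exact hm ⟨j, hj⟩ hr

/-- Maximal separated sets with an enumeration and a colouring in which points of the same colour
are far apart. -/
theorem IsHomogeneousType.exists_colored_net [MeasurableSpace S] [Nonempty S] {μ : Measure S}
    {cμ : ℝ≥0} (H : IsHomogeneousType d μ cd cμ) (hcd : 1 ≤ cd) {r M : ℝ} (hr : 0 < r)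
    (hM : 0 ≤ M) :
    ∃ (f : ℕ → S) (I : Set ℕ) (col : ℕ → Fin (packing cd cμ M + 1)),
      (∀ i ∈ I, ∀ j ∈ I, i ≠ j → r ≤ d (f i) (f j)) ∧ (∀ s, ∃ i ∈ I, d s (f i) < r) ∧
      ∀ i ∈ I, ∀ j ∈ I, col i = col j → d (f i) (f j) < M * r → i = j := by
  classical
  have hd := H.quasiMetric
  obtain ⟨N, hN⟩ := zorn_subset {N : Set S | N.Pairwise fun y y' => r ≤ d y y'} (by
    intro c hc hchain
    refine ⟨⋃₀ c, ?_, fun s hs => subset_sUnion_of_mem hs⟩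
    exact (Set.pairwise_sUnion hchain.directedOn).2 fun s hs => hc hs)
  have hsep : N.Pairwise fun y y' => r ≤ d y y' := hN.prop
  have hcov : ∀ s, ∃ z ∈ N, d s z < r := by
    intro s
    by_contra! hcon
    have hins : (insert s N).Pairwise fun y y' => r ≤ d y y' := by
      refine hsep.insert fun z hz _ => ⟨hcon z hz, ?_⟩
      rw [hd.symm]; exact hcon z hz
    have hsN : s ∈ N := hN.le_of_ge hins (subset_insert s N) (mem_insert s N)
    have := hcon s hsN
    rw [hd.self] at this
    linarith
  -- Disjoint balls of positive measure in a σ-finite space are countably many.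
  have hNc : N.Countable := by
    have := H.sigmaFinite
    have hcd0 : 0 < cd := by linarith
    have h := Measure.countable_meas_pos_of_disjoint_iUnion (μ := μ)
      (As := fun y : N => qball d (y : S) (r / (2 * cd)))
      (fun y => H.measurableSet_qball _ _)
      (fun y y' hne => hd.disjoint_qball hcd (hsep y.2 y'.2 (Subtype.coe_injective.ne hne)))
    have huniv : {y : N | 0 < μ (qball d (y : S) (r / (2 * cd)))} = univ :=
      eq_univ_of_forall fun y => H.measure_qball_pos _ _ (by positivity)
    rw [huniv] at h
    exact Set.countable_coe_iff.1 (Set.countable_univ_iff.1 h)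
  obtain ⟨s₀⟩ := ‹Nonempty S›
  obtain ⟨f, hf⟩ := hNc.exists_eq_range (let ⟨z, hz, _⟩ := hcov s₀; ⟨z, hz⟩)
  -- Only first occurrences are kept, which makes the enumeration injective on `I` even when the net
  -- is finite.
  set I : Set ℕ := {i | ∀ j < i, f j ≠ f i} with hI
  have hinj : ∀ i ∈ I, ∀ j ∈ I, f i = f j → i = j := by
    intro i hi j hj hij
    rcases lt_trichotomy i j with h | h | h
    · exact absurd hij (hj i h)
    · exact h
    · exact absurd hij.symm (hi j h)
  have hsepI : ∀ i ∈ I, ∀ j ∈ I, i ≠ j → r ≤ d (f i) (f j) := by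
    intro i hi j hj hne
    exact hsep (hf ▸ mem_range_self i) (hf ▸ mem_range_self j) fun h => hne (hinj i hi j hj h)
  set R : ℕ → ℕ → Prop := fun i j => i ∈ I ∧ j ∈ I ∧ d (f i) (f j) < M * r with hR
  have hspec : ∀ i, greedyColor R i ≤ packing cd cμ M ∧
      ∀ j < i, R i j → greedyColor R j ≠ greedyColor R i := by
    intro i
    refine greedyColor_spec R i _ fun F hF => ?_
    have hcard : (F.image f).card = F.card :=
      Finset.card_image_of_injOn fun j hj k hk h =>
        hinj j (hF j hj).2.2.1 k (hF k hk).2.2.1 h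
    rw [← hcard]
    refine H.card_le_packing hcd (x := f i) hr hM _ ?_ ?_
    · intro y hy
      obtain ⟨j, hj, rfl⟩ := Finset.mem_image.1 hy
      exact (hF j hj).2.2.2.le
    · intro y hy y' hy' hne
      obtain ⟨j, hj, rfl⟩ := Finset.mem_image.1 hy
      obtain ⟨k, hk, rfl⟩ := Finset.mem_image.1 hy'
      exact hsepI j (hF j hj).2.2.1 k (hF k hk).2.2.1 fun h => hne (h ▸ rfl)
  refine ⟨f, I, fun i => ⟨greedyColor R i, Nat.lt_succ_of_le (hspec i).1⟩, hsepI, ?_, ?_⟩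
  · intro s
    obtain ⟨z, hz, hsz⟩ := hcov s
    rw [hf] at hz
    have hex : ∃ i, f i = z := hz
    refine ⟨Nat.find hex, fun j hj h => Nat.find_min hex hj ?_, ?_⟩
    · rw [h]; exact Nat.find_spec hex
    · rw [Nat.find_spec hex]; exact hsz
  · intro i hi j hj hcol hlt
    have hcol' : greedyColor R i = greedyColor R j := by simpa using hcol
    rcases lt_trichotomy i j with h | h | h
    · exact absurd hcol' ((hspec j).2 i h ⟨hj, hi, by rw [hd.symm]; exact hlt⟩)
    · exact h
    · exact absurd hcol'.symm ((hspec i).2 j h ⟨hi, hj, hlt⟩)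

end Nets

/-! ### Limit labels and dyadic cubes; construction of adjacent systems -/

section Tree

/-- Nets at all scales `δ ^ k`, `k ∈ ℤ`, with labels in `I k ⊆ ℕ`, and a parent for each point. -/
structure LabelTree {S : Type u} (d : S → S → ℝ) (cd δ : ℝ) where
  f : ℤ → ℕ → S
  I : ℤ → Set ℕ
  par : ℤ → ℕ → ℕ
  sep : ∀ k, ∀ i ∈ I k, ∀ j ∈ I k, i ≠ j → δ ^ k ≤ d (f k i) (f k j)
  cov : ∀ k s, ∃ i ∈ I k, d s (f k i) < δ ^ k
  par_mem : ∀ k, ∀ i ∈ I (k + 1), par k i ∈ I k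
  dist_par : ∀ k, ∀ i ∈ I (k + 1), d (f (k + 1) i) (f k (par k i)) ≤ 2 * cd * δ ^ k

variable {S : Type u} {d : S → S → ℝ} {cd δ : ℝ}

namespace LabelTree

/-- The ancestor in generation `k` of a label in generation `k + n`. -/
def anc (L : LabelTree d cd δ) : ℤ → ℕ → ℕ → ℕ
  | _, 0, i => i
  | k, n + 1, i => L.par k (anc L (k + 1) n i)

/-- The first point of the net of generation `k` near `s`. -/
noncomputable def near (L : LabelTree d cd δ) (k : ℤ) (s : S) : ℕ :=
  sInf {i | i ∈ L.I k ∧ d s (L.f k i) < δ ^ k}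

theorem near_spec (L : LabelTree d cd δ) (k : ℤ) (s : S) :
    L.near k s ∈ L.I k ∧ d s (L.f k (L.near k s)) < δ ^ k :=
  Nat.sInf_mem (s := {i | i ∈ L.I k ∧ d s (L.f k i) < δ ^ k}) (L.cov k s)

/-- The label in generation `k` of the point near `s` in generation `k + n`. -/
noncomputable def approx (L : LabelTree d cd δ) (k : ℤ) (n : ℕ) (s : S) : ℕ :=
  L.anc k n (L.near (k + n) s)

theorem approx_succ (L : LabelTree d cd δ) (k : ℤ) (n : ℕ) (s : S) :
    L.approx k (n + 1) s = L.par k (L.approx (k + 1) n s) := by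
  have : k + ((n + 1 : ℕ) : ℤ) = k + 1 + n := by push_cast; ring
  rw [approx, approx, this, anc]

/-- The bound `4 cd² δ^k` reproduces itself: passing to the parent gives `cd (4 cd² δ · δ^k + 2 cd
δ^k) = 2 cd² (2 cd δ + 1) δ^k`, and `2 cd δ ≤ 1`. So following ancestors through any number of
generations costs only a fixed multiple of the coarsest scale. -/
theorem approx_spec (hd : IsQuasiMetric d cd) (hcd : 1 ≤ cd) (hδ : 0 < δ) (hδ' : 2 * cd * δ ≤ 1)
    (L : LabelTree d cd δ) (n : ℕ) (s : S) :
    ∀ k, L.approx k n s ∈ L.I k ∧ d s (L.f k (L.approx k n s)) ≤ 4 * cd ^ 2 * δ ^ k := by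
  induction n with
  | zero =>
    intro k
    have h := L.near_spec k s
    have h2 : L.approx k 0 s = L.near k s := by simp [approx, anc]
    rw [h2]
    refine ⟨h.1, h.2.le.trans ?_⟩
    have : 0 < δ ^ k := zpow_pos hδ k
    have h1 : 1 ≤ cd ^ 2 := one_le_pow₀ hcd
    nlinarith
  | succ n ih =>
    intro k
    obtain ⟨h1, h2⟩ := ih (k + 1)
    rw [approx_succ]
    refine ⟨L.par_mem k _ h1, ?_⟩
    have h3 := L.dist_par k _ h1
    have h4 := hd.triangle s (L.f k (L.par k (L.approx (k + 1) n s)))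
      (L.f (k + 1) (L.approx (k + 1) n s))
    have hk : 0 < δ ^ k := zpow_pos hδ k
    rw [zpow_add_one₀ hδ.ne'] at h2
    calc _ ≤ _ := h4
      _ ≤ cd * (4 * cd ^ 2 * (δ ^ k * δ) + 2 * cd * δ ^ k) := by gcongr
      _ = 2 * cd ^ 2 * δ ^ k * (2 * cd * δ + 1) := by ring
      _ ≤ 2 * cd ^ 2 * δ ^ k * (1 + 1) := by gcongr
      _ = _ := by ring

/-- `i` is a limit label of `s` in generation `k`. -/
def Freq (L : LabelTree d cd δ) (k : ℤ) (i : ℕ) (s : S) : Prop :=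
  ∃ᶠ n in Filter.atTop, L.approx k n s = i

theorem Freq.spec (hd : IsQuasiMetric d cd) (hcd : 1 ≤ cd) (hδ : 0 < δ) (hδ' : 2 * cd * δ ≤ 1)
    {L : LabelTree d cd δ} {k : ℤ} {i : ℕ} {s : S} (h : L.Freq k i s) :
    i ∈ L.I k ∧ d s (L.f k i) ≤ 4 * cd ^ 2 * δ ^ k := by
  obtain ⟨n, rfl⟩ := h.exists
  exact approx_spec hd hcd hδ hδ' L n s k

theorem Freq.par {L : LabelTree d cd δ} {k : ℤ} {i : ℕ} {s : S} (h : L.Freq (k + 1) i s) :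
    L.Freq k (L.par k i) s := by
  rw [Freq, Filter.frequently_atTop] at h ⊢
  intro a
  obtain ⟨b, hb, hi⟩ := h a
  exact ⟨b + 1, by omega, by rw [approx_succ, hi]⟩

theorem Freq.anc {L : LabelTree d cd δ} {s : S} (n : ℕ) :
    ∀ {k : ℤ} {i : ℕ}, L.Freq (k + n) i s → L.Freq k (L.anc k n i) s := by
  induction n with
  | zero => intro k i h; simpa [LabelTree.anc] using h
  | succ n ih =>
    intro k i h
    rw [LabelTree.anc]
    refine Freq.par (ih ?_)
    have : k + 1 + (n : ℤ) = k + ((n + 1 : ℕ) : ℤ) := by push_cast; ring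
    rw [this]; exact h

variable [MeasurableSpace S] {μ : Measure S} {cμ : ℝ≥0}

theorem finite_near (H : IsHomogeneousType d μ cd cμ) (hcd : 1 ≤ cd) (hδ : 0 < δ)
    (L : LabelTree d cd δ) (k : ℤ) (s : S) :
    {i | i ∈ L.I k ∧ d s (L.f k i) ≤ 4 * cd ^ 2 * δ ^ k}.Finite := by
  classical
  by_contra hinf
  obtain ⟨F, hF, hcard⟩ := Set.Infinite.exists_subset_card_eq hinf (packing cd cμ (4 * cd ^ 2) + 1)
  have hpos : 0 < δ ^ k := zpow_pos hδ k
  have hinj : Set.InjOn (L.f k) F := by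
    intro i hi j hj hij
    by_contra hne
    have := L.sep k i (hF hi).1 j (hF hj).1 hne
    rw [hij, H.quasiMetric.self] at this
    linarith
  have h := H.card_le_packing hcd (x := s) hpos (M := 4 * cd ^ 2) (by positivity) (F.image (L.f k))
    (by
      intro y hy
      obtain ⟨i, hi, rfl⟩ := Finset.mem_image.1 hy
      exact (hF hi).2)
    (by
      intro y hy y' hy' hne
      obtain ⟨i, hi, rfl⟩ := Finset.mem_image.1 hy
      obtain ⟨j, hj, rfl⟩ := Finset.mem_image.1 hy'
      exact L.sep k i (hF hi).1 j (hF hj).1 fun h => hne (h ▸ rfl))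
  rw [Finset.card_image_of_injOn hinj, hcard] at h
  omega

/-- Pigeonhole: the approximating labels take only finitely many values, so a property that holds
for infinitely many approximations holds for a value taken infinitely often. -/
theorem exists_freq_of_frequently (H : IsHomogeneousType d μ cd cμ) (hcd : 1 ≤ cd) (hδ : 0 < δ)
    (hδ' : 2 * cd * δ ≤ 1) (L : LabelTree d cd δ) (k : ℤ) (s : S) (p : ℕ → Prop)
    (h : ∃ᶠ n in Filter.atTop, p (L.approx k n s)) : ∃ i, L.Freq k i s ∧ p i := by
  by_contra! hcon
  have hfin := finite_near H hcd hδ L k s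
  have : ∀ᶠ n in Filter.atTop, ∀ i ∈ {i | i ∈ L.I k ∧ d s (L.f k i) ≤ 4 * cd ^ 2 * δ ^ k},
      p i → L.approx k n s ≠ i := by
    refine (Filter.eventually_all_finite hfin).2 fun i _ => ?_
    by_cases hp : p i
    · have : ¬ L.Freq k i s := fun h => hcon i h hp
      rw [Freq, Filter.not_frequently] at this
      exact this.mono fun n hn _ => hn
    · exact Filter.Eventually.of_forall fun n h => absurd h hp
  obtain ⟨n, hn1, hn2⟩ := (h.and_eventually this).exists
  exact hn2 _ (approx_spec H.quasiMetric hcd hδ hδ' L n s k) hn1 rfl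

/-- A limit label of `s` in generation `n ≥ 0`, chosen consistently with the parents. -/
noncomputable def limitNat (L : LabelTree d cd δ) : ℕ → S → ℕ
  | 0, s => sInf {i | L.Freq 0 i s}
  | n + 1, s => sInf {i | L.Freq (n + 1) i s ∧ L.par n i = limitNat L n s}

/-- The limit label of `s` in generation `k`. -/
noncomputable def label (L : LabelTree d cd δ) (k : ℤ) (s : S) : ℕ :=
  L.anc k (-k).toNat (L.limitNat k.toNat s)

/-- The inductive step of König's lemma. A limit label in generation `n` is infinitely often the
parent of an approximation in generation `n + 1`, and the pigeonhole principle then gives a limit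
label there with this very parent. -/
theorem limitNat_freq (H : IsHomogeneousType d μ cd cμ) (hcd : 1 ≤ cd) (hδ : 0 < δ)
    (hδ' : 2 * cd * δ ≤ 1) (L : LabelTree d cd δ) (n : ℕ) (s : S) :
    L.Freq n (L.limitNat n s) s := by
  induction n with
  | zero =>
    obtain ⟨i, hi, _⟩ := exists_freq_of_frequently H hcd hδ hδ' L 0 s (fun _ => True)
      (Filter.Frequently.of_forall fun _ => trivial)
    exact Nat.sInf_mem (s := {i | L.Freq 0 i s}) ⟨i, hi⟩
  | succ n ih =>
    obtain ⟨i, hi⟩ := exists_freq_of_frequently H hcd hδ hδ' L (n + 1) s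
      (fun i => L.par n i = L.limitNat n s) (by
        rw [Freq, Filter.frequently_atTop] at ih
        rw [Filter.frequently_atTop]
        intro a
        obtain ⟨b, hb, h⟩ := ih (a + 1)
        obtain ⟨c, rfl⟩ : ∃ c, b = c + 1 := ⟨b - 1, by omega⟩
        exact ⟨c, by omega, by rw [← h, approx_succ]⟩)
    exact (Nat.sInf_mem (s := {i | L.Freq (n + 1) i s ∧ L.par n i = limitNat L n s}) ⟨i, hi⟩).1

theorem par_limitNat (H : IsHomogeneousType d μ cd cμ) (hcd : 1 ≤ cd) (hδ : 0 < δ)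
    (hδ' : 2 * cd * δ ≤ 1) (L : LabelTree d cd δ) (n : ℕ) (s : S) :
    L.par n (L.limitNat (n + 1) s) = L.limitNat n s := by
  obtain ⟨i, hi⟩ := exists_freq_of_frequently H hcd hδ hδ' L (n + 1) s
    (fun i => L.par n i = L.limitNat n s) (by
      have ih := limitNat_freq H hcd hδ hδ' L n s
      rw [Freq, Filter.frequently_atTop] at ih
      rw [Filter.frequently_atTop]
      intro a
      obtain ⟨b, hb, h⟩ := ih (a + 1)
      obtain ⟨c, rfl⟩ : ∃ c, b = c + 1 := ⟨b - 1, by omega⟩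
      exact ⟨c, by omega, by rw [← h, approx_succ]⟩)
  exact (Nat.sInf_mem (s := {i | L.Freq (n + 1) i s ∧ L.par n i = limitNat L n s}) ⟨i, hi⟩).2

theorem label_freq (H : IsHomogeneousType d μ cd cμ) (hcd : 1 ≤ cd) (hδ : 0 < δ)
    (hδ' : 2 * cd * δ ≤ 1) (L : LabelTree d cd δ) (k : ℤ) (s : S) :
    L.Freq k (L.label k s) s := by
  refine Freq.anc _ ?_
  have : k + ((-k).toNat : ℤ) = (k.toNat : ℤ) := by omega
  rw [this]
  exact limitNat_freq H hcd hδ hδ' L _ s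

theorem par_label (H : IsHomogeneousType d μ cd cμ) (hcd : 1 ≤ cd) (hδ : 0 < δ)
    (hδ' : 2 * cd * δ ≤ 1) (L : LabelTree d cd δ) (k : ℤ) (s : S) :
    L.par k (L.label (k + 1) s) = L.label k s := by
  rcases lt_or_ge k 0 with h | h
  · have h1 : (-k).toNat = (-(k + 1)).toNat + 1 := by omega
    have h2 : (k + 1).toNat = k.toNat := by omega
    rw [label, label, h1, anc, h2]
  · obtain ⟨n, rfl⟩ := Int.eq_ofNat_of_zero_le h
    have h1 : (-(n : ℤ)).toNat = 0 := by omega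
    have h2 : (-((n : ℤ) + 1)).toNat = 0 := by omega
    have h3 : ((n : ℤ) + 1).toNat = n + 1 := by omega
    rw [label, label, h1, h2, anc, anc, h3, Int.toNat_natCast]
    exact par_limitNat H hcd hδ hδ' L n s

theorem measurable_sInf_nat {p : S → ℕ → Prop} (hp : ∀ i, MeasurableSet {s | p s i}) :
    Measurable fun s => sInf {i | p s i} := by
  classical
  -- The second alternative makes `Nat.find` total and equal to `0` where no index qualifies, in
  -- agreement with `sInf ∅ = 0`.
  have h : ∀ s, ∃ i, p s i ∨ ∀ j, ¬ p s j := by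
    intro s
    by_cases h : ∃ i, p s i
    · exact ⟨h.choose, Or.inl h.choose_spec⟩
    · exact ⟨0, Or.inr (not_exists.1 h)⟩
  have heq : (fun s => sInf {i | p s i}) = fun s => Nat.find (h s) := by
    funext s
    by_cases hs : ∃ i, p s i
    · have h1 : {i | p s i} = {i | p s i ∨ ∀ j, ¬ p s j} := by
        ext i
        refine ⟨Or.inl, fun hi => hi.resolve_right fun h => ?_⟩
        exact h _ hs.choose_spec
      rw [h1]
      refine (Nat.sInf_def (s := {i | p s i ∨ ∀ j, ¬ p s j}) (h s)).trans ?_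
      congr!
    · have h1 : {i | p s i} = ∅ := eq_empty_of_forall_notMem (not_exists.1 hs)
      rw [h1, Nat.sInf_empty, eq_comm, Nat.find_eq_zero]
      exact Or.inr (not_exists.1 hs)
  rw [heq]
  refine measurable_find h fun i => ?_
  have h2 : MeasurableSet {s | ∀ j, ¬ p s j} := by
    rw [ofPred_forall]
    exact MeasurableSet.iInter fun j => (hp j).compl
  exact (hp i).union h2

theorem measurable_approx (H : IsHomogeneousType d μ cd cμ) (L : LabelTree d cd δ) (k : ℤ) (n : ℕ) :
    Measurable (L.approx k n) := by
  refine (measurable_from_top (f := L.anc k n)).comp (measurable_sInf_nat fun i => ?_)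
  by_cases hi : i ∈ L.I (k + n)
  · have : {s | i ∈ L.I (k + n) ∧ d s (L.f (k + n) i) < δ ^ (k + n : ℤ)}
        = qball d (L.f (k + n) i) (δ ^ (k + n : ℤ)) := by
      ext s; simp [hi, qball, H.quasiMetric.symm s]
    rw [this]; exact H.measurableSet_qball _ _
  · simp [hi]

theorem measurableSet_freq (H : IsHomogeneousType d μ cd cμ) (L : LabelTree d cd δ) (k : ℤ) (i : ℕ) :
    MeasurableSet {s | L.Freq k i s} := by
  simp only [Freq, Filter.frequently_atTop, ofPred_forall, ofPred_exists]
  refine MeasurableSet.iInter fun a => MeasurableSet.iUnion fun b => ?_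
  by_cases h : b ≥ a
  · simp only [h, true_and]
    exact measurable_approx H L k b (measurableSet_singleton i)
  · simp [h]

theorem measurable_limitNat (H : IsHomogeneousType d μ cd cμ) (L : LabelTree d cd δ) (n : ℕ) :
    Measurable (L.limitNat n) := by
  induction n with
  | zero => exact measurable_sInf_nat fun i => measurableSet_freq H L 0 i
  | succ n ih =>
    refine measurable_sInf_nat fun i => (measurableSet_freq H L (n + 1) i).inter ?_
    exact measurableSet_eq_fun measurable_const ih

theorem measurable_label (H : IsHomogeneousType d μ cd cμ) (L : LabelTree d cd δ) (k : ℤ) :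
    Measurable (L.label k) :=
  (measurable_from_top (f := L.anc k (-k).toNat)).comp (measurable_limitNat H L _)

/-- The dyadic system of all points with given labels. -/
noncomputable def dyadicSystem (H : IsHomogeneousType d μ cd cμ) (hcd : 1 ≤ cd) (hδ : 0 < δ)
    (hδ' : 2 * cd * δ ≤ 1) (L : LabelTree d cd δ) {c₁ c₀ : ℝ}
    (hpar : ∀ k, ∀ i ∈ L.I (k + 1), ∀ j ∈ L.I k,
      d (L.f (k + 1) i) (L.f k j) < c₁ * δ ^ k → L.par k i = j)
    (hc : cd * (c₀ + 4 * cd ^ 2 * δ) ≤ c₁) :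
    DyadicSystem d c₀ (8 * cd ^ 2) δ where
  J k := ULift.{u} (L.I k)
  cube k j := {s | L.label k s = j.down}
  center k j := L.f k j.down
  measurableSet_cube k j := measurable_label H L k (measurableSet_singleton _)
  pairwise_disjoint k i j hij := by
    refine Set.disjoint_left.2 fun s hs hs' => hij ?_
    exact ULift.ext _ _ (Subtype.ext (hs.symm.trans hs'))
  iUnion_cube k := eq_univ_of_forall fun s => mem_iUnion.2
    ⟨⟨⟨L.label k s, (Freq.spec H.quasiMetric hcd hδ hδ' (label_freq H hcd hδ hδ' L k s)).1⟩⟩, rfl⟩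
  nested k l hkl i j := by
    -- The coarser label is a function of the finer one, because labels are compatible with parents;
    -- hence a fine fibre lies inside one coarse fibre.
    have hg : ∃ g : ℕ → ℕ, ∀ s, L.label l s = g (L.label k s) := by
      induction k, hkl using Int.leInduction with
      | base => exact ⟨id, fun s => rfl⟩
      | succ k hk ih =>
        obtain ⟨g, hg⟩ := ih ⟨⟨L.par k i.down, L.par_mem k _ i.down.2⟩⟩
        exact ⟨g ∘ L.par k, fun s => by
          rw [hg, comp_apply, par_label H hcd hδ hδ']⟩
    obtain ⟨g, hg⟩ := hg
    by_cases h : g i.down = j.down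
    · refine Or.inr fun s hs => ?_
      have hs' : L.label k s = i.down := hs
      show L.label l s = j.down
      rw [hg, hs', h]
    · refine Or.inl (Set.disjoint_left.2 fun s hs hs' => h ?_)
      have hs1 : L.label k s = i.down := hs
      have hs2 : L.label l s = j.down := hs'
      rw [← hs1, ← hg, hs2]
  -- A point close to the center has its label of generation `k + 1` within `c₁ * δ ^ k` of that
  -- center, and `hpar` then forces the parent to be `j`.
  qball_subset_cube k j := by
    intro s hs
    have hs' : d (L.f k j.down) s < c₀ * δ ^ k := hs
    show L.label k s = j.down
    rw [← par_label H hcd hδ hδ']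
    have h1 := Freq.spec H.quasiMetric hcd hδ hδ' (label_freq H hcd hδ hδ' L (k + 1) s)
    refine hpar k _ h1.1 _ j.down.2 ?_
    have h2 := H.quasiMetric.triangle (L.f (k + 1) (L.label (k + 1) s)) (L.f k j.down) s
    rw [H.quasiMetric.symm _ s, H.quasiMetric.symm s (L.f k j.down)] at h2
    have h3 := h1.2
    rw [zpow_add_one₀ hδ.ne'] at h3
    have hk : 0 < δ ^ k := zpow_pos hδ k
    calc _ ≤ _ := h2
      _ < cd * (4 * cd ^ 2 * (δ ^ k * δ) + c₀ * δ ^ k) :=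
        mul_lt_mul_of_pos_left (add_lt_add_of_le_of_lt h3 hs') (by linarith)
      _ = cd * (c₀ + 4 * cd ^ 2 * δ) * δ ^ k := by ring
      _ ≤ c₁ * δ ^ k := by gcongr
  cube_subset_qball k j := by
    intro s hs
    have hs' : L.label k s = j.down := hs
    have h1 := (Freq.spec H.quasiMetric hcd hδ hδ' (label_freq H hcd hδ hδ' L k s)).2
    rw [hs'] at h1
    show d _ s < _
    rw [H.quasiMetric.symm]
    have hk : 0 < δ ^ k := zpow_pos hδ k
    have : 0 < cd ^ 2 * δ ^ k := by positivity
    linarith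

end LabelTree

end Tree

/-- For given constants there are adjacent dyadic systems with constants depending only on them. -/
theorem exists_adjacent (cd : ℝ) (hcd : 1 ≤ cd) (cμ : ℝ≥0) :
    ∃ (m : ℕ) (c₀ C₀ δ γ : ℝ), 0 < c₀ ∧ c₀ ≤ C₀ ∧ 0 < δ ∧ 2 * cd * δ ≤ 1 ∧ 1 ≤ γ ∧
      ∀ (S : Type u) [MeasurableSpace S] (d : S → S → ℝ) (μ : Measure S),
        IsHomogeneousType d μ cd cμ →
          ∃ D : Fin m → DyadicSystem d c₀ C₀ δ, IsAdjacent D γ := by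
  classical
  have hcd0 : 0 < cd := by linarith
  have hp5 : 1 ≤ cd ^ 5 := one_le_pow₀ hcd
  have hp3 : 1 ≤ cd ^ 3 := one_le_pow₀ hcd
  -- The constants satisfy `Lc * δ = c₁` and `cd * (c₀ + 4 * cd ^ 2 * δ) = c₁`. Also `M = 2 * cd *
  -- Lc`, so that two points of the same colour within `Lc` times the scale of a common point
  -- coincide.
  set δ : ℝ := 1 / (32 * cd ^ 5) with hδ
  have hδ0 : 0 < δ := by positivity
  have hδ1 : 2 * cd * δ ≤ 1 := by
    rw [hδ, mul_one_div, div_le_one (by positivity)]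
    nlinarith [le_self_pow₀ hcd (n := 5) (by norm_num)]
  have hδlt : δ < 1 := by nlinarith
  set Lc : ℝ := 8 * cd ^ 3 with hLc
  set M : ℝ := 2 * cd * Lc with hM
  set c₁ : ℝ := 1 / (4 * cd ^ 2) with hc₁
  set c₀ : ℝ := 1 / (8 * cd ^ 3) with hc₀
  have hc : cd * (c₀ + 4 * cd ^ 2 * δ) ≤ c₁ := by
    apply le_of_eq; rw [hc₀, hc₁, hδ]; field_simp; norm_num
  refine ⟨packing cd cμ M + 1, c₀, 8 * cd ^ 2, δ, 16 * cd ^ 3 / δ ^ 2, by positivity, ?_, hδ0, hδ1,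
    ?_, ?_⟩
  · rw [hc₀, div_le_iff₀ (by positivity)]
    have : 1 ≤ cd ^ 2 := one_le_pow₀ hcd
    nlinarith
  · rw [le_div_iff₀ (by positivity)]
    have : δ ^ 2 ≤ 1 := pow_le_one₀ hδ0.le hδlt.le
    linarith
  intro S _ d μ H
  rcases isEmpty_or_nonempty S with hS | hS
  · refine ⟨fun _ => ⟨fun _ => PEmpty, fun _ j => j.elim, fun _ j => j.elim, fun _ j => j.elim,
      fun _ j => j.elim, fun _ => ?_, fun _ _ _ i => i.elim, fun _ j => j.elim,
      fun _ j => j.elim⟩, fun s => hS.elim s⟩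
    exact Subsingleton.elim _ _
  have hd := H.quasiMetric
  choose f I col hsep hcov hcol using fun k : ℤ =>
    H.exists_colored_net hcd (r := δ ^ k) (M := M) (zpow_pos hδ0 k) (by positivity)
  -- A basic parent map that respects proximity: `r`-separation leaves at most one net point within
  -- `δ ^ k / (2 * cd)`, and if there is one it is chosen.
  have hbase : ∀ (k : ℤ) (s : S), ∃ z ∈ I k, d s (f k z) < δ ^ k ∧
      ∀ z' ∈ I k, d s (f k z') < 1 / (2 * cd) * δ ^ k → z' = z := by
    intro k s
    have hk : 0 < δ ^ k := zpow_pos hδ0 k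
    by_cases h : ∃ z ∈ I k, d s (f k z) < 1 / (2 * cd) * δ ^ k
    · obtain ⟨z, hz, hlt⟩ := h
      refine ⟨z, hz, hlt.trans_le ?_, fun z' hz' hlt' => ?_⟩
      · have : 1 / (2 * cd) ≤ 1 := by rw [div_le_one (by positivity)]; linarith
        nlinarith
      · by_contra hne
        have h1 := hsep k z' hz' z hz hne
        rw [hd.symm] at hlt'
        have h2 := hd.triangle_lt hcd hlt' hlt
        have h3 : cd * (1 / (2 * cd) * δ ^ k + 1 / (2 * cd) * δ ^ k) = δ ^ k := by
          field_simp; ring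
        linarith
    · push Not at h
      obtain ⟨z, hz, hlt⟩ := hcov k s
      exact ⟨z, hz, hlt, fun z' hz' h' => absurd h' (not_lt.2 (h z' hz'))⟩
  choose b hbI hbd hbu using hbase
  -- the parent of `i` in the system of colour `c`
  have hparex : ∀ (c : Fin (packing cd cμ M + 1)) (k : ℤ) (i : ℕ), ∃ j : ℕ, i ∈ I (k + 1) →
      (j ∈ I k ∧ d (f (k + 1) i) (f k j) ≤ 2 * cd * δ ^ k) ∧
      (∀ z ∈ I k, d (f (k + 1) i) (f k z) < c₁ * δ ^ k → j = z) ∧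
      (∀ x ∈ I (k + 1), col (k + 1) x = c → d (f (k + 1) x) (f (k + 1) i) < Lc * δ ^ (k + 1) →
        j = b k (f (k + 1) x)) := by
    intro c k i
    have hk : 0 < δ ^ k := zpow_pos hδ0 k
    have hLδ : Lc * δ ^ (k + 1) = c₁ * δ ^ k := by
      have : Lc * δ = c₁ := by rw [hLc, hc₁, hδ]; field_simp; norm_num
      rw [zpow_add_one₀ hδ0.ne', ← this]; ring
    have hc₁1 : c₁ ≤ 1 / (2 * cd) := by
      rw [hc₁]; apply one_div_le_one_div_of_le (by positivity); nlinarith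
    have hc₁2 : 1 / (2 * cd) ≤ 1 := by
      rw [div_le_one (by positivity)]; linarith
    -- Near a point `x` of colour `c` all points adopt the parent of `x`, so a whole ball around `x`
    -- lands in one cube of the system of colour `c`. The colouring makes `x` unique, and `Lc * δ ^
    -- (k + 1) = c₁ * δ ^ k` is small enough not to disturb the points close to a center of
    -- generation `k`.
    by_cases h : ∃ x ∈ I (k + 1), col (k + 1) x = c ∧
        d (f (k + 1) x) (f (k + 1) i) < Lc * δ ^ (k + 1)
    · obtain ⟨x, hx, hxc, hxd⟩ := h
      refine ⟨b k (f (k + 1) x), fun hi => ⟨⟨hbI _ _, ?_⟩, fun z hz hzd => ?_, fun y hy hyc hyd => ?_⟩⟩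
      · have h1 : d (f (k + 1) i) (f (k + 1) x) < Lc * δ ^ (k + 1) := by rw [hd.symm]; exact hxd
        have h2 := hd.triangle_lt hcd h1 (hbd k (f (k + 1) x))
        refine h2.le.trans ?_
        rw [hLδ]
        calc cd * (c₁ * δ ^ k + δ ^ k) ≤ cd * (1 * δ ^ k + δ ^ k) := by
              gcongr; exact hc₁1.trans hc₁2
          _ = _ := by ring
      · refine (hbu k _ z hz ?_).symm
        have h2 := hd.triangle_lt hcd hxd hzd
        refine h2.trans_le (le_of_eq ?_)
        rw [hLδ, hc₁]; field_simp; ring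
      · congr 2
        refine hcol (k + 1) x hx y hy (hxc.trans hyc.symm) ?_
        rw [hd.symm] at hyd
        have h2 := hd.triangle_lt hcd hxd hyd
        refine h2.trans_le (le_of_eq ?_)
        rw [hM]; ring
    · push Not at h
      refine ⟨b k (f (k + 1) i), fun hi => ⟨⟨hbI _ _, ?_⟩, fun z hz hzd => ?_, fun y hy hyc hyd => ?_⟩⟩
      · have := hbd k (f (k + 1) i)
        nlinarith
      · exact (hbu k _ z hz (hzd.trans_le (by gcongr))).symm
      · exact absurd hyd (not_lt.2 (h y hy hyc))
  choose par hpar using hparex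
  let T : Fin (packing cd cμ M + 1) → LabelTree d cd δ := fun c =>
    { f := f
      I := I
      par := par c
      sep := hsep
      cov := hcov
      par_mem := fun k i hi => (hpar c k i hi).1.1
      dist_par := fun k i hi => (hpar c k i hi).1.2 }
  let D : ∀ c, DyadicSystem d c₀ (8 * cd ^ 2) δ := fun c =>
    (T c).dyadicSystem H hcd hδ0 hδ1 (c₁ := c₁) (fun k i hi j hj h => (hpar c k i hi).2.1 j hj h) hc
  refine ⟨D, fun s ρ hρ => ?_⟩
  obtain ⟨n, hn1, hn2⟩ := exists_mem_Ioc_zpow hρ ((one_lt_inv₀ hδ0).2 hδlt)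
  obtain ⟨k, rfl⟩ : ∃ k : ℤ, n = -(k + 2) := ⟨-n - 2, by ring⟩
  have hρ1 : δ ^ (k + 2) < ρ := by rwa [inv_zpow, zpow_neg, inv_inv] at hn1
  have hρ2 : ρ ≤ δ ^ (k + 1) := by
    rw [inv_zpow, show -(k + 2) + 1 = -(k + 1) by ring, zpow_neg, inv_inv] at hn2
    exact hn2
  -- The colour of a net point `x` near the center of the ball selects the system. Since `ρ ≤ δ ^ (k
  -- + 1)`, all labels of points of the ball lie within `Lc * δ ^ (k + 1)` of `x` and have its
  -- parent. The lower bound `δ ^ (k + 2) < ρ` accounts for the `δ ^ 2` in the adjacency constant.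
  obtain ⟨x, hx, hsx⟩ := hcov (k + 1) s
  set c := col (k + 1) x with hcdef
  set z := b k (f (k + 1) x) with hz
  refine ⟨c, (D c).cube k ⟨⟨z, hbI _ _⟩⟩, ⟨k, _, rfl⟩, fun t ht => ?_, fun t ht t' ht' => ?_⟩
  · show (T c).label k t = z
    rw [← LabelTree.par_label H hcd hδ0 hδ1]
    have h1 := LabelTree.Freq.spec hd hcd hδ0 hδ1
      (LabelTree.label_freq H hcd hδ0 hδ1 (T c) (k + 1) t)
    refine (hpar c k _ h1.1).2.2 x hx rfl ?_
    have ht' : d s t < ρ := ht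
    have hk : 0 < δ ^ (k + 1) := zpow_pos hδ0 _
    have h2 : d (f (k + 1) x) t < cd * (δ ^ (k + 1) + δ ^ (k + 1)) := by
      refine hd.triangle_lt hcd (r := s) ?_ (ht'.trans_le hρ2)
      rw [hd.symm]; exact hsx
    have h3 := hd.triangle (f (k + 1) x) (f (k + 1) ((T c).label (k + 1) t)) t
    refine h3.trans_lt ?_
    calc _ < cd * (cd * (δ ^ (k + 1) + δ ^ (k + 1)) + 4 * cd ^ 2 * δ ^ (k + 1)) :=
          mul_lt_mul_of_pos_left (add_lt_add_of_lt_of_le h2 h1.2) hcd0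
      _ = (2 * cd ^ 2 + 4 * cd ^ 3) * δ ^ (k + 1) := by ring
      _ ≤ Lc * δ ^ (k + 1) := by
        gcongr
        have : cd ^ 2 ≤ cd ^ 3 := pow_le_pow_right₀ hcd (by norm_num)
        linarith
  · have hk : 0 < δ ^ k := zpow_pos hδ0 k
    have h1 := (D c).cube_subset_qball k _ ht
    have h2 := (D c).cube_subset_qball k _ ht'
    rw [mem_qball, hd.symm] at h1
    have h3 := hd.triangle_lt hcd h1 h2
    refine h3.le.trans ?_
    rw [zpow_add₀ hδ0.ne'] at hρ1
    calc cd * (8 * cd ^ 2 * δ ^ k + 8 * cd ^ 2 * δ ^ k) = 16 * cd ^ 3 / δ ^ 2 * (δ ^ k * δ ^ (2 : ℤ)) := by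
          rw [zpow_ofNat]; field_simp; ring
      _ ≤ _ := by gcongr

/-! ### Weak-type estimates for nested families -/

section Laminar

variable {S : Type u} [MeasurableSpace S] {ν : Measure S}

/-- The maximal members of a finite nested family are disjoint and have the same union, so the
inequalities for them can be added. Neither doubling nor finiteness of the measure is needed. -/
theorem laminar_finset_weak (F : Finset (Set S)) (hm : ∀ A ∈ F, MeasurableSet A)
    (hlam : ∀ A ∈ F, ∀ B ∈ F, Disjoint A B ∨ A ⊆ B ∨ B ⊆ A) (g : S → ℝ≥0∞) (a : ℝ≥0∞)
    (h : ∀ A ∈ F, a * ν A ≤ ∫⁻ t in A, g t ∂ν) :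
    a * ν (⋃ A ∈ F, A) ≤ ∫⁻ t in ⋃ A ∈ F, A, g t ∂ν := by
  classical
  set G := F.filter (fun A => Maximal (· ∈ F) A) with hG
  have hGF : G ⊆ F := Finset.filter_subset _ _
  have hU : ⋃ A ∈ F, A = ⋃ A ∈ G, A := by
    refine subset_antisymm (iUnion₂_subset fun A hA => ?_) (biUnion_subset_biUnion_left hGF)
    obtain ⟨B, hAB, hB⟩ := F.exists_le_maximal hA
    exact hAB.trans (subset_biUnion_of_mem (u := id) (Finset.mem_filter.2 ⟨hB.1, hB⟩))
  have hdisj : (G : Set (Set S)).PairwiseDisjoint id := by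
    intro A hA B hB hne
    have hA' := Finset.mem_filter.1 hA
    have hB' := Finset.mem_filter.1 hB
    rcases hlam A hA'.1 B hB'.1 with h | h | h
    · exact h
    · exact absurd (le_antisymm h (hA'.2.2 hB'.1 h)) hne
    · exact absurd (le_antisymm (hB'.2.2 hA'.1 h) h) hne
  rw [hU]
  calc a * ν (⋃ A ∈ G, A) ≤ a * ∑ A ∈ G, ν A := by
        gcongr; exact measure_biUnion_finset_le G id
    _ = ∑ A ∈ G, a * ν A := Finset.mul_sum _ _ _
    _ ≤ ∑ A ∈ G, ∫⁻ t in A, g t ∂ν := Finset.sum_le_sum fun A hA => h A (hGF hA)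
    _ = _ := (lintegral_biUnion_finset (t := id) hdisj (fun A hA => hm A (hGF hA)) g).symm

/-- Weak-type estimate for a countable family of sets any two of which are nested or disjoint. -/
theorem laminar_weak {ι : Type*} [Countable ι] (A : ι → Set S) (hm : ∀ i, MeasurableSet (A i))
    (hlam : ∀ i j, Disjoint (A i) (A j) ∨ A i ⊆ A j ∨ A j ⊆ A i) (g : S → ℝ≥0∞) (a : ℝ≥0∞)
    (h : ∀ i, a * ν (A i) ≤ ∫⁻ t in A i, g t ∂ν) :
    a * ν (⋃ i, A i) ≤ ∫⁻ t in ⋃ i, A i, g t ∂ν := by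
  classical
  have hU : ⋃ i, A i = ⋃ F : Finset ι, ⋃ i ∈ F, A i := by
    rw [← iUnion_eq_iUnion_finset]
  have hdir : Directed (· ⊆ ·) fun F : Finset ι => ⋃ i ∈ F, A i := by
    refine Monotone.directed_le fun F G hFG => ?_
    exact biUnion_subset_biUnion_left hFG
  rw [hU, hdir.measure_iUnion, ENNReal.mul_iSup]
  refine iSup_le fun F => ?_
  have hF : ⋃ i ∈ F, A i = ⋃ B ∈ F.image A, B := by
    simp
  calc a * ν (⋃ i ∈ F, A i) ≤ ∫⁻ t in ⋃ i ∈ F, A i, g t ∂ν := by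
        rw [hF]
        refine laminar_finset_weak _ ?_ ?_ g a ?_ <;> simp only [Finset.mem_image]
        · rintro _ ⟨i, _, rfl⟩; exact hm i
        · rintro _ ⟨i, _, rfl⟩ _ ⟨j, _, rfl⟩; exact hlam i j
        · rintro _ ⟨i, _, rfl⟩; exact h i
    _ ≤ _ := lintegral_mono_set (subset_iUnion (fun F : Finset ι => ⋃ i ∈ F, A i) F)

end Laminar

/-! ### Measures of cubes and stopping cubes -/

namespace DyadicSystem

variable {S : Type u} [MeasurableSpace S] {d : S → S → ℝ} {c₀ C₀ δ : ℝ}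
  (D : DyadicSystem d c₀ C₀ δ)

/-- Indices of cubes: a generation and an index within the generation. -/
abbrev Idx : Type u := Σ k : ℤ, D.J k

/-- The cube with index `q`. -/
def set (q : D.Idx) : Set S := D.cube q.1 q.2

/-- The center of the cube with index `q`. -/
def ctr (q : D.Idx) : S := D.center q.1 q.2

/-- The dilated cube `αQ`, a ball. -/
def dil (α : ℝ) (q : D.Idx) : Set S := qball d (D.ctr q) (α * (C₀ * δ ^ q.1))

variable {D}

theorem measurableSet_set (q : D.Idx) : MeasurableSet (D.set q) := D.measurableSet_cube _ _

theorem exists_mem_cube (k : ℤ) (s : S) : ∃ j, s ∈ D.cube k j := by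
  have := D.iUnion_cube k
  exact mem_iUnion.1 (this ▸ mem_univ s)

theorem eq_of_mem_cube {k : ℤ} {i j : D.J k} {s : S} (hi : s ∈ D.cube k i) (hj : s ∈ D.cube k j) :
    i = j := by
  by_contra hne
  exact Set.disjoint_left.1 (D.pairwise_disjoint k hne) hi hj

theorem cube_subset_cube_of_mem {k l : ℤ} (h : l ≤ k) {i : D.J k} {j : D.J l} {s : S}
    (hi : s ∈ D.cube k i) (hj : s ∈ D.cube l j) : D.cube k i ⊆ D.cube l j :=
  (D.nested k l h i j).resolve_left fun hd => Set.disjoint_left.1 hd hi hj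

theorem laminar_set (q q' : D.Idx) :
    Disjoint (D.set q) (D.set q') ∨ D.set q ⊆ D.set q' ∨ D.set q' ⊆ D.set q := by
  rcases le_total q'.1 q.1 with h | h
  · exact (D.nested _ _ h q.2 q'.2).imp id Or.inl
  · exact (D.nested _ _ h q'.2 q.2).imp (fun h => Disjoint.symm h) Or.inr

theorem set_subset_qball (q : D.Idx) : D.set q ⊆ qball d (D.ctr q) (C₀ * δ ^ q.1) :=
  D.cube_subset_qball _ _

theorem qball_subset_set (q : D.Idx) : qball d (D.ctr q) (c₀ * δ ^ q.1) ⊆ D.set q :=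
  D.qball_subset_cube _ _

variable {μ : Measure S} {cd : ℝ} {cμ : ℝ≥0}

theorem ctr_mem (hd : IsQuasiMetric d cd) (hc₀ : 0 < c₀) (hδ : 0 < δ) (q : D.Idx) :
    D.ctr q ∈ D.set q :=
  qball_subset_set q (hd.mem_qball_self _ (mul_pos hc₀ (zpow_pos hδ _)))

theorem measure_set_pos (H : IsHomogeneousType d μ cd cμ) (hc₀ : 0 < c₀) (hδ : 0 < δ) (q : D.Idx) :
    0 < μ (D.set q) :=
  (H.measure_qball_pos _ _ (mul_pos hc₀ (zpow_pos hδ _))).trans_le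
    (measure_mono (qball_subset_set q))

theorem measure_set_ne_top (H : IsHomogeneousType d μ cd cμ) (q : D.Idx) : μ (D.set q) ≠ ∞ :=
  ((measure_mono (set_subset_qball q)).trans_lt (H.measure_qball_lt_top _ _)).ne

theorem countable_idx (H : IsHomogeneousType d μ cd cμ) (hc₀ : 0 < c₀) (hδ : 0 < δ) :
    Countable D.Idx := by
  have := H.sigmaFinite
  have : ∀ k, Countable (D.J k) := by
    intro k
    have h := Measure.countable_meas_pos_of_disjoint_iUnion (μ := μ) (As := D.cube k)
      (D.measurableSet_cube k) (D.pairwise_disjoint k)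
    have huniv : {j | 0 < μ (D.cube k j)} = univ :=
      eq_univ_of_forall fun j => measure_set_pos H hc₀ hδ ⟨k, j⟩
    rw [huniv] at h
    exact Set.countable_univ_iff.1 h
  infer_instance

theorem measure_dil_le (H : IsHomogeneousType d μ cd cμ) (hcd : 1 ≤ cd) (hc₀ : 0 < c₀)
    (hC₀ : c₀ ≤ C₀) (hδ : 0 < δ) {α : ℝ} (hα : 0 ≤ α) (q : D.Idx) :
    μ (D.dil α q) ≤ dbl cd cμ (α * C₀ / c₀) * μ (D.set q) := by
  have hk : 0 < δ ^ q.1 := zpow_pos hδ _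
  have hC : 0 < C₀ := hc₀.trans_le hC₀
  refine (H.measure_qball_le hcd (s := D.ctr q) (ρ := c₀ * δ ^ q.1)
    (L := α * C₀ / c₀) (by positivity) ?_ ?_).trans ?_
  · rw [H.quasiMetric.self]; positivity
  · apply le_of_eq; field_simp
  · gcongr; exact qball_subset_set q

theorem measure_parent_le (H : IsHomogeneousType d μ cd cμ) (hcd : 1 ≤ cd) (hc₀ : 0 < c₀)
    (hδ : 0 < δ) {k : ℤ} {i : D.J (k + 1)} {j : D.J k} (h : D.cube (k + 1) i ⊆ D.cube k j) :
    μ (D.cube k j) ≤ dbl cd cμ (C₀ / (c₀ * δ)) * μ (D.cube (k + 1) i) := by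
  have hk : 0 < δ ^ k := zpow_pos hδ _
  have hk1 : 0 < δ ^ (k + 1) := zpow_pos hδ _
  have heq : C₀ / (c₀ * δ) * (c₀ * δ ^ (k + 1)) = C₀ * δ ^ k := by
    rw [zpow_add_one₀ hδ.ne']; field_simp
  have hmem : D.center (k + 1) i ∈ D.cube (k + 1) i := ctr_mem H.quasiMetric hc₀ hδ ⟨k + 1, i⟩
  have h2 := D.cube_subset_qball k j (h hmem)
  refine (measure_mono (D.cube_subset_qball k j)).trans
    ((H.measure_qball_le hcd (s := D.center (k + 1) i) (ρ := c₀ * δ ^ (k + 1)) (by positivity) ?_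
      heq.ge).trans ?_)
  · rw [heq, H.quasiMetric.symm]; exact le_of_lt h2
  · gcongr; exact D.qball_subset_cube _ _

theorem exists_cube_subset_qball (hd : IsQuasiMetric d cd) (hcd : 1 ≤ cd) (hδ : 0 < δ) (hδ' : δ < 1)
    (s : S) {ρ : ℝ} (hρ : 0 < ρ) (k₀ : ℤ) :
    ∃ k, k₀ < k ∧ ∀ j, s ∈ D.cube k j → D.cube k j ⊆ qball d s ρ := by
  have hlim : Filter.Tendsto (fun n : ℕ => cd * (C₀ * (δ ^ k₀ * δ ^ n) + C₀ * (δ ^ k₀ * δ ^ n)))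
      Filter.atTop (nhds (cd * (C₀ * (δ ^ k₀ * 0) + C₀ * (δ ^ k₀ * 0)))) := by
    have := tendsto_pow_atTop_nhds_zero_of_lt_one hδ.le hδ'
    exact ((((this.const_mul _).const_mul _).add ((this.const_mul _).const_mul _)).const_mul _)
  simp only [mul_zero, add_zero] at hlim
  obtain ⟨n, hn, hn1⟩ := ((hlim.eventually (gt_mem_nhds hρ)).and (Filter.eventually_ge_atTop 1)).exists
  refine ⟨k₀ + n, by omega, fun j hs t ht => ?_⟩
  have h1 := D.cube_subset_qball _ _ hs
  have h2 := D.cube_subset_qball _ _ ht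
  rw [mem_qball, hd.symm, zpow_add₀ hδ.ne', zpow_natCast] at h1
  rw [mem_qball, zpow_add₀ hδ.ne', zpow_natCast] at h2
  exact (hd.triangle_lt hcd h1 h2).trans hn

/-- Maximal cubes of generation greater than `k₀` on which the average of `h` exceeds `a`. -/
theorem exists_stopping (H : IsHomogeneousType d μ cd cμ) (hcd : 1 ≤ cd) (hc₀ : 0 < c₀)
    (hδ : 0 < δ) (k₀ : ℤ) (h : S → ℝ≥0∞) (a : ℝ≥0∞)
    (htop : ∀ j, ∫⁻ t in D.cube k₀ j, h t ∂μ ≤ a * μ (D.cube k₀ j)) :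
    ∃ P : Set D.Idx, (∀ q ∈ P, k₀ < q.1) ∧ P.PairwiseDisjoint D.set ∧
      (∀ q ∈ P, a * μ (D.set q) < ∫⁻ t in D.set q, h t ∂μ ∧
        ∫⁻ t in D.set q, h t ∂μ ≤ a * (dbl cd cμ (C₀ / (c₀ * δ)) * μ (D.set q))) ∧
      ∀ s, (∀ q ∈ P, s ∉ D.set q) → ∀ k, k₀ < k → ∀ j, s ∈ D.cube k j →
        ∫⁻ t in D.cube k j, h t ∂μ ≤ a * μ (D.cube k j) := by
  set bad : D.Idx → Prop := fun q => k₀ < q.1 ∧ a * μ (D.set q) < ∫⁻ t in D.set q, h t ∂μ with hbad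
  set P : Set D.Idx := {q | bad q ∧ ∀ q', bad q' → q'.1 < q.1 → ¬ D.set q ⊆ D.set q'} with hP
  refine ⟨P, fun q hq => hq.1.1, ?_, fun q hq => ⟨hq.1.2, ?_⟩, ?_⟩
  · intro q hq q' hq' hne
    by_contra hnd
    obtain ⟨s, hs, hs'⟩ := Set.not_disjoint_iff.1 hnd
    rcases lt_trichotomy q.1 q'.1 with hlt | heq | hlt
    · exact hq'.2 q hq.1 hlt (cube_subset_cube_of_mem hlt.le hs' hs)
    · obtain ⟨k, i⟩ := q
      obtain ⟨k', j⟩ := q'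
      obtain rfl : k = k' := heq
      exact hne (by rw [eq_of_mem_cube (i := i) (j := j) hs hs'])
    · exact hq.2 q' hq'.1 hlt (cube_subset_cube_of_mem hlt.le hs hs')
  -- The dyadic parent of a maximal bad cube is not bad, or it has generation `k₀`, where `htop`
  -- applies. Doubling transfers its bound to the cube.
  · obtain ⟨k', i⟩ := q
    obtain ⟨k, rfl⟩ : ∃ k, k' = k + 1 := ⟨k' - 1, by ring⟩
    have hmem : D.center (k + 1) i ∈ D.cube (k + 1) i := ctr_mem H.quasiMetric hc₀ hδ ⟨k + 1, i⟩
    obtain ⟨j, hj⟩ := D.exists_mem_cube k (D.center (k + 1) i)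
    have hsub : D.cube (k + 1) i ⊆ D.cube k j := cube_subset_cube_of_mem (by omega) hmem hj
    have hpar : ∫⁻ t in D.cube k j, h t ∂μ ≤ a * μ (D.cube k j) := by
      have hk : k₀ < k + 1 := hq.1.1
      rcases eq_or_lt_of_le (Int.lt_add_one_iff.1 hk) with rfl | hlt
      · exact htop j
      · by_contra hcon
        exact hq.2 ⟨k, j⟩ ⟨hlt, not_le.1 hcon⟩ (by simp) hsub
    calc _ ≤ ∫⁻ t in D.cube k j, h t ∂μ := lintegral_mono_set hsub
      _ ≤ _ := hpar
      _ ≤ _ := by gcongr; exact measure_parent_le H hcd hc₀ hδ hsub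
  · intro s hs
    by_contra! hcon
    -- The first bad generation above `s`, counted from `k₀ + 1`, yields a maximal bad cube that
    -- contains `s`.
    have hex : ∃ n : ℕ, ∃ j, s ∈ D.cube (k₀ + 1 + n) j ∧ bad ⟨k₀ + 1 + n, j⟩ := by
      obtain ⟨k, hk, j, hj, hlt⟩ := hcon
      obtain ⟨n, hn⟩ := Int.eq_ofNat_of_zero_le (show 0 ≤ k - (k₀ + 1) by omega)
      obtain rfl : k = k₀ + 1 + n := by omega
      exact ⟨n, j, hj, by show k₀ < k₀ + 1 + n; omega, hlt⟩
    classical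
    obtain ⟨j, hj, hb⟩ := Nat.find_spec hex
    refine hs ⟨_, j⟩ ⟨hb, fun q' hq' hlt hsub => ?_⟩ hj
    obtain ⟨k', i⟩ := q'
    have hk' : k₀ < k' := hq'.1
    obtain ⟨n, hn⟩ := Int.eq_ofNat_of_zero_le (show 0 ≤ k' - (k₀ + 1) by omega)
    obtain rfl : k' = k₀ + 1 + n := by omega
    have hlt' : k₀ + 1 + (n : ℤ) < k₀ + 1 + (Nat.find hex : ℕ) := hlt
    exact Nat.find_min hex (m := n) (by omega) ⟨i, hsub hj, hq'⟩

end DyadicSystem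

/-! ### Open covers of almost the same measure -/

section Covering

variable {S : Type u} [MeasurableSpace S] {d : S → S → ℝ} {μ : Measure S} {cd : ℝ} {cμ : ℝ≥0}

/-- A bounded set can be covered by a bounded open set of nearly the same measure. -/
theorem IsHomogeneousType.exists_open_cover (H : IsHomogeneousType d μ cd cμ) (hcd : 1 ≤ cd)
    {F : Set S} {z : S} {R : ℝ} (hR : 0 < R) (hF : F ⊆ qball d z R) {ε : ℝ≥0∞} (hε : ε ≠ 0) :
    ∃ U, F ⊆ U ∧ U ⊆ qball d z (2 * cd * R) ∧ MeasurableSet U ∧ μ U ≤ μ F + ε ∧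
      ∀ s ∈ U, ∃ ρ, 0 < ρ ∧ qball d s ρ ⊆ U := by
  have hd := H.quasiMetric
  let top := quasiTopology d
  have hB : BorelSpace S := ⟨H.borel⟩
  choose V hVo hVm hVs using fun t => hd.exists_isOpen_subset_qball hcd t hR
  -- A bounded open neighbourhood: the measure restricted to it is finite, as outer regularity
  -- requires, and the final cover remains bounded.
  set W := ⋃ t ∈ qball d z R, V t with hW
  have hWo : IsOpen W := isOpen_biUnion fun t _ => hVo t
  have hWs : W ⊆ qball d z (2 * cd * R) := by
    refine iUnion₂_subset fun t ht => (hVs t).trans ?_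
    refine hd.qball_subset_qball hcd (le_of_lt ht) ?_
    apply le_of_eq; ring
  have hFW : F ⊆ W := fun t ht => mem_biUnion (hF ht) (hVm t)
  have hfin : IsFiniteMeasure (μ.restrict W) :=
    ⟨by rw [Measure.restrict_apply_univ]
        exact (measure_mono hWs).trans_lt (H.measure_qball_lt_top _ _)⟩
  obtain ⟨U, hFU, hUo, hUm, hle⟩ := H.exists_isOpen_le hcd (μ.restrict W) F hε
  refine ⟨U ∩ W, subset_inter hFU hFW, inter_subset_right.trans hWs,
    hUm.inter hWo.measurableSet, ?_, ?_⟩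
  · rw [Measure.restrict_apply hUm] at hle
    exact hle.trans (add_le_add_left (Measure.restrict_apply_le W F) ε)
  · exact hUo.inter hWo

end Covering

/-! ### Kernel tails and the Dini condition -/

section Tail

variable {S : Type u} [MeasurableSpace S] {d : S → S → ℝ} {μ : Measure S} {cd : ℝ} {cμ : ℝ≥0}
  {ω : ℝ → ℝ≥0}

/-- The function `∑ₖ ω(2⁻ᵏ⁻¹) μ(Bₖ)⁻¹ 1_{Bₖ}` with `Bₖ = B(z, 2ᵏ⁺¹ R)`. -/
noncomputable def tail (d : S → S → ℝ) (μ : Measure S) (ω : ℝ → ℝ≥0) (z : S) (R : ℝ) (t : S) :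
    ℝ≥0∞ :=
  ∑' k : ℕ, (qball d z (2 ^ (k + 1) * R)).indicator
    (fun _ => (ω ((1 / 2) ^ (k + 1)) : ℝ≥0∞) * (μ (qball d z (2 ^ (k + 1) * R)))⁻¹) t

/-- On `(2^{-k-1}, 2^{-k}]` the integrand `ω(t)/t` is at least `ω(2^{-k-1}) / 2^{-k}`, and the
interval has length `2^{-k-1}`; so each term is at most twice its piece of the Dini integral. -/
theorem tsum_modulus_le (hω : MonotoneOn ω (Icc 0 1)) :
    ∑' k : ℕ, (ω ((1 / 2) ^ (k + 1)) : ℝ≥0∞) ≤ 2 * diniNorm ω := by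
  set I : ℕ → Set ℝ := fun k => Ioc ((1 / 2) ^ (k + 1)) ((1 / 2) ^ k) with hI
  have hanti : Antitone fun k : ℕ => (1 / 2 : ℝ) ^ k :=
    fun a b hab => pow_le_pow_of_le_one (by norm_num) (by norm_num) hab
  have hdisj : Pairwise (Disjoint on I) := by
    have := hanti.pairwise_disjoint_on_Ioc_succ
    exact this
  have hsub : ⋃ k, I k ⊆ Ioc 0 1 := by
    refine iUnion_subset fun k t ht => ⟨lt_trans (by positivity) ht.1, ht.2.trans ?_⟩
    exact pow_le_one₀ (by norm_num) (by norm_num)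
  have hk : ∀ k : ℕ, (ω ((1 / 2) ^ (k + 1)) : ℝ≥0∞) ≤
      2 * ∫⁻ t in I k, (ω t : ℝ≥0∞) / ENNReal.ofReal t := by
    intro k
    have h1 : ∫⁻ _ in I k, (ω ((1 / 2) ^ (k + 1)) : ℝ≥0∞) / ENNReal.ofReal ((1 / 2) ^ k) ≤
        ∫⁻ t in I k, (ω t : ℝ≥0∞) / ENNReal.ofReal t := by
      refine setLIntegral_mono' measurableSet_Ioc fun t ht => ?_
      have ht1 : t ≤ 1 := ht.2.trans (pow_le_one₀ (by norm_num) (by norm_num))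
      have ht0 : 0 < t := lt_trans (by positivity) ht.1
      refine ENNReal.div_le_div ?_ (ENNReal.ofReal_le_ofReal ht.2)
      exact_mod_cast hω ⟨by positivity, pow_le_one₀ (by norm_num) (by norm_num)⟩ ⟨ht0.le, ht1⟩ ht.1.le
    rw [setLIntegral_const, Real.volume_Ioc] at h1
    have h2 : (1 / 2 : ℝ) ^ k - (1 / 2) ^ (k + 1) = (1 / 2) ^ k * (1 / 2) := by ring
    rw [h2, ENNReal.ofReal_mul (by positivity), ← mul_assoc, ENNReal.div_mul_cancel
      (ENNReal.ofReal_pos.2 (by positivity)).ne' ENNReal.ofReal_ne_top] at h1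
    calc (ω ((1 / 2) ^ (k + 1)) : ℝ≥0∞)
        = 2 * ((ω ((1 / 2) ^ (k + 1)) : ℝ≥0∞) * ENNReal.ofReal (1 / 2)) := by
          rw [one_div, ENNReal.ofReal_inv_of_pos (by norm_num), ENNReal.ofReal_ofNat, mul_comm,
            mul_assoc, ENNReal.inv_mul_cancel (by norm_num) (by norm_num), mul_one]
      _ ≤ _ := by gcongr
  calc ∑' k : ℕ, (ω ((1 / 2) ^ (k + 1)) : ℝ≥0∞)
      ≤ ∑' k, 2 * ∫⁻ t in I k, (ω t : ℝ≥0∞) / ENNReal.ofReal t := ENNReal.tsum_le_tsum hk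
    _ = 2 * ∫⁻ t in ⋃ k, I k, (ω t : ℝ≥0∞) / ENNReal.ofReal t := by
        rw [ENNReal.tsum_mul_left, lintegral_iUnion (fun _ => measurableSet_Ioc) hdisj]
    _ ≤ _ := by
        gcongr
        exact lintegral_mono_set hsub

theorem measurable_tail (H : IsHomogeneousType d μ cd cμ) (z : S) (R : ℝ) :
    Measurable (tail d μ ω z R) :=
  Measurable.tsum fun _ => measurable_const.indicator (H.measurableSet_qball _ _)

/-- Integrated against `g`, the `k`-th term of the tail is `ω(2^{-k-1})` times the average of `g`
over `B(z, 2^{k+1} R)`. With `g = 1` this bounds the decay of atoms; with `g = ‖F‖` it bounds the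
oscillation by averages of `F`. -/
theorem lintegral_tail_mul_le (H : IsHomogeneousType d μ cd cμ) (hω : MonotoneOn ω (Icc 0 1))
    {z : S} {R : ℝ} (hR : 0 < R) {g : S → ℝ≥0∞} (hg : AEMeasurable g μ) {b : ℝ≥0∞}
    (h : ∀ k : ℕ, ∫⁻ t in qball d z (2 ^ (k + 1) * R), g t ∂μ ≤
      b * μ (qball d z (2 ^ (k + 1) * R))) :
    ∫⁻ t, tail d μ ω z R t * g t ∂μ ≤ 2 * diniNorm ω * b := by
  have h1 : ∀ t, tail d μ ω z R t * g t = ∑' k : ℕ, (qball d z (2 ^ (k + 1) * R)).indicator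
      (fun t => (ω ((1 / 2) ^ (k + 1)) : ℝ≥0∞) * (μ (qball d z (2 ^ (k + 1) * R)))⁻¹ * g t) t := by
    intro t
    rw [tail, ← ENNReal.tsum_mul_right]
    refine tsum_congr fun k => ?_
    by_cases ht : t ∈ qball d z (2 ^ (k + 1) * R) <;> simp [ht]
  simp_rw [h1]
  rw [lintegral_tsum fun k => (hg.const_mul _).indicator (H.measurableSet_qball _ _)]
  calc _ ≤ ∑' k : ℕ, (ω ((1 / 2) ^ (k + 1)) : ℝ≥0∞) * b := by
        refine ENNReal.tsum_le_tsum fun k => ?_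
        rw [lintegral_indicator (H.measurableSet_qball _ _), lintegral_const_mul'' _ hg.restrict,
          mul_assoc]
        gcongr
        have h0 := (H.measure_qball_pos z (2 ^ (k + 1) * R) (by positivity)).ne'
        have ht := H.measure_qball_ne_top z (2 ^ (k + 1) * R)
        calc _ ≤ (μ (qball d z (2 ^ (k + 1) * R)))⁻¹ * (b * μ (qball d z (2 ^ (k + 1) * R))) := by
              gcongr; exact h k
          _ = b := by rw [mul_left_comm, ENNReal.inv_mul_cancel h0 ht, mul_one]
    _ ≤ _ := by rw [ENNReal.tsum_mul_right]; gcongr; exact tsum_modulus_le hω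

theorem lintegral_tail_le (H : IsHomogeneousType d μ cd cμ) (hω : MonotoneOn ω (Icc 0 1))
    (z : S) {R : ℝ} (hR : 0 < R) : ∫⁻ t, tail d μ ω z R t ∂μ ≤ 2 * diniNorm ω := by
  have := lintegral_tail_mul_le H hω (z := z) hR (g := fun _ => 1) aemeasurable_const (b := 1)
    (fun k => by simp)
  simpa using this

/-- One estimate serves both smoothness conditions: `p` is near `z`, `q` is far away, `v` is the
displacement of one variable, and `x` is the first variable of the kernel, at which the ball in the
denominator is centered. If `2^k R ≤ d z q < 2^{k+1} R`, then `v / d p q ≤ 2^{-k-1}`, and `B(x, d p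
q)` has measure at least a fixed fraction of that of `B(z, 2^{k+1} R)`. -/
theorem modulus_div_measure_le (H : IsHomogeneousType d μ cd cμ) (hcd : 1 ≤ cd) (hcμ : 1 ≤ cμ)
    (hω : MonotoneOn ω (Icc 0 1)) {z p q x : S} {r R v : ℝ} (hr : 0 < r)
    (hR : 8 * cd ^ 2 * r ≤ R) (hp : d z p ≤ r) (hq : R ≤ d z q) (hv : 0 ≤ v) (hv' : v ≤ 2 * cd * r)
    (hx : x = p ∨ x = q) :
    0 < d p q ∧ (ω (v / d p q) : ℝ≥0∞) * (μ (qball d x (d p q)))⁻¹ ≤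
      dbl cd cμ (8 * cd ^ 2) * tail d μ ω z R q := by
  have hd := H.quasiMetric
  have hcd0 : 0 < cd := by linarith
  have hcd2 : 1 ≤ cd ^ 2 := one_le_pow₀ hcd
  have hR0 : 0 < R := lt_of_lt_of_le (by positivity) hR
  have hcr : cd * r ≤ cd ^ 2 * r := by gcongr; exact le_self_pow₀ hcd (by norm_num)
  have hpq : d z q ≤ 2 * cd * d p q := by
    have := hd.triangle z q p
    nlinarith
  have hpq0 : 0 < d p q := by
    by_contra hcon
    nlinarith
  refine ⟨hpq0, ?_⟩
  obtain ⟨k, hk1, hk2⟩ := exists_nat_pow_near ((one_le_div hR0).2 hq) (one_lt_two : (1 : ℝ) < 2)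
  rw [le_div_iff₀ hR0] at hk1
  rw [div_lt_iff₀ hR0] at hk2
  have hrzq : r ≤ d z q := by nlinarith
  have hball : μ (qball d z (2 ^ (k + 1) * R)) ≤ dbl cd cμ (8 * cd ^ 2) * μ (qball d x (d p q)) := by
    refine H.measure_qball_le hcd hpq0 ?_ ?_
    · rw [hd.symm]
      have : d z x ≤ d z q := by
        rcases hx with rfl | rfl
        · exact hp.trans hrzq
        · exact le_rfl
      nlinarith
    · rw [pow_succ]
      nlinarith
  have hdbl0 : (dbl cd cμ (8 * cd ^ 2) : ℝ≥0∞) ≠ 0 := by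
    have := one_le_dbl (cd := cd) hcμ (8 * cd ^ 2)
    exact_mod_cast (zero_lt_one.trans_le this).ne'
  have hinv : (μ (qball d x (d p q)))⁻¹ ≤
      dbl cd cμ (8 * cd ^ 2) * (μ (qball d z (2 ^ (k + 1) * R)))⁻¹ := by
    have h1 := ENNReal.inv_le_inv.2 hball
    rw [ENNReal.mul_inv (Or.inl hdbl0) (Or.inl ENNReal.coe_ne_top)] at h1
    calc _ = (dbl cd cμ (8 * cd ^ 2) : ℝ≥0∞) *
          ((dbl cd cμ (8 * cd ^ 2) : ℝ≥0∞)⁻¹ * (μ (qball d x (d p q)))⁻¹) := by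
          rw [← mul_assoc, ENNReal.mul_inv_cancel hdbl0 ENNReal.coe_ne_top, one_mul]
      _ ≤ _ := by gcongr
  have hratio : v / d p q ≤ (1 / 2) ^ (k + 1) := by
    rw [div_le_iff₀ hpq0, one_div, inv_pow, ← div_eq_inv_mul, le_div_iff₀ (by positivity)]
    have h2k : (0 : ℝ) < 2 ^ k := by positivity
    have h3 : 2 ^ k * (8 * cd ^ 2 * r) ≤ 2 * cd * d p q := by
      calc _ ≤ 2 ^ k * R := by gcongr
        _ ≤ _ := hk1.trans hpq
    have h4 : 2 ^ k * (4 * cd * r) ≤ d p q := by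
      have : 2 * cd * (2 ^ k * (4 * cd * r)) ≤ 2 * cd * d p q := by linarith
      exact le_of_mul_le_mul_left this (by positivity)
    calc v * 2 ^ (k + 1) ≤ (2 * cd * r) * 2 ^ (k + 1) := by gcongr
      _ = 2 ^ k * (4 * cd * r) := by ring
      _ ≤ _ := h4
  have hωle : ω (v / d p q) ≤ ω ((1 / 2) ^ (k + 1)) := by
    have h1 : (1 / 2 : ℝ) ^ (k + 1) ≤ 1 := pow_le_one₀ (by norm_num) (by norm_num)
    exact hω ⟨by positivity, hratio.trans h1⟩ ⟨by positivity, h1⟩ hratio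
  have hmem : q ∈ qball d z (2 ^ (k + 1) * R) := hk2
  calc _ ≤ (ω ((1 / 2) ^ (k + 1)) : ℝ≥0∞) *
        (dbl cd cμ (8 * cd ^ 2) * (μ (qball d z (2 ^ (k + 1) * R)))⁻¹) := by
        gcongr
    _ = dbl cd cμ (8 * cd ^ 2) * (qball d z (2 ^ (k + 1) * R)).indicator
        (fun _ => (ω ((1 / 2) ^ (k + 1)) : ℝ≥0∞) * (μ (qball d z (2 ^ (k + 1) * R)))⁻¹) q := by
        rw [indicator_of_mem hmem]; ring
    _ ≤ _ := by gcongr; exact ENNReal.le_tsum k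

end Tail

/-! ### From the kernel to oscillation and decay -/

section Operators

variable {S : Type u} [MeasurableSpace S] {X : Type v} [NormedAddCommGroup X]
  {Y : Type w} [NormedAddCommGroup Y]

/-- `U`, acting on functions in `L^p`, is a linear operator of weak type `(p, p)` with constant
at most `A`. -/
structure IsWeakOp (μ : Measure S) (p : ℝ≥0) (A : ℝ≥0) (U : (S → X) → S → Y) : Prop where
  sub : ∀ f g, MemLp f p μ → MemLp g p μ → U (f - g) =ᵐ[μ] U f - U g
  weak : ∀ f, MemLp f p μ → ∀ t : ℝ≥0∞,
    t * μ {s | t < ‖U f s‖ₑ} ^ (1 / (p : ℝ)) ≤ A * eLpNorm f p μ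

/-- Differences of values of `U f` away from the support of `f` are controlled by tails. -/
def HasOscillation (d : S → S → ℝ) (μ : Measure S) (ω : ℝ → ℝ≥0) (p : ℝ≥0) (M : ℝ) (C : ℝ≥0)
    (U : (S → X) → S → Y) : Prop :=
  ∀ f : S → X, MemLp f p μ → (∃ z ρ, support f ⊆ qball d z ρ) → ∀ z r R, 0 < r → M * r ≤ R →
    (∀ t ∈ qball d z R, f t = 0) → ∀ᵐ s ∂μ, s ∈ qball d z r → ∀ᵐ s' ∂μ, s' ∈ qball d z r →
      ‖U f s - U f s'‖ₑ ≤ C * ∫⁻ t, tail d μ ω z R t * ‖f t‖ₑ ∂μ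

/-- Away from its support `U` maps functions of mean zero to small functions. -/
def HasAtomDecay [NormedSpace ℝ X] (d : S → S → ℝ) (μ : Measure S) (ω : ℝ → ℝ≥0) (p : ℝ≥0)
    (M : ℝ) (C : ℝ≥0) (U : (S → X) → S → Y) : Prop :=
  ∀ f : S → X, MemLp f p μ → ∀ z r R, 0 < r → M * r ≤ R → support f ⊆ qball d z r →
    ∫ t, f t ∂μ = 0 → ∀ᵐ s ∂μ, s ∉ qball d z R →
      ‖U f s‖ₑ ≤ C * tail d μ ω z R s * ∫⁻ t, ‖f t‖ₑ ∂μ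

section OnFun

variable {𝕜 : Type x} [RCLike 𝕜] [NormedSpace 𝕜 X] [NormedSpace 𝕜 Y] {μ : Measure S}

open Classical in
/-- An operator on `L^p`, acting on functions. -/
noncomputable def onFun {p : ℝ≥0∞} (T : Lp X p μ →ₗ[𝕜] (S →ₘ[μ] Y)) (f : S → X) : S → Y :=
  if h : MemLp f p μ then T (h.toLp f) else 0

theorem onFun_eq {p : ℝ≥0∞} (T : Lp X p μ →ₗ[𝕜] (S →ₘ[μ] Y)) {f : S → X} (h : MemLp f p μ) :
    onFun T f = T (h.toLp f) := dif_pos h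

theorem onFun_coe {p : ℝ≥0∞} (T : Lp X p μ →ₗ[𝕜] (S →ₘ[μ] Y)) (f : Lp X p μ) :
    onFun T f = T f := by
  rw [onFun_eq T (Lp.memLp f), Lp.toLp_coeFn]

theorem onFun_sub {p : ℝ≥0∞} (T : Lp X p μ →ₗ[𝕜] (S →ₘ[μ] Y)) {f g : S → X} (hf : MemLp f p μ)
    (hg : MemLp g p μ) : onFun T (f - g) =ᵐ[μ] onFun T f - onFun T g := by
  rw [onFun_eq T hf, onFun_eq T hg, onFun_eq T (hf.sub hg), MemLp.toLp_sub, map_sub]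
  exact AEEqFun.coeFn_sub _ _

theorem weak_of_weakNorm_le {p : ℝ≥0} (hp : p ≠ 0) {g : S → Y} {b : ℝ≥0∞}
    (h : weakNorm p μ g ≤ b) (t : ℝ≥0∞) : t * μ {s | t < ‖g s‖ₑ} ^ (1 / (p : ℝ)) ≤ b := by
  induction t with
  | top =>
    have hp0 : (0 : ℝ) < p := by positivity
    simp [hp0]
  | coe t =>
    exact (le_iSup (fun t : ℝ≥0 => (t : ℝ≥0∞) * μ {s | (t : ℝ≥0∞) < ‖g s‖ₑ} ^ (1 / (p : ℝ))) t).trans h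

theorem isWeakOp_onFun {p : ℝ≥0} (hp : p ≠ 0) (T : Lp X (p : ℝ≥0∞) μ →ₗ[𝕜] (S →ₘ[μ] Y)) {A : ℝ≥0}
    (hA : ∀ f, weakNorm p μ (T f) ≤ A * eLpNorm f p μ) : IsWeakOp μ p A (onFun T) where
  sub f g hf hg := onFun_sub T hf hg
  weak f hf t := by
    rw [onFun_eq T hf]
    refine weak_of_weakNorm_le hp ((hA _).trans ?_) t
    rw [eLpNorm_congr_ae hf.coeFn_toLp]

theorem weakNorm_le_of_weakOpNorm_lt {p : ℝ≥0} {T : Lp X (p : ℝ≥0∞) μ →ₗ[𝕜] (S →ₘ[μ] Y)} {A : ℝ≥0}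
    (hA : weakOpNorm T < A) (f : Lp X (p : ℝ≥0∞) μ) : weakNorm p μ (T f) ≤ A * eLpNorm f p μ := by
  obtain ⟨C, hC, hlt⟩ := sInf_lt_iff.1 hA
  exact (hC f).trans (by gcongr)

end OnFun

section Kernel

variable {𝕜 : Type x} [RCLike 𝕜] [NormedSpace 𝕜 X] [NormedSpace 𝕜 Y]
  {d : S → S → ℝ} {μ : Measure S} {cd : ℝ} {cμ : ℝ≥0} {K : S → S → X →L[𝕜] Y} {ω : ℝ → ℝ≥0}
  {cK : ℝ} {p : ℝ≥0}

theorem enorm_le_of_norm_le (H : IsHomogeneousType d μ cd cμ) {L : X →L[𝕜] Y} {s : S} {ρ : ℝ}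
    {b : ℝ≥0} (hρ : 0 < ρ) (h : ‖L‖ ≤ b * (1 / μ.real (qball d s ρ))) :
    ‖L‖ₑ ≤ b * (μ (qball d s ρ))⁻¹ := by
  have h1 : 0 < μ.real (qball d s ρ) :=
    ENNReal.toReal_pos (H.measure_qball_pos s ρ hρ).ne' (H.measure_qball_ne_top s ρ)
  rw [← ofReal_norm]
  refine (ENNReal.ofReal_le_ofReal h).trans ?_
  rw [ENNReal.ofReal_mul (by positivity), ENNReal.ofReal_coe_nnreal, one_div,
    ENNReal.ofReal_inv_of_pos h1, Measure.real, ENNReal.ofReal_toReal (H.measure_qball_ne_top s ρ)]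

/-- Both values are kernel integrals, so their difference integrates `K s t - K s' t`. With `M = 8
cd² cK` one has `d s s' ≤ 2 cd r` and `4 cd cK r ≤ d s t`, which puts the difference in the range of
the smoothness condition. -/
theorem hasOscillation_of_hasKernel [CompleteSpace Y] (H : IsHomogeneousType d μ cd cμ)
    (hcd : 1 ≤ cd) (hcμ : 1 ≤ cμ) (hK : IsDiniKernel d μ K ω cK)
    {T : Lp X (p : ℝ≥0∞) μ →ₗ[𝕜] (S →ₘ[μ] Y)} (hT : HasKernel d T K) :
    HasOscillation d μ ω p (8 * cd ^ 2 * cK) (dbl cd cμ (8 * cd ^ 2)) (onFun T) := by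
  let : NormedSpace ℝ Y := NormedSpace.restrictScalars ℝ 𝕜 Y
  have hd := H.quasiMetric
  have hcK := hK.two_le
  have hcd0 : 0 < cd := by linarith
  have hcd2 : 1 ≤ cd ^ 2 := one_le_pow₀ hcd
  have hcd3 : cd ≤ cd ^ 2 := le_self_pow₀ hcd (by norm_num)
  intro f hf hfb z r R hr hMR hfz
  have hR1 : 8 * cd ^ 2 * r ≤ R := le_trans (by
    have : 0 < 8 * cd ^ 2 * r := by positivity
    nlinarith) hMR
  have hcl : ∀ s ∈ qball d z r, s ∉ @closure S (quasiTopology d) (support f) := by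
    intro s hs
    refine hd.notMem_closure hcd hr (Set.disjoint_left.2 fun t ht hft => hft ?_)
    refine hfz t ?_
    refine lt_of_lt_of_le (hd.triangle_lt hcd hs ht) ?_
    nlinarith
  have hker := hT f hf hfb
  filter_upwards [hker] with s hs hsz
  filter_upwards [hker] with s' hs' hsz'
  obtain ⟨hi, he⟩ := hs (hcl s hsz)
  obtain ⟨hi', he'⟩ := hs' (hcl s' hsz')
  rw [onFun_eq T hf, he, he', ← integral_sub hi hi']
  refine (enorm_integral_le_lintegral_enorm _).trans ?_
  rw [← lintegral_const_mul' _ _ ENNReal.coe_ne_top]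
  refine lintegral_mono fun t => ?_
  rw [← sub_apply]
  by_cases ht : f t = 0
  · simp [ht]
  have hzt : R ≤ d z t := not_lt.1 fun h => ht (hfz t h)
  refine (ContinuousLinearMap.le_opENorm _ _).trans ?_
  rw [← mul_assoc]
  gcongr
  by_cases hss : s = s'
  · rw [hss, sub_self, ← ofReal_norm, norm_zero, ENNReal.ofReal_zero]; exact zero_le
  have hss0 : 0 < d s s' :=
    lt_of_le_of_ne (hd.nonneg _ _) fun h => hss ((hd.eq_zero_iff _ _).1 h.symm)
  have hss2 : d s s' ≤ 2 * cd * r := by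
    have h1 : d s z < r := by rw [hd.symm]; exact hsz
    refine (hd.triangle_lt hcd h1 hsz').le.trans (le_of_eq (by ring))
  obtain ⟨hst0, hst⟩ := modulus_div_measure_le H hcd hcμ hK.monotoneOn (z := z) (p := s) (q := t)
    (x := s) hr hR1 (le_of_lt hsz) hzt hss0.le hss2 (Or.inl rfl)
  refine (enorm_le_of_norm_le H hst0 (hK.smooth_left s s' t hss0 ?_)).trans hst
  rw [one_div, ← div_eq_inv_mul, le_div_iff₀ (by linarith)]
  have hst2 : d z t ≤ 2 * cd * d s t := by
    have := hd.triangle z t s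
    have h2 : d z s ≤ r := le_of_lt hsz
    nlinarith
  have h5 : 2 * cd * (4 * cd * cK * r) ≤ 2 * cd * d s t := by
    refine le_trans ?_ hst2
    refine le_trans ?_ hzt
    refine le_trans (le_of_eq ?_) hMR
    ring
  have h6 : 4 * cd * cK * r ≤ d s t := le_of_mul_le_mul_left h5 (by positivity)
  have h7 : 0 < cd * r * cK := by positivity
  nlinarith

/-- Since `f` has mean zero, `K s z` may be subtracted from `K s t` under the integral. Smoothness
in the second variable then gives the tail at `s`, uniformly in `t` in the support. -/
theorem hasAtomDecay_of_hasKernel [CompleteSpace X] [CompleteSpace Y] [NormedSpace ℝ X]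
    (H : IsHomogeneousType d μ cd cμ) (hp : 1 ≤ p)
    (hcd : 1 ≤ cd) (hcμ : 1 ≤ cμ) (hK : IsDiniKernel d μ K ω cK)
    {T : Lp X (p : ℝ≥0∞) μ →ₗ[𝕜] (S →ₘ[μ] Y)} (hT : HasKernel d T K) :
    HasAtomDecay d μ ω p (8 * cd ^ 2 * cK) (dbl cd cμ (8 * cd ^ 2)) (onFun T) := by
  let : NormedSpace ℝ Y := NormedSpace.restrictScalars ℝ 𝕜 Y
  have hd := H.quasiMetric
  have hcK := hK.two_le
  have hcd0 : 0 < cd := by linarith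
  have hcd2 : 1 ≤ cd ^ 2 := one_le_pow₀ hcd
  have hcd3 : cd ≤ cd ^ 2 := le_self_pow₀ hcd (by norm_num)
  intro f hf z r R hr hMR hfz hmean
  have hR1 : 8 * cd ^ 2 * r ≤ R := le_trans (by
    have : 0 < 8 * cd ^ 2 * r := by positivity
    nlinarith) hMR
  have hfi : Integrable f μ := by
    refine memLp_one_iff_integrable.1 (hf.mono_exponent_of_measure_support_ne_top
      (s := qball d z r) (fun t ht => ?_) (H.measure_qball_ne_top z r) (by exact_mod_cast hp))
    by_contra h
    exact ht (hfz h)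
  have hcl : ∀ s, s ∉ qball d z R → s ∉ @closure S (quasiTopology d) (support f) := by
    intro s hs
    refine hd.notMem_closure hcd hr (Set.disjoint_left.2 fun t ht hft => hs ?_)
    have h1 : d t s < r := by rw [hd.symm]; exact ht
    refine lt_of_lt_of_le (hd.triangle_lt hcd (hfz hft) h1) ?_
    nlinarith
  filter_upwards [hT f hf ⟨z, r, hfz⟩] with s hs hsz
  obtain ⟨hi, he⟩ := hs (hcl s hsz)
  have hzs : R ≤ d z s := not_lt.1 hsz
  have hi' : Integrable (fun t => K s z (f t)) μ := (K s z).integrable_comp hfi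
  have h0 : ∫ t, K s z (f t) ∂μ = 0 := by
    rw [ContinuousLinearMap.integral_comp_comm (K s z) hfi, hmean, map_zero]
  rw [onFun_eq T hf, he, ← sub_zero (∫ t, K s t (f t) ∂μ), ← h0, ← integral_sub hi hi']
  refine (enorm_integral_le_lintegral_enorm _).trans ?_
  rw [mul_assoc, ← lintegral_const_mul'' _ hfi.aestronglyMeasurable.enorm,
    ← lintegral_const_mul' _ _ ENNReal.coe_ne_top]
  refine lintegral_mono fun t => ?_
  rw [← sub_apply]
  by_cases ht : f t = 0
  · simp [ht]
  have hzt : d z t < r := hfz ht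
  refine (ContinuousLinearMap.le_opENorm _ _).trans ?_
  rw [← mul_assoc]
  gcongr
  by_cases htz : z = t
  · rw [htz, sub_self, ← ofReal_norm, norm_zero, ENNReal.ofReal_zero]; exact zero_le
  have hzt0 : 0 < d z t :=
    lt_of_le_of_ne (hd.nonneg _ _) fun h => htz ((hd.eq_zero_iff _ _).1 h.symm)
  obtain ⟨hst0, hst⟩ := modulus_div_measure_le H hcd hcμ hK.monotoneOn (z := z) (p := z) (q := s)
    (x := s) (v := d z t) hr hR1 (by rw [hd.self]; exact hr.le) hzs hzt0.le (by nlinarith)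
    (Or.inr rfl)
  rw [hd.symm z s] at hst0 hst
  rw [← enorm_neg, neg_sub]
  refine (enorm_le_of_norm_le H hst0 (hK.smooth_right s z t hzt0 ?_)).trans hst
  rw [one_div, ← div_eq_inv_mul, le_div_iff₀ (by linarith), hd.symm s z]
  have h7 : cK * r ≤ 8 * cd ^ 2 * cK * r := by
    have : 0 < cK * r := by positivity
    nlinarith
  nlinarith

end Kernel

end Operators

/-! ### Consequences of the weak-type bound -/

section WeakOp

variable {S : Type u} [MeasurableSpace S] {X : Type v} [NormedAddCommGroup X]
  {Y : Type w} [NormedAddCommGroup Y] {μ : Measure S} {p A : ℝ≥0} {U : (S → X) → S → Y}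

theorem IsWeakOp.weak_pow (hU : IsWeakOp μ p A U) (hp : p ≠ 0) {f : S → X} (hf : MemLp f p μ)
    (t : ℝ≥0∞) :
    t ^ (p : ℝ) * μ {s | t < ‖U f s‖ₑ} ≤ (A : ℝ≥0∞) ^ (p : ℝ) * ∫⁻ s, ‖f s‖ₑ ^ (p : ℝ) ∂μ := by
  have hp0 : (0 : ℝ) < p := by positivity
  have h := ENNReal.rpow_le_rpow (hU.weak f hf t) hp0.le
  rwa [ENNReal.mul_rpow_of_nonneg _ _ hp0.le, ENNReal.mul_rpow_of_nonneg _ _ hp0.le,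
    ← ENNReal.rpow_mul, one_div, inv_mul_cancel₀ hp0.ne', ENNReal.rpow_one,
    eLpNorm_nnreal_pow_eq_lintegral hp] at h

theorem ae_eq_zero_of_forall_measure {g : S → Y} (h : ∀ t : ℝ≥0∞, t ≠ 0 → μ {s | t < ‖g s‖ₑ} = 0) :
    g =ᵐ[μ] 0 := by
  have h1 : ∀ n : ℕ, ∀ᵐ s ∂μ, ¬ ((n : ℝ≥0∞) + 1)⁻¹ < ‖g s‖ₑ := fun n => by
    have := h ((n : ℝ≥0∞) + 1)⁻¹ (by simp)
    rw [ae_iff]; simpa only [not_not] using this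
  filter_upwards [ae_all_iff.2 h1] with s hs
  by_contra hne
  have h0 : ‖g s‖ₑ ≠ 0 := by simpa using hne
  obtain ⟨n, hn⟩ := ENNReal.exists_inv_nat_lt h0
  refine hs n (lt_of_le_of_lt ?_ hn)
  exact ENNReal.inv_le_inv.2 le_self_add

theorem IsWeakOp.ae_eq_zero (hU : IsWeakOp μ p A U) (hp : p ≠ 0) {f : S → X} (hf : MemLp f p μ)
    (h0 : eLpNorm f p μ = 0) : U f =ᵐ[μ] 0 := by
  refine ae_eq_zero_of_forall_measure fun t ht => ?_
  have h := hU.weak f hf t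
  rw [h0, mul_zero, nonpos_iff_eq_zero, mul_eq_zero, or_iff_right ht] at h
  have hp0 : (0 : ℝ) < 1 / p := by positivity
  exact (ENNReal.rpow_eq_zero_iff_of_pos hp0).1 h

/-- Operators act on functions rather than on classes; the weak bound applied to the null difference
shows that the choice of representative is irrelevant. -/
theorem IsWeakOp.congr (hU : IsWeakOp μ p A U) (hp : p ≠ 0) {f g : S → X} (hf : MemLp f p μ)
    (hfg : f =ᵐ[μ] g) : U f =ᵐ[μ] U g := by
  have hg : MemLp g p μ := hf.ae_eq hfg
  have h0 : eLpNorm (f - g) p μ = 0 := by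
    rw [eLpNorm_congr_ae (g := 0)]
    · simp
    · filter_upwards [hfg] with s hs; simp [hs]
  filter_upwards [hU.sub f g hf hg, hU.ae_eq_zero hp (hf.sub hg) h0] with s h1 h2
  rw [h2, Pi.sub_apply] at h1
  exact (sub_eq_zero.1 h1.symm)

theorem IsWeakOp.add (hU : IsWeakOp μ p A U) {f g : S → X} (hf : MemLp f p μ) (hg : MemLp g p μ) :
    U (f + g) =ᵐ[μ] U f + U g := by
  have h := hU.sub (f + g) g (hf.add hg) hg
  rw [add_sub_cancel_right] at h
  filter_upwards [h] with s hs
  rw [Pi.add_apply, hs, Pi.sub_apply, sub_add_cancel]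

theorem IsWeakOp.sum (hU : IsWeakOp μ p A U) (hp : p ≠ 0) {ι : Type*} (F : Finset ι)
    (f : ι → S → X) (hf : ∀ i, MemLp (f i) p μ) :
    U (∑ i ∈ F, f i) =ᵐ[μ] ∑ i ∈ F, U (f i) := by
  classical
  induction F using Finset.induction_on with
  | empty => simpa using hU.ae_eq_zero hp MemLp.zero (by simp)
  | insert i F hi ih =>
    rw [Finset.sum_insert hi, Finset.sum_insert hi]
    filter_upwards [hU.add (hf i) (memLp_finsetSum' F fun i _ => hf i), ih] with s h1 h2
    rw [h1, Pi.add_apply, Pi.add_apply, h2]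

end WeakOp

/-! ### Calderón–Zygmund decomposition and the weak `(1,1)` bound -/

section CalderonZygmund

variable {S : Type u} [MeasurableSpace S] {X : Type v} [NormedAddCommGroup X] [NormedSpace ℝ X]
  {Y : Type w} [NormedAddCommGroup Y] {d : S → S → ℝ} {μ : Measure S} {cd : ℝ} {cμ : ℝ≥0}
  {c₀ C₀ δ : ℝ} {ω : ℝ → ℝ≥0} {p A : ℝ≥0} {U : (S → X) → S → Y}

theorem enorm_setAverage_le {f : S → X} {Q : Set S} (h0 : μ Q ≠ 0) (ht : μ Q ≠ ∞) :
    ‖⨍ t in Q, f t ∂μ‖ₑ ≤ (μ Q)⁻¹ * ∫⁻ t in Q, ‖f t‖ₑ ∂μ := by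
  rw [setAverage_eq, enorm_smul]
  gcongr
  · have : 0 < μ.real Q := ENNReal.toReal_pos h0 ht
    rw [Real.enorm_eq_ofReal (by positivity), ENNReal.ofReal_inv_of_pos this, Measure.real,
      ENNReal.ofReal_toReal ht]
  · exact enorm_integral_le_lintegral_enorm _

/-- The part of the Calderón–Zygmund decomposition that does not involve the choice of cubes. -/
theorem weak_one_of_cubes [CompleteSpace X] (H : IsHomogeneousType d μ cd cμ) (hp : 1 ≤ p)
    (hU : IsWeakOp μ p A U) {M : ℝ} {C B E : ℝ≥0} (hUa : HasAtomDecay d μ ω p M C U)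
    (hω : MonotoneOn ω (Icc 0 1)) (hM : 0 < M) (hA : A ≠ 0) (hdini : diniNorm ω ≤ A)
    (hB : 1 ≤ B) {ι : Type*} [Countable ι] (Q : ι → Set S) (z : ι → S) (r : ι → ℝ)
    (hr : ∀ i, 0 < r i) (hQm : ∀ i, MeasurableSet (Q i)) (hQ : ∀ i, Q i ⊆ qball d (z i) (r i))
    (hQ0 : ∀ i, μ (Q i) ≠ 0)
    (hQd : Pairwise (Disjoint on Q)) (hE : ∀ i, μ (qball d (z i) (M * r i)) ≤ E * μ (Q i))
    {f : S → X} (hf : MemLp f p μ) {a t : ℝ≥0} (ha : a ≠ 0) (hta : t = a * A)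
    (hfa : ∀ s, (∀ i, s ∉ Q i) → ‖f s‖ₑ ≤ a)
    (hfQ : ∀ i, ∫⁻ s in Q i, ‖f s‖ₑ ∂μ ≤ a * (B * μ (Q i))) {N : ℝ≥0∞}
    (hN : a * ∑' i, μ (Q i) ≤ N) (hfN : ∫⁻ s, ‖f s‖ₑ ∂μ ≤ N) :
    t * μ {s | (t : ℝ≥0∞) < ‖U f s‖ₑ} ≤
      (E + 4 * 3 ^ (p : ℝ) * B ^ ((p : ℝ) - 1) + 12 * C : ℝ≥0) * (A * N) := by
  classical
  have hp0 : p ≠ 0 := (zero_lt_one.trans_le hp).ne'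
  have hp0' : (0 : ℝ) < p := by positivity
  have hp1 : (1 : ℝ) ≤ p := by exact_mod_cast hp
  have hpE : (1 : ℝ≥0∞) ≤ p := by exact_mod_cast hp
  have ht : t ≠ 0 := by rw [hta]; exact mul_ne_zero ha hA
  have ht' : (t : ℝ≥0∞) ≠ 0 := by exact_mod_cast ht
  have hQt : ∀ i, μ (Q i) ≠ ∞ := fun i =>
    ((measure_mono (hQ i)).trans_lt (H.measure_qball_lt_top _ _)).ne
  have hfm := hf.1
  set c : ι → X := fun i => ⨍ s in Q i, f s ∂μ with hc
  set b : ι → S → X := fun i => (Q i).indicator (f - fun _ => c i) with hb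
  set V : Set S := ⋃ i, Q i with hV
  have hVm : MeasurableSet V := MeasurableSet.iUnion hQm
  set VF : Finset ι → Set S := fun F => ⋃ i ∈ F, Q i with hVF
  have hVFm : ∀ F, MeasurableSet (VF F) := fun F => F.measurableSet_biUnion fun i _ => hQm i
  -- Additivity of `U` is available for finite sums only. Hence only the cubes in `F` are corrected
  -- to mean zero, `f` is kept on the remaining ones as an error `e F`, and this error disappears in
  -- `L^p` as `F` exhausts the index set.
  set e : Finset ι → S → X := fun F => (V \ VF F).indicator f with he
  set g : Finset ι → S → X := fun F => f - ∑ i ∈ F, b i - e F with hg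
  have hcle : ∀ i, μ (Q i) * ‖c i‖ₑ ≤ ∫⁻ s in Q i, ‖f s‖ₑ ∂μ := by
    intro i
    calc μ (Q i) * ‖c i‖ₑ ≤ μ (Q i) * ((μ (Q i))⁻¹ * ∫⁻ s in Q i, ‖f s‖ₑ ∂μ) := by
          gcongr; exact enorm_setAverage_le (hQ0 i) (hQt i)
      _ = _ := by rw [← mul_assoc, ENNReal.mul_inv_cancel (hQ0 i) (hQt i), one_mul]
  have hcB : ∀ i, ‖c i‖ₑ ≤ a * B := by
    intro i
    refine (enorm_setAverage_le (hQ0 i) (hQt i)).trans ?_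
    calc _ ≤ (μ (Q i))⁻¹ * (a * (B * μ (Q i))) := by gcongr; exact hfQ i
      _ = a * B * ((μ (Q i))⁻¹ * μ (Q i)) := by ring
      _ = _ := by rw [ENNReal.inv_mul_cancel (hQ0 i) (hQt i), mul_one]
  have hbp : ∀ i, MemLp (b i) p μ := by
    intro i
    rw [hb]
    refine MemLp.congr_norm (f := (Q i).indicator f - (Q i).indicator fun _ => c i) ?_ ?_ ?_
    · exact (hf.indicator (hQm i)).sub (memLp_indicator_const _ (hQm i) _ (Or.inr (hQt i)))
    · exact (hfm.sub aestronglyMeasurable_const).indicator (hQm i)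
    · refine Filter.Eventually.of_forall fun s => ?_
      by_cases hs : s ∈ Q i <;> simp [hs]
  have hb1 : ∀ i, ∫⁻ s, ‖b i s‖ₑ ∂μ ≤ 2 * ∫⁻ s in Q i, ‖f s‖ₑ ∂μ := by
    intro i
    calc ∫⁻ s, ‖b i s‖ₑ ∂μ = ∫⁻ s in Q i, ‖f s - c i‖ₑ ∂μ := by
          rw [← lintegral_indicator (hQm i)]
          refine lintegral_congr fun s => ?_
          by_cases hs : s ∈ Q i <;> simp [hb, hs]
      _ ≤ ∫⁻ s in Q i, (‖f s‖ₑ + ‖c i‖ₑ) ∂μ := lintegral_mono fun s => enorm_sub_le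
      _ = ∫⁻ s in Q i, ‖f s‖ₑ ∂μ + μ (Q i) * ‖c i‖ₑ := by
          rw [lintegral_add_right _ measurable_const, setLIntegral_const, mul_comm]
      _ ≤ _ := by rw [two_mul]; gcongr; exact hcle i
  have hbmean : ∀ i, ∫ s, b i s ∂μ = 0 := by
    intro i
    rw [hb]
    simp only
    rw [integral_indicator (hQm i)]
    have : IsFiniteMeasure (μ.restrict (Q i)) := ⟨by
      rw [Measure.restrict_apply_univ]; exact (hQt i).lt_top⟩
    simp only [Pi.sub_apply]
    exact setAverage_sub_setAverage (hQt i) f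
  have hbs : ∀ i, support (b i) ⊆ qball d (z i) (r i) := fun i =>
    (support_indicator_subset).trans (hQ i)
  have hSV : ∑' i, ∫⁻ s in Q i, ‖f s‖ₑ ∂μ ≤ N := by
    rw [← lintegral_iUnion hQm hQd]
    exact (setLIntegral_le_lintegral _ _).trans hfN
  -- the bad part
  set G : Set S := ⋃ i, qball d (z i) (M * r i) with hG
  have hGle : t * μ G ≤ E * (A * N) := by
    calc t * μ G ≤ t * ∑' i, E * μ (Q i) := by
          gcongr; exact (measure_iUnion_le _).trans (ENNReal.tsum_le_tsum hE)
      _ = E * (A * (a * ∑' i, μ (Q i))) := by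
          rw [ENNReal.tsum_mul_left, hta]; push_cast; ring
      _ ≤ _ := by gcongr
  have hbF : ∀ F : Finset ι, t * μ ({s | (t : ℝ≥0∞) / 3 < ‖U (∑ i ∈ F, b i) s‖ₑ} \ G) ≤
      (12 * C : ℝ≥0) * (A * N) := by
    intro F
    set Ψ : S → ℝ≥0∞ := fun s => ∑ i ∈ F, C * tail d μ ω (z i) (M * r i) s * ∫⁻ s, ‖b i s‖ₑ ∂μ
      with hΨ
    have hΨm : Measurable Ψ := Finset.measurable_sum _ fun i _ =>
      ((measurable_tail H _ _).const_mul _).mul_const _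
    have hsub : ∀ᵐ s ∂μ, s ∈ {s | (t : ℝ≥0∞) / 3 < ‖U (∑ i ∈ F, b i) s‖ₑ} \ G →
        s ∈ {s | (t : ℝ≥0∞) / 3 ≤ Ψ s} := by
      have h1 : ∀ᵐ s ∂μ, ∀ i, s ∉ qball d (z i) (M * r i) →
          ‖U (b i) s‖ₑ ≤ C * tail d μ ω (z i) (M * r i) s * ∫⁻ t, ‖b i t‖ₑ ∂μ :=
        ae_all_iff.2 fun i => hUa (b i) (hbp i) (z i) (r i) (M * r i) (hr i) le_rfl (hbs i) (hbmean i)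
      filter_upwards [hU.sum hp0 F b hbp, h1] with s hs1 hs2 hs3
      have hsG : ∀ i, s ∉ qball d (z i) (M * r i) := fun i hi => hs3.2 (mem_iUnion.2 ⟨i, hi⟩)
      refine (le_of_lt hs3.1).trans ?_
      rw [hs1, Finset.sum_apply]
      exact (enorm_sum_le _ _).trans (Finset.sum_le_sum fun i _ => hs2 i (hsG i))
    have hint : ∫⁻ s, Ψ s ∂μ ≤ C * (2 * A) * (2 * N) := by
      rw [lintegral_finsetSum _ fun i _ => ((measurable_tail H _ _).const_mul _).mul_const _]
      calc _ = ∑ i ∈ F, C * (∫⁻ s, tail d μ ω (z i) (M * r i) s ∂μ) * ∫⁻ s, ‖b i s‖ₑ ∂μ := by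
            refine Finset.sum_congr rfl fun i _ => ?_
            rw [lintegral_mul_const _ ((measurable_tail H _ _).const_mul _),
              lintegral_const_mul _ (measurable_tail H _ _)]
        _ ≤ ∑ i ∈ F, C * (2 * A) * (2 * ∫⁻ s in Q i, ‖f s‖ₑ ∂μ) := by
            refine Finset.sum_le_sum fun i _ => ?_
            gcongr
            · refine (lintegral_tail_le H hω (z i) (mul_pos hM (hr i))).trans ?_
              gcongr
            · exact hb1 i
        _ = C * (2 * A) * (2 * ∑ i ∈ F, ∫⁻ s in Q i, ‖f s‖ₑ ∂μ) := by
            rw [← Finset.mul_sum, ← Finset.mul_sum]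
        _ ≤ _ := by
            gcongr
            exact (ENNReal.sum_le_tsum F).trans hSV
    have h3 : (t : ℝ≥0∞) / 3 * μ {s | (t : ℝ≥0∞) / 3 ≤ Ψ s} ≤ C * (2 * A) * (2 * N) :=
      (mul_meas_ge_le_lintegral hΨm _).trans hint
    calc t * μ ({s | (t : ℝ≥0∞) / 3 < ‖U (∑ i ∈ F, b i) s‖ₑ} \ G)
        ≤ t * μ {s | (t : ℝ≥0∞) / 3 ≤ Ψ s} := mul_le_mul_right (measure_mono_ae hsub) _
      _ = 3 * ((t : ℝ≥0∞) / 3 * μ {s | (t : ℝ≥0∞) / 3 ≤ Ψ s}) := by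
          rw [← mul_assoc, ENNReal.mul_div_cancel (by norm_num) (by norm_num)]
      _ ≤ 3 * (C * (2 * A) * (2 * N)) := by gcongr
      _ = _ := by push_cast; ring
  -- the good part
  have hep : ∀ F, MemLp (e F) p μ := fun F => hf.indicator (hVm.diff (hVFm F))
  have hgp : ∀ F, MemLp (g F) p μ := fun F =>
    (hf.sub (memLp_finsetSum' F fun i _ => hbp i)).sub (hep F)
  have hbsum : ∀ F : Finset ι, ∀ i ∈ F, ∀ s ∈ Q i, (∑ i ∈ F, b i) s = f s - c i := by
    intro F i hi s hs
    rw [Finset.sum_apply, Finset.sum_eq_single_of_mem i hi]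
    · simp [hb, hs]
    · intro j _ hne
      have : s ∉ Q j := fun h => Set.disjoint_left.1 (hQd hne) h hs
      simp [hb, this]
  have hbsum0 : ∀ F : Finset ι, ∀ s, s ∉ VF F → (∑ i ∈ F, b i) s = 0 := by
    intro F s hs
    rw [Finset.sum_apply]
    refine Finset.sum_eq_zero fun i hi => ?_
    have : s ∉ Q i := fun h => hs (mem_biUnion (Finset.mem_coe.2 hi) h)
    simp [hb, this]
  have hgB : ∀ F s, ‖g F s‖ₑ ≤ a * B := by
    intro F s
    have hg1 : g F s = f s - (∑ i ∈ F, b i) s - e F s := rfl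
    rw [hg1]
    by_cases hsF : s ∈ VF F
    · obtain ⟨i, hi, hs⟩ := mem_iUnion₂.1 hsF
      have : e F s = 0 := indicator_of_notMem (fun h => h.2 hsF) _
      rw [hbsum F i hi s hs, this, sub_zero, sub_sub_cancel]
      exact hcB i
    · rw [hbsum0 F s hsF, sub_zero]
      by_cases hsV : s ∈ V
      · have : e F s = f s := indicator_of_mem (show s ∈ V \ VF F from ⟨hsV, hsF⟩) _
        simp [this]
      · have : e F s = 0 := indicator_of_notMem (fun h => hsV h.1) _
        rw [this, sub_zero]
        have hs : ∀ i, s ∉ Q i := fun i hi => hsV (mem_iUnion_of_mem i hi)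
        refine (hfa s hs).trans ?_
        calc (a : ℝ≥0∞) = a * 1 := (mul_one _).symm
          _ ≤ _ := by gcongr; exact_mod_cast hB
  have hg1 : ∀ F, ∫⁻ s, ‖g F s‖ₑ ∂μ ≤ 4 * N := by
    intro F
    calc ∫⁻ s, ‖g F s‖ₑ ∂μ ≤ ∫⁻ s, ((‖f s‖ₑ + ∑ i ∈ F, ‖b i s‖ₑ) + ‖f s‖ₑ) ∂μ := by
          refine lintegral_mono fun s => ?_
          have hg1 : g F s = f s - (∑ i ∈ F, b i) s - e F s := rfl
          rw [hg1]
          refine enorm_sub_le.trans (add_le_add (enorm_sub_le.trans ?_) ?_)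
          · gcongr
            rw [Finset.sum_apply]
            exact enorm_sum_le _ _
          · exact enorm_indicator_le_enorm_self f s
      _ = (∫⁻ s, ‖f s‖ₑ ∂μ + ∑ i ∈ F, ∫⁻ s, ‖b i s‖ₑ ∂μ) + ∫⁻ s, ‖f s‖ₑ ∂μ := by
          rw [lintegral_add_right' _ hfm.enorm, lintegral_add_left' hfm.enorm,
            lintegral_finsetSum' _ fun i _ => (hbp i).1.enorm]
      _ ≤ (N + 2 * N) + N := by
          gcongr
          calc _ ≤ ∑ i ∈ F, 2 * ∫⁻ s in Q i, ‖f s‖ₑ ∂μ := Finset.sum_le_sum fun i _ => hb1 i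
            _ ≤ 2 * N := by
                rw [← Finset.mul_sum]; gcongr; exact (ENNReal.sum_le_tsum F).trans hSV
      _ = _ := by ring
  -- Interpolation of the good part between its supremum `a * B` and its `L^1` mass.
  have hgpow : ∀ F, ∫⁻ s, ‖g F s‖ₑ ^ (p : ℝ) ∂μ ≤ (a * B : ℝ≥0∞) ^ ((p : ℝ) - 1) * (4 * N) := by
    intro F
    calc ∫⁻ s, ‖g F s‖ₑ ^ (p : ℝ) ∂μ ≤ ∫⁻ s, (a * B : ℝ≥0∞) ^ ((p : ℝ) - 1) * ‖g F s‖ₑ ∂μ := by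
          refine lintegral_mono fun s => ?_
          have : (p : ℝ) = (p - 1) + 1 := by ring
          conv_lhs => rw [this]
          rw [ENNReal.rpow_add_of_nonneg _ _ (by linarith) zero_le_one, ENNReal.rpow_one]
          gcongr
          exact hgB F s
      _ = (a * B : ℝ≥0∞) ^ ((p : ℝ) - 1) * ∫⁻ s, ‖g F s‖ₑ ∂μ :=
          lintegral_const_mul'' _ (hgp F).1.enorm
      _ ≤ _ := by gcongr; exact hg1 F
  -- The choice `t = a * A` gives `t ^ (p - 1) = a ^ (p - 1) * A ^ (p - 1)`. Dividing the weak `(p,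
  -- p)` bound by this power leaves a single factor `A`, and the factor `a ^ (1 - p)` cancels
  -- against the good part.
  have htpow : ∀ W : Set S, ∀ I : ℝ≥0∞,
      ((t : ℝ≥0∞) / 3) ^ (p : ℝ) * μ W ≤ (A : ℝ≥0∞) ^ (p : ℝ) * I →
      t * μ W ≤ 3 ^ (p : ℝ) * (A * ((a : ℝ≥0∞) ^ ((p : ℝ) - 1))⁻¹ * I) := by
    intro W I h
    have ha' : (a : ℝ≥0∞) ^ ((p : ℝ) - 1) ≠ 0 := by
      simp [ENNReal.rpow_eq_zero_iff, ha]
    have ha'' : (a : ℝ≥0∞) ^ ((p : ℝ) - 1) ≠ ∞ :=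
      ENNReal.rpow_ne_top_of_nonneg (by linarith) ENNReal.coe_ne_top
    have hA' : (A : ℝ≥0∞) ^ ((p : ℝ) - 1) ≠ 0 := by
      simp [ENNReal.rpow_eq_zero_iff, hA]
    have hA'' : (A : ℝ≥0∞) ^ ((p : ℝ) - 1) ≠ ∞ :=
      ENNReal.rpow_ne_top_of_nonneg (by linarith) ENNReal.coe_ne_top
    have hsplit : ∀ y : ℝ≥0∞, y ^ (p : ℝ) = y ^ ((p : ℝ) - 1) * y := by
      intro y
      have : (p : ℝ) = (p - 1) + 1 := by ring
      conv_lhs => rw [this]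
      rw [ENNReal.rpow_add_of_nonneg _ _ (by linarith) zero_le_one, ENNReal.rpow_one]
    have h3 : (3 : ℝ≥0∞) ^ (p : ℝ) ≠ 0 := by simp [ENNReal.rpow_eq_zero_iff]
    have h3' : (3 : ℝ≥0∞) ^ (p : ℝ) ≠ ∞ :=
      ENNReal.rpow_ne_top_of_nonneg hp0'.le (by norm_num)
    have h5 : (t : ℝ≥0∞) ^ (p : ℝ) * μ W ≤ 3 ^ (p : ℝ) * ((A : ℝ≥0∞) ^ (p : ℝ) * I) := by
      calc (t : ℝ≥0∞) ^ (p : ℝ) * μ W = 3 ^ (p : ℝ) * (((t : ℝ≥0∞) / 3) ^ (p : ℝ) * μ W) := by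
            rw [← mul_assoc, ← ENNReal.mul_rpow_of_nonneg _ _ hp0'.le,
              ENNReal.mul_div_cancel (by norm_num) (by norm_num)]
        _ ≤ _ := by gcongr
    have hk0 : (a : ℝ≥0∞) ^ ((p : ℝ) - 1) * (A : ℝ≥0∞) ^ ((p : ℝ) - 1) ≠ 0 := mul_ne_zero ha' hA'
    have hkt : (a : ℝ≥0∞) ^ ((p : ℝ) - 1) * (A : ℝ≥0∞) ^ ((p : ℝ) - 1) ≠ ∞ :=
      ENNReal.mul_ne_top ha'' hA''
    refine (ENNReal.mul_le_mul_iff_right hk0 hkt).1 ?_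
    calc (a : ℝ≥0∞) ^ ((p : ℝ) - 1) * (A : ℝ≥0∞) ^ ((p : ℝ) - 1) * (t * μ W)
        = (t : ℝ≥0∞) ^ (p : ℝ) * μ W := by
          rw [hsplit t, hta, ENNReal.coe_mul, ENNReal.mul_rpow_of_nonneg _ _ (by linarith)]
          ring
      _ ≤ _ := h5
      _ = 3 ^ (p : ℝ) * ((A : ℝ≥0∞) ^ ((p : ℝ) - 1) * A * I) *
            ((a : ℝ≥0∞) ^ ((p : ℝ) - 1) * ((a : ℝ≥0∞) ^ ((p : ℝ) - 1))⁻¹) := by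
          rw [ENNReal.mul_inv_cancel ha' ha'', mul_one, hsplit A]
      _ = _ := by ring
  have hgF : ∀ F, t * μ {s | (t : ℝ≥0∞) / 3 < ‖U (g F) s‖ₑ} ≤
      (4 * 3 ^ (p : ℝ) * B ^ ((p : ℝ) - 1) : ℝ≥0) * (A * N) := by
    intro F
    refine (htpow _ _ ((hU.weak_pow hp0 (hgp F) _).trans
      (mul_le_mul_right (hgpow F) _))).trans (le_of_eq ?_)
    have ha' : (a : ℝ≥0∞) ^ ((p : ℝ) - 1) ≠ 0 := by
      simp [ENNReal.rpow_eq_zero_iff, ha]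
    have ha'' : (a : ℝ≥0∞) ^ ((p : ℝ) - 1) ≠ ∞ :=
      ENNReal.rpow_ne_top_of_nonneg (by linarith) ENNReal.coe_ne_top
    rw [ENNReal.mul_rpow_of_nonneg _ _ (by linarith : (0 : ℝ) ≤ p - 1)]
    push_cast
    rw [ENNReal.coe_rpow_of_nonneg _ hp0'.le, ENNReal.coe_rpow_of_nonneg _ (by linarith)]
    push_cast
    calc _ = 3 ^ (p : ℝ) * (A * (B : ℝ≥0∞) ^ ((p : ℝ) - 1) * (4 * N)) *
          ((a : ℝ≥0∞) ^ ((p : ℝ) - 1) * ((a : ℝ≥0∞) ^ ((p : ℝ) - 1))⁻¹) := by ring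
      _ = _ := by rw [ENNReal.mul_inv_cancel ha' ha'']; ring
  -- the remainder
  set m : Finset ι → ℝ≥0∞ := fun F => ∑' i : {i // i ∉ F}, ∫⁻ s in Q i, ‖f s‖ₑ ^ (p : ℝ) ∂μ with hm
  have hfp : ∫⁻ s, ‖f s‖ₑ ^ (p : ℝ) ∂μ ≠ ∞ := by
    rw [← eLpNorm_nnreal_pow_eq_lintegral hp0]
    exact ENNReal.rpow_ne_top_of_nonneg hp0'.le hf.2.ne
  have hmlim : Filter.Tendsto m Filter.atTop (nhds 0) := by
    refine ENNReal.tendsto_tsum_compl_atTop_zero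
      (f := fun i => ∫⁻ s in Q i, ‖f s‖ₑ ^ (p : ℝ) ∂μ) (ne_top_of_le_ne_top hfp ?_)
    rw [← lintegral_iUnion hQm hQd]
    exact setLIntegral_le_lintegral _ _
  have heF : ∀ F, t * μ {s | (t : ℝ≥0∞) / 3 < ‖U (e F) s‖ₑ} ≤
      3 ^ (p : ℝ) * (A * ((a : ℝ≥0∞) ^ ((p : ℝ) - 1))⁻¹) * m F := by
    intro F
    rw [mul_assoc]
    refine htpow _ _ ((hU.weak_pow hp0 (hep F) _).trans ?_)
    gcongr
    calc ∫⁻ s, ‖e F s‖ₑ ^ (p : ℝ) ∂μ = ∫⁻ s in V \ VF F, ‖f s‖ₑ ^ (p : ℝ) ∂μ := by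
          rw [← lintegral_indicator (hVm.diff (hVFm F))]
          refine lintegral_congr fun s => ?_
          by_cases hs : s ∈ V \ VF F
          · simp only [he, indicator_of_mem hs]
          · simp only [he, indicator_of_notMem hs]; simp [pos_iff_ne_zero.2 hp0]
      _ ≤ ∫⁻ s in ⋃ i : {i // i ∉ F}, Q i, ‖f s‖ₑ ^ (p : ℝ) ∂μ := by
          refine lintegral_mono_set ?_
          rintro s ⟨hs1, hs2⟩
          obtain ⟨i, hi⟩ := mem_iUnion.1 hs1
          refine mem_iUnion.2 ⟨⟨i, fun h => hs2 ?_⟩, hi⟩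
          exact mem_biUnion (Finset.mem_coe.2 h) hi
      _ ≤ m F := lintegral_iUnion_le _ _
  have hsplit : ∀ F, μ {s | (t : ℝ≥0∞) < ‖U f s‖ₑ} ≤ μ {s | (t : ℝ≥0∞) / 3 < ‖U (g F) s‖ₑ} +
      (μ ({s | (t : ℝ≥0∞) / 3 < ‖U (∑ i ∈ F, b i) s‖ₑ} \ G) + μ G) +
        μ {s | (t : ℝ≥0∞) / 3 < ‖U (e F) s‖ₑ} := by
    intro F
    have hbFp : MemLp (∑ i ∈ F, b i) p μ := memLp_finsetSum' F fun i _ => hbp i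
    have hsub : ∀ᵐ s ∂μ, s ∈ {s | (t : ℝ≥0∞) < ‖U f s‖ₑ} →
        s ∈ ({s | (t : ℝ≥0∞) / 3 < ‖U (g F) s‖ₑ} ∪
          (({s | (t : ℝ≥0∞) / 3 < ‖U (∑ i ∈ F, b i) s‖ₑ} \ G) ∪ G)) ∪
            {s | (t : ℝ≥0∞) / 3 < ‖U (e F) s‖ₑ} := by
      filter_upwards [hU.sub _ _ (hf.sub hbFp) (hep F), hU.sub _ _ hf hbFp] with s h1 h2 h3
      by_contra hcon
      simp only [mem_union, mem_ofPred_eq, mem_sdiff, not_or, not_and, not_not, not_lt] at hcon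
      obtain ⟨⟨hc1, hc2, hc3⟩, hc4⟩ := hcon
      have hc2' : ‖U (∑ i ∈ F, b i) s‖ₑ ≤ (t : ℝ≥0∞) / 3 := by
        by_contra h; exact hc3 (hc2 (not_le.1 h))
      have heq : U f s = U (g F) s + U (∑ i ∈ F, b i) s + U (e F) s := by
        rw [hg]
        simp only
        rw [h1, Pi.sub_apply, h2, Pi.sub_apply]; abel
      have h3' : (t : ℝ≥0∞) < ‖U f s‖ₑ := h3
      refine absurd h3' (not_lt.2 ?_)
      rw [heq]
      calc _ ≤ ‖U (g F) s‖ₑ + ‖U (∑ i ∈ F, b i) s‖ₑ + ‖U (e F) s‖ₑ :=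
            (enorm_add_le _ _).trans (by gcongr; exact enorm_add_le _ _)
        _ ≤ (t : ℝ≥0∞) / 3 + t / 3 + t / 3 := by gcongr
        _ = t := ENNReal.add_thirds _
    refine (measure_mono_ae hsub).trans ?_
    refine (measure_union_le _ _).trans ?_
    gcongr
    refine (measure_union_le _ _).trans ?_
    gcongr
    exact measure_union_le _ _
  have hfinal : ∀ F, t * μ {s | (t : ℝ≥0∞) < ‖U f s‖ₑ} ≤
      (E + 4 * 3 ^ (p : ℝ) * B ^ ((p : ℝ) - 1) + 12 * C : ℝ≥0) * (A * N) +
        3 ^ (p : ℝ) * (A * ((a : ℝ≥0∞) ^ ((p : ℝ) - 1))⁻¹) * m F := by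
    intro F
    refine (mul_le_mul_right (hsplit F) _).trans ?_
    rw [mul_add, mul_add, mul_add]
    refine add_le_add ?_ (heF F)
    refine (add_le_add (hgF F) (add_le_add (hbF F) hGle)).trans (le_of_eq ?_)
    push_cast
    ring
  have hlim : Filter.Tendsto (fun F =>
      (E + 4 * 3 ^ (p : ℝ) * B ^ ((p : ℝ) - 1) + 12 * C : ℝ≥0) * (A * N) +
        3 ^ (p : ℝ) * (A * ((a : ℝ≥0∞) ^ ((p : ℝ) - 1))⁻¹) * m F) Filter.atTop
      (nhds ((E + 4 * 3 ^ (p : ℝ) * B ^ ((p : ℝ) - 1) + 12 * C : ℝ≥0) * (A * N) +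
        3 ^ (p : ℝ) * (A * ((a : ℝ≥0∞) ^ ((p : ℝ) - 1))⁻¹) * 0)) := by
    refine tendsto_const_nhds.add (ENNReal.Tendsto.const_mul hmlim (Or.inr ?_))
    refine ENNReal.mul_ne_top (ENNReal.rpow_ne_top_of_nonneg hp0'.le (by norm_num)) ?_
    refine ENNReal.mul_ne_top ENNReal.coe_ne_top (ENNReal.inv_ne_top.2 ?_)
    simp [ENNReal.rpow_eq_zero_iff, ha]
  rw [mul_zero, add_zero] at hlim
  exact ge_of_tendsto' hlim hfinal

/-- The constant in the weak-type `(1, 1)` estimate. -/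
noncomputable def czConst (cd : ℝ) (cμ : ℝ≥0) (c₀ C₀ δ M : ℝ) (C p : ℝ≥0) : ℝ≥0 :=
  5 * (dbl cd cμ (M * C₀ / c₀) + 4 * 3 ^ (p : ℝ) * dbl cd cμ (C₀ / (c₀ * δ)) ^ ((p : ℝ) - 1) +
    12 * C + dbl cd cμ (2 * cd * C₀ / c₀))

/-- A cube of very coarse generation that meets a fixed ball has an inner ball comparable to one
containing `B(x, n)`. So if such cubes have measure at most `b` in every generation, the whole space
has measure at most a constant times `b`. -/
theorem measure_univ_le_of_forall_cube (H : IsHomogeneousType d μ cd cμ) (hcd : 1 ≤ cd)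
    (hc₀ : 0 < c₀) (hC₀ : c₀ ≤ C₀) (hδ : 0 < δ) (hδ' : δ < 1) (D : DyadicSystem d c₀ C₀ δ) (x : S)
    (R : ℝ) {b : ℝ≥0∞} (h : ∀ k : ℤ, ∃ j, (∃ y ∈ D.cube k j, d x y < R) ∧ μ (D.cube k j) ≤ b) :
    μ univ ≤ dbl cd cμ (2 * cd * C₀ / c₀) * b := by
  have hd := H.quasiMetric
  have hC : 0 < C₀ := hc₀.trans_le hC₀
  have hmono : Monotone fun n : ℕ => qball d x (n : ℝ) :=
    fun m n hmn => qball_mono x (by exact_mod_cast hmn)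
  rw [← iUnion_qball_nat (d := d) x, hmono.measure_iUnion]
  refine iSup_le fun n => ?_
  obtain ⟨k, hk⟩ : ∃ k : ℤ, max (n : ℝ) R ≤ C₀ * δ ^ k := by
    obtain ⟨m, hm⟩ := pow_unbounded_of_one_lt (max (n : ℝ) R / C₀) ((one_lt_inv₀ hδ).2 hδ')
    refine ⟨-m, ?_⟩
    rw [div_lt_iff₀ hC, inv_pow] at hm
    rw [zpow_neg, zpow_natCast, mul_comm]
    exact hm.le
  obtain ⟨j, ⟨y, hy, hxy⟩, hle⟩ := h k
  have hk0 : 0 < δ ^ k := zpow_pos hδ k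
  have hL : 2 * cd * C₀ / c₀ * (c₀ * δ ^ k) = 2 * cd * (C₀ * δ ^ k) := by field_simp
  have hdist : d (D.center k j) x ≤ 2 * cd * (C₀ * δ ^ k) := by
    have h1 := D.cube_subset_qball k j hy
    rw [hd.symm x y] at hxy
    have h2 := hd.triangle_lt hcd h1 (hxy.trans_le ((le_max_right _ _).trans hk))
    refine h2.le.trans (le_of_eq (by ring))
  refine (H.measure_qball_le hcd (s := D.center k j) (ρ := c₀ * δ ^ k)
    (L := 2 * cd * C₀ / c₀) (by positivity) ?_ ?_).trans ?_
  · rw [hL]; exact hdist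
  · rw [hL]
    refine ((le_max_left _ _).trans hk).trans ?_
    have : 0 < C₀ * δ ^ k := by positivity
    nlinarith
  · gcongr
    exact (measure_mono (D.qball_subset_cube k j)).trans hle

/-- The weak-type `(1, 1)` estimate for functions of bounded support. -/
theorem weak_one_of_atomDecay [CompleteSpace X] (H : IsHomogeneousType d μ cd cμ) (hcd : 1 ≤ cd)
    (hcμ : 1 ≤ cμ) (hc₀ : 0 < c₀) (hC₀ : c₀ ≤ C₀) (hδ : 0 < δ) (hδ' : δ < 1)
    (D : DyadicSystem d c₀ C₀ δ) (hp : 1 ≤ p) (hU : IsWeakOp μ p A U) {M : ℝ} {C : ℝ≥0}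
    (hUa : HasAtomDecay d μ ω p M C U) (hω : MonotoneOn ω (Icc 0 1)) (hM : 0 < M) (hA : A ≠ 0)
    (hdini : diniNorm ω ≤ A) {f : S → X} (hf : MemLp f p μ) {x : S} {R : ℝ}
    (hfs : support f ⊆ qball d x R) (t : ℝ≥0∞) :
    t * μ {s | t < ‖U f s‖ₑ} ≤ czConst cd cμ c₀ C₀ δ M C p * (A * ∫⁻ s, ‖f s‖ₑ ∂μ) := by
  have hd := H.quasiMetric
  have hp0 : p ≠ 0 := (zero_lt_one.trans_le hp).ne'
  have hC : 0 < C₀ := hc₀.trans_le hC₀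
  induction t with
  | top => simp
  | coe t =>
  rcases eq_or_ne t 0 with rfl | ht
  · simp
  wlog hR : 0 < R generalizing R
  · exact this (hfs.trans (qball_mono x ((not_lt.1 hR).trans zero_le_one))) one_pos
  have hf1 : Integrable f μ := by
    refine memLp_one_iff_integrable.1 (hf.mono_exponent_of_measure_support_ne_top
      (s := qball d x R) (fun t ht => ?_) (H.measure_qball_ne_top x R) (by exact_mod_cast hp))
    by_contra h
    exact ht (hfs h)
  set N := ∫⁻ s, ‖f s‖ₑ ∂μ with hN
  have hNt : N ≠ ∞ := hf1.2.ne
  rcases eq_or_ne N 0 with hN0 | hN0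
  · have h0 : f =ᵐ[μ] 0 := by
      have := (lintegral_eq_zero_iff' hf1.1.enorm).1 hN0
      filter_upwards [this] with s hs
      simpa using hs
    have h1 := hU.ae_eq_zero hp0 hf (by rw [eLpNorm_congr_ae h0]; simp)
    have h2 : μ {s | (t : ℝ≥0∞) < ‖U f s‖ₑ} = 0 := by
      have h3 : ∀ᵐ s ∂μ, ¬ (t : ℝ≥0∞) < ‖U f s‖ₑ := by
        filter_upwards [h1] with s hs; simp [hs]
      simpa only [not_not] using ae_iff.1 h3
    rw [h2, mul_zero]; exact zero_le
  set a : ℝ≥0 := t / A with ha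
  have ha0 : a ≠ 0 := div_ne_zero ht hA
  have ha0' : (a : ℝ≥0∞) ≠ 0 := by exact_mod_cast ha0
  have hta : t = a * A := by rw [ha, div_mul_cancel₀ _ hA]
  set F : Set S := {s | (a : ℝ≥0∞) < ‖f s‖ₑ} with hF
  have hFs : F ⊆ qball d x R := fun s hs => hfs fun h0 => by
    have hs' : (a : ℝ≥0∞) < ‖f s‖ₑ := hs
    simp [h0] at hs'
  have hFle : F ⊆ {s | (a : ℝ≥0∞) ≤ ‖f s‖ₑ} := fun s (hs : (a : ℝ≥0∞) < ‖f s‖ₑ) => hs.le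
  have haF : a * μ F ≤ N :=
    (mul_le_mul_right (measure_mono hFle) _).trans (mul_meas_ge_le_lintegral₀ hf1.1.enorm a)
  obtain ⟨V, hFV, hVs, hVm, hVle, hVo⟩ := H.exists_open_cover hcd hR hFs (ε := N / a)
    (by simp [ENNReal.div_eq_zero_iff, hN0])
  have haV : a * μ V ≤ 2 * N := by
    calc a * μ V ≤ a * (μ F + N / a) := by gcongr
      _ = a * μ F + N := by rw [mul_add, ENNReal.mul_div_cancel ha0' ENNReal.coe_ne_top]
      _ ≤ _ := by rw [two_mul]; gcongr
  -- The extra height `2 * a` on the open set `V ⊇ {‖f‖ > a}` makes every small cube inside `V` bad.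
  -- The stopping cubes therefore cover `V` at every point, and `‖f‖ ≤ a` outside them without
  -- differentiation. The price is the factor `5`: `N + 2 * (2 * N)` in place of `N`.
  set h : S → ℝ≥0∞ := fun s => ‖f s‖ₑ + V.indicator (fun _ => 2 * (a : ℝ≥0∞)) s with hh
  have hhN : ∫⁻ s, h s ∂μ ≤ 5 * N := by
    rw [hh, lintegral_add_left' hf1.1.enorm, lintegral_indicator hVm, setLIntegral_const]
    calc _ = N + 2 * (a * μ V) := by rw [mul_assoc]
      _ ≤ N + 2 * (2 * N) := by gcongr
      _ = _ := by ring
  by_cases htop : ∃ k₀ : ℤ, ∀ j, ∫⁻ s in D.cube k₀ j, h s ∂μ ≤ a * μ (D.cube k₀ j)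
  · obtain ⟨k₀, hk₀⟩ := htop
    obtain ⟨P, -, hPd, hPa, hPn⟩ := DyadicSystem.exists_stopping H hcd hc₀ hδ k₀ h a hk₀
    have := DyadicSystem.countable_idx (D := D) H hc₀ hδ
    have hPd' : Pairwise (Disjoint on fun q : P => D.set q) := fun q q' hne =>
      hPd q.2 q'.2 (Subtype.coe_injective.ne hne)
    have hPN : a * ∑' q : P, μ (D.set q) ≤ 5 * N := by
      rw [← ENNReal.tsum_mul_left]
      refine (ENNReal.tsum_le_tsum fun q : P => (hPa q q.2).1.le).trans ?_
      rw [← lintegral_iUnion (fun q : P => DyadicSystem.measurableSet_set _) hPd']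
      exact (setLIntegral_le_lintegral _ _).trans hhN
    have hmain := weak_one_of_cubes H hp hU (A := A) (M := M) (B := dbl cd cμ (C₀ / (c₀ * δ)))
      (E := dbl cd cμ (M * C₀ / c₀)) hUa hω hM hA hdini (one_le_dbl hcμ _)
      (fun q : P => D.set q) (fun q => D.ctr q) (fun q => C₀ * δ ^ q.1.1)
      (fun q => mul_pos hC (zpow_pos hδ _)) (fun q => DyadicSystem.measurableSet_set _)
      (fun q => DyadicSystem.set_subset_qball _)
      (fun q => (DyadicSystem.measure_set_pos H hc₀ hδ _).ne') hPd'
      (fun q => DyadicSystem.measure_dil_le H hcd hc₀ hC₀ hδ hM.le _)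
      hf ha0 hta ?_ (fun q => ?_) hPN (le_mul_of_one_le_left zero_le (by norm_num))
    · refine hmain.trans ?_
      rw [czConst]
      calc _ = (5 * (dbl cd cμ (M * C₀ / c₀) +
            4 * 3 ^ (p : ℝ) * dbl cd cμ (C₀ / (c₀ * δ)) ^ ((p : ℝ) - 1) + 12 * C) : ℝ≥0) *
              (A * N) := by push_cast; ring
        _ ≤ _ := by
          refine mul_le_mul_left (ENNReal.coe_le_coe.2 (mul_le_mul_right ?_ 5)) _
          exact le_self_add
    · intro s hs
      by_contra hcon
      have hsV : s ∈ V := hFV (not_le.1 hcon)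
      obtain ⟨ρ, hρ, hsub⟩ := hVo s hsV
      obtain ⟨k, hk, hks⟩ := D.exists_cube_subset_qball hd hcd hδ hδ' s hρ k₀
      obtain ⟨j, hj⟩ := D.exists_mem_cube k s
      have h1 := hPn s (fun q hq => hs ⟨q, hq⟩) k hk j hj
      have h2 : 2 * a * μ (D.cube k j) ≤ ∫⁻ s in D.cube k j, h s ∂μ := by
        rw [← setLIntegral_const]
        refine setLIntegral_mono' (D.measurableSet_cube k j) fun u hu => ?_
        have : u ∈ V := hsub (hks j hj hu)
        simp only [hh, indicator_of_mem this]
        exact le_add_self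
      have hpos : 0 < a * μ (D.cube k j) := ENNReal.mul_pos ha0'
        (DyadicSystem.measure_set_pos H hc₀ hδ ⟨k, j⟩).ne'
      have hlt : a * μ (D.cube k j) < 2 * a * μ (D.cube k j) := by
        rw [mul_assoc, two_mul]
        exact ENNReal.lt_add_right (ENNReal.mul_ne_top ENNReal.coe_ne_top
          (DyadicSystem.measure_set_ne_top H ⟨k, j⟩)) hpos.ne'
      exact absurd (h2.trans h1) (not_le.2 hlt)
    · refine le_trans (lintegral_mono fun s => ?_) (hPa q q.2).2
      exact le_self_add
  -- If no generation can start the stopping time, every generation has a cube on which `h` has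
  -- average above `a`. This cube meets the ball that carries `h` and has measure at most `5 * N /
  -- a`, so `S` itself is so small that the bound is trivial.
  · push Not at htop
    have huniv := measure_univ_le_of_forall_cube H hcd hc₀ hC₀ hδ hδ' D x (max R (2 * cd * R))
      (b := 5 * N / a) (fun k => by
        obtain ⟨j, hj⟩ := htop k
        refine ⟨j, ?_, ?_⟩
        · by_contra! hcon
          have h0 : ∫⁻ s in D.cube k j, h s ∂μ = 0 := by
            rw [setLIntegral_congr_fun (g := fun _ => 0) (D.measurableSet_cube k j)]
            · simp
            · intro s hs
              have h1 := hcon s hs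
              have h2 : s ∉ V := fun hsV => by
                have : d x s < 2 * cd * R := hVs hsV
                exact absurd (h1.trans_lt this) (not_lt.2 (le_max_right _ _))
              have h3 : f s = 0 := by
                by_contra hne
                have : d x s < R := hfs hne
                exact absurd (h1.trans_lt this) (not_lt.2 (le_max_left _ _))
              simp [hh, h2, h3]
          rw [h0] at hj
          exact absurd hj not_lt_zero
        · rw [ENNReal.le_div_iff_mul_le (Or.inl ha0') (Or.inl ENNReal.coe_ne_top), mul_comm]
          exact hj.le.trans ((setLIntegral_le_lintegral _ _).trans hhN))
    calc t * μ {s | (t : ℝ≥0∞) < ‖U f s‖ₑ} ≤ t * (dbl cd cμ (2 * cd * C₀ / c₀) * (5 * N / a)) := by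
          gcongr; exact (measure_mono (subset_univ _)).trans huniv
      _ = (5 * dbl cd cμ (2 * cd * C₀ / c₀) : ℝ≥0) * (A * (a * (N / a))) := by
          rw [hta, mul_div_assoc 5 N]; push_cast; ring
      _ = (5 * dbl cd cμ (2 * cd * C₀ / c₀) : ℝ≥0) * (A * N) := by
          rw [ENNReal.mul_div_cancel ha0' ENNReal.coe_ne_top]
      _ ≤ _ := by
          rw [czConst]
          refine mul_le_mul_left (ENNReal.coe_le_coe.2 (mul_le_mul_right ?_ 5)) _
          exact le_add_self

end CalderonZygmund

/-! ### Truncations and convergence in measure -/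

section Limits

variable {S : Type u} [MeasurableSpace S] {X : Type v} [NormedAddCommGroup X]
  {Y : Type w} [NormedAddCommGroup Y] {μ : Measure S}

theorem tendsto_eLpNorm_sub_indicator {p : ℝ≥0} (hp : p ≠ 0) {f : S → X} (hf : MemLp f p μ)
    {E : ℕ → Set S} (hE : ∀ n, MeasurableSet (E n)) (hlim : ∀ s, ∀ᶠ n in Filter.atTop, s ∈ E n) :
    Filter.Tendsto (fun n => eLpNorm (f - (E n).indicator f) p μ) Filter.atTop (nhds 0) := by
  have hp0 : (0 : ℝ) < p := by positivity
  have hfp : ∫⁻ s, ‖f s‖ₑ ^ (p : ℝ) ∂μ ≠ ∞ := by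
    rw [← eLpNorm_nnreal_pow_eq_lintegral hp]
    exact ENNReal.rpow_ne_top_of_nonneg hp0.le hf.2.ne
  have h1 : Filter.Tendsto (fun n => ∫⁻ s, ‖(f - (E n).indicator f) s‖ₑ ^ (p : ℝ) ∂μ) Filter.atTop
      (nhds (∫⁻ _, 0 ∂μ)) := by
    refine tendsto_lintegral_of_dominated_convergence' (fun s => ‖f s‖ₑ ^ (p : ℝ)) ?_ ?_ hfp ?_
    · exact fun n => ((hf.1.sub (hf.1.indicator (hE n))).enorm.pow_const _)
    · refine fun n => Filter.Eventually.of_forall fun s => ?_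
      refine ENNReal.rpow_le_rpow ?_ hp0.le
      by_cases hs : s ∈ E n <;> simp [hs]
    · refine Filter.Eventually.of_forall fun s => ?_
      refine tendsto_const_nhds.congr' ?_
      filter_upwards [hlim s] with n hn
      simp [hn, hp0]
  rw [lintegral_zero] at h1
  have h2 := (ENNReal.continuous_rpow_const (y := (p : ℝ)⁻¹)).tendsto 0 |>.comp h1
  rw [ENNReal.zero_rpow_of_pos (by positivity)] at h2
  refine h2.congr fun n => ?_
  rw [comp_apply, ← eLpNorm_nnreal_pow_eq_lintegral hp, ← ENNReal.rpow_mul,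
    mul_inv_cancel₀ hp0.ne', ENNReal.rpow_one]

theorem ae_eq_of_tendsto_measure {g h : S → Y}
    (H : ∀ t : ℝ≥0∞, t ≠ 0 → ∀ ε : ℝ≥0∞, 0 < ε → μ {s | t < ‖g s - h s‖ₑ} ≤ ε) : g =ᵐ[μ] h := by
  have h0 : g - h =ᵐ[μ] 0 := by
    refine ae_eq_zero_of_forall_measure fun t ht => ?_
    exact le_antisymm (le_of_forall_gt_imp_ge_of_dense fun ε hε => H t ht ε hε) zero_le
  filter_upwards [h0] with s hs
  exact sub_eq_zero.1 hs

theorem IsWeakOp.measure_le {p A : ℝ≥0} {U : (S → X) → S → Y} (hU : IsWeakOp μ p A U) (hp : p ≠ 0)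
    {f : S → X} (hf : MemLp f p μ) {t : ℝ≥0∞} (ht : t ≠ 0) :
    μ {s | t < ‖U f s‖ₑ} ≤ (t⁻¹ * (A * eLpNorm f p μ)) ^ (p : ℝ) := by
  have hp0 : (0 : ℝ) < p := by positivity
  rcases eq_or_ne t ∞ with rfl | ht'
  · simp
  have h := hU.weak f hf t
  have h1 : μ {s | t < ‖U f s‖ₑ} ^ (1 / (p : ℝ)) ≤ t⁻¹ * (A * eLpNorm f p μ) := by
    calc _ = t⁻¹ * (t * μ {s | t < ‖U f s‖ₑ} ^ (1 / (p : ℝ))) := by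
          rw [← mul_assoc, ENNReal.inv_mul_cancel ht ht', one_mul]
      _ ≤ _ := by gcongr
  calc _ = (μ {s | t < ‖U f s‖ₑ} ^ (1 / (p : ℝ))) ^ (p : ℝ) := by
        rw [← ENNReal.rpow_mul, one_div, inv_mul_cancel₀ hp0.ne', ENNReal.rpow_one]
    _ ≤ _ := ENNReal.rpow_le_rpow h1 hp0.le

theorem IsWeakOp.tendsto_measure {p A : ℝ≥0} {U : (S → X) → S → Y} (hU : IsWeakOp μ p A U)
    (hp : p ≠ 0) {f : ℕ → S → X} {g : S → X} (hf : ∀ n, MemLp (f n) p μ) (hg : MemLp g p μ)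
    (hlim : Filter.Tendsto (fun n => eLpNorm (g - f n) p μ) Filter.atTop (nhds 0)) {t : ℝ≥0∞}
    (ht : t ≠ 0) :
    Filter.Tendsto (fun n => μ {s | t < ‖U g s - U (f n) s‖ₑ}) Filter.atTop (nhds 0) := by
  have hp0 : (0 : ℝ) < p := by positivity
  have h1 : Filter.Tendsto (fun n => (t⁻¹ * (A * eLpNorm (g - f n) p μ)) ^ (p : ℝ)) Filter.atTop
      (nhds ((t⁻¹ * (A * 0)) ^ (p : ℝ))) := by
    refine ((ENNReal.continuous_rpow_const (y := (p : ℝ))).tendsto _).comp ?_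
    refine ENNReal.Tendsto.const_mul (ENNReal.Tendsto.const_mul hlim (Or.inr ENNReal.coe_ne_top))
      (Or.inr (ENNReal.inv_ne_top.2 ht))
  rw [mul_zero, mul_zero, ENNReal.zero_rpow_of_pos hp0] at h1
  refine tendsto_of_tendsto_of_tendsto_of_le_of_le tendsto_const_nhds h1 (fun _ => zero_le)
    fun n => ?_
  refine le_trans (le_of_eq (measure_congr ?_)) (hU.measure_le hp (hg.sub (hf n)) ht)
  filter_upwards [hU.sub g (f n) hg (hf n)] with s hs
  exact congrArg (fun y => t < ‖y‖ₑ) hs.symm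

theorem tendstoInMeasure_of_measure_lt {f : ℕ → S → Y} {g : S → Y}
    (h : ∀ t : ℝ≥0∞, t ≠ 0 →
      Filter.Tendsto (fun n => μ {s | t < ‖g s - f n s‖ₑ}) Filter.atTop (nhds 0)) :
    TendstoInMeasure μ f Filter.atTop g := by
  intro ε hε
  have h2 : ε / 2 ≠ 0 := (ENNReal.half_pos hε.ne').ne'
  rcases eq_or_ne ε ∞ with rfl | hε'
  · refine tendsto_const_nhds.congr fun n => ?_
    have : {x | (∞ : ℝ≥0∞) ≤ edist (f n x) (g x)} = ∅ := by
      ext x; simp [edist_ne_top]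
    rw [this, measure_empty]
  refine tendsto_of_tendsto_of_tendsto_of_le_of_le tendsto_const_nhds (h _ h2) (fun _ => zero_le)
    fun n => measure_mono fun s hs => ?_
  have hs' : ε ≤ edist (f n s) (g s) := hs
  show ε / 2 < ‖g s - f n s‖ₑ
  rw [edist_comm, edist_eq_enorm_sub] at hs'
  exact (ENNReal.half_lt_self hε.ne' hε').trans_le hs'

end Limits

/-! ### Extension by density of weak-type operators -/

section Extension

variable {S : Type u} [MeasurableSpace S] {Y : Type w} [NormedAddCommGroup Y]
  {𝕜 : Type x} [RCLike 𝕜] [NormedSpace 𝕜 Y] {μ : Measure S}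
  {E : Type v} [NormedAddCommGroup E] [NormedSpace 𝕜 E] {V : Submodule 𝕜 E}

/-- Approximation at rate `4^{-n}` and the weak bound at height `2^{-n}` give exceptional sets of
summable measure, so by Borel–Cantelli the images converge almost everywhere. The estimate is kept
relative to every `v` at once, with the same constant, because this determines the limit. -/
theorem exists_weak_limit [CompleteSpace Y] (hV : Dense (V : Set E)) (A : V →ₗ[𝕜] (S →ₘ[μ] Y))
    {C : ℝ≥0} (hA : ∀ v : V, ∀ t : ℝ≥0∞, t * μ {s | t < ‖A v s‖ₑ} ≤ C * ‖(v : E)‖ₑ) (e : E) :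
    ∃ y : S →ₘ[μ] Y, ∀ v : V, ∀ t : ℝ≥0∞, t * μ {s | t < ‖y s - A v s‖ₑ} ≤ C * ‖e - v‖ₑ := by
  have hseq : ∀ n : ℕ, ∃ v : V, ‖e - v‖ₑ ≤ (1 / 4 : ℝ≥0∞) ^ n := by
    intro n
    obtain ⟨v, hv, hve⟩ := EMetric.mem_closure_iff.1 (hV e) ((1 / 4 : ℝ≥0∞) ^ n)
      (ENNReal.pow_pos (by simp) n)
    exact ⟨⟨v, hv⟩, by rw [edist_eq_enorm_sub] at hve; exact hve.le⟩
  choose a ha using hseq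
  have hAsub : ∀ v v' : V, ∀ᵐ s ∂μ, A (v - v') s = A v s - A v' s := by
    intro v v'
    rw [map_sub]
    exact AEEqFun.coeFn_sub _ _
  have hstep : ∀ n, μ {s | (1 / 2 : ℝ≥0∞) ^ n < ‖A (a n) s - A (a (n + 1)) s‖ₑ} ≤
      (2 * C) * (1 / 2 : ℝ≥0∞) ^ n := by
    intro n
    have h1 := hA (a n - a (n + 1)) ((1 / 2 : ℝ≥0∞) ^ n)
    have h2 : ‖((a n - a (n + 1) : V) : E)‖ₑ ≤ 2 * (1 / 4 : ℝ≥0∞) ^ n := by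
      have : ((a n - a (n + 1) : V) : E) = (e - a (n + 1)) - (e - a n) := by
        rw [Submodule.coe_sub]; abel
      rw [this, two_mul]
      refine enorm_sub_le.trans (add_le_add ((ha (n + 1)).trans ?_) (ha n))
      exact pow_le_pow_of_le_one zero_le (by simp) (Nat.le_succ n)
    have h3 : μ {s | (1 / 2 : ℝ≥0∞) ^ n < ‖A (a n) s - A (a (n + 1)) s‖ₑ} =
        μ {s | (1 / 2 : ℝ≥0∞) ^ n < ‖A (a n - a (n + 1)) s‖ₑ} := by
      refine measure_congr ?_
      filter_upwards [hAsub (a n) (a (n + 1))] with s hs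
      exact congrArg (fun y => (1 / 2 : ℝ≥0∞) ^ n < ‖y‖ₑ) hs.symm
    rw [h3]
    have h4 : (1 / 4 : ℝ≥0∞) ^ n = (1 / 2) ^ n * (1 / 2) ^ n := by
      rw [← mul_pow]
      congr 1
      rw [one_div, one_div, ← ENNReal.mul_inv (by simp) (by simp)]
      norm_num
    have h5 : (1 / 2 : ℝ≥0∞) ^ n ≠ 0 := by simp
    have h6 : (1 / 2 : ℝ≥0∞) ^ n ≠ ∞ := by simp
    refine (ENNReal.mul_le_mul_iff_right h5 h6).1 (h1.trans ?_)
    calc C * ‖((a n - a (n + 1) : V) : E)‖ₑ ≤ C * (2 * (1 / 4 : ℝ≥0∞) ^ n) := by gcongr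
      _ = _ := by rw [h4]; ring
  have hsum : ∑' n, μ {s | (1 / 2 : ℝ≥0∞) ^ n < ‖A (a n) s - A (a (n + 1)) s‖ₑ} ≠ ∞ := by
    refine ne_top_of_le_ne_top ?_ (ENNReal.tsum_le_tsum hstep)
    rw [ENNReal.tsum_mul_left, ENNReal.tsum_geometric]
    refine ENNReal.mul_ne_top (ENNReal.mul_ne_top (by simp) ENNReal.coe_ne_top) ?_
    rw [ENNReal.inv_ne_top]
    simp
  have hconv : ∀ᵐ s ∂μ, ∃ y, Filter.Tendsto (fun n => A (a n) s) Filter.atTop (nhds y) := by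
    filter_upwards [ae_eventually_notMem hsum] with s hs
    obtain ⟨N, hN⟩ := Filter.eventually_atTop.1 hs
    refine cauchySeq_tendsto_of_complete ((cauchySeq_shift (u := fun n => A (a n) s) N).1 ?_)
    refine cauchySeq_of_edist_le_of_tsum_ne_top (fun n => (1 / 2 : ℝ≥0∞) ^ n) (fun n => ?_) ?_
    · have h1 := hN (n + N) (Nat.le_add_left _ _)
      simp only [not_lt] at h1
      rw [edist_eq_enorm_sub, show n.succ + N = n + N + 1 by omega]
      exact h1.trans (pow_le_pow_of_le_one zero_le (by simp) (Nat.le_add_right n N))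
    · rw [ENNReal.tsum_geometric, ENNReal.inv_ne_top]
      simp
  obtain ⟨g, hg, hlim⟩ := exists_stronglyMeasurable_limit_of_tendsto_ae
    (fun n => (AEEqFun.aestronglyMeasurable (A (a n)))) hconv
  refine ⟨AEEqFun.mk g hg.aestronglyMeasurable, fun v t => ?_⟩
  rcases eq_or_ne t 0 with rfl | ht
  · simp
  rcases eq_or_ne t ∞ with rfl | ht'
  · simp
  -- Strict superlevel sets of the limit lie in the lower limit of those of the sequence. Continuity
  -- from below then plays the role of Fatou's lemma and preserves the constant.
  set W : ℕ → Set S := fun n => {s | t < ‖A (a n) s - A v s‖ₑ} with hW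
  have hsub : ∀ᵐ s ∂μ, s ∈ {s | t < ‖(AEEqFun.mk g hg.aestronglyMeasurable : S →ₘ[μ] Y) s - A v s‖ₑ} →
      s ∈ ⋃ N, ⋂ n ≥ N, W n := by
    filter_upwards [hlim, AEEqFun.coeFn_mk g hg.aestronglyMeasurable] with s hs1 hs2 hs3
    have hs3' : t < ‖g s - A v s‖ₑ := by rw [← hs2]; exact hs3
    have h1 : Filter.Tendsto (fun n => ‖A (a n) s - A v s‖ₑ) Filter.atTop (nhds ‖g s - A v s‖ₑ) :=
      (hs1.sub_const _).enorm
    obtain ⟨N, hN⟩ := Filter.eventually_atTop.1 (h1.eventually (lt_mem_nhds hs3'))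
    exact mem_iUnion.2 ⟨N, mem_iInter₂.2 fun n hn => hN n hn⟩
  have hWn : ∀ n, t * μ (W n) ≤ C * ‖(a n : E) - v‖ₑ := by
    intro n
    refine le_trans (le_of_eq ?_) (hA (a n - v) t)
    congr 1
    refine measure_congr ?_
    filter_upwards [hAsub (a n) v] with s hs
    exact congrArg (fun y => t < ‖y‖ₑ) hs.symm
  have hlim2 : Filter.Tendsto (fun n => C * ‖(a n : E) - v‖ₑ) Filter.atTop (nhds (C * ‖e - v‖ₑ)) := by
    refine ENNReal.Tendsto.const_mul ?_ (Or.inr ENNReal.coe_ne_top)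
    refine Filter.Tendsto.enorm (Filter.Tendsto.sub_const ?_ _)
    rw [tendsto_iff_edist_tendsto_0]
    refine tendsto_of_tendsto_of_tendsto_of_le_of_le tendsto_const_nhds
      (ENNReal.tendsto_pow_atTop_nhds_zero_of_lt_one (r := 1 / 4) ?_) (fun _ => zero_le) fun n => ?_
    · rw [one_div]; exact ENNReal.inv_lt_one.2 (by norm_num)
    · rw [edist_comm, edist_eq_enorm_sub]; exact ha n
  calc t * μ {s | t < ‖(AEEqFun.mk g hg.aestronglyMeasurable : S →ₘ[μ] Y) s - A v s‖ₑ}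
      ≤ t * μ (⋃ N, ⋂ n ≥ N, W n) := mul_le_mul_right (measure_mono_ae hsub) _
    _ = ⨆ N, t * μ (⋂ n ≥ N, W n) := by
        have hmono : Monotone fun N => ⋂ n ≥ N, W n := fun N M hNM =>
          biInter_subset_biInter_left fun n hn => le_trans hNM hn
        rw [hmono.measure_iUnion, ENNReal.mul_iSup]
    _ ≤ _ := by
        refine iSup_le fun N => ge_of_tendsto hlim2 ?_
        filter_upwards [Filter.eventually_ge_atTop N] with n hn
        exact (mul_le_mul_right (measure_mono (biInter_subset_of_mem hn)) _).trans (hWn n)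

/-- Extension by density of a linear operator satisfying a weak-type estimate. -/
theorem exists_weak_extension [CompleteSpace Y] (hV : Dense (V : Set E)) (A : V →ₗ[𝕜] (S →ₘ[μ] Y))
    {C : ℝ≥0} (hA : ∀ v : V, ∀ t : ℝ≥0∞, t * μ {s | t < ‖A v s‖ₑ} ≤ C * ‖(v : E)‖ₑ) :
    ∃ B : E →ₗ[𝕜] (S →ₘ[μ] Y), (∀ v : V, B v = A v) ∧
      ∀ e, ∀ t : ℝ≥0∞, t * μ {s | t < ‖B e s‖ₑ} ≤ C * ‖e‖ₑ := by
  choose B hB using exists_weak_limit hV A hA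
  -- a value is determined by its distance to the values of `A`
  have huniq : ∀ (e : E) (y z : S →ₘ[μ] Y) (c : ℝ≥0),
      (∀ v : V, ∀ t : ℝ≥0∞, t * μ {s | t < ‖y s - A v s‖ₑ} ≤ c * ‖e - v‖ₑ) →
      (∀ v : V, ∀ t : ℝ≥0∞, t * μ {s | t < ‖z s - A v s‖ₑ} ≤ c * ‖e - v‖ₑ) → y = z := by
    intro e y z c hy hz
    refine AEEqFun.ext (ae_eq_of_tendsto_measure fun t ht ε hε => ?_)
    rcases eq_or_ne t ∞ with rfl | ht'
    · simp
    have ht2 : t / 2 ≠ 0 := (ENNReal.half_pos ht).ne'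
    have ht2' : t / 2 ≠ ∞ := (ENNReal.half_lt_self ht ht').ne_top
    obtain ⟨η, hη0, hη⟩ : ∃ η : ℝ≥0∞, 0 < η ∧ (t / 2)⁻¹ * (c * η) + (t / 2)⁻¹ * (c * η) ≤ ε := by
      have hlim : Filter.Tendsto (fun η : ℝ≥0∞ => (t / 2)⁻¹ * (c * η) + (t / 2)⁻¹ * (c * η))
          (nhdsWithin 0 (Ioi 0)) (nhds ((t / 2)⁻¹ * (c * 0) + (t / 2)⁻¹ * (c * 0))) := by
        have h1 : Filter.Tendsto (fun η : ℝ≥0∞ => (t / 2)⁻¹ * (c * η)) (nhdsWithin 0 (Ioi 0))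
            (nhds ((t / 2)⁻¹ * (c * 0))) :=
          ENNReal.Tendsto.const_mul (ENNReal.Tendsto.const_mul
            (tendsto_nhdsWithin_of_tendsto_nhds Filter.tendsto_id) (Or.inr ENNReal.coe_ne_top))
              (Or.inr (ENNReal.inv_ne_top.2 ht2))
        exact h1.add h1
      simp only [mul_zero, add_zero] at hlim
      obtain ⟨η, h1, h2⟩ := ((hlim.eventually (gt_mem_nhds hε)).and self_mem_nhdsWithin).exists
      exact ⟨η, h2, h1.le⟩
    obtain ⟨v, hv, hve⟩ := EMetric.mem_closure_iff.1 (hV e) η hη0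
    rw [edist_eq_enorm_sub] at hve
    have key : ∀ y : S →ₘ[μ] Y,
        (∀ v : V, ∀ t : ℝ≥0∞, t * μ {s | t < ‖y s - A v s‖ₑ} ≤ c * ‖e - v‖ₑ) →
        μ {s | t / 2 < ‖y s - A ⟨v, hv⟩ s‖ₑ} ≤ (t / 2)⁻¹ * (c * η) := by
      intro y hy
      have h := hy ⟨v, hv⟩ (t / 2)
      calc _ = (t / 2)⁻¹ * (t / 2 * μ {s | t / 2 < ‖y s - A ⟨v, hv⟩ s‖ₑ}) := by
            rw [← mul_assoc, ENNReal.inv_mul_cancel ht2 ht2', one_mul]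
        _ ≤ _ := mul_le_mul_right (h.trans (mul_le_mul_right hve.le _)) _
    refine (measure_mono (t := {s | t / 2 < ‖y s - A ⟨v, hv⟩ s‖ₑ} ∪
      {s | t / 2 < ‖z s - A ⟨v, hv⟩ s‖ₑ}) fun s hs => ?_).trans ((measure_union_le _ _).trans
        ((add_le_add (key y hy) (key z hz)).trans hη))
    by_contra hcon
    simp only [mem_union, mem_ofPred_eq, not_or, not_lt] at hcon
    have hs' : t < ‖y s - z s‖ₑ := hs
    refine absurd hs' (not_lt.2 ?_)
    calc ‖y s - z s‖ₑ = ‖(y s - A ⟨v, hv⟩ s) - (z s - A ⟨v, hv⟩ s)‖ₑ := by rw [sub_sub_sub_cancel_right]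
      _ ≤ _ := enorm_sub_le
      _ ≤ t / 2 + t / 2 := add_le_add hcon.1 hcon.2
      _ = t := ENNReal.add_halves t
  have hAsub : ∀ v v' : V, ∀ᵐ s ∂μ, A (v - v') s = A v s - A v' s := by
    intro v v'
    rw [map_sub]
    exact AEEqFun.coeFn_sub _ _
  have hext : ∀ v : V, B v = A v := by
    intro v
    refine huniq v _ _ C (hB v) fun v' t => ?_
    refine le_trans (le_of_eq ?_) (hA (v - v') t)
    congr 1
    refine measure_congr ?_
    filter_upwards [hAsub v v'] with s hs
    exact congrArg (fun y => t < ‖y‖ₑ) hs.symm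
  -- Write `v` as `w n + (v - w n)` with `w n → e`. Halving the level `t` costs a factor `2`, which
  -- is why uniqueness was proved for an arbitrary constant `c`.
  have hadd : ∀ e e', B (e + e') = B e + B e' := by
    intro e e'
    refine huniq (e + e') _ _ (2 * C) (fun v t => (hB (e + e') v t).trans ?_) fun v t => ?_
    · gcongr
      exact_mod_cast le_mul_of_one_le_left zero_le one_le_two
    obtain ⟨w, hw, hwe⟩ := mem_closure_iff_seq_limit.1 (hV e)
    have hlim : Filter.Tendsto (fun n => 2 * (C * ‖e - w n‖ₑ) + 2 * (C * ‖e' - (v - w n)‖ₑ))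
        Filter.atTop (nhds (2 * (C * ‖e - e‖ₑ) + 2 * (C * ‖e' - (v - e)‖ₑ))) := by
      refine Filter.Tendsto.add ?_ ?_
      · exact ENNReal.Tendsto.const_mul (ENNReal.Tendsto.const_mul
          ((tendsto_const_nhds.sub hwe).enorm) (Or.inr ENNReal.coe_ne_top)) (Or.inr (by simp))
      · exact ENNReal.Tendsto.const_mul (ENNReal.Tendsto.const_mul
          ((tendsto_const_nhds.sub (tendsto_const_nhds.sub hwe)).enorm)
            (Or.inr ENNReal.coe_ne_top)) (Or.inr (by simp))
    have hval : 2 * (C * ‖e - e‖ₑ) + 2 * (C * ‖e' - ((v : E) - e)‖ₑ) =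
        ((2 * C : ℝ≥0) : ℝ≥0∞) * ‖e + e' - v‖ₑ := by
      rw [sub_self, enorm_zero, show e' - ((v : E) - e) = e + e' - v by abel]
      push_cast
      ring
    rw [hval] at hlim
    refine ge_of_tendsto' hlim fun n => ?_
    have h1 := hB e ⟨w n, hw n⟩ (t / 2)
    have h2 := hB e' (v - ⟨w n, hw n⟩) (t / 2)
    have hsub : ∀ᵐ s ∂μ, s ∈ {s | t < ‖(B e + B e' : S →ₘ[μ] Y) s - A v s‖ₑ} →
        s ∈ {s | t / 2 < ‖B e s - A ⟨w n, hw n⟩ s‖ₑ} ∪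
          {s | t / 2 < ‖B e' s - A (v - ⟨w n, hw n⟩) s‖ₑ} := by
      filter_upwards [hAsub v ⟨w n, hw n⟩, AEEqFun.coeFn_add (B e) (B e')] with s hs1 hs2 hs3
      by_contra hcon
      simp only [mem_union, mem_ofPred_eq, not_or, not_lt] at hcon
      have hs' : t < ‖(B e + B e' : S →ₘ[μ] Y) s - A v s‖ₑ := hs3
      refine absurd hs' (not_lt.2 ?_)
      have heq : (B e + B e' : S →ₘ[μ] Y) s - A v s =
          (B e s - A ⟨w n, hw n⟩ s) + (B e' s - A (v - ⟨w n, hw n⟩) s) := by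
        rw [hs1, hs2, Pi.add_apply]; abel
      rw [heq]
      exact (enorm_add_le _ _).trans ((add_le_add hcon.1 hcon.2).trans (ENNReal.add_halves t).le)
    calc t * μ {s | t < ‖(B e + B e' : S →ₘ[μ] Y) s - A v s‖ₑ}
        ≤ t * (μ {s | t / 2 < ‖B e s - A ⟨w n, hw n⟩ s‖ₑ} +
          μ {s | t / 2 < ‖B e' s - A (v - ⟨w n, hw n⟩) s‖ₑ}) := by
          gcongr; exact (measure_mono_ae hsub).trans (measure_union_le _ _)
      _ = 2 * (t / 2 * μ {s | t / 2 < ‖B e s - A ⟨w n, hw n⟩ s‖ₑ}) +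
          2 * (t / 2 * μ {s | t / 2 < ‖B e' s - A (v - ⟨w n, hw n⟩) s‖ₑ}) := by
          rw [← mul_assoc, ← mul_assoc, ENNReal.mul_div_cancel (by simp) (by simp), mul_add]
      _ ≤ _ := add_le_add (mul_le_mul_right h1 _) (mul_le_mul_right h2 _)
  have hsmul : ∀ (c : 𝕜) e, B (c • e) = c • B e := by
    intro c e
    rcases eq_or_ne c 0 with rfl | hc
    · rw [zero_smul, zero_smul]
      have := hext 0
      rwa [map_zero, Submodule.coe_zero] at this
    have hc0 : ‖c‖ₑ ≠ 0 := by simpa using hc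
    have hct : ‖c‖ₑ ≠ ∞ := enorm_ne_top
    refine huniq (c • e) _ _ C (hB (c • e)) fun v t => ?_
    have h1 := hB e (c⁻¹ • v) (t / ‖c‖ₑ)
    have hsub : ∀ᵐ s ∂μ, s ∈ {s | t < ‖(c • B e : S →ₘ[μ] Y) s - A v s‖ₑ} →
        s ∈ {s | t / ‖c‖ₑ < ‖B e s - A (c⁻¹ • v) s‖ₑ} := by
      have hA' : A v = c • A (c⁻¹ • v) := by rw [map_smul, smul_inv_smul₀ hc]
      filter_upwards [AEEqFun.coeFn_smul c (B e), AEEqFun.coeFn_smul c (A (c⁻¹ • v))]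
        with s hs1 hs2 hs3
      have hs3' : t < ‖(c • B e : S →ₘ[μ] Y) s - A v s‖ₑ := hs3
      rw [hA', hs1, hs2, Pi.smul_apply, Pi.smul_apply, ← smul_sub, enorm_smul] at hs3'
      show t / ‖c‖ₑ < _
      rwa [ENNReal.div_lt_iff (Or.inl hc0) (Or.inl hct), mul_comm]
    calc t * μ {s | t < ‖(c • B e : S →ₘ[μ] Y) s - A v s‖ₑ}
        ≤ t * μ {s | t / ‖c‖ₑ < ‖B e s - A (c⁻¹ • v) s‖ₑ} := by
          exact mul_le_mul_right (measure_mono_ae hsub) _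
      _ = ‖c‖ₑ * (t / ‖c‖ₑ * μ {s | t / ‖c‖ₑ < ‖B e s - A (c⁻¹ • v) s‖ₑ}) := by
          rw [← mul_assoc, ENNReal.mul_div_cancel hc0 hct]
      _ ≤ ‖c‖ₑ * (C * ‖e - (c⁻¹ • v : V)‖ₑ) := by gcongr
      _ = C * ‖c • (e - (c⁻¹ • v : V))‖ₑ := by rw [enorm_smul]; ring
      _ = _ := by rw [smul_sub, Submodule.coe_smul, smul_inv_smul₀ hc]
  refine ⟨{ toFun := B, map_add' := hadd, map_smul' := hsmul }, hext, fun e t => ?_⟩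
  have h := hB e 0 t
  rw [Submodule.coe_zero, sub_zero, map_zero] at h
  refine le_trans (le_of_eq ?_) h
  congr 1
  refine measure_congr ?_
  filter_upwards [AEEqFun.coeFn_zero (μ := μ) (α := S) (β := Y)] with s hs
  refine congrArg (fun y => t < ‖y‖ₑ) ?_
  simp [hs]

end Extension

/-! ### The extension to `L^1` and its compatibility with `T` -/

section ExtensionToLOne

variable {S : Type u} [MeasurableSpace S] {d : S → S → ℝ} {μ : Measure S} {cd : ℝ} {cμ : ℝ≥0}
  {X : Type v} [NormedAddCommGroup X] {Y : Type w} [NormedAddCommGroup Y]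
  {𝕜 : Type x} [RCLike 𝕜] [NormedSpace 𝕜 X] [NormedSpace 𝕜 Y] {p : ℝ≥0}

/-- Truncation in space and in size, the latter through a measurable representative: bounded
functions of bounded support lie in every `L^q`, so one sequence approximates in several spaces at
once. -/
theorem IsHomogeneousType.exists_truncation (H : IsHomogeneousType d μ cd cμ) (z : S) {f : S → X}
    (hf : AEStronglyMeasurable f μ) :
    ∃ E : ℕ → Set S, (∀ n, MeasurableSet (E n)) ∧ (∀ s, ∀ᶠ n in Filter.atTop, s ∈ E n) ∧
      (∀ n, E n ⊆ qball d z n) ∧ ∀ n, ∀ q : ℝ≥0∞, MemLp ((E n).indicator f) q μ := by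
  refine ⟨fun n => {s | ‖hf.mk f s‖ ≤ n} ∩ qball d z n, fun n => ?_, fun s => ?_,
    fun n => inter_subset_right, fun n q => ?_⟩
  · exact (measurableSet_le hf.stronglyMeasurable_mk.norm.measurable measurable_const).inter
      (H.measurableSet_qball z n)
  · obtain ⟨N, hN⟩ := exists_nat_gt (max ‖hf.mk f s‖ (d z s))
    filter_upwards [Filter.eventually_ge_atTop N] with n hn
    have hn' : (N : ℝ) ≤ n := by exact_mod_cast hn
    exact ⟨((le_max_left _ _).trans_lt (hN.trans_le hn')).le,
      (le_max_right _ _).trans_lt (hN.trans_le hn')⟩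
  · have hm : MeasurableSet ({s | ‖hf.mk f s‖ ≤ n} ∩ qball d z n) :=
      (measurableSet_le hf.stronglyMeasurable_mk.norm.measurable measurable_const).inter
        (H.measurableSet_qball z n)
    rw [memLp_indicator_iff_restrict hm]
    have : IsFiniteMeasure (μ.restrict ({s | ‖hf.mk f s‖ ≤ n} ∩ qball d z n)) :=
      isFiniteMeasure_restrict.2 (ne_top_of_le_ne_top (H.measure_qball_ne_top z n)
        (measure_mono inter_subset_right))
    refine MemLp.of_bound hf.restrict n ?_
    filter_upwards [ae_restrict_mem hm, ae_restrict_of_ae hf.ae_eq_mk] with s hs hs2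
    rw [hs2]; exact hs.1

theorem lintegral_enorm_eq_eLpNorm_one (f : S → X) :
    ∫⁻ s, ‖f s‖ₑ ∂μ = eLpNorm f ((1 : ℝ≥0) : ℝ≥0∞) μ := by
  rw [ENNReal.coe_one, eLpNorm_one_eq_lintegral_enorm]

/-- The functions in `L^r(ν) ∩ L^q(μ)` that vanish outside a ball. -/
def boundedSupport (𝕜 : Type x) [RCLike 𝕜] [NormedSpace 𝕜 X] (d : S → S → ℝ) (r q : ℝ≥0∞)
    {μ ν : Measure S} (h : μ ≪ ν) (z : S) : Submodule 𝕜 (Lp X r ν) where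
  carrier := {f | MemLp f q μ ∧ ∃ ρ, ∀ᵐ s ∂μ, s ∉ qball d z ρ → f s = 0}
  add_mem' := by
    rintro f g ⟨hf, ρ, hρ⟩ ⟨hg, ρ', hρ'⟩
    have hfg := h.ae_eq (Lp.coeFn_add f g)
    refine ⟨(hf.add hg).ae_eq hfg.symm, max ρ ρ', ?_⟩
    filter_upwards [hρ, hρ', hfg] with s h1 h2 h3 hs
    rw [h3, Pi.add_apply, h1 fun h => hs (qball_mono z (le_max_left _ _) h),
      h2 fun h => hs (qball_mono z (le_max_right _ _) h), add_zero]
  zero_mem' := by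
    have h0 := h.ae_eq (Lp.coeFn_zero X r ν)
    refine ⟨MemLp.zero.ae_eq h0.symm, 0, ?_⟩
    filter_upwards [h0] with s hs _
    rw [hs, Pi.zero_apply]
  smul_mem' := by
    rintro c f ⟨hf, ρ, hρ⟩
    have hcf := h.ae_eq (Lp.coeFn_smul c f)
    refine ⟨(hf.const_smul c).ae_eq hcf.symm, ρ, ?_⟩
    filter_upwards [hρ, hcf] with s h1 h3 hs
    rw [h3, Pi.smul_apply, h1 hs, smul_zero]

/-- The weak `(1,1)` bound is known for functions of bounded support only, so the operator is
extended from that dense subspace. Agreement on all of `L^p ∩ L^1` is recovered later by truncation.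
-/
theorem exists_extension_one [CompleteSpace Y] (H : IsHomogeneousType d μ cd cμ) (hcd : 1 ≤ cd)
    (z : S) (T : Lp X (p : ℝ≥0∞) μ →ₗ[𝕜] (S →ₘ[μ] Y)) {A : ℝ≥0}
    (hw : ∀ f : S → X, MemLp f p μ → (∃ z ρ, support f ⊆ qball d z ρ) → ∀ t : ℝ≥0∞,
      t * μ {s | t < ‖onFun T f s‖ₑ} ≤ A * ∫⁻ s, ‖f s‖ₑ ∂μ) :
    ∃ T₁ : Lp X ((1 : ℝ≥0) : ℝ≥0∞) μ →ₗ[𝕜] (S →ₘ[μ] Y),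
      (∀ f, weakNorm 1 μ (T₁ f) ≤ A * eLpNorm f ((1 : ℝ≥0) : ℝ≥0∞) μ) ∧
      ∀ f : S → X, MemLp f p μ → MemLp f ((1 : ℝ≥0) : ℝ≥0∞) μ →
        (∃ z ρ, support f ⊆ qball d z ρ) → onFun T₁ f =ᵐ[μ] onFun T f := by
  have hd := H.quasiMetric
  have hfact : Fact (1 ≤ ((1 : ℝ≥0) : ℝ≥0∞)) := ⟨le_rfl⟩
  let V := boundedSupport (X := X) 𝕜 d ((1 : ℝ≥0) : ℝ≥0∞) p (Measure.AbsolutelyContinuous.refl μ) z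
  have hV : Dense (V : Set (Lp X ((1 : ℝ≥0) : ℝ≥0∞) μ)) := by
    intro f
    obtain ⟨E, hEm, hElim, hEs, hEL⟩ := H.exists_truncation z (Lp.aestronglyMeasurable f)
    refine mem_closure_of_tendsto (f := fun n => (hEL n ((1 : ℝ≥0) : ℝ≥0∞)).toLp _)
      (b := Filter.atTop) ?_ (Filter.Eventually.of_forall fun n => ?_)
    · rw [tendsto_iff_edist_tendsto_0]
      refine (tendsto_eLpNorm_sub_indicator one_ne_zero (Lp.memLp f) hEm hElim).congr fun n => ?_
      rw [edist_comm, Lp.edist_def]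
      refine eLpNorm_congr_ae ?_
      filter_upwards [(hEL n ((1 : ℝ≥0) : ℝ≥0∞)).coeFn_toLp] with s hs
      rw [Pi.sub_apply, Pi.sub_apply, hs]
    · refine ⟨(hEL n p).ae_eq (MemLp.coeFn_toLp _).symm, n, ?_⟩
      filter_upwards [(hEL n ((1 : ℝ≥0) : ℝ≥0∞)).coeFn_toLp] with s hs hs2
      rw [hs, indicator_of_notMem fun h => hs2 (hEs n h)]
  let A₀ : V →ₗ[𝕜] (S →ₘ[μ] Y) :=
    { toFun := fun f => T (f.2.1.toLp _)
      map_add' := fun f g => by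
        rw [← map_add, ← MemLp.toLp_add]
        exact congrArg T (MemLp.toLp_congr _ _ (Lp.coeFn_add f.1 g.1))
      map_smul' := fun c f => by
        rw [RingHom.id_apply, ← map_smul, ← MemLp.toLp_const_smul]
        exact congrArg T (MemLp.toLp_congr _ _ (Lp.coeFn_smul c f.1)) }
  have hA₀ : ∀ v : V, ∀ t : ℝ≥0∞, t * μ {s | t < ‖A₀ v s‖ₑ} ≤
      A * ‖(v : Lp X ((1 : ℝ≥0) : ℝ≥0∞) μ)‖ₑ := by
    intro v t
    obtain ⟨hv, ρ, hρ⟩ := v.2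
    have heq : (qball d z ρ).indicator (v : Lp X ((1 : ℝ≥0) : ℝ≥0∞) μ) =ᵐ[μ]
        (v : Lp X ((1 : ℝ≥0) : ℝ≥0∞) μ) := by
      filter_upwards [hρ] with s hs
      by_cases h : s ∈ qball d z ρ
      · rw [indicator_of_mem h]
      · rw [indicator_of_notMem h, hs h]
    have h := hw _ (hv.ae_eq heq.symm) ⟨z, ρ, support_indicator_subset⟩ t
    rw [onFun_eq T (hv.ae_eq heq.symm), MemLp.toLp_congr _ hv heq] at h
    rw [Lp.enorm_def, ← lintegral_enorm_eq_eLpNorm_one]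
    refine h.trans (le_of_eq ?_)
    congr 1
    refine lintegral_congr_ae ?_
    filter_upwards [heq] with s hs
    rw [hs]
  obtain ⟨B, hB, hBw⟩ := exists_weak_extension hV A₀ hA₀
  refine ⟨B, fun f => iSup_le fun t => ?_, fun f hf hf1 ⟨z', ρ, hρ⟩ => ?_⟩
  · have := hBw f t
    rw [Lp.enorm_def] at this
    simpa using this
  · have hmem : hf1.toLp f ∈ V := by
      refine ⟨hf.ae_eq hf1.coeFn_toLp.symm, cd * (d z z' + ρ), ?_⟩
      filter_upwards [hf1.coeFn_toLp] with s hs hs2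
      rw [hs]
      by_contra hne
      exact hs2 (hd.qball_subset_qball hcd le_rfl le_rfl (hρ hne))
    rw [onFun_eq B hf1, onFun_eq T hf]
    have h := hB ⟨hf1.toLp f, hmem⟩
    have h2 : A₀ ⟨hf1.toLp f, hmem⟩ = T (hf.toLp f) :=
      congrArg T (MemLp.toLp_congr _ _ hf1.coeFn_toLp)
    rw [← h2, ← h]

variable {A B : ℝ≥0} {U U₁ : (S → X) → S → Y}

/-- Two weak-type operators that agree on functions of bounded support agree. -/
theorem IsWeakOp.ae_eq_of_bounded_support (H : IsHomogeneousType d μ cd cμ) (z : S) {q : ℝ≥0}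
    (hp : p ≠ 0) (hq : q ≠ 0) (hU : IsWeakOp μ p A U) (hU₁ : IsWeakOp μ q B U₁)
    (h : ∀ f : S → X, MemLp f p μ → MemLp f q μ → (∃ z ρ, support f ⊆ qball d z ρ) →
      U₁ f =ᵐ[μ] U f) {f : S → X} (hf : MemLp f p μ) (hf1 : MemLp f q μ) : U₁ f =ᵐ[μ] U f := by
  obtain ⟨E, hEm, hElim, hEs, hEL⟩ := H.exists_truncation z hf.1
  have hlim := fun t ht => hU.tendsto_measure hp (fun n => hEL n p) hf
    (tendsto_eLpNorm_sub_indicator hp hf hEm hElim) (t := t) ht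
  have hlim₁ := fun t ht => hU₁.tendsto_measure hq (fun n => hEL n q) hf1
    (tendsto_eLpNorm_sub_indicator hq hf1 hEm hElim) (t := t) ht
  have h1 := tendstoInMeasure_of_measure_lt hlim
  have h2 := tendstoInMeasure_of_measure_lt hlim₁
  have h3 : ∀ n, U₁ ((E n).indicator f) =ᵐ[μ] U ((E n).indicator f) := fun n =>
    h _ (hEL n p) (hEL n q) ⟨z, n, support_indicator_subset.trans (hEs n)⟩
  exact tendstoInMeasure_ae_unique (h2.congr_left h3) h1

/-- The kernel represents `T` on `L^p` only. For `f` in `L^1` the truncations obey the estimate with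
a smaller right-hand side, and along a subsequence their images converge almost everywhere. -/
theorem HasOscillation.of_bounded_support (H : IsHomogeneousType d μ cd cμ)
    {ω : ℝ → ℝ≥0} {M : ℝ} {C : ℝ≥0} (hU₁ : IsWeakOp μ 1 B U₁)
    (h : ∀ f : S → X, MemLp f p μ → MemLp f ((1 : ℝ≥0) : ℝ≥0∞) μ →
      (∃ z ρ, support f ⊆ qball d z ρ) → U₁ f =ᵐ[μ] U f) (hosc : HasOscillation d μ ω p M C U) :
    HasOscillation d μ ω 1 M C U₁ := by
  rintro f hf ⟨z₀, ρ, hρ⟩ z r R hr hMR hfz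
  obtain ⟨E, hEm, hElim, hEs, hEL⟩ := H.exists_truncation z hf.1
  have hbd : ∀ n, ∃ z ρ, support ((E n).indicator f) ⊆ qball d z ρ := fun n =>
    ⟨z, n, support_indicator_subset.trans (hEs n)⟩
  have hlim₁ := fun t ht => hU₁.tendsto_measure one_ne_zero (fun n => hEL n _) hf
    (tendsto_eLpNorm_sub_indicator one_ne_zero hf hEm hElim) (t := t) ht
  obtain ⟨ns, -, hns⟩ := (tendstoInMeasure_of_measure_lt hlim₁).exists_seq_tendsto_ae
  have heq : ∀ᵐ s ∂μ, ∀ n, U₁ ((E n).indicator f) s = U ((E n).indicator f) s :=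
    ae_all_iff.2 fun n => h _ (hEL n p) (hEL n _) (hbd n)
  have hosc' : ∀ᵐ s ∂μ, ∀ n, s ∈ qball d z r → ∀ᵐ s' ∂μ, s' ∈ qball d z r →
      ‖U ((E n).indicator f) s - U ((E n).indicator f) s'‖ₑ ≤
        C * ∫⁻ t, tail d μ ω z R t * ‖(E n).indicator f t‖ₑ ∂μ :=
    ae_all_iff.2 fun n => hosc _ (hEL n p) (hbd n) z r R hr hMR fun t ht => by
      by_cases hE : t ∈ E n
      · rw [indicator_of_mem hE, hfz t ht]
      · rw [indicator_of_notMem hE]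
  filter_upwards [hns, heq, hosc'] with s h1 h2 h3 hs
  have h3' : ∀ᵐ s' ∂μ, ∀ n, s' ∈ qball d z r →
      ‖U ((E n).indicator f) s - U ((E n).indicator f) s'‖ₑ ≤
        C * ∫⁻ t, tail d μ ω z R t * ‖(E n).indicator f t‖ₑ ∂μ := ae_all_iff.2 fun n => h3 n hs
  filter_upwards [hns, heq, h3'] with s' h1' h2' h3' hs'
  refine le_of_tendsto' (h1.sub h1').enorm fun n => ?_
  rw [h2, h2']
  refine (h3' (ns n) hs').trans ?_
  gcongr with t
  exact enorm_indicator_le_enorm_self _ _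

end ExtensionToLOne

/-! ### The dyadic maximal function -/

section Maximal

variable {S : Type u} [MeasurableSpace S] {d : S → S → ℝ} {c₀ C₀ δ : ℝ}

/-- The points lying in a cube on which the average of `g` exceeds `a`. -/
def DyadicSystem.bad (D : DyadicSystem d c₀ C₀ δ) (ν : Measure S) (g : S → ℝ≥0∞) (a : ℝ≥0∞) :
    Set S :=
  {s | ∃ q : D.Idx, s ∈ D.set q ∧ a * ν (D.set q) < ∫⁻ t in D.set q, g t ∂ν}

/-- The weak-type estimate for the dyadic maximal function. -/
theorem DyadicSystem.mul_measure_bad_le (D : DyadicSystem d c₀ C₀ δ) [Countable D.Idx]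
    (ν : Measure S) (g : S → ℝ≥0∞) (a : ℝ≥0∞) :
    a * ν (D.bad ν g a) ≤ ∫⁻ t in D.bad ν g a, g t ∂ν := by
  have h : D.bad ν g a = ⋃ q : {q : D.Idx // a * ν (D.set q) < ∫⁻ t in D.set q, g t ∂ν},
      D.set q := by
    ext s
    simp only [bad, mem_ofPred_eq, mem_iUnion, Subtype.exists, exists_prop]
    exact exists_congr fun q => and_comm
  rw [h]
  exact laminar_weak _ (fun q => measurableSet_set _) (fun q q' => laminar_set _ _) g a
    fun q => q.2.le

end Maximal

/-! ### One step of the stopping time -/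

section Step

variable {S : Type u} [MeasurableSpace S] {d : S → S → ℝ} {μ : Measure S} {cd : ℝ} {cμ : ℝ≥0}
  {X : Type v} [NormedAddCommGroup X] {Y : Type w} [NormedAddCommGroup Y]
  {c₀ C₀ δ γ : ℝ} {m : ℕ} {ω : ℝ → ℝ≥0} {A : ℝ≥0} {U : (S → X) → S → Y}

/-- The average of `‖f‖` over the dilated cube `αQ`. -/
noncomputable def DyadicSystem.dilAvg (D : DyadicSystem d c₀ C₀ δ) (μ : Measure S) (α : ℝ)
    (f : S → X) (q : D.Idx) : ℝ≥0∞ :=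
  (∫⁻ t in D.dil α q, ‖f t‖ₑ ∂μ) / μ (D.dil α q)

/-- The adjacent cube around the ball contains `s` too, and since `s` is not bad the average over
this cube is at most `a`. One good point thus controls all balls through it. -/
theorem IsAdjacent.lintegral_qball_le (H : IsHomogeneousType d μ cd cμ) (hcd : 1 ≤ cd)
    {D : Fin m → DyadicSystem d c₀ C₀ δ} (hγ : 1 ≤ γ)
    (hD : IsAdjacent D γ) {g : S → ℝ≥0∞} {a : ℝ≥0∞} {s z : S} {ρ : ℝ} (hρ : 0 < ρ)
    (hs : ∀ j, s ∉ (D j).bad μ g a) (hsz : s ∈ qball d z ρ) :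
    ∫⁻ t in qball d z ρ, g t ∂μ ≤ a * dbl cd cμ (γ + 1) * μ (qball d z ρ) := by
  obtain ⟨j, Q, ⟨k, i, rfl⟩, hQ, hdiam⟩ := hD z ρ hρ
  have hz : z ∈ (D j).cube k i := hQ (H.quasiMetric.mem_qball_self z hρ)
  have h1 : ∫⁻ t in (D j).cube k i, g t ∂μ ≤ a * μ ((D j).cube k i) := by
    by_contra hcon
    exact hs j ⟨⟨k, i⟩, hQ hsz, not_le.1 hcon⟩
  have h2 : (D j).cube k i ⊆ qball d z ((γ + 1) * ρ) := fun t ht =>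
    (hdiam z hz t ht).trans_lt (by nlinarith)
  have h3 := H.measure_qball_le hcd (s := z) (t := z) (L := γ + 1) hρ
    (by rw [H.quasiMetric.self]; positivity) le_rfl
  calc _ ≤ ∫⁻ t in (D j).cube k i, g t ∂μ := lintegral_mono_set hQ
    _ ≤ a * μ ((D j).cube k i) := h1
    _ ≤ a * (dbl cd cμ (γ + 1) * μ (qball d z ρ)) := by
        gcongr; exact (measure_mono h2).trans h3
    _ = _ := by ring

/-- The constant in the pointwise estimate on a single scale. -/
noncomputable def stepConst (cd : ℝ) (cμ : ℝ≥0) (m : ℕ) (c₀ C₀ δ γ α : ℝ) (C : ℝ≥0) : ℝ≥0 :=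
  16 * (m + 1) * dbl cd cμ (α * C₀ / c₀) * dbl cd cμ (C₀ / (c₀ * δ)) *
    (2 * C * dbl cd cμ (γ + 1) + 1 + 4 * dbl cd cμ (γ + 1) * dbl cd cμ (α * C₀ / c₀))

theorem DyadicSystem.dil_subset_dil (hd : IsQuasiMetric d cd) (hcd : 1 ≤ cd)
    (D : DyadicSystem d c₀ C₀ δ) (hc₀ : 0 < c₀) (hC₀ : c₀ ≤ C₀) (hδ : 0 < δ) (hδcd : 2 * cd * δ ≤ 1)
    {α : ℝ} (hα : 2 * cd ≤ α) {p q : D.Idx} (hlt : q.1 < p.1) (hpq : D.set p ⊆ D.set q) :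
    D.dil α p ⊆ D.dil α q := by
  have hC : 0 < C₀ := hc₀.trans_le hC₀
  have h1 : D.ctr p ∈ qball d (D.ctr q) (C₀ * δ ^ q.1) :=
    set_subset_qball q (hpq (ctr_mem hd hc₀ hδ p))
  have hδ1 : δ ≤ 1 := by nlinarith
  have h2 : δ ^ p.1 ≤ δ * δ ^ q.1 := by
    rw [← zpow_one_add₀ hδ.ne']
    exact zpow_le_zpow_right_of_le_one₀ hδ hδ1 (by omega)
  have hk : 0 < C₀ * δ ^ q.1 := mul_pos hC (zpow_pos hδ _)
  refine hd.qball_subset_qball hcd (le_of_lt h1) ?_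
  calc cd * (C₀ * δ ^ q.1 + α * (C₀ * δ ^ p.1))
      ≤ cd * (C₀ * δ ^ q.1 + α * (C₀ * (δ * δ ^ q.1))) := by gcongr; linarith
    _ = (cd + α * (cd * δ)) * (C₀ * δ ^ q.1) := by ring
    _ ≤ α * (C₀ * δ ^ q.1) := by gcongr; nlinarith

/-- The recursive step. The children cover the part of the cube where `U F` or a maximal function of
`F` is large compared with the average. On each child the difference of `U F` and the localized
image is compared with its value at a single good point, so oscillation replaces a maximal
truncation of `U`. -/
theorem exists_stopping_children (H : IsHomogeneousType d μ cd cμ) (hcd : 1 ≤ cd) (hcμ : 1 ≤ cμ)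
    (hc₀ : 0 < c₀) (hC₀ : c₀ ≤ C₀) (hδ : 0 < δ) (hδcd : 2 * cd * δ ≤ 1) (hγ : 1 ≤ γ)
    {D : Fin m → DyadicSystem d c₀ C₀ δ} (hD : IsAdjacent D γ) (hU : IsWeakOp μ 1 A U)
    {M : ℝ} {C : ℝ≥0} (hosc : HasOscillation d μ ω 1 M C U) (hω : MonotoneOn ω (Icc 0 1))
    (hA : A ≠ 0) (hdini : diniNorm ω ≤ A) {α : ℝ} (hαM : M ≤ α) (hα : 2 * cd ≤ α)
    {f : S → X} (hf : MemLp f ((1 : ℝ≥0) : ℝ≥0∞) μ) (i₀ : Fin m) (q : (D i₀).Idx) :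
    ∃ P : Set (D i₀).Idx, (∀ p ∈ P, q.1 < p.1 ∧ (D i₀).set p ⊆ (D i₀).set q) ∧
      P.PairwiseDisjoint (D i₀).set ∧
      2 * ∑' p : P, μ ((D i₀).set p) ≤ μ ((D i₀).set q) ∧
      ∀ᵐ s ∂μ, s ∈ (D i₀).set q →
        ((∀ p ∈ P, s ∉ (D i₀).set p) → ‖U (((D i₀).dil α q).indicator f) s‖ₑ ≤
          stepConst cd cμ m c₀ C₀ δ γ α C * A * (D i₀).dilAvg μ α f q) ∧
        ∀ p ∈ P, s ∈ (D i₀).set p → ‖U (((D i₀).dil α q).indicator f) s‖ₑ ≤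
          stepConst cd cμ m c₀ C₀ δ γ α C * A * (D i₀).dilAvg μ α f q +
            ‖U (((D i₀).dil α p).indicator f) s‖ₑ := by
  have hd := H.quasiMetric
  have hcnt : ∀ j, Countable (D j).Idx := fun j => DyadicSystem.countable_idx H hc₀ hδ
  have hC : 0 < C₀ := hc₀.trans_le hC₀
  have hδ1 : δ < 1 := by nlinarith
  have hα0 : 0 < α := by linarith
  have hk0 : ∀ p : (D i₀).Idx, 0 < C₀ * δ ^ p.1 := fun p => mul_pos hC (zpow_pos hδ _)
  have hdilm : ∀ p : (D i₀).Idx, MeasurableSet ((D i₀).dil α p) := fun p => H.measurableSet_qball _ _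
  have hdil0 : ∀ p : (D i₀).Idx, μ ((D i₀).dil α p) ≠ 0 := fun p =>
    (H.measure_qball_pos _ _ (mul_pos hα0 (hk0 p))).ne'
  have hdilt : ∀ p : (D i₀).Idx, μ ((D i₀).dil α p) ≠ ∞ := fun p => H.measure_qball_ne_top _ _
  set F : S → X := ((D i₀).dil α q).indicator f with hF
  have hFL : ∀ p, MemLp (((D i₀).dil α p).indicator f) ((1 : ℝ≥0) : ℝ≥0∞) μ := fun p =>
    hf.indicator (hdilm p)
  have hFi : ∀ p, ∫⁻ t, ‖((D i₀).dil α p).indicator f t‖ₑ ∂μ = ∫⁻ t in (D i₀).dil α p, ‖f t‖ₑ ∂μ := by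
    intro p
    rw [← lintegral_indicator (hdilm p)]
    congr 1 with t
    rw [enorm_indicator_eq_indicator_enorm]
  have hfint : ∫⁻ t, ‖f t‖ₑ ∂μ ≠ ∞ := by
    rw [lintegral_enorm_eq_eLpNorm_one]; exact hf.2.ne
  set a := (D i₀).dilAvg μ α f q with ha
  have hat : a ≠ ∞ := ENNReal.div_ne_top (ne_top_of_le_ne_top hfint (setLIntegral_le_lintegral _ _))
    (hdil0 q)
  have haF : ∫⁻ t, ‖F t‖ₑ ∂μ = a * μ ((D i₀).dil α q) := by
    rw [hF, hFi q, ha, DyadicSystem.dilAvg, ENNReal.div_mul_cancel (hdil0 q) (hdilt q)]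
  have hA' : (A : ℝ≥0∞) ≠ 0 := by exact_mod_cast hA
  set Dα := dbl cd cμ (α * C₀ / c₀) with hDα
  set G := dbl cd cμ (γ + 1) with hG
  set B := dbl cd cμ (C₀ / (c₀ * δ)) with hB
  have hDα1 : 1 ≤ Dα := one_le_dbl hcμ _
  have hG1 : 1 ≤ G := one_le_dbl hcμ _
  have hB1 : 1 ≤ B := one_le_dbl hcμ _
  have hDα0 : Dα ≠ 0 := (zero_lt_one.trans_le hDα1).ne'
  have hG0 : G ≠ 0 := (zero_lt_one.trans_le hG1).ne'
  have hB0 : B ≠ 0 := (zero_lt_one.trans_le hB1).ne'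
  -- The exceptional set is a union of `m + 1` sets, each of measure at most `Dα * μ Q / N`. Hence
  -- it occupies at most `1 / (16 * B) = lam / 4` of `Q`, where `B` is the cost of passing to a
  -- parent cube.
  set N : ℝ≥0 := 16 * (m + 1) * Dα * B with hN
  have hN0 : N ≠ 0 := by positivity
  set κ : ℝ≥0 := stepConst cd cμ m c₀ C₀ δ γ α C with hκ
  -- The summands are, in order: the kernel tail, `U F` at a good point, and the localized image at
  -- that point.
  have hκN : κ = N * (2 * C * G + 1 + 4 * G * Dα) := rfl
  set Q := (D i₀).set q with hQ
  have hQm : MeasurableSet Q := DyadicSystem.measurableSet_set q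
  have hQ0 : μ Q ≠ 0 := (DyadicSystem.measure_set_pos H hc₀ hδ q).ne'
  have hQt : μ Q ≠ ∞ := DyadicSystem.measure_set_ne_top H q
  have hdilQ : μ ((D i₀).dil α q) ≤ Dα * μ Q := DyadicSystem.measure_dil_le H hcd hc₀ hC₀ hδ hα0.le q
  -- the case of vanishing average
  rcases eq_or_ne a 0 with ha0 | ha0
  · refine ⟨∅, by simp, by simp, by simp, ?_⟩
    have h0 : eLpNorm F ((1 : ℝ≥0) : ℝ≥0∞) μ = 0 := by
      rw [← lintegral_enorm_eq_eLpNorm_one, haF, ha0, zero_mul]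
    filter_upwards [hU.ae_eq_zero one_ne_zero (hFL q) h0] with s hs _
    refine ⟨fun _ => ?_, by simp⟩
    rw [hs]; simp
  have hweak : ∀ (g : S → X), MemLp g ((1 : ℝ≥0) : ℝ≥0∞) μ → ∀ t : ℝ≥0∞,
      t * μ {s | t < ‖U g s‖ₑ} ≤ A * ∫⁻ s, ‖g s‖ₑ ∂μ := by
    intro g hg t
    have := hU.weak g hg t
    rw [← lintegral_enorm_eq_eLpNorm_one] at this
    simpa using this
  -- the exceptional set
  set Ω₁ : Set S := {s | N * A * a < ‖U F s‖ₑ} with hΩ₁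
  set Ω₂ : Set S := ⋃ j, (D j).bad μ (fun t => ‖F t‖ₑ) (N * a) with hΩ₂
  have hNa0 : N * a ≠ 0 := mul_ne_zero (by exact_mod_cast hN0) ha0
  have hNat : N * a ≠ ∞ := ENNReal.mul_ne_top ENNReal.coe_ne_top hat
  have hμΩ₁ : N * μ Ω₁ ≤ Dα * μ Q := by
    have h := hweak F (hFL q) (N * A * a)
    rw [haF] at h
    have h2 : (A * a) * (N * μ Ω₁) ≤ (A * a) * (Dα * μ Q) := by
      calc _ = N * A * a * μ Ω₁ := by ring
        _ ≤ _ := h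
        _ = A * a * μ ((D i₀).dil α q) := by ring
        _ ≤ _ := by gcongr
    exact (ENNReal.mul_le_mul_iff_right (mul_ne_zero hA' ha0)
      (ENNReal.mul_ne_top ENNReal.coe_ne_top hat)).1 h2
  have hμbad : ∀ j, N * μ ((D j).bad μ (fun t => ‖F t‖ₑ) (N * a)) ≤ Dα * μ Q := by
    intro j
    have h := ((D j).mul_measure_bad_le μ (fun t => ‖F t‖ₑ) (N * a)).trans
      (setLIntegral_le_lintegral _ _)
    rw [haF] at h
    have h2 : a * (N * μ ((D j).bad μ (fun t => ‖F t‖ₑ) (N * a))) ≤ a * (Dα * μ Q) := by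
      calc _ = N * a * μ ((D j).bad μ (fun t => ‖F t‖ₑ) (N * a)) := by ring
        _ ≤ _ := h
        _ ≤ _ := by gcongr
    exact (ENNReal.mul_le_mul_iff_right ha0 hat).1 h2
  have hμΩ : N * μ (Ω₁ ∪ Ω₂) ≤ (m + 1) * (Dα * μ Q) := by
    calc N * μ (Ω₁ ∪ Ω₂) ≤ N * (μ Ω₁ + ∑ j, μ ((D j).bad μ (fun t => ‖F t‖ₑ) (N * a))) := by
          gcongr
          refine (measure_union_le _ _).trans ?_
          gcongr
          exact measure_iUnion_fintype_le _ _
      _ = N * μ Ω₁ + ∑ j, N * μ ((D j).bad μ (fun t => ‖F t‖ₑ) (N * a)) := by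
          rw [mul_add, Finset.mul_sum]
      _ ≤ Dα * μ Q + ∑ _j : Fin m, Dα * μ Q :=
          add_le_add hμΩ₁ (Finset.sum_le_sum fun j _ => hμbad j)
      _ = _ := by rw [Finset.sum_const, Finset.card_univ, Fintype.card_fin, nsmul_eq_mul]; ring
  set lam : ℝ≥0 := 1 / (4 * B) with hlam
  have hlam0 : lam ≠ 0 := by positivity
  have hlam1 : lam < 1 := by
    rw [hlam, div_lt_one (by positivity)]
    calc (1 : ℝ≥0) < 4 * 1 := by norm_num
      _ ≤ 4 * B := by gcongr
  have hlamB : lam * B = 1 / 4 := by rw [hlam]; field_simp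
  have hμΩ' : μ (Ω₁ ∪ Ω₂) ≤ (lam / 4 : ℝ≥0) * μ Q := by
    have h1 : (N : ℝ≥0∞) * μ (Ω₁ ∪ Ω₂) ≤ N * ((lam / 4 : ℝ≥0) * μ Q) := by
      refine hμΩ.trans (le_of_eq ?_)
      rw [← mul_assoc, ← mul_assoc]
      congr 1
      have : ((m : ℝ≥0) + 1) * Dα = N * (lam / 4) := by rw [hN, hlam]; field_simp; norm_num
      exact_mod_cast congrArg (fun x : ℝ≥0 => (x : ℝ≥0∞)) this
    exact (ENNReal.mul_le_mul_iff_right (by exact_mod_cast hN0) ENNReal.coe_ne_top).1 h1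
  -- Opening up the exceptional set doubles the bound to `lam / 2`. Stopping at density `lam = 1 /
  -- (4 * B)` then makes the children cover at most half of `Q`, while the density of `V` in each
  -- child is at most `lam * B = 1 / 4`.
  obtain ⟨V, hΩV, -, hVm, hVle, hVo⟩ := H.exists_open_cover hcd (hk0 q) (F := (Ω₁ ∪ Ω₂) ∩ Q)
    (inter_subset_right.trans (DyadicSystem.set_subset_qball q)) (ε := (lam / 4 : ℝ≥0) * μ Q)
    (mul_ne_zero (by simpa using hlam0) hQ0)
  have hVle2 : μ V ≤ (lam / 2 : ℝ≥0) * μ Q := by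
    calc μ V ≤ (lam / 4 : ℝ≥0) * μ Q + (lam / 4 : ℝ≥0) * μ Q :=
          hVle.trans (by gcongr; exact (measure_mono inter_subset_left).trans hμΩ')
      _ = _ := by
          rw [← add_mul]
          congr 1
          have : lam / 4 + lam / 4 = lam / 2 := by
            rw [← add_div, ← two_mul, show (4 : ℝ≥0) = 2 * 2 by norm_num, mul_div_mul_left _ _ two_ne_zero]
          exact_mod_cast congrArg (fun x : ℝ≥0 => (x : ℝ≥0∞)) this
  set h : S → ℝ≥0∞ := (V ∩ Q).indicator fun _ => 1 with hh
  have hhi : ∀ E : Set S, MeasurableSet E → ∫⁻ t in E, h t ∂μ = μ (V ∩ Q ∩ E) := by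
    intro E hE
    rw [hh, lintegral_indicator (hVm.inter hQm), Measure.restrict_restrict (hVm.inter hQm),
      setLIntegral_const, one_mul]
  obtain ⟨P, hPk, hPd, hPa, hPn⟩ := DyadicSystem.exists_stopping H hcd hc₀ hδ (D := D i₀) q.1 h lam
    (by
      intro j
      rw [hhi _ ((D i₀).measurableSet_cube _ _)]
      by_cases hj : j = q.2
      · subst hj
        refine (measure_mono (inter_subset_left.trans inter_subset_left)).trans (hVle2.trans ?_)
        show _ ≤ lam * μ Q
        gcongr
        exact half_le_self zero_le
      · have : V ∩ Q ∩ (D i₀).cube q.1 j = ∅ := by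
          refine disjoint_iff_inter_eq_empty.1 (Disjoint.mono_left inter_subset_right ?_)
          exact (D i₀).pairwise_disjoint q.1 (Ne.symm hj)
        rw [this, measure_empty]; exact zero_le)
  have hPm : ∀ p : (D i₀).Idx, MeasurableSet ((D i₀).set p) := DyadicSystem.measurableSet_set
  have hPa1 : ∀ p ∈ P, lam * μ ((D i₀).set p) ≤ μ (V ∩ Q ∩ (D i₀).set p) := fun p hp => by
    have := (hPa p hp).1.le
    rwa [hhi _ (hPm p)] at this
  have hPa2 : ∀ p ∈ P, μ (V ∩ Q ∩ (D i₀).set p) ≤ (1 / 4 : ℝ≥0) * μ ((D i₀).set p) := fun p hp => by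
    have := (hPa p hp).2
    rwa [hhi _ (hPm p), ← mul_assoc, ← ENNReal.coe_mul, hlamB] at this
  have hp0 : ∀ p : (D i₀).Idx, μ ((D i₀).set p) ≠ 0 := fun p =>
    (DyadicSystem.measure_set_pos H hc₀ hδ p).ne'
  have hpt : ∀ p : (D i₀).Idx, μ ((D i₀).set p) ≠ ∞ := fun p => DyadicSystem.measure_set_ne_top H p
  -- The stopping time ran over all cubes finer than `q`; since `h` vanishes off `Q`, a selected
  -- cube must meet `Q`, hence lies in it.
  have hPQ : ∀ p ∈ P, (D i₀).set p ⊆ Q := by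
    intro p hp
    refine ((D i₀).nested _ _ (hPk p hp).le p.2 q.2).resolve_left fun hdis => ?_
    have h1 := hPa1 p hp
    have h2 : V ∩ Q ∩ (D i₀).set p = ∅ :=
      disjoint_iff_inter_eq_empty.1 (Disjoint.mono_left inter_subset_right (Disjoint.symm hdis))
    rw [h2, measure_empty, nonpos_iff_eq_zero, mul_eq_zero] at h1
    exact h1.elim (by simpa using hlam0) (hp0 p)
  have hout : ∀ s ∈ Q, (∀ p ∈ P, s ∉ (D i₀).set p) → s ∉ V := by
    intro s hsQ hs hsV
    obtain ⟨ρ, hρ, hρV⟩ := hVo s hsV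
    obtain ⟨k, hk, hkρ⟩ := DyadicSystem.exists_cube_subset_qball (D := D i₀) hd hcd hδ hδ1 s hρ q.1
    obtain ⟨j, hj⟩ := DyadicSystem.exists_mem_cube (D := D i₀) k s
    have h1 := hPn s hs k hk j hj
    have h2 : (D i₀).cube k j ⊆ Q := DyadicSystem.cube_subset_cube_of_mem hk.le hj hsQ
    have h3 : V ∩ Q ∩ (D i₀).cube k j = (D i₀).cube k j :=
      inter_eq_right.2 fun t ht => ⟨hρV (hkρ j hj ht), h2 ht⟩
    rw [hhi _ ((D i₀).measurableSet_cube _ _), h3] at h1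
    have h4 : lam * μ ((D i₀).cube k j) < 1 * μ ((D i₀).cube k j) := by
      refine (ENNReal.mul_lt_mul_iff_left (hp0 ⟨k, j⟩) (hpt ⟨k, j⟩)).2 ?_
      exact_mod_cast hlam1
    rw [one_mul] at h4
    exact absurd h1 (not_le.2 h4)
  have hnotV : ∀ s ∈ Q, s ∉ V → ‖U F s‖ₑ ≤ N * A * a ∧
      ∀ j, s ∉ (D j).bad μ (fun t => ‖F t‖ₑ) (N * a) := by
    intro s hsQ hsV
    have h1 : s ∉ Ω₁ ∪ Ω₂ := fun h => hsV (hΩV ⟨h, hsQ⟩)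
    rw [mem_union, not_or] at h1
    exact ⟨not_lt.1 h1.1, fun j hj => h1.2 (mem_iUnion.2 ⟨j, hj⟩)⟩
  have hNκ : (N : ℝ≥0∞) * A * a ≤ κ * A * a := by
    gcongr
    rw [hκN]
    refine le_mul_of_one_le_right zero_le ?_
    exact le_add_right (le_add_left le_rfl)
  have key : ∀ p ∈ P, ∀ᵐ s ∂μ, s ∈ (D i₀).set p → ‖U F s‖ₑ ≤ κ * A * a +
      ‖U (((D i₀).dil α p).indicator f) s‖ₑ := by
    intro p hp
    set Fp : S → X := ((D i₀).dil α p).indicator f with hFp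
    have hsub : (D i₀).dil α p ⊆ (D i₀).dil α q :=
      DyadicSystem.dil_subset_dil hd hcd (D i₀) hc₀ hC₀ hδ hδcd hα (hPk p hp) (hPQ p hp)
    have hpV : μ ((D i₀).set p ∩ V) ≤ (1 / 4 : ℝ≥0) * μ ((D i₀).set p) := by
      refine le_trans (measure_mono ?_) (hPa2 p hp)
      exact fun s hs => ⟨⟨hs.2, hPQ p hp hs.1⟩, hs.1⟩
    -- all balls around the center have small averages
    have hball : ∀ ρ, C₀ * δ ^ p.1 ≤ ρ → ∫⁻ t in qball d ((D i₀).ctr p) ρ, ‖F t‖ₑ ∂μ ≤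
        N * a * G * μ (qball d ((D i₀).ctr p) ρ) := by
      intro ρ hρ
      obtain ⟨s, hsp, hsV⟩ : ∃ s ∈ (D i₀).set p, s ∉ V := by
        by_contra! hcon
        rw [inter_eq_left.2 hcon] at hpV
        have : ((1 / 4 : ℝ≥0) : ℝ≥0∞) * μ ((D i₀).set p) < 1 * μ ((D i₀).set p) := by
          rw [ENNReal.mul_lt_mul_iff_left (hp0 p) (hpt p)]
          exact_mod_cast (by rw [div_lt_one (by norm_num)]; norm_num : (1 / 4 : ℝ≥0) < 1)
        rw [one_mul] at this
        exact absurd hpV (not_le.2 this)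
      exact hD.lintegral_qball_le H hcd hγ ((hk0 p).trans_le hρ) (hnotV s (hPQ p hp hsp) hsV).2
        (qball_mono _ hρ (DyadicSystem.set_subset_qball p hsp))
    have hR : C₀ * δ ^ p.1 ≤ α * (C₀ * δ ^ p.1) := le_mul_of_one_le_left (hk0 p).le (by linarith)
    have hFFp : ∫⁻ t, ‖Fp t‖ₑ ∂μ ≤ N * a * G * Dα * μ ((D i₀).set p) := by
      rw [hFp, hFi p]
      calc ∫⁻ t in (D i₀).dil α p, ‖f t‖ₑ ∂μ = ∫⁻ t in (D i₀).dil α p, ‖F t‖ₑ ∂μ := by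
            refine setLIntegral_congr_fun (hdilm p) fun t ht => ?_
            simp only [hF, indicator_of_mem (hsub ht)]
        _ ≤ N * a * G * μ ((D i₀).dil α p) := hball _ hR
        _ ≤ N * a * G * (Dα * μ ((D i₀).set p)) := by
            gcongr; exact DyadicSystem.measure_dil_le H hcd hc₀ hC₀ hδ hα0.le p
        _ = _ := by ring
    -- At this height the weak bound leaves at most a quarter of the child, so together with `V` at
    -- least half of the child consists of good points.
    set W : Set S := {s | 4 * A * (N * a * G * Dα) < ‖U Fp s‖ₑ} with hW
    have hWle : μ W ≤ (1 / 4 : ℝ≥0) * μ ((D i₀).set p) := by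
      have h1 := (hweak Fp (hFL p) (4 * A * (N * a * G * Dα))).trans (mul_le_mul_right hFFp _)
      have hb0 : A * (N * a * G * Dα) ≠ 0 := by
        refine mul_ne_zero hA' (mul_ne_zero (mul_ne_zero hNa0 ?_) ?_)
        · exact_mod_cast hG0
        · exact_mod_cast hDα0
      have hbt : A * (N * a * G * Dα) ≠ ∞ :=
        ENNReal.mul_ne_top ENNReal.coe_ne_top (ENNReal.mul_ne_top (ENNReal.mul_ne_top hNat
          ENNReal.coe_ne_top) ENNReal.coe_ne_top)
      have h2 : A * (N * a * G * Dα) * (4 * μ W) ≤ A * (N * a * G * Dα) * μ ((D i₀).set p) := by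
        refine (le_of_eq ?_).trans (h1.trans (le_of_eq ?_)) <;> ring
      have h3 := (ENNReal.mul_le_mul_iff_right hb0 hbt).1 h2
      have h4 : ((4 : ℝ≥0) : ℝ≥0∞) * μ W ≤
          ((4 : ℝ≥0) : ℝ≥0∞) * ((1 / 4 : ℝ≥0) * μ ((D i₀).set p)) := by
        rw [← mul_assoc, ← ENNReal.coe_mul, mul_one_div_cancel four_ne_zero, ENNReal.coe_one, one_mul]
        exact_mod_cast h3
      exact (ENNReal.mul_le_mul_iff_right (by norm_num) ENNReal.coe_ne_top).1 h4
    -- oscillation of the difference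
    have hgL : MemLp (F - Fp) ((1 : ℝ≥0) : ℝ≥0∞) μ := (hFL q).sub (hFL p)
    have hgs : support (F - Fp) ⊆ (D i₀).dil α q := by
      intro t ht
      by_contra hnot
      refine ht ?_
      rw [Pi.sub_apply, hF, hFp, indicator_of_notMem hnot, indicator_of_notMem fun h => hnot (hsub h),
        sub_zero]
    have hg0 : ∀ t ∈ qball d ((D i₀).ctr p) (α * (C₀ * δ ^ p.1)), (F - Fp) t = 0 := by
      intro t ht
      have ht' : t ∈ (D i₀).dil α p := ht
      rw [Pi.sub_apply, hF, hFp, indicator_of_mem ht', indicator_of_mem (hsub ht'), sub_self]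
    have hgle : ∀ t, ‖(F - Fp) t‖ₑ ≤ ‖F t‖ₑ := by
      intro t
      by_cases ht : t ∈ (D i₀).dil α p
      · rw [hg0 t ht]; simp
      · rw [Pi.sub_apply, hFp, indicator_of_notMem ht, sub_zero]
    have htail : C * ∫⁻ t, tail d μ ω ((D i₀).ctr p) (α * (C₀ * δ ^ p.1)) t * ‖(F - Fp) t‖ₑ ∂μ ≤
        C * (2 * A * (N * a * G)) := by
      gcongr
      refine (lintegral_mono fun t => mul_le_mul_right (hgle t) _).trans
        ((lintegral_tail_mul_le H hω (mul_pos hα0 (hk0 p)) (hFL q).1.enorm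
          (b := N * a * G) fun k => ?_).trans ?_)
      · refine hball _ (hR.trans (le_mul_of_one_le_left (mul_pos hα0 (hk0 p)).le ?_))
        exact one_le_pow₀ (by norm_num)
      · gcongr
    have hoscp := hosc (F - Fp) hgL ⟨_, _, hgs⟩ ((D i₀).ctr p) (C₀ * δ ^ p.1) (α * (C₀ * δ ^ p.1))
      (hk0 p) (by have := hk0 p; gcongr) hg0
    have hsubU := hU.sub F Fp (hFL q) (hFL p)
    filter_upwards [hoscp, hsubU] with s hs1 hs2 hsp
    have hs3 := hs1 (DyadicSystem.set_subset_qball p hsp)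
    -- a good point of the cube
    obtain ⟨s', hs'p, hs'V, hs'W, hs'1, hs'2⟩ : ∃ s' ∈ (D i₀).set p, s' ∉ V ∧ s' ∉ W ∧
        (s' ∈ qball d ((D i₀).ctr p) (C₀ * δ ^ p.1) → ‖U (F - Fp) s - U (F - Fp) s'‖ₑ ≤
          C * ∫⁻ t, tail d μ ω ((D i₀).ctr p) (α * (C₀ * δ ^ p.1)) t * ‖(F - Fp) t‖ₑ ∂μ) ∧
        U (F - Fp) s' = (U F - U Fp) s' := by
      by_contra! hcon
      have h0 : μ {s' | ¬((s' ∈ qball d ((D i₀).ctr p) (C₀ * δ ^ p.1) →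
          ‖U (F - Fp) s - U (F - Fp) s'‖ₑ ≤ C * ∫⁻ t, tail d μ ω ((D i₀).ctr p)
            (α * (C₀ * δ ^ p.1)) t * ‖(F - Fp) t‖ₑ ∂μ) ∧ U (F - Fp) s' = (U F - U Fp) s')} = 0 :=
        ae_iff.1 (hs3.and hsubU)
      have h1 : (D i₀).set p ⊆ ((D i₀).set p ∩ V) ∪ W ∪
          {s' | ¬((s' ∈ qball d ((D i₀).ctr p) (C₀ * δ ^ p.1) →
          ‖U (F - Fp) s - U (F - Fp) s'‖ₑ ≤ C * ∫⁻ t, tail d μ ω ((D i₀).ctr p)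
            (α * (C₀ * δ ^ p.1)) t * ‖(F - Fp) t‖ₑ ∂μ) ∧ U (F - Fp) s' = (U F - U Fp) s')} := by
        intro s' hs'
        by_cases hV : s' ∈ V
        · exact Or.inl (Or.inl ⟨hs', hV⟩)
        by_cases hW' : s' ∈ W
        · exact Or.inl (Or.inr hW')
        exact Or.inr fun hand => hcon s' hs' hV hW' hand.1 hand.2
      have h2 : μ ((D i₀).set p) ≤ (1 / 2 : ℝ≥0) * μ ((D i₀).set p) := by
        calc _ ≤ _ := measure_mono h1
          _ ≤ μ ((D i₀).set p ∩ V) + μ W + 0 := by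
              refine (measure_union_le _ _).trans (add_le_add (measure_union_le _ _) h0.le)
          _ ≤ (1 / 4 : ℝ≥0) * μ ((D i₀).set p) + (1 / 4 : ℝ≥0) * μ ((D i₀).set p) := by
              rw [add_zero]; exact add_le_add hpV hWle
          _ = _ := by
              rw [← add_mul, ← ENNReal.coe_add]
              congr 2
              rw [← add_div, div_eq_div_iff (by norm_num) (by norm_num)]; norm_num
      have h3 : ((1 / 2 : ℝ≥0) : ℝ≥0∞) * μ ((D i₀).set p) < 1 * μ ((D i₀).set p) := by
        rw [ENNReal.mul_lt_mul_iff_left (hp0 p) (hpt p)]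
        exact_mod_cast (by rw [div_lt_one (by norm_num)]; norm_num : (1 / 2 : ℝ≥0) < 1)
      rw [one_mul] at h3
      exact absurd h2 (not_le.2 h3)
    have h1 := hs'1 (DyadicSystem.set_subset_qball p hs'p)
    have h2 := (hnotV s' (hPQ p hp hs'p) hs'V).1
    have h3 : ‖U Fp s'‖ₑ ≤ 4 * A * (N * a * G * Dα) := not_lt.1 hs'W
    -- Away from the supports of the kernel integrals nothing is evaluated directly: the value of `U
    -- (F - Fp)` at `s` is replaced by that at `s'`, where `U F` and `U Fp` are separately small.
    have hdec : U F s = (U (F - Fp) s - U (F - Fp) s') + (U F s' - U Fp s') + U Fp s := by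
      rw [hs2, hs'2, Pi.sub_apply, Pi.sub_apply]; abel
    rw [hdec]
    calc _ ≤ ‖U (F - Fp) s - U (F - Fp) s'‖ₑ + (‖U F s'‖ₑ + ‖U Fp s'‖ₑ) + ‖U Fp s‖ₑ := by
          refine (enorm_add_le _ _).trans (add_le_add ((enorm_add_le _ _).trans
            (add_le_add le_rfl enorm_sub_le)) le_rfl)
      _ ≤ C * (2 * A * (N * a * G)) + (N * A * a + 4 * A * (N * a * G * Dα)) + ‖U Fp s‖ₑ :=
          add_le_add (add_le_add (h1.trans htail) (add_le_add h2 h3)) le_rfl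
      _ = _ := by rw [hκN]; push_cast; ring
  refine ⟨P, fun p hp => ⟨hPk p hp, hPQ p hp⟩, hPd, ?_, ?_⟩
  · have hPd' : Pairwise (Disjoint on fun p : P => V ∩ Q ∩ (D i₀).set p) := fun p p' hne =>
      (hPd p.2 p'.2 (Subtype.coe_injective.ne hne)).mono inter_subset_right inter_subset_right
    have h1 : lam * ∑' p : P, μ ((D i₀).set p) ≤ (lam / 2 : ℝ≥0) * μ Q := by
      rw [← ENNReal.tsum_mul_left]
      refine (ENNReal.tsum_le_tsum fun p : P => hPa1 p p.2).trans ?_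
      rw [← measure_iUnion hPd' fun p => (hVm.inter hQm).inter (hPm p)]
      refine (measure_mono (iUnion_subset fun p => ?_)).trans hVle2
      exact inter_subset_left.trans inter_subset_left
    have h2 : (lam / 2 : ℝ≥0) * (2 * ∑' p : P, μ ((D i₀).set p)) ≤ (lam / 2 : ℝ≥0) * μ Q := by
      refine le_trans (le_of_eq ?_) h1
      rw [← mul_assoc]
      congr 1
      exact_mod_cast congrArg (fun x : ℝ≥0 => (x : ℝ≥0∞)) (div_mul_cancel₀ lam (two_ne_zero (α := ℝ≥0)))
    refine (ENNReal.mul_le_mul_iff_right ?_ ENNReal.coe_ne_top).1 h2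
    simpa using hlam0
  · have hall : ∀ᵐ s ∂μ, ∀ p : (D i₀).Idx, p ∈ P → s ∈ (D i₀).set p → ‖U F s‖ₑ ≤ κ * A * a +
        ‖U (((D i₀).dil α p).indicator f) s‖ₑ := by
      refine ae_all_iff.2 fun p => ?_
      by_cases hp : p ∈ P
      · filter_upwards [key p hp] with s hs _ using hs
      · exact Filter.Eventually.of_forall fun s h => absurd h hp
    filter_upwards [hall] with s hs hsQ
    exact ⟨fun hsP => (hnotV s hsQ (hout s hsQ hsP)).1.trans hNκ, hs⟩

end Step

/-! ### Iteration along the tree of stopping cubes -/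

section Tree

variable {S : Type u} [MeasurableSpace S] {d : S → S → ℝ} {μ : Measure S} {c₀ C₀ δ : ℝ}
  {D : DyadicSystem d c₀ C₀ δ}

/-- The `n`-th generation of descendants of `q` in the tree with children `P`. -/
def DyadicSystem.gen (P : D.Idx → Set D.Idx) (q : D.Idx) : ℕ → Set D.Idx
  | 0 => {q}
  | n + 1 => ⋃ p ∈ gen P q n, P p

/-- The children of each cube are pairwise disjoint smaller cubes covering at most half of it. -/
structure DyadicSystem.IsChildren (μ : Measure S) (P : D.Idx → Set D.Idx) : Prop where
  lt : ∀ q, ∀ p ∈ P q, q.1 < p.1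
  subset : ∀ q, ∀ p ∈ P q, D.set p ⊆ D.set q
  disjoint : ∀ q, (P q).PairwiseDisjoint D.set
  half : ∀ q, 2 * ∑' p : P q, μ (D.set p) ≤ μ (D.set q)

/-- The part of a cube not covered by its children. -/
def DyadicSystem.core (P : D.Idx → Set D.Idx) (q : D.Idx) : Set S := D.set q \ ⋃ p ∈ P q, D.set p

variable {P : D.Idx → Set D.Idx}

namespace DyadicSystem

theorem mem_gen_succ {q p : D.Idx} {n : ℕ} : p ∈ gen P q (n + 1) ↔ ∃ p' ∈ gen P q n, p ∈ P p' := by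
  simp [gen]

theorem IsChildren.gen_subset (hP : IsChildren μ P) {q : D.Idx} (n : ℕ) :
    ∀ p ∈ gen P q n, D.set p ⊆ D.set q := by
  induction n with
  | zero => intro p hp; rw [show p = q from hp]
  | succ n ih =>
    intro p hp
    obtain ⟨p', hp', hpp⟩ := mem_gen_succ.1 hp
    exact (hP.subset _ p hpp).trans (ih p' hp')

theorem IsChildren.gen_eq (hP : IsChildren μ P) {q : D.Idx} (n : ℕ) :
    ∀ p ∈ gen P q n, ∀ p' ∈ gen P q n, ∀ s, s ∈ D.set p → s ∈ D.set p' → p = p' := by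
  induction n with
  | zero => intro p hp p' hp' _ _ _; rw [show p = q from hp, show p' = q from hp']
  | succ n ih =>
    intro p hp p' hp' s hs hs'
    obtain ⟨r, hr, hpr⟩ := mem_gen_succ.1 hp
    obtain ⟨r', hr', hpr'⟩ := mem_gen_succ.1 hp'
    have : r = r' := ih r hr r' hr' s (hP.subset _ p hpr hs) (hP.subset _ p' hpr' hs')
    subst this
    by_contra hne
    exact Set.disjoint_left.1 (hP.disjoint r hpr hpr' hne) hs hs'

theorem IsChildren.mem_children_of_mem (hP : IsChildren μ P) {q p : D.Idx} {n : ℕ}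
    (hp : p ∈ gen P q n) (j : ℕ) :
    ∀ p' ∈ gen P q (n + 1 + j), ∀ s, s ∈ D.set p → s ∈ D.set p' → ∃ r ∈ P p, s ∈ D.set r := by
  induction j with
  | zero =>
    intro p' hp' s hs hs'
    obtain ⟨r, hr, hpr⟩ := mem_gen_succ.1 hp'
    have : p = r := hP.gen_eq n p hp r hr s hs (hP.subset _ p' hpr hs')
    subst this
    exact ⟨p', hpr, hs'⟩
  | succ j ih =>
    intro p' hp' s hs hs'
    obtain ⟨r, hr, hpr⟩ := mem_gen_succ.1 hp'
    exact ih r hr s hs (hP.subset _ p' hpr hs')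

/-- Within one generation the cubes are disjoint. A cube of a later generation that meets an earlier
one at `s` shows that `s` lies in a child of the earlier cube, so `s` is outside its core. -/
theorem IsChildren.core_disjoint (hP : IsChildren μ P) {q p p' : D.Idx} {n n' : ℕ}
    (hp : p ∈ gen P q n) (hp' : p' ∈ gen P q n') (hne : p ≠ p') :
    Disjoint (core P p) (core P p') := by
  wlog h : n ≤ n' generalizing n n' p p'
  · exact (this hp' hp hne.symm (le_of_not_ge h)).symm
  refine Set.disjoint_left.2 fun s hs hs' => ?_
  rcases h.eq_or_lt with rfl | hlt
  · exact hne (hP.gen_eq n p hp p' hp' s hs.1 hs'.1)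
  · obtain ⟨j, rfl⟩ := Nat.exists_eq_add_of_le (Nat.succ_le_of_lt hlt)
    obtain ⟨r, hr, hsr⟩ := hP.mem_children_of_mem hp j p' hp' s hs.1 hs'.1
    exact hs.2 (mem_biUnion hr hsr)

theorem measurableSet_core [Countable D.Idx] (q : D.Idx) : MeasurableSet (core P q) :=
  (measurableSet_set q).diff (MeasurableSet.biUnion (to_countable _) fun p _ => measurableSet_set p)

theorem IsChildren.measure_core (hP : IsChildren μ P) [Countable D.Idx] (q : D.Idx)
    (hq : μ (D.set q) ≠ ∞) : μ (D.set q) ≤ 2 * μ (core P q) := by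
  have h1 : 2 * μ (⋃ p ∈ P q, D.set p) ≤ μ (D.set q) := by
    refine le_trans ?_ (hP.half q)
    gcongr
    exact measure_biUnion_le _ (to_countable _) _
  have h2 : μ (D.set q) ≤ μ (core P q) + μ (⋃ p ∈ P q, D.set p) := by
    refine (measure_mono fun s hs => ?_).trans (measure_union_le _ _)
    by_cases h : s ∈ ⋃ p ∈ P q, D.set p
    · exact Or.inr h
    · exact Or.inl ⟨hs, h⟩
  have h3 : μ (D.set q) + μ (D.set q) ≤ 2 * μ (core P q) + μ (D.set q) := by
    calc μ (D.set q) + μ (D.set q) = 2 * μ (D.set q) := (two_mul _).symm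
      _ ≤ 2 * (μ (core P q) + μ (⋃ p ∈ P q, D.set p)) := by gcongr
      _ = 2 * μ (core P q) + 2 * μ (⋃ p ∈ P q, D.set p) := mul_add _ _ _
      _ ≤ _ := by gcongr
  exact (ENNReal.add_le_add_iff_right hq).1 h3

/-- Each generation carries at most half of the measure of the preceding one, so almost no point
lies in all of them and the recursion terminates almost everywhere. -/
theorem IsChildren.measure_iUnion_gen (hP : IsChildren μ P) [Countable D.Idx] (q : D.Idx) (n : ℕ) :
    2 ^ n * μ (⋃ p ∈ gen P q n, D.set p) ≤ μ (D.set q) := by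
  induction n with
  | zero => simp [gen]
  | succ n ih =>
    have hsub : ⋃ p ∈ gen P q (n + 1), D.set p ⊆ ⋃ p : gen P q n, ⋃ p' ∈ P p, D.set p' := by
      refine iUnion₂_subset fun p hp => ?_
      obtain ⟨r, hr, hpr⟩ := mem_gen_succ.1 hp
      exact (subset_biUnion_of_mem (u := D.set) hpr).trans
        (subset_iUnion (fun p : gen P q n => ⋃ p' ∈ P p, D.set p') ⟨r, hr⟩)
    have hd : (gen P q n).PairwiseDisjoint D.set := fun p hp p' hp' hne =>
      Set.disjoint_left.2 fun s hs hs' => hne (hP.gen_eq n p hp p' hp' s hs hs')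
    calc 2 ^ (n + 1) * μ (⋃ p ∈ gen P q (n + 1), D.set p)
        ≤ 2 ^ (n + 1) * ∑' p : gen P q n, ∑' p' : P p, μ (D.set p') := by
          gcongr
          refine (measure_mono hsub).trans ((measure_iUnion_le _).trans
            (ENNReal.tsum_le_tsum fun p => measure_biUnion_le _ (to_countable _) _))
      _ = 2 ^ n * ∑' p : gen P q n, 2 * ∑' p' : P p, μ (D.set p') := by
          rw [ENNReal.tsum_mul_left, pow_succ]; ring
      _ ≤ 2 ^ n * ∑' p : gen P q n, μ (D.set p) := by
          gcongr with p; exact hP.half p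
      _ = 2 ^ n * μ (⋃ p ∈ gen P q n, D.set p) := by
          rw [measure_biUnion (to_countable _) hd fun p _ => measurableSet_set p]
      _ ≤ _ := ih

/-- Almost every point lies in finitely many generations only. -/
theorem IsChildren.ae_exists_notMem (hP : IsChildren μ P) [Countable D.Idx] (q : D.Idx)
    (hq : μ (D.set q) ≠ ∞) : ∀ᵐ s ∂μ, ∃ n, ∀ p ∈ gen P q n, s ∉ D.set p := by
  have h0 : μ (⋂ n, ⋃ p ∈ gen P q n, D.set p) = 0 := by
    by_contra hne
    have h1 : ∀ n : ℕ, (n : ℝ≥0∞) * μ (⋂ n, ⋃ p ∈ gen P q n, D.set p) ≤ μ (D.set q) := fun n => by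
      refine le_trans ?_ (hP.measure_iUnion_gen q n)
      refine mul_le_mul' ?_ (measure_mono (iInter_subset _ n))
      exact_mod_cast (Nat.lt_two_pow_self (n := n)).le
    have h2 : μ (⋂ n, ⋃ p ∈ gen P q n, D.set p) ≠ ∞ := by
      refine ne_top_of_le_ne_top hq ?_
      simpa using h1 1
    obtain ⟨n, hn⟩ := ENNReal.exists_nat_mul_gt hne hq
    exact absurd (h1 n) (not_le.2 hn)
  have h1 : ∀ᵐ s ∂μ, s ∉ ⋂ n, ⋃ p ∈ gen P q n, D.set p := by
    rw [ae_iff]; simp only [not_not]; exact h0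
  filter_upwards [h1] with s hs
  simp only [mem_iInter, mem_iUnion, not_forall, not_exists] at hs
  obtain ⟨n, hn⟩ := hs
  exact ⟨n, fun p hp => hn p hp⟩

/-- The recursive domination along the tree. -/
theorem IsChildren.le_tsum_of_step (hP : IsChildren μ P) {q : D.Idx} {s : S}
    {F : D.Idx → ℝ≥0∞} {b : D.Idx → ℝ≥0∞} (hq : s ∈ D.set q)
    (h1 : ∀ p, s ∈ D.set p → (∀ r ∈ P p, s ∉ D.set r) → F p ≤ b p)
    (h2 : ∀ p, s ∈ D.set p → ∀ r ∈ P p, s ∈ D.set r → F p ≤ b p + F r)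
    (hs : ∃ n, ∀ p ∈ gen P q n, s ∉ D.set p) :
    F q ≤ ∑' p : ⋃ n, gen P q n, (D.set (p : D.Idx)).indicator (fun _ => b p) s := by
  classical
  -- finite chains
  have hchain : ∀ n, ∀ p ∈ gen P q n, s ∈ D.set p → ∃ G : Finset (⋃ n, gen P q n),
      (∀ r ∈ G, s ∈ D.set (r : D.Idx) ∧ (r : D.Idx).1 < p.1) ∧ F q ≤ ∑ r ∈ G, b r + F p := by
    intro n
    induction n with
    | zero => intro p hp _; rw [show p = q from hp]; exact ⟨∅, by simp, by simp⟩
    | succ n ih =>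
      intro p hp hsp
      obtain ⟨r, hr, hpr⟩ := mem_gen_succ.1 hp
      have hsr := hP.subset _ p hpr hsp
      obtain ⟨G, hG, hle⟩ := ih r hr hsr
      have hmem : r ∈ ⋃ n, gen P q n := mem_iUnion.2 ⟨n, hr⟩
      have hnot : (⟨r, hmem⟩ : ⋃ n, gen P q n) ∉ G := fun h => lt_irrefl _ (hG _ h).2
      refine ⟨insert ⟨r, hmem⟩ G, ?_, ?_⟩
      · intro x hx
        rcases Finset.mem_insert.1 hx with rfl | hx
        · exact ⟨hsr, hP.lt _ p hpr⟩
        · exact ⟨(hG x hx).1, (hG x hx).2.trans (hP.lt _ p hpr)⟩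
      · rw [Finset.sum_insert hnot]
        refine hle.trans ((add_le_add le_rfl (h2 r hsr p hpr hsp)).trans (le_of_eq ?_))
        rw [← add_assoc, add_comm (∑ r ∈ G, b r)]
  obtain ⟨n, hn, hmin⟩ : ∃ n, (∀ p ∈ gen P q n, s ∉ D.set p) ∧
      ∀ k < n, ¬ ∀ p ∈ gen P q k, s ∉ D.set p :=
    ⟨Nat.find hs, Nat.find_spec hs, fun k hk => Nat.find_min hs hk⟩
  rcases n with _ | n
  · exact absurd hq (hn q rfl)
  · have := hmin n n.lt_succ_self
    push Not at this
    obtain ⟨p, hp, hsp⟩ := this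
    obtain ⟨G, hG, hle⟩ := hchain n p hp hsp
    have hmem : p ∈ ⋃ n, gen P q n := mem_iUnion.2 ⟨n, hp⟩
    have hnot : (⟨p, hmem⟩ : ⋃ n, gen P q n) ∉ G := fun h => lt_irrefl _ (hG _ h).2
    have hlast : F p ≤ b p := h1 p hsp fun r hr => hn r (mem_gen_succ.2 ⟨p, hp, hr⟩)
    calc F q ≤ ∑ r ∈ insert ⟨p, hmem⟩ G, b r := by
          rw [Finset.sum_insert hnot, add_comm]
          exact hle.trans (add_le_add le_rfl hlast)
      _ = ∑ r ∈ insert ⟨p, hmem⟩ G, (D.set (r : D.Idx)).indicator (fun _ => b r) s := by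
          refine Finset.sum_congr rfl fun r hr => ?_
          rw [indicator_of_mem]
          rcases Finset.mem_insert.1 hr with rfl | hr
          · exact hsp
          · exact (hG r hr).1
      _ ≤ _ := ENNReal.sum_le_tsum _

/-- A partition into cubes whose dilates all contain a given ball. -/
theorem exists_initial_partition {cd : ℝ} (hd : IsQuasiMetric d cd) (hcd : 1 ≤ cd) (hc₀ : 0 < c₀)
    (hC₀ : c₀ ≤ C₀) (hδ : 0 < δ) (hδ' : δ < 1) (D : DyadicSystem d c₀ C₀ δ) (z : S) (ρ : ℝ) {α : ℝ}
    (hα : 3 * cd ^ 2 / δ ≤ α) :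
    ∃ F : Set D.Idx, (∀ q ∈ F, qball d z ρ ⊆ D.dil α q) ∧ (∀ s, ∃ q ∈ F, s ∈ D.set q) ∧
      ∀ q ∈ F, ∀ q' ∈ F, ∀ s, s ∈ D.set q → s ∈ D.set q' → q = q' := by
  have hC : 0 < C₀ := hc₀.trans_le hC₀
  -- The condition is imposed on all coarser ancestors, so that it is monotone in `n` and depends
  -- only on the cube of generation `-n` containing `s`.
  let good : ℕ → S → Prop := fun n s => ∀ i, n ≤ i → ∀ j, s ∈ D.cube (-(i : ℤ)) j →
    qball d z ρ ⊆ D.dil (2 * cd) ⟨-(i : ℤ), j⟩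
  have hmono : ∀ s n n', n ≤ n' → good n s → good n' s := fun s n n' h hg i hi => hg i (h.trans hi)
  have hcongr : ∀ s t (n : ℕ) (k : ℤ) (j : D.J k), -(n : ℤ) ≤ k → s ∈ D.cube k j → t ∈ D.cube k j →
      good n s → good n t := by
    intro s t n k j hk hs ht hg i hi j' ht'
    exact hg i hi j' (cube_subset_cube_of_mem (by omega) ht ht' hs)
  have hex : ∀ s, ∃ n, good n s := by
    intro s
    have hlim : Filter.Tendsto (fun i : ℕ => C₀ * (δ⁻¹) ^ i) Filter.atTop Filter.atTop :=
      (tendsto_pow_atTop_atTop_of_one_lt ((one_lt_inv₀ hδ).2 hδ')).const_mul_atTop hC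
    obtain ⟨n, hn⟩ := Filter.eventually_atTop.1
      (hlim.eventually (Filter.eventually_ge_atTop (cd * (d s z + ρ))))
    refine ⟨n, fun i hi j hs t ht => ?_⟩
    have h1 := D.cube_subset_qball _ _ hs
    have h2 : δ ^ (-(i : ℤ)) = (δ⁻¹) ^ i := by rw [zpow_neg, zpow_natCast, inv_pow]
    have h3 := hn i hi
    rw [← h2] at h3
    have h4 : t ∈ qball d s (C₀ * δ ^ (-(i : ℤ))) := hd.qball_subset_qball hcd le_rfl h3 ht
    refine hd.qball_subset_qball hcd (le_of_lt h1) (le_of_eq ?_) h4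
    ring
  obtain ⟨N, hN, hNmin⟩ : ∃ N : S → ℕ, (∀ s, good (N s) s) ∧ ∀ s n, n < N s → ¬ good n s := by
    classical
    exact ⟨fun s => Nat.find (hex s), fun s => Nat.find_spec (hex s), fun s n => Nat.find_min (hex s)⟩
  have hNeq : ∀ s t (j : D.J (1 - (N s : ℤ))), s ∈ D.cube _ j → t ∈ D.cube _ j → N t = N s := by
    intro s t j hs ht
    refine le_antisymm ?_ ?_
    · by_contra hlt
      exact hNmin t _ (not_le.1 hlt) (hcongr s t _ _ j (by omega) hs ht (hN s))
    · by_contra hlt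
      have h0 : N t < N s := not_le.1 hlt
      refine hNmin s (N s - 1) (by omega) (hcongr t s _ _ j (by omega) ht hs ?_)
      exact hmono t (N t) _ (by omega) (hN t)
  -- The generation is `1 - N s` rather than `-N s`: points in a common cube of generation `1 - N s`
  -- agree about `good (N s)` and also about `good (N s - 1)`, so `N` is constant on the cube and
  -- the chosen cubes form a partition. The lost generation is paid for by the `δ` in `3 * cd ^ 2 /
  -- δ ≤ α`.
  refine ⟨{q | ∃ s, q.1 = 1 - (N s : ℤ) ∧ s ∈ D.set q}, ?_, ?_, ?_⟩
  · rintro ⟨k, j⟩ ⟨s, hk, hs⟩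
    dsimp only at hk
    subst hk
    obtain ⟨j', hj'⟩ := exists_mem_cube (D := D) (-(N s : ℤ)) s
    refine (hN s (N s) le_rfl j' hj').trans ?_
    have h1 : D.set ⟨_, j⟩ ⊆ D.cube (-(N s : ℤ)) j' :=
      cube_subset_cube_of_mem (show -(N s : ℤ) ≤ 1 - (N s : ℤ) by omega) hs hj'
    have h2 := D.cube_subset_qball _ _ (h1 (ctr_mem hd hc₀ hδ _))
    have h3 : d (D.ctr ⟨_, j⟩) (D.center _ j') ≤ C₀ * δ ^ (-(N s : ℤ)) := by
      rw [hd.symm]; exact le_of_lt h2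
    refine hd.qball_subset_qball hcd h3 ?_
    have h4 : δ ^ (1 - (N s : ℤ)) = δ * δ ^ (-(N s : ℤ)) := by
      rw [sub_eq_add_neg, zpow_add₀ hδ.ne', zpow_one]
    have h5 : 0 < C₀ * δ ^ (-(N s : ℤ)) := mul_pos hC (zpow_pos hδ _)
    show _ ≤ α * (C₀ * δ ^ (1 - (N s : ℤ)))
    rw [h4]
    rw [div_le_iff₀ hδ] at hα
    calc cd * (C₀ * δ ^ (-(N s : ℤ)) + 2 * cd * (C₀ * δ ^ (-(N s : ℤ))))
        = (cd + 2 * cd ^ 2) * (C₀ * δ ^ (-(N s : ℤ))) := by ring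
      _ ≤ (α * δ) * (C₀ * δ ^ (-(N s : ℤ))) := by
          gcongr
          nlinarith
      _ = _ := by ring
  · intro s
    obtain ⟨j, hj⟩ := exists_mem_cube (D := D) (1 - (N s : ℤ)) s
    exact ⟨⟨_, j⟩, ⟨s, rfl, hj⟩, hj⟩
  · rintro ⟨k, j⟩ ⟨s, hk, hs⟩ ⟨k', j'⟩ ⟨s', hk', hs'⟩ t ht ht'
    dsimp only at hk hk'
    subst hk hk'
    have h1 := hNeq s t j hs ht
    have h2 := hNeq s' t j' hs' ht'
    have h3 : N s = N s' := h1.symm.trans h2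
    revert j j'
    rw [h3]
    intro j hs ht j' hs' ht'
    exact congrArg (Sigma.mk _) (eq_of_mem_cube ht ht')

end DyadicSystem

end Tree

/-! ### Sparse families with repetitions -/

section Regroup

variable {S : Type u} [MeasurableSpace S] {μ : Measure S}

/-- A family of sets with disjoint major parts is sparse and has bounded multiplicity. -/
theorem isSparse_range {ι : Type*} {τ E : ι → Set S} {L : ℝ≥0} (hL0 : L ≠ 0)
    (hE : ∀ i, MeasurableSet (E i)) (hsub : ∀ i, E i ⊆ τ i) (hdisj : Pairwise (Disjoint on E))
    (hL : ∀ i, μ (τ i) ≤ L * μ (E i)) : IsSparse μ L⁻¹ (range τ) := by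
  classical
  refine ⟨fun Q => if h : Q ∈ range τ then E h.choose else ∅, fun Q hQ => ?_, ?_⟩
  · have h1 : τ hQ.choose = Q := hQ.choose_spec
    simp only [dif_pos hQ]
    refine ⟨(hsub hQ.choose).trans h1.le, hE _, ?_⟩
    have h2 := hL hQ.choose
    rw [h1] at h2
    calc ((L⁻¹ : ℝ≥0) : ℝ≥0∞) * μ Q ≤ ((L⁻¹ : ℝ≥0) : ℝ≥0∞) * (L * μ (E hQ.choose)) := by gcongr
      _ = _ := by rw [← mul_assoc, ← ENNReal.coe_mul, inv_mul_cancel₀ hL0, ENNReal.coe_one, one_mul]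
  · intro Q hQ Q' hQ' hne
    simp only [Function.onFun, dif_pos hQ, dif_pos hQ']
    refine hdisj fun h => hne ?_
    rw [← hQ.choose_spec, ← hQ'.choose_spec, h]

/-- Several stopping cubes may select the same adjacent cube. If `n` of them select `Q`, then `n
μ(Q) ≤ L ∑ μ(E i) ≤ L μ(Q)` because the `E i` are disjoint subsets of `Q`; so the multiplicity is at
most `L`. -/
theorem tsum_comp_le_tsum_range {ι : Type*} [Countable ι] {τ E : ι → Set S} {L : ℝ≥0}
    (hE : ∀ i, MeasurableSet (E i)) (hsub : ∀ i, E i ⊆ τ i) (hdisj : Pairwise (Disjoint on E))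
    (hL : ∀ i, μ (τ i) ≤ L * μ (E i)) (h0 : ∀ i, μ (τ i) ≠ 0) (ht : ∀ i, μ (τ i) ≠ ∞)
    (g : Set S → ℝ≥0∞) : ∑' i, g (τ i) ≤ L * ∑' Q : range τ, g Q := by
  rw [← (Equiv.sigmaFiberEquiv (rangeFactorization τ)).tsum_eq, ENNReal.tsum_sigma',
    ← ENNReal.tsum_mul_left]
  refine ENNReal.tsum_le_tsum fun Q => ?_
  have hτ : ∀ i : {i // rangeFactorization τ i = Q}, τ i = Q := fun i => congrArg Subtype.val i.2
  have h1 : ∑' i : {i // rangeFactorization τ i = Q},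
      g (τ (Equiv.sigmaFiberEquiv (rangeFactorization τ) ⟨Q, i⟩)) =
      (∑' _ : {i // rangeFactorization τ i = Q}, 1) * g Q := by
    rw [← ENNReal.tsum_mul_right]
    refine tsum_congr fun i => ?_
    rw [one_mul]
    exact congrArg g (hτ i)
  rw [h1]
  gcongr
  obtain ⟨Q, i₀, rfl⟩ := Q
  have hd : Pairwise (Disjoint on fun i : {i // rangeFactorization τ i = ⟨τ i₀, i₀, rfl⟩} => E i) :=
    fun i j hne => hdisj (Subtype.coe_injective.ne hne)
  refine (ENNReal.mul_le_mul_iff_left (h0 i₀) (ht i₀)).1 ?_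
  calc (∑' _ : {i // rangeFactorization τ i = ⟨τ i₀, i₀, rfl⟩}, 1) * μ (τ i₀)
      = ∑' i : {i // rangeFactorization τ i = ⟨τ i₀, i₀, rfl⟩}, μ (τ i) := by
        rw [← ENNReal.tsum_mul_right]
        refine tsum_congr fun i => ?_
        rw [one_mul, hτ i]
    _ ≤ ∑' i : {i // rangeFactorization τ i = ⟨τ i₀, i₀, rfl⟩}, L * μ (E i) :=
        ENNReal.tsum_le_tsum fun i => hL i
    _ = L * μ (⋃ i : {i // rangeFactorization τ i = ⟨τ i₀, i₀, rfl⟩}, E i) := by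
        rw [ENNReal.tsum_mul_left, measure_iUnion hd fun i => hE i]
    _ ≤ L * μ (τ i₀) := by
        gcongr
        exact iUnion_subset fun i => (hsub i).trans (hτ i).le

end Regroup

/-! ### Pointwise sparse domination -/

section Domination

variable {S : Type u} [MeasurableSpace S] {d : S → S → ℝ} {μ : Measure S} {cd : ℝ} {cμ : ℝ≥0}
  {X : Type v} [NormedAddCommGroup X] {Y : Type w} [NormedAddCommGroup Y]
  {c₀ C₀ δ γ : ℝ} {m : ℕ} {ω : ℝ → ℝ≥0} {A : ℝ≥0} {U : (S → X) → S → Y}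

/-- The reciprocal of the sparsity constant. -/
noncomputable def sparsity (cd : ℝ) (cμ : ℝ≥0) (c₀ C₀ γ α : ℝ) : ℝ≥0 :=
  2 * (dbl cd cμ (γ + 1) * dbl cd cμ (α * C₀ / c₀))

theorem avg_one (g : S → ℝ≥0∞) (E : Set S) : avg μ g 1 E = (∫⁻ t in E, g t ∂μ) / μ E := by
  simp only [avg, ENNReal.rpow_one, div_one, setLAverage_eq]

/-- The trees grown from the cubes of an initial partition all start with `f` itself, because the
top dilates contain its support. Summing the recursion along the tree above a point gives dilated
averages, and each dilate is replaced by an adjacent cube of comparable measure. -/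
theorem exists_sparse_domination (H : IsHomogeneousType d μ cd cμ) (hcd : 1 ≤ cd) (hcμ : 1 ≤ cμ)
    (hc₀ : 0 < c₀) (hC₀ : c₀ ≤ C₀) (hδ : 0 < δ) (hδcd : 2 * cd * δ ≤ 1) (hγ : 1 ≤ γ)
    {D : Fin m → DyadicSystem d c₀ C₀ δ} (hD : IsAdjacent D γ) (hU : IsWeakOp μ 1 A U)
    {M : ℝ} {C : ℝ≥0} (hosc : HasOscillation d μ ω 1 M C U) (hω : MonotoneOn ω (Icc 0 1))
    (hA : A ≠ 0) (hdini : diniNorm ω ≤ A) {α : ℝ} (hαM : M ≤ α) (hα : 2 * cd ≤ α)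
    (hα3 : 3 * cd ^ 2 / δ ≤ α)
    {f : S → X} (hf : MemLp f ((1 : ℝ≥0) : ℝ≥0∞) μ) {z : S} {ρ : ℝ} (hfs : support f ⊆ qball d z ρ) :
    ∃ 𝒮 : Set (Set S), (∀ Q ∈ 𝒮, ∃ j, (D j).IsCube Q) ∧
      IsSparse μ (sparsity cd cμ c₀ C₀ γ α)⁻¹ 𝒮 ∧
      ∀ᵐ s ∂μ, ‖U f s‖ₑ ≤ (stepConst cd cμ m c₀ C₀ δ γ α C * dbl cd cμ (γ + 1) *
        sparsity cd cμ c₀ C₀ γ α : ℝ≥0) * A * sparseOp μ 𝒮 f s := by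
  have hd := H.quasiMetric
  have hδ1 : δ < 1 := by nlinarith
  have hC : 0 < C₀ := hc₀.trans_le hC₀
  have hα0 : 0 < α := by linarith
  obtain ⟨i₀, -⟩ := hD z 1 one_pos
  set D₀ := D i₀ with hD₀
  have hcnt : Countable D₀.Idx := DyadicSystem.countable_idx H hc₀ hδ
  choose P hPsub hPd hPhalf hPstep using
    exists_stopping_children H hcd hcμ hc₀ hC₀ hδ hδcd hγ hD hU hosc hω hA hdini hαM hα hf i₀
  have hP : DyadicSystem.IsChildren μ P :=
    ⟨fun q p hp => (hPsub q p hp).1, fun q p hp => (hPsub q p hp).2, hPd, hPhalf⟩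
  obtain ⟨F, hFdil, hFcov, hFeq⟩ :=
    DyadicSystem.exists_initial_partition hd hcd hc₀ hC₀ hδ hδ1 D₀ z ρ hα3
  set κ := stepConst cd cμ m c₀ C₀ δ γ α C with hκ
  set G := dbl cd cμ (γ + 1) with hG
  set Dα := dbl cd cμ (α * C₀ / c₀) with hDα
  set L := sparsity cd cμ c₀ C₀ γ α with hL
  have hLeq : L = 2 * (G * Dα) := rfl
  have hG1 : 1 ≤ G := one_le_dbl hcμ _
  have hDα1 : 1 ≤ Dα := one_le_dbl hcμ _
  have hL0 : L ≠ 0 := by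
    rw [hLeq]
    exact mul_ne_zero two_ne_zero (mul_ne_zero (zero_lt_one.trans_le hG1).ne'
      (zero_lt_one.trans_le hDα1).ne')
  set 𝒢 : Set D₀.Idx := ⋃ q ∈ F, ⋃ n, DyadicSystem.gen P q n with h𝒢
  -- the adjacent cube containing a dilated cube
  have hτ : ∀ q : D₀.Idx, ∃ Q : Set S, (∃ j, (D j).IsCube Q) ∧ D₀.dil α q ⊆ Q ∧
      μ Q ≤ G * μ (D₀.dil α q) := by
    intro q
    have hρ : 0 < α * (C₀ * δ ^ q.1) := mul_pos hα0 (mul_pos hC (zpow_pos hδ _))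
    obtain ⟨j, Q, hQ, hsub, hdiam⟩ := hD (D₀.ctr q) _ hρ
    refine ⟨Q, ⟨j, hQ⟩, hsub, ?_⟩
    have h1 : Q ⊆ qball d (D₀.ctr q) ((γ + 1) * (α * (C₀ * δ ^ q.1))) := fun t ht =>
      (hdiam _ (hsub (hd.mem_qball_self _ hρ)) t ht).trans_lt (by nlinarith)
    exact (measure_mono h1).trans (H.measure_qball_le hcd (s := D₀.ctr q) (L := γ + 1) hρ
      (by rw [hd.self]; positivity) le_rfl)
  choose τ hτc hτsub hτle using hτ
  have hsetdil : ∀ q : D₀.Idx, D₀.set q ⊆ D₀.dil α q := fun q =>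
    (DyadicSystem.set_subset_qball q).trans (qball_mono _ (le_mul_of_one_le_left
      (mul_pos hC (zpow_pos hδ _)).le (by linarith)))
  have hq0 : ∀ q : D₀.Idx, μ (D₀.set q) ≠ 0 := fun q =>
    (DyadicSystem.measure_set_pos H hc₀ hδ q).ne'
  have hqt : ∀ q : D₀.Idx, μ (D₀.set q) ≠ ∞ := fun q => DyadicSystem.measure_set_ne_top H q
  have hdil0 : ∀ q : D₀.Idx, μ (D₀.dil α q) ≠ 0 := fun q h =>
    hq0 q (measure_mono_null (hsetdil q) h)
  have hdilt : ∀ q : D₀.Idx, μ (D₀.dil α q) ≠ ∞ := fun q => H.measure_qball_ne_top _ _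
  have hτ0 : ∀ q : D₀.Idx, μ (τ q) ≠ 0 := fun q h => hdil0 q (measure_mono_null (hτsub q) h)
  have hτt : ∀ q : D₀.Idx, μ (τ q) ≠ ∞ := fun q =>
    ne_top_of_le_ne_top (ENNReal.mul_ne_top ENNReal.coe_ne_top (hdilt q)) (hτle q)
  -- The three factors of `L`: a core has at least half of the measure of its cube, the dilate costs
  -- `Dα`, and the adjacent cube costs `G`.
  have hcore : ∀ q : D₀.Idx, μ (τ q) ≤ L * μ (DyadicSystem.core P q) := by
    intro q
    calc μ (τ q) ≤ G * (Dα * (2 * μ (DyadicSystem.core P q))) := by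
          refine (hτle q).trans ?_
          gcongr
          refine (DyadicSystem.measure_dil_le H hcd hc₀ hC₀ hδ hα0.le q).trans ?_
          gcongr
          exact hP.measure_core q (hqt q)
      _ = _ := by rw [hLeq]; push_cast; ring
  have hcoresub : ∀ q : D₀.Idx, DyadicSystem.core P q ⊆ τ q := fun q =>
    sdiff_subset.trans ((hsetdil q).trans (hτsub q))
  have hcored : Pairwise (Disjoint on fun q : 𝒢 => DyadicSystem.core P (q : D₀.Idx)) := by
    rintro ⟨p, hp⟩ ⟨p', hp'⟩ hne
    simp only [h𝒢, mem_iUnion, exists_prop] at hp hp'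
    obtain ⟨q, hq, n, hpn⟩ := hp
    obtain ⟨q', hq', n', hpn'⟩ := hp'
    by_cases h : q = q'
    · subst h
      exact hP.core_disjoint hpn hpn' fun h => hne (Subtype.ext h)
    · refine Set.disjoint_left.2 fun s hs hs' => h (hFeq q hq q' hq' s ?_ ?_)
      · exact hP.gen_subset n p hpn hs.1
      · exact hP.gen_subset n' p' hpn' hs'.1
  refine ⟨range fun q : 𝒢 => τ q, ?_, ?_, ?_⟩
  · rintro _ ⟨q, rfl⟩
    exact hτc q
  · exact isSparse_range hL0 (fun q => DyadicSystem.measurableSet_core (q : D₀.Idx))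
      (fun q => hcoresub q) hcored fun q => hcore q
  · have hstep : ∀ᵐ s ∂μ, ∀ q, _ := ae_all_iff.2 hPstep
    have hex : ∀ᵐ s ∂μ, ∀ q : D₀.Idx, ∃ n, ∀ p ∈ DyadicSystem.gen P q n, s ∉ D₀.set p :=
      ae_all_iff.2 fun q => hP.ae_exists_notMem q (hqt q)
    filter_upwards [hstep, hex] with s hs1 hs2
    obtain ⟨q, hqF, hsq⟩ := hFcov s
    have hFq : (D₀.dil α q).indicator f = f :=
      indicator_eq_self.2 (hfs.trans (hFdil q hqF))
    have hmain := hP.le_tsum_of_step (q := q) (s := s)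
      (F := fun p => ‖U ((D₀.dil α p).indicator f) s‖ₑ)
      (b := fun p => κ * A * D₀.dilAvg μ α f p) hsq (fun p hp => (hs1 p hp).1)
      (fun p hp => (hs1 p hp).2) (hs2 q)
    simp only [hFq] at hmain
    have hsub : ⋃ n, DyadicSystem.gen P q n ⊆ 𝒢 := subset_biUnion_of_mem (u := fun q =>
      ⋃ n, DyadicSystem.gen P q n) hqF
    have hterm : ∀ p : D₀.Idx, (D₀.set p).indicator (fun _ => κ * A * D₀.dilAvg μ α f p) s ≤
        κ * A * G * (τ p).indicator (fun _ => avg μ (fun t => ‖f t‖ₑ) 1 (τ p)) s := by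
      intro p
      by_cases hsp : s ∈ D₀.set p
      · rw [indicator_of_mem hsp, indicator_of_mem (hτsub p (hsetdil p hsp)), avg_one, mul_assoc _ (G : ℝ≥0∞)]
        gcongr
        rw [DyadicSystem.dilAvg, ENNReal.div_le_iff (hdil0 p) (hdilt p)]
        calc ∫⁻ t in D₀.dil α p, ‖f t‖ₑ ∂μ ≤ ∫⁻ t in τ p, ‖f t‖ₑ ∂μ := lintegral_mono_set (hτsub p)
          _ = (∫⁻ t in τ p, ‖f t‖ₑ ∂μ) / μ (τ p) * μ (τ p) :=
              (ENNReal.div_mul_cancel (hτ0 p) (hτt p)).symm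
          _ ≤ (∫⁻ t in τ p, ‖f t‖ₑ ∂μ) / μ (τ p) * (G * μ (D₀.dil α p)) := by
              gcongr; exact hτle p
          _ = _ := by ring
      · rw [indicator_of_notMem hsp]; exact zero_le
    have hmult := tsum_comp_le_tsum_range (τ := fun q : 𝒢 => τ q)
      (fun q => DyadicSystem.measurableSet_core (q : D₀.Idx)) (fun q => hcoresub q) hcored
      (fun q => hcore q) (fun q => hτ0 q) (fun q => hτt q)
      (fun Q => Q.indicator (fun _ => avg μ (fun t => ‖f t‖ₑ) 1 Q) s)
    calc ‖U f s‖ₑ ≤ _ := hmain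
      _ ≤ ∑' p : 𝒢, (D₀.set (p : D₀.Idx)).indicator (fun _ => κ * A * D₀.dilAvg μ α f p) s :=
          ENNReal.tsum_mono_subtype
            (fun p : D₀.Idx => (D₀.set p).indicator (fun _ => κ * A * D₀.dilAvg μ α f p) s) hsub
      _ ≤ ∑' p : 𝒢, κ * A * G * (τ p).indicator (fun _ => avg μ (fun t => ‖f t‖ₑ) 1 (τ p)) s :=
          ENNReal.tsum_le_tsum fun p => hterm p
      _ ≤ κ * A * G * (L * sparseOp μ (range fun q : 𝒢 => τ q) f s) := by
          rw [ENNReal.tsum_mul_left]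
          exact mul_le_mul_right hmult _
      _ = _ := by push_cast; ring

end Domination

/-! ### Dyadic layer-cake sums -/

section Levels

/-- The dyadic levels. -/
noncomputable def level (l : ℤ) : ℝ≥0∞ := (2 : ℝ≥0∞) ^ l

theorem level_ne_zero (l : ℤ) : level l ≠ 0 := (ENNReal.zpow_pos two_ne_zero ENNReal.ofNat_ne_top l).ne'

theorem level_ne_top (l : ℤ) : level l ≠ ∞ :=
  (ENNReal.zpow_lt_top two_ne_zero ENNReal.ofNat_ne_top l).ne

theorem level_add (k l : ℤ) : level (k + l) = level k * level l :=
  ENNReal.zpow_add two_ne_zero ENNReal.ofNat_ne_top k l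

theorem exists_level {x : ℝ≥0∞} (h0 : x ≠ 0) (ht : x ≠ ∞) : ∃ l, level l < x ∧ x ≤ 2 * level l := by
  obtain ⟨l, h1, h2⟩ := ENNReal.exists_mem_Ioc_zpow h0 ht (y := 2) (by norm_num) (by norm_num)
  refine ⟨l, h1, ?_⟩
  have : (2 : ℝ≥0∞) ^ (l + 1) = 2 * level l := by
    rw [ENNReal.zpow_add two_ne_zero ENNReal.ofNat_ne_top, zpow_one, mul_comm]; rfl
  rwa [this] at h2

-- A single level already suffices for finite `x`: if `level l < x ≤ 2 * level l`, the term at `l -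
-- 1` counts and `x ≤ 4 * level (l - 1)`. The condition `2 * level l < x` leaves room to cut a
-- function at height `level l` when its average is `x`.
open Classical in
theorem rpow_le_tsum_level {p : ℝ} (hp : 0 < p) (x : ℝ≥0∞) :
    x ^ p ≤ 4 ^ p * ∑' l : ℤ, if 2 * level l < x then level l ^ p else 0 := by
  rcases eq_or_ne x 0 with rfl | h0
  · simp [hp]
  rcases eq_or_ne x ∞ with rfl | ht
  · have h1 : ∀ l : ℤ, 2 * level l < ∞ := fun l => ENNReal.mul_lt_top (by simp) (level_ne_top l).lt_top
    simp only [h1, if_true]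
    have h2 : ∞ ≤ ∑' l : ℤ, level l ^ p := by
      calc (∞ : ℝ≥0∞) = ∑' _ : ℕ, 1 := (ENNReal.tsum_const_eq_top_of_ne_zero one_ne_zero).symm
        _ ≤ ∑' n : ℕ, level (n : ℤ) ^ p := by
            refine ENNReal.tsum_le_tsum fun n => ENNReal.one_le_rpow ?_ hp
            rw [level, zpow_natCast]
            exact one_le_pow₀ (by norm_num)
        _ ≤ _ := ENNReal.tsum_comp_le_tsum_of_injective Nat.cast_injective _
    rw [top_le_iff.1 h2, ENNReal.mul_top]
    · exact le_top
    · simp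
  · obtain ⟨l, h1, h2⟩ := exists_level h0 ht
    have h3 : 2 * level (l - 1) = level l := by
      have := level_add 1 (l - 1)
      rw [add_sub_cancel] at this
      rw [this, level, level, zpow_one]
    have h4 : x ^ p ≤ 4 ^ p * level (l - 1) ^ p := by
      rw [← ENNReal.mul_rpow_of_nonneg _ _ hp.le]
      refine ENNReal.rpow_le_rpow (h2.trans (le_of_eq ?_)) hp.le
      rw [← h3, ← mul_assoc]; norm_num
    refine h4.trans ?_
    gcongr
    refine le_trans ?_ (ENNReal.le_tsum (l - 1))
    rw [h3, if_pos h1]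

/-- The sum of a geometric series. -/
noncomputable def geomConst (ε : ℝ) : ℝ≥0∞ := (1 - (2 : ℝ≥0∞) ^ (-ε))⁻¹

theorem geomConst_ne_top {ε : ℝ} (hε : 0 < ε) : geomConst ε ≠ ∞ := by
  rw [geomConst, ENNReal.inv_ne_top, Ne, tsub_eq_zero_iff_le, not_le]
  exact ENNReal.rpow_lt_one_of_one_lt_of_neg (by norm_num) (by linarith)

theorem geomConst_ne_zero {ε : ℝ} : geomConst ε ≠ 0 := by
  rw [geomConst, Ne, ENNReal.inv_eq_zero]
  exact ne_top_of_le_ne_top ENNReal.one_ne_top tsub_le_self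

open Classical in
theorem tsum_level_le {ε : ℝ} (hε : 0 < ε) (x : ℝ≥0∞) :
    (∑' l : ℤ, if level l < x then level l ^ ε else 0) ≤ geomConst ε * x ^ ε := by
  rcases eq_or_ne x 0 with rfl | h0
  · simp
  rcases eq_or_ne x ∞ with rfl | ht
  · rw [ENNReal.top_rpow_of_pos hε, ENNReal.mul_top geomConst_ne_zero]
    exact le_top
  obtain ⟨l, h1, h2⟩ := exists_level h0 ht
  have hinj : Injective fun n : ℕ => l - (n : ℤ) := fun a b h => by
    have : l - (a : ℤ) = l - b := h
    omega
  have hsupp : support (fun l : ℤ => if level l < x then level l ^ ε else 0) ⊆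
      range fun n : ℕ => l - (n : ℤ) := by
    intro k hk
    by_cases hkl : k ≤ l
    · exact ⟨(l - k).toNat, by simp only; omega⟩
    · exfalso
      refine hk (if_neg (not_lt.2 (h2.trans ?_)))
      have h3 : 2 * level l = level (l + 1) := by rw [level_add, mul_comm]; simp [level]
      rw [h3]
      exact ENNReal.zpow_le_of_le (by norm_num) (by omega)
  rw [← hinj.tsum_eq hsupp]
  calc _ ≤ ∑' n : ℕ, x ^ ε * ((2 : ℝ≥0∞) ^ (-ε)) ^ n := by
        refine ENNReal.tsum_le_tsum fun n => ?_
        have h3 : level (l - n) ^ ε = level l ^ ε * ((2 : ℝ≥0∞) ^ (-ε)) ^ n := by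
          rw [sub_eq_add_neg, level_add, ENNReal.mul_rpow_of_nonneg _ _ hε.le]
          congr 1
          rw [level, ← ENNReal.rpow_intCast, ← ENNReal.rpow_mul, ← ENNReal.rpow_natCast,
            ← ENNReal.rpow_mul]
          congr 1
          push_cast; ring
        simp only [h3]
        split_ifs
        · gcongr
        · exact zero_le
    _ = _ := by rw [ENNReal.tsum_mul_left, ENNReal.tsum_geometric, geomConst, mul_comm]

end Levels

/-! ### Dyadic maximal inequality for general measures -/

section CarlesonEmbedding

variable {S : Type u} [MeasurableSpace S] {d : S → S → ℝ} {c₀ C₀ δ : ℝ}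

/-- The constant of the dyadic maximal inequality in `L^p`. -/
noncomputable def maxConst (p : ℝ) : ℝ≥0∞ := 4 ^ p * geomConst (p - 1)

/-- A form of the dyadic maximal inequality. -/
theorem DyadicSystem.tsum_avg_rpow_le (D : DyadicSystem d c₀ C₀ δ) [Countable D.Idx]
    (ν : Measure S) (h0 : ∀ q : D.Idx, ν (D.set q) ≠ 0) (ht : ∀ q : D.Idx, ν (D.set q) ≠ ∞)
    {p : ℝ} (hp : 1 < p) {g : S → ℝ≥0∞} (hg : Measurable g) {ι : Type*} [Countable ι] (q : ι → D.Idx)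
    {E : ι → Set S} (hE : ∀ i, MeasurableSet (E i)) (hsub : ∀ i, E i ⊆ D.set (q i))
    (hd : Pairwise (Disjoint on E)) :
    ∑' i, ((∫⁻ t in D.set (q i), g t ∂ν) / ν (D.set (q i))) ^ p * ν (E i) ≤
      maxConst p * ∫⁻ t, g t ^ p ∂ν := by
  classical
  have hp0 : 0 < p := by linarith
  have hp1 : 0 < p - 1 := by linarith
  set x : ι → ℝ≥0∞ := fun i => (∫⁻ t in D.set (q i), g t ∂ν) / ν (D.set (q i)) with hx
  have hset : ∀ l, MeasurableSet {t | level l < g t} := fun l => measurableSet_lt measurable_const hg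
  -- the level sets
  have hlevel : ∀ l : ℤ, ∑' i, (if 2 * level l < x i then level l ^ p else 0) * ν (E i) ≤
      level l ^ (p - 1) * ∫⁻ t in {t | level l < g t}, g t ∂ν := by
    intro l
    -- The Marcinkiewicz cut: the part of `g` below `level l` adds at most `level l` to an average,
    -- so an average above `2 * level l` forces that of `gl` above `level l`. The cube is then bad
    -- for `gl`, and the weak-type bound applies.
    set gl : S → ℝ≥0∞ := {t | level l < g t}.indicator g with hgl
    have hbad : ∀ i, 2 * level l < x i → E i ⊆ D.bad ν gl (level l) := by
      intro i hi s hs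
      refine ⟨q i, hsub i hs, ?_⟩
      rw [hx, ENNReal.lt_div_iff_mul_lt (Or.inl (h0 _)) (Or.inl (ht _)), two_mul, add_mul] at hi
      have h1 : ∫⁻ t in D.set (q i), g t ∂ν ≤
          ∫⁻ t in D.set (q i), gl t ∂ν + level l * ν (D.set (q i)) := by
        calc _ ≤ ∫⁻ t in D.set (q i), (gl t + level l) ∂ν := by
              refine lintegral_mono fun t => ?_
              by_cases h : level l < g t
              · rw [hgl, indicator_of_mem (show t ∈ {t | level l < g t} from h)]
                exact le_self_add
              · exact (not_lt.1 h).trans le_add_self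
          _ = _ := by rw [lintegral_add_right _ measurable_const, setLIntegral_const]
      by_contra hcon
      exact absurd (hi.trans_le h1) (not_lt.2 (add_le_add (not_lt.1 hcon) le_rfl))
    have hdl : Pairwise (Disjoint on fun i : {i // 2 * level l < x i} => E i) := fun i j hne =>
      hd (Subtype.coe_injective.ne hne)
    calc ∑' i, (if 2 * level l < x i then level l ^ p else 0) * ν (E i)
        = ∑' i : {i // 2 * level l < x i}, level l ^ p * ν (E i) := by
          refine Eq.trans (tsum_congr fun i => ?_)
            (tsum_subtype {i | 2 * level l < x i} fun i => level l ^ p * ν (E i)).symm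
          by_cases h : 2 * level l < x i
          · rw [if_pos h, indicator_of_mem (show i ∈ {i | 2 * level l < x i} from h)]
          · rw [if_neg h, indicator_of_notMem (show i ∉ {i | 2 * level l < x i} from h), zero_mul]
      _ = level l ^ p * ν (⋃ i : {i // 2 * level l < x i}, E i) := by
          rw [ENNReal.tsum_mul_left, measure_iUnion hdl fun i => hE i]
      _ ≤ level l ^ p * ν (D.bad ν gl (level l)) := by
          gcongr
          exact iUnion_subset fun i => hbad i i.2
      _ = level l ^ (p - 1) * (level l * ν (D.bad ν gl (level l))) := by
          rw [← mul_assoc]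
          congr 1
          conv_rhs => rw [← ENNReal.rpow_one (level l), ← ENNReal.rpow_mul, one_mul]
          rw [← ENNReal.rpow_add _ _ (level_ne_zero l) (level_ne_top l), sub_add_cancel]
      _ ≤ level l ^ (p - 1) * ∫⁻ t, gl t ∂ν := by
          gcongr
          exact (D.mul_measure_bad_le ν gl (level l)).trans (setLIntegral_le_lintegral _ _)
      _ = _ := by rw [hgl, lintegral_indicator (hset l)]
  calc ∑' i, x i ^ p * ν (E i)
      ≤ ∑' i, (4 ^ p * ∑' l : ℤ, if 2 * level l < x i then level l ^ p else 0) * ν (E i) := by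
        refine ENNReal.tsum_le_tsum fun i => ?_
        gcongr
        exact rpow_le_tsum_level hp0 _
    _ = 4 ^ p * ∑' i, ∑' l : ℤ, (if 2 * level l < x i then level l ^ p else 0) * ν (E i) := by
        rw [← ENNReal.tsum_mul_left]
        refine tsum_congr fun i => ?_
        rw [ENNReal.tsum_mul_right, mul_assoc]
    _ = 4 ^ p * ∑' l : ℤ, ∑' i, (if 2 * level l < x i then level l ^ p else 0) * ν (E i) := by
        rw [ENNReal.tsum_comm]
    _ ≤ 4 ^ p * ∑' l : ℤ, level l ^ (p - 1) * ∫⁻ t in {t | level l < g t}, g t ∂ν := by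
        gcongr with l; exact hlevel l
    _ = 4 ^ p * ∫⁻ t, ∑' l : ℤ, level l ^ (p - 1) * {t | level l < g t}.indicator g t ∂ν := by
        rw [lintegral_tsum fun l => ((hg.indicator (hset l)).const_mul _).aemeasurable]
        congr 1
        refine tsum_congr fun l => ?_
        rw [lintegral_const_mul _ (hg.indicator (hset l)), lintegral_indicator (hset l)]
    _ ≤ 4 ^ p * ∫⁻ t, geomConst (p - 1) * g t ^ p ∂ν := by
        gcongr with t
        calc ∑' l : ℤ, level l ^ (p - 1) * {t | level l < g t}.indicator g t
            = (∑' l : ℤ, if level l < g t then level l ^ (p - 1) else 0) * g t := by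
              rw [← ENNReal.tsum_mul_right]
              refine tsum_congr fun l => ?_
              by_cases h : level l < g t
              · rw [if_pos h, indicator_of_mem (show t ∈ {t | level l < g t} from h)]
              · rw [if_neg h, indicator_of_notMem (show t ∉ {t | level l < g t} from h), zero_mul,
                  mul_zero]
          _ ≤ geomConst (p - 1) * g t ^ (p - 1) * g t := by
              gcongr; exact tsum_level_le hp1 _
          _ = geomConst (p - 1) * g t ^ p := by
              rw [mul_assoc]
              congr 1
              nth_rewrite 2 [← ENNReal.rpow_one (g t)]
              rw [← ENNReal.rpow_add_of_nonneg _ _ hp1.le zero_le_one, sub_add_cancel]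
    _ = _ := by rw [lintegral_const_mul _ (hg.pow_const p), maxConst, mul_assoc]

theorem tsum_avg_rpow_le_of_systems {m : ℕ} (D : Fin m → DyadicSystem d c₀ C₀ δ)
    [∀ j, Countable (D j).Idx] (ν : Measure S) (h0 : ∀ j, ∀ q : (D j).Idx, ν ((D j).set q) ≠ 0)
    (ht : ∀ j, ∀ q : (D j).Idx, ν ((D j).set q) ≠ ∞) {p : ℝ} (hp : 1 < p) {g : S → ℝ≥0∞}
    (hg : Measurable g) {ι : Type*} [Countable ι] {Q E : ι → Set S}
    (hQ : ∀ i, ∃ j, (D j).IsCube (Q i)) (hE : ∀ i, MeasurableSet (E i)) (hsub : ∀ i, E i ⊆ Q i)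
    (hd : Pairwise (Disjoint on E)) :
    ∑' i, ((∫⁻ t in Q i, g t ∂ν) / ν (Q i)) ^ p * ν (E i) ≤ m * maxConst p * ∫⁻ t, g t ^ p ∂ν := by
  choose j k l hQ using hQ
  rw [← (Equiv.sigmaFiberEquiv j).tsum_eq, ENNReal.tsum_sigma', tsum_fintype]
  calc _ ≤ ∑ _j : Fin m, maxConst p * ∫⁻ t, g t ^ p ∂ν := by
        refine Finset.sum_le_sum fun j₀ _ => ?_
        have hq : ∀ i : {i // j i = j₀}, ∃ q : (D j₀).Idx, Q i = (D j₀).set q := by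
          rintro ⟨i, rfl⟩
          exact ⟨⟨k i, l i⟩, hQ i⟩
        choose q hq using hq
        have := (D j₀).tsum_avg_rpow_le ν (h0 j₀) (ht j₀) hp hg q (E := fun i => E i)
          (fun i => hE i) (fun i => (hsub i).trans (hq i).le)
          (fun i i' hne => hd (Subtype.coe_injective.ne hne))
        refine le_trans (le_of_eq (tsum_congr fun i => ?_)) this
        rw [← hq i]
        rfl
    _ = _ := by rw [Finset.sum_const, Finset.card_univ, Fintype.card_fin, nsmul_eq_mul, mul_assoc]

end CarlesonEmbedding

/-! ### The two-measure bilinear estimate -/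

section Bilinear

theorem tsum_mul_le_Lp_mul_Lq {ι : Type*} {p q : ℝ} (hpq : p.HolderConjugate q) (f g : ι → ℝ≥0∞) :
    ∑' i, f i * g i ≤ (∑' i, f i ^ p) ^ (1 / p) * (∑' i, g i ^ q) ^ (1 / q) := by
  rw [ENNReal.tsum_eq_iSup_sum]
  refine iSup_le fun s => (ENNReal.inner_le_Lp_mul_Lq s f g hpq).trans ?_
  have hp := hpq.pos
  have hq := hpq.symm.pos
  gcongr <;> exact ENNReal.sum_le_tsum _

/-- Here `W, Z, V` stand for `ν, ξ, μ` of a cube and `w, s, v` for those of its major part. Write `Z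
= Z^{p-1} Z^{2-p}`: the `A_p` condition absorbs `W Z^{p-1}`, and since `p ≥ 2` the negative power
satisfies `Z^{2-p} ≤ s^{2-p}`. The remaining `V^{p-1}` passes to `v^{p-1}` by sparseness, then to
`w` and `s` by Hölder. The constant `K` enters to the first power, which is the source of sharpness.
-/
theorem testing_le {p : ℝ} (hp : 2 ≤ p) {W Z V w s v K L : ℝ≥0∞} (hV0 : V ≠ 0) (hVt : V ≠ ∞)
    (hZt : Z ≠ ∞) (hAp : W * Z ^ (p - 1) ≤ K * V ^ p) (hs : s ≤ Z) (hv : V ≤ L * v)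
    (hH : v ^ p ≤ w * s ^ (p - 1)) :
    W * Z / V ≤ K * L ^ (p - 1) * (s ^ (1 / p) * w ^ (1 - 1 / p)) := by
  have hp0 : 0 < p := by linarith
  have hp1 : 0 < p - 1 := by linarith
  have hv0 : v ≠ 0 := by rintro rfl; simp [hV0] at hv
  have hs0 : s ≠ 0 := by
    rintro rfl
    rw [ENNReal.zero_rpow_of_pos hp1, mul_zero, nonpos_iff_eq_zero,
      ENNReal.rpow_eq_zero_iff_of_pos hp0] at hH
    exact hv0 hH
  have hst : s ≠ ∞ := ne_top_of_le_ne_top hZt hs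
  have hZ0 : Z ≠ 0 := fun h => hs0 (le_zero_iff.1 (h ▸ hs))
  have h1 : Z ^ (2 - p) ≤ s ^ (2 - p) := by
    rw [show 2 - p = -(p - 2) by ring, ENNReal.rpow_neg, ENNReal.rpow_neg, ENNReal.inv_le_inv]
    exact ENNReal.rpow_le_rpow hs (by linarith)
  have h2 : v ^ (p - 1) ≤ w ^ (1 - 1 / p) * s ^ ((p - 1) * (1 - 1 / p)) := by
    have h3 : 0 ≤ 1 - 1 / p := by rw [sub_nonneg, div_le_one hp0]; linarith
    have := ENNReal.rpow_le_rpow hH h3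
    rw [← ENNReal.rpow_mul, ENNReal.mul_rpow_of_nonneg _ _ h3, ← ENNReal.rpow_mul] at this
    rwa [show p * (1 - 1 / p) = p - 1 by field_simp] at this
  calc W * Z / V = W * Z ^ (p - 1) * (Z ^ (2 - p) * V⁻¹) := by
        rw [div_eq_mul_inv, mul_assoc W (Z ^ (p - 1)), ← mul_assoc (Z ^ (p - 1)),
          ← ENNReal.rpow_add _ _ hZ0 hZt, show p - 1 + (2 - p) = 1 by ring, ENNReal.rpow_one, mul_assoc]
    _ ≤ K * V ^ p * (s ^ (2 - p) * V⁻¹) := by gcongr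
    _ = K * V ^ (p - 1) * s ^ (2 - p) := by
        rw [ENNReal.rpow_sub _ _ hV0 hVt, ENNReal.rpow_one, div_eq_mul_inv]; ring
    _ ≤ K * (L * v) ^ (p - 1) * s ^ (2 - p) := by gcongr
    _ = K * (L ^ (p - 1) * v ^ (p - 1)) * s ^ (2 - p) := by
        rw [ENNReal.mul_rpow_of_nonneg _ _ hp1.le]
    _ ≤ K * (L ^ (p - 1) * (w ^ (1 - 1 / p) * s ^ ((p - 1) * (1 - 1 / p)))) * s ^ (2 - p) := by gcongr
    _ = K * L ^ (p - 1) * (s ^ ((p - 1) * (1 - 1 / p)) * s ^ (2 - p) * w ^ (1 - 1 / p)) := by ring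
    _ = _ := by
        rw [← ENNReal.rpow_add _ _ hs0 hst,
          show (p - 1) * (1 - 1 / p) + (2 - p) = 1 / p by field_simp; ring]

variable {S : Type u} [MeasurableSpace S] {d : S → S → ℝ} {c₀ C₀ δ : ℝ} {m : ℕ}

/-- The constant in the bilinear estimate. -/
noncomputable def bilConst (m : ℕ) (L : ℝ≥0) (p : ℝ) : ℝ≥0∞ :=
  (L : ℝ≥0∞) ^ (p - 1) * ((m * maxConst p) ^ (1 / p) * (m * maxConst (p / (p - 1))) ^ (1 - 1 / p))

/-- Testing moves the mass of each cube to its disjoint major part; Hölder's inequality for sums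
then separates `g` from `h`, and each factor is a maximal inequality for its own measure,
independent of `K`. -/
theorem bilinear_le_of_two_le (D : Fin m → DyadicSystem d c₀ C₀ δ) [∀ j, Countable (D j).Idx]
    {μ ν ξ : Measure S} (hμ0 : ∀ j, ∀ q : (D j).Idx, μ ((D j).set q) ≠ 0)
    (hμt : ∀ j, ∀ q : (D j).Idx, μ ((D j).set q) ≠ ∞)
    (hν0 : ∀ j, ∀ q : (D j).Idx, ν ((D j).set q) ≠ 0)
    (hνt : ∀ j, ∀ q : (D j).Idx, ν ((D j).set q) ≠ ∞)
    (hξ0 : ∀ j, ∀ q : (D j).Idx, ξ ((D j).set q) ≠ 0)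
    (hξt : ∀ j, ∀ q : (D j).Idx, ξ ((D j).set q) ≠ ∞) {p : ℝ} (hp : 2 ≤ p)
    {K : ℝ≥0∞} {L : ℝ≥0} {ι : Type*} [Countable ι] {Q E : ι → Set S}
    (hQ : ∀ i, ∃ j, (D j).IsCube (Q i)) (hE : ∀ i, MeasurableSet (E i)) (hsub : ∀ i, E i ⊆ Q i)
    (hd : Pairwise (Disjoint on E)) (hL : ∀ i, μ (Q i) ≤ L * μ (E i))
    (hAp : ∀ i, ν (Q i) * ξ (Q i) ^ (p - 1) ≤ K * μ (Q i) ^ p)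
    (hH : ∀ i, μ (E i) ^ p ≤ ν (E i) * ξ (E i) ^ (p - 1)) {g h : S → ℝ≥0∞} (hg : Measurable g)
    (hh : Measurable h) :
    ∑' i, (∫⁻ t in Q i, g t ∂ξ) * (∫⁻ t in Q i, h t ∂ν) / μ (Q i) ≤
      bilConst m L p * K * ((∫⁻ t, g t ^ p ∂ξ) ^ (1 / p) *
        (∫⁻ t, h t ^ (p / (p - 1)) ∂ν) ^ (1 - 1 / p)) := by
  have hp0 : 0 < p := by linarith
  have hp1 : 0 < p - 1 := by linarith
  have hpq : p.HolderConjugate (p / (p - 1)) := Real.HolderConjugate.conjExponent (by linarith)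
  have hq : 1 / (p / (p - 1)) = 1 - 1 / p := by field_simp
  have hq0 : 0 ≤ 1 - 1 / p := by rw [sub_nonneg, div_le_one hp0]; linarith
  have hcube : ∀ {ν : Measure S}, (∀ j, ∀ q : (D j).Idx, ν ((D j).set q) ≠ 0) → ∀ i, ν (Q i) ≠ 0 := by
    intro ν h i
    obtain ⟨j, k, l, hi⟩ := hQ i
    rw [hi]; exact h j ⟨k, l⟩
  have hcubet : ∀ {ν : Measure S}, (∀ j, ∀ q : (D j).Idx, ν ((D j).set q) ≠ ∞) →
      ∀ i, ν (Q i) ≠ ∞ := by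
    intro ν h i
    obtain ⟨j, k, l, hi⟩ := hQ i
    rw [hi]; exact h j ⟨k, l⟩
  set a : ι → ℝ≥0∞ := fun i => (∫⁻ t in Q i, g t ∂ξ) / ξ (Q i) with ha
  set b : ι → ℝ≥0∞ := fun i => (∫⁻ t in Q i, h t ∂ν) / ν (Q i) with hb
  have hterm : ∀ i, (∫⁻ t in Q i, g t ∂ξ) * (∫⁻ t in Q i, h t ∂ν) / μ (Q i) ≤
      K * (L : ℝ≥0∞) ^ (p - 1) * ((a i * ξ (E i) ^ (1 / p)) * (b i * ν (E i) ^ (1 - 1 / p))) := by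
    intro i
    have h1 : ∫⁻ t in Q i, g t ∂ξ = a i * ξ (Q i) :=
      (ENNReal.div_mul_cancel (hcube hξ0 i) (hcubet hξt i)).symm
    have h2 : ∫⁻ t in Q i, h t ∂ν = b i * ν (Q i) :=
      (ENNReal.div_mul_cancel (hcube hν0 i) (hcubet hνt i)).symm
    rw [h1, h2]
    calc a i * ξ (Q i) * (b i * ν (Q i)) / μ (Q i) = a i * b i * (ν (Q i) * ξ (Q i) / μ (Q i)) := by
          rw [div_eq_mul_inv, div_eq_mul_inv]; ring
      _ ≤ a i * b i * (K * (L : ℝ≥0∞) ^ (p - 1) * (ξ (E i) ^ (1 / p) * ν (E i) ^ (1 - 1 / p))) := by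
          gcongr
          exact testing_le hp (hcube hμ0 i) (hcubet hμt i) (hcubet hξt i) (hAp i)
            (measure_mono (hsub i)) (hL i) (hH i)
      _ = _ := by ring
  have hsum1 : ∑' i, (a i * ξ (E i) ^ (1 / p)) ^ p ≤ m * maxConst p * ∫⁻ t, g t ^ p ∂ξ := by
    refine le_trans (le_of_eq (tsum_congr fun i => ?_))
      (tsum_avg_rpow_le_of_systems D ξ hξ0 hξt (by linarith) hg hQ hE hsub hd)
    rw [ENNReal.mul_rpow_of_nonneg _ _ hp0.le, ← ENNReal.rpow_mul, one_div, inv_mul_cancel₀ hp0.ne',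
      ENNReal.rpow_one]
  have hsum2 : ∑' i, (b i * ν (E i) ^ (1 - 1 / p)) ^ (p / (p - 1)) ≤
      m * maxConst (p / (p - 1)) * ∫⁻ t, h t ^ (p / (p - 1)) ∂ν := by
    refine le_trans (le_of_eq (tsum_congr fun i => ?_))
      (tsum_avg_rpow_le_of_systems D ν hν0 hνt hpq.symm.lt hh hQ hE hsub hd)
    rw [ENNReal.mul_rpow_of_nonneg _ _ hpq.symm.pos.le, ← ENNReal.rpow_mul,
      show (1 - 1 / p) * (p / (p - 1)) = 1 by field_simp, ENNReal.rpow_one]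
  calc _ ≤ ∑' i, K * (L : ℝ≥0∞) ^ (p - 1) *
        ((a i * ξ (E i) ^ (1 / p)) * (b i * ν (E i) ^ (1 - 1 / p))) := ENNReal.tsum_le_tsum hterm
    _ ≤ K * (L : ℝ≥0∞) ^ (p - 1) * ((m * maxConst p * ∫⁻ t, g t ^ p ∂ξ) ^ (1 / p) *
        (m * maxConst (p / (p - 1)) * ∫⁻ t, h t ^ (p / (p - 1)) ∂ν) ^ (1 - 1 / p)) := by
        rw [ENNReal.tsum_mul_left]
        gcongr
        refine (tsum_mul_le_Lp_mul_Lq hpq _ _).trans ?_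
        rw [hq]
        gcongr
    _ = _ := by
        rw [ENNReal.mul_rpow_of_nonneg _ _ (by positivity), ENNReal.mul_rpow_of_nonneg _ _ hq0,
          bilConst]
        ring

end Bilinear

/-! ### Muckenhoupt weights and sparse operators -/

section Weights

variable {S : Type u} [MeasurableSpace S] {d : S → S → ℝ} {μ : Measure S} {cd : ℝ} {cμ : ℝ≥0}
  {c₀ C₀ δ : ℝ} {m : ℕ} {p : ℝ} {a : S → ℝ≥0}

theorem bilConst_ne_top (m : ℕ) (L : ℝ≥0) {p : ℝ} (hp : 1 < p) : bilConst m L p ≠ ∞ := by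
  have hp1 : 0 < p - 1 := by linarith
  have hp0 : 0 < p := by linarith
  have h1 : 0 < p / (p - 1) - 1 := by
    rw [show p / (p - 1) - 1 = 1 / (p - 1) by field_simp; ring]; positivity
  have hmax : ∀ q : ℝ, 0 < q → 0 < q - 1 → maxConst q ≠ ∞ := fun q hq hq1 =>
    ENNReal.mul_ne_top (ENNReal.rpow_ne_top_of_nonneg hq.le (by simp)) (geomConst_ne_top hq1)
  refine ENNReal.mul_ne_top (ENNReal.rpow_ne_top_of_nonneg hp1.le ENNReal.coe_ne_top)
    (ENNReal.mul_ne_top (ENNReal.rpow_ne_top_of_nonneg (by positivity) (ENNReal.mul_ne_top (by simp)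
      (hmax p hp0 hp1))) (ENNReal.rpow_ne_top_of_nonneg ?_ (ENNReal.mul_ne_top (by simp)
      (hmax _ (by positivity) h1))))
  rw [sub_nonneg, div_le_one hp0]; linarith

/-- The dual weight `w^{-1/(p-1)}`. -/
noncomputable def dualWeight (p : ℝ) (a : S → ℝ≥0) (s : S) : ℝ≥0 := a s ^ (-(1 / (p - 1)))

theorem IsWeight.measurable_dualWeight (ha : IsWeight d μ a) : Measurable (dualWeight p a) :=
  ha.measurable.pow_const _

theorem IsWeight.dualWeight_pos (ha : IsWeight d μ a) (s : S) : 0 < dualWeight p a s :=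
  NNReal.rpow_pos (ha.pos s)

theorem absolutelyContinuous_weighted {b : S → ℝ≥0} (hb : Measurable b) (h0 : ∀ s, 0 < b s) :
    μ ≪ weighted μ b :=
  withDensity_absolutelyContinuous' hb.coe_nnreal_ennreal.aemeasurable
    (Filter.Eventually.of_forall fun s => by exact_mod_cast (h0 s).ne')

theorem weighted_absolutelyContinuous {b : S → ℝ≥0} : weighted μ b ≪ μ :=
  withDensity_absolutelyContinuous _ _

theorem avg_dual (ha : ∀ s, 0 < a s) {B : Set S} (hB : MeasurableSet B) :
    avg μ (fun t => (a t : ℝ≥0∞)⁻¹) (1 / (p - 1)) B =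
      (weighted μ (dualWeight p a) B / μ B) ^ (p - 1) := by
  have h1 : ∀ t, ((a t : ℝ≥0∞)⁻¹) ^ (1 / (p - 1)) = (dualWeight p a t : ℝ≥0∞) := by
    intro t
    rw [dualWeight, ENNReal.coe_rpow_of_ne_zero (ha t).ne', ENNReal.rpow_neg, ENNReal.inv_rpow]
  rw [avg, one_div_one_div]
  congr 1
  simp only [h1]
  rw [setLAverage_eq, weighted, withDensity_apply _ hB]

theorem ap_qball_le (H : IsHomogeneousType d μ cd cμ) (ha : IsWeight d μ a) (s : S)
    {ρ : ℝ} (hρ : 0 < ρ) :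
    (weighted μ a (qball d s ρ) / μ (qball d s ρ)) *
      (weighted μ (dualWeight p a) (qball d s ρ) / μ (qball d s ρ)) ^ (p - 1) ≤ apChar d μ p a := by
  have hB := H.measurableSet_qball s ρ
  have h1 : avg μ (fun t => (a t : ℝ≥0∞)) 1 (qball d s ρ) =
      weighted μ a (qball d s ρ) / μ (qball d s ρ) := by
    rw [avg_one, weighted, withDensity_apply _ hB]
  rw [← avg_dual ha.pos hB, ← h1]
  exact le_iSup_of_le s (le_iSup_of_le ρ (le_iSup_of_le hρ le_rfl))

theorem IsWeight.weighted_qball_ne_top (H : IsHomogeneousType d μ cd cμ) (ha : IsWeight d μ a) (s : S)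
    (ρ : ℝ) : weighted μ a (qball d s ρ) ≠ ∞ := by
  rw [weighted, withDensity_apply _ (H.measurableSet_qball s ρ)]
  exact (ha.integrable_qball s ρ).ne

/-- Local integrability of the dual weight is not part of the definition of a weight; it follows
from finiteness of the characteristic because `w` has positive mass on every ball. -/
theorem dual_qball_ne_top (H : IsHomogeneousType d μ cd cμ) (hp : 1 < p) (ha : IsWeight d μ a)
    (hap : apChar d μ p a ≠ ∞) (s : S) (ρ : ℝ) :
    weighted μ (dualWeight p a) (qball d s ρ) ≠ ∞ := by
  wlog hρ : 0 < ρ generalizing ρ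
  · exact ne_top_of_le_ne_top (this 1 one_pos)
      (measure_mono (qball_mono s ((not_lt.1 hρ).trans zero_le_one)))
  intro htop
  have h := ap_qball_le (p := p) H ha s hρ
  have h0 : weighted μ a (qball d s ρ) ≠ 0 := fun h0 =>
    (H.measure_qball_pos s ρ hρ).ne' (absolutelyContinuous_weighted ha.measurable ha.pos h0)
  rw [htop, ENNReal.top_div_of_ne_top (H.measure_qball_ne_top s ρ),
    ENNReal.top_rpow_of_pos (by linarith), ENNReal.mul_top] at h
  · exact hap (top_le_iff.1 h)
  · exact (ENNReal.div_pos h0 (H.measure_qball_ne_top s ρ)).ne'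

theorem ap_qball_mul_le (H : IsHomogeneousType d μ cd cμ) (hp : 1 < p) (ha : IsWeight d μ a) (s : S)
    {ρ : ℝ} (hρ : 0 < ρ) :
    weighted μ a (qball d s ρ) * weighted μ (dualWeight p a) (qball d s ρ) ^ (p - 1) ≤
      apChar d μ p a * μ (qball d s ρ) ^ p := by
  have h0 := (H.measure_qball_pos s ρ hρ).ne'
  have ht := H.measure_qball_ne_top s ρ
  have hp1 : 0 ≤ p - 1 := by linarith
  set B := qball d s ρ
  calc weighted μ a B * weighted μ (dualWeight p a) B ^ (p - 1)
      = (weighted μ a B / μ B * μ B) * (weighted μ (dualWeight p a) B / μ B * μ B) ^ (p - 1) := by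
        rw [ENNReal.div_mul_cancel h0 ht, ENNReal.div_mul_cancel h0 ht]
    _ = (weighted μ a B / μ B) * (weighted μ (dualWeight p a) B / μ B) ^ (p - 1) *
        (μ B ^ (1 : ℝ) * μ B ^ (p - 1)) := by
        rw [ENNReal.mul_rpow_of_nonneg _ _ hp1, ENNReal.rpow_one]; ring
    _ ≤ _ := by
        rw [← ENNReal.rpow_add _ _ h0 ht, add_sub_cancel]
        gcongr
        exact ap_qball_le H ha s hρ

/-- Hölder's inequality for a weight and its dual. -/
theorem measure_rpow_le_weighted (hp : 1 < p) (ha : IsWeight d μ a) {E : Set S}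
    (hE : MeasurableSet E) :
    μ E ^ p ≤ weighted μ a E * weighted μ (dualWeight p a) E ^ (p - 1) := by
  have hp0 : 0 < p := by linarith
  have hp1 : 0 < p - 1 := by linarith
  have hpq : p.HolderConjugate (p / (p - 1)) := Real.HolderConjugate.conjExponent hp
  have hq : 1 / (p / (p - 1)) = 1 - 1 / p := by field_simp
  have hq0 : 0 ≤ 1 - 1 / p := by rw [sub_nonneg, div_le_one hp0]; linarith
  have h1 : ∀ s, ((a s : ℝ≥0∞) ^ (1 / p)) * ((dualWeight p a s : ℝ≥0∞) ^ (1 - 1 / p)) = 1 := by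
    intro s
    have hne := (ha.pos s).ne'
    rw [dualWeight, ENNReal.coe_rpow_of_ne_zero hne, ← ENNReal.rpow_mul, ← ENNReal.rpow_add _ _
      (by exact_mod_cast hne) ENNReal.coe_ne_top, show 1 / p + -(1 / (p - 1)) * (1 - 1 / p) = 0 by
        field_simp; ring, ENNReal.rpow_zero]
  have h2 := ENNReal.lintegral_mul_le_Lp_mul_Lq (μ.restrict E) hpq
    (f := fun s => (a s : ℝ≥0∞) ^ (1 / p)) (g := fun s => (dualWeight p a s : ℝ≥0∞) ^ (1 - 1 / p))
    (ha.measurable.coe_nnreal_ennreal.pow_const _).aemeasurable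
    (ha.measurable_dualWeight.coe_nnreal_ennreal.pow_const _).aemeasurable
  have h3 : ∀ s, ((a s : ℝ≥0∞) ^ (1 / p)) ^ p = a s := fun s => by
    rw [← ENNReal.rpow_mul, one_div, inv_mul_cancel₀ hp0.ne', ENNReal.rpow_one]
  have h4 : ∀ s, ((dualWeight p a s : ℝ≥0∞) ^ (1 - 1 / p)) ^ (p / (p - 1)) = dualWeight p a s :=
    fun s => by
      rw [← ENNReal.rpow_mul, show (1 - 1 / p) * (p / (p - 1)) = 1 by field_simp, ENNReal.rpow_one]
  simp only [Pi.mul_apply, h1, h3, h4, hq, lintegral_const, Measure.restrict_apply_univ, one_mul] at h2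
  rw [weighted, weighted, withDensity_apply _ hE, withDensity_apply _ hE]
  refine (ENNReal.rpow_le_rpow h2 hp0.le).trans (le_of_eq ?_)
  rw [ENNReal.mul_rpow_of_nonneg _ _ hp0.le, ← ENNReal.rpow_mul, ← ENNReal.rpow_mul, one_div,
    inv_mul_cancel₀ hp0.ne', ENNReal.rpow_one, show (1 - p⁻¹) * p = p - 1 by field_simp]

/-- The constant in the weighted bilinear estimate. -/
noncomputable def weightConst (cd : ℝ) (cμ : ℝ≥0) (m : ℕ) (c₀ C₀ : ℝ) (L : ℝ≥0) (p : ℝ) : ℝ≥0∞ :=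
  bilConst m L p * (dbl cd cμ (1 * C₀ / c₀) : ℝ≥0∞) ^ p +
    bilConst m L (p / (p - 1)) * ((dbl cd cμ (1 * C₀ / c₀) : ℝ≥0∞) ^ p) ^ (1 / (p - 1))

theorem weightConst_ne_top (cd : ℝ) (cμ : ℝ≥0) (m : ℕ) (c₀ C₀ : ℝ) (L : ℝ≥0) {p : ℝ} (hp : 1 < p) :
    weightConst cd cμ m c₀ C₀ L p ≠ ∞ := by
  have hp0 : 0 ≤ p := by linarith
  have hp1 : 0 < p - 1 := by linarith
  have h2 : (dbl cd cμ (1 * C₀ / c₀) : ℝ≥0∞) ^ p ≠ ∞ :=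
    ENNReal.rpow_ne_top_of_nonneg hp0 ENNReal.coe_ne_top
  refine ENNReal.add_ne_top.2 ⟨ENNReal.mul_ne_top (bilConst_ne_top m L hp) h2,
    ENNReal.mul_ne_top (bilConst_ne_top m L ?_) (ENNReal.rpow_ne_top_of_nonneg (by positivity) h2)⟩
  rw [lt_div_iff₀ hp1]; linarith

/-- For `p ≥ 2` the general estimate applies directly. For `p ≤ 2` the weight and its dual are
exchanged and `p` is replaced by its conjugate `q ≥ 2`; raising the `A_p` inequality to the power `1
/ (p - 1) = q - 1` gives the dual condition, and with it the exponent `1 / (p - 1)`. -/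
theorem bilinear_weighted_le (H : IsHomogeneousType d μ cd cμ) (hcd : 1 ≤ cd) (hc₀ : 0 < c₀)
    (hC₀ : c₀ ≤ C₀) (hδ : 0 < δ) (D : Fin m → DyadicSystem d c₀ C₀ δ) (hp : 1 < p)
    (ha : IsWeight d μ a) (hap : apChar d μ p a ≠ ∞) {L : ℝ≥0} {ι : Type*} [Countable ι]
    {Q E : ι → Set S}
    (hQ : ∀ i, ∃ j, (D j).IsCube (Q i)) (hE : ∀ i, MeasurableSet (E i)) (hsub : ∀ i, E i ⊆ Q i)
    (hd : Pairwise (Disjoint on E)) (hL : ∀ i, μ (Q i) ≤ L * μ (E i))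
    {g h : S → ℝ≥0∞} (hg : Measurable g) (hh : Measurable h) :
    ∑' i, (∫⁻ t in Q i, g t ∂(weighted μ (dualWeight p a))) * (∫⁻ t in Q i, h t ∂(weighted μ a)) /
      μ (Q i) ≤ weightConst cd cμ m c₀ C₀ L p * apChar d μ p a ^ max (1 / (p - 1)) 1 *
        ((∫⁻ t, g t ^ p ∂(weighted μ (dualWeight p a))) ^ (1 / p) *
          (∫⁻ t, h t ^ (p / (p - 1)) ∂(weighted μ a)) ^ (1 - 1 / p)) := by
  have hp0 : 0 < p := by linarith
  have hp1 : 0 < p - 1 := by linarith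
  have hcnt : ∀ j, Countable (D j).Idx := fun j => DyadicSystem.countable_idx H hc₀ hδ
  have hC : 0 < C₀ := hc₀.trans_le hC₀
  have hdil : ∀ j, ∀ q : (D j).Idx, (D j).set q ⊆ (D j).dil 1 q := fun j q =>
    (DyadicSystem.set_subset_qball q).trans (qball_mono _ (by rw [one_mul]))
  have hμ0 : ∀ j, ∀ q : (D j).Idx, μ ((D j).set q) ≠ 0 := fun j q =>
    (DyadicSystem.measure_set_pos H hc₀ hδ q).ne'
  have hμt : ∀ j, ∀ q : (D j).Idx, μ ((D j).set q) ≠ ∞ := fun j q =>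
    DyadicSystem.measure_set_ne_top H q
  have hν0 : ∀ j, ∀ q : (D j).Idx, weighted μ a ((D j).set q) ≠ 0 := fun j q h0 =>
    hμ0 j q (absolutelyContinuous_weighted ha.measurable ha.pos h0)
  have hξ0 : ∀ j, ∀ q : (D j).Idx, weighted μ (dualWeight p a) ((D j).set q) ≠ 0 := fun j q h0 =>
    hμ0 j q (absolutelyContinuous_weighted ha.measurable_dualWeight ha.dualWeight_pos h0)
  have hνt : ∀ j, ∀ q : (D j).Idx, weighted μ a ((D j).set q) ≠ ∞ := fun j q =>
    ne_top_of_le_ne_top (ha.weighted_qball_ne_top H _ _) (measure_mono (hdil j q))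
  have hξt : ∀ j, ∀ q : (D j).Idx, weighted μ (dualWeight p a) ((D j).set q) ≠ ∞ := fun j q =>
    ne_top_of_le_ne_top (dual_qball_ne_top H hp ha hap _ _) (measure_mono (hdil j q))
  set G : ℝ≥0∞ := ((dbl cd cμ (1 * C₀ / c₀) : ℝ≥0) : ℝ≥0∞) with hG
  set A := apChar d μ p a with hA
  have hcube : ∀ i, weighted μ a (Q i) * weighted μ (dualWeight p a) (Q i) ^ (p - 1) ≤
      (A * G ^ p) * μ (Q i) ^ p := by
    intro i
    obtain ⟨j, k, l, hi⟩ := hQ i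
    have hi' : Q i = (D j).set ⟨k, l⟩ := hi
    rw [hi']
    set q : (D j).Idx := ⟨k, l⟩
    calc _ ≤ weighted μ a ((D j).dil 1 q) * weighted μ (dualWeight p a) ((D j).dil 1 q) ^ (p - 1) := by
          gcongr <;> exact hdil j q
      _ ≤ A * μ ((D j).dil 1 q) ^ p :=
          ap_qball_mul_le H hp ha _ (mul_pos one_pos (mul_pos hC (zpow_pos hδ _)))
      _ ≤ A * (G * μ ((D j).set q)) ^ p := by
          gcongr
          exact DyadicSystem.measure_dil_le H hcd hc₀ hC₀ hδ zero_le_one q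
      _ = _ := by rw [ENNReal.mul_rpow_of_nonneg _ _ hp0.le]; ring
  have hHol : ∀ i, μ (E i) ^ p ≤ weighted μ a (E i) * weighted μ (dualWeight p a) (E i) ^ (p - 1) :=
    fun i => measure_rpow_le_weighted hp ha (hE i)
  rcases le_total 2 p with h2 | h2
  · have hmax : max (1 / (p - 1)) 1 = 1 := max_eq_right (by rw [div_le_one hp1]; linarith)
    have := bilinear_le_of_two_le D hμ0 hμt hν0 hνt hξ0 hξt h2 hQ hE hsub hd hL hcube hHol hg hh
    refine this.trans ?_
    rw [hmax, ENNReal.rpow_one]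
    refine mul_le_mul_left ?_ _
    rw [weightConst, add_mul]
    refine le_trans (le_of_eq ?_) le_self_add
    ring
  · have hmax : max (1 / (p - 1)) 1 = 1 / (p - 1) := max_eq_left (by rw [le_div_iff₀ hp1]; linarith)
    set q := p / (p - 1) with hq
    have hq2 : 2 ≤ q := by rw [hq, le_div_iff₀ hp1]; linarith
    have hq1 : q - 1 = 1 / (p - 1) := by rw [hq]; field_simp; ring
    have hqq : q / (q - 1) = p := by rw [hq1, hq]; field_simp
    have hq1' : 1 - 1 / q = 1 / p := by rw [hq]; field_simp; ring
    have hq1'' : 1 / q = 1 - 1 / p := by rw [hq]; field_simp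
    have hpe : p * (1 / (p - 1)) = q := by rw [hq]; field_simp
    have hi0 : 0 ≤ 1 / (p - 1) := by positivity
    have hcube' : ∀ i, weighted μ (dualWeight p a) (Q i) * weighted μ a (Q i) ^ (q - 1) ≤
        (A * G ^ p) ^ (1 / (p - 1)) * μ (Q i) ^ q := by
      intro i
      have := ENNReal.rpow_le_rpow (hcube i) hi0
      rw [ENNReal.mul_rpow_of_nonneg _ _ hi0, ENNReal.mul_rpow_of_nonneg _ _ hi0, ← ENNReal.rpow_mul,
        mul_one_div_cancel hp1.ne', ENNReal.rpow_one, ← ENNReal.rpow_mul, hpe] at this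
      rw [hq1, mul_comm]
      exact this
    have hHol' : ∀ i, μ (E i) ^ q ≤ weighted μ (dualWeight p a) (E i) * weighted μ a (E i) ^ (q - 1) := by
      intro i
      have := ENNReal.rpow_le_rpow (hHol i) hi0
      rw [ENNReal.mul_rpow_of_nonneg _ _ hi0, ← ENNReal.rpow_mul, ← ENNReal.rpow_mul,
        mul_one_div_cancel hp1.ne', ENNReal.rpow_one, hpe] at this
      rw [hq1, mul_comm]
      exact this
    have := bilinear_le_of_two_le D hμ0 hμt hξ0 hξt hν0 hνt hq2 hQ hE hsub hd hL hcube' hHol' hh hg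
    rw [hqq, hq1', hq1''] at this
    refine le_trans (le_of_eq (tsum_congr fun i => by rw [mul_comm])) (this.trans ?_)
    rw [hmax, mul_comm ((∫⁻ t, h t ^ q ∂(weighted μ a)) ^ (1 - 1 / p))]
    refine mul_le_mul_left ?_ _
    rw [weightConst, add_mul]
    refine le_trans (le_of_eq ?_) le_add_self
    rw [ENNReal.mul_rpow_of_nonneg _ _ hi0]
    ring

/-- The weighted bound for sparse operators. -/
theorem lintegral_sparse_rpow_le (H : IsHomogeneousType d μ cd cμ) (hcd : 1 ≤ cd) (hc₀ : 0 < c₀)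
    (hC₀ : c₀ ≤ C₀) (hδ : 0 < δ) (D : Fin m → DyadicSystem d c₀ C₀ δ) (z : S) (hp : 1 < p)
    (ha : IsWeight d μ a) (hap : apChar d μ p a ≠ ∞) {L : ℝ≥0} (hL0 : L ≠ 0) {𝒮 : Set (Set S)}
    (hQ : ∀ Q ∈ 𝒮, ∃ j, (D j).IsCube Q) (hS : IsSparse μ L⁻¹ 𝒮)
    {g : S → ℝ≥0∞} (hg : Measurable g) :
    (∫⁻ s, (∑' Q : 𝒮, (Q : Set S).indicator (fun _ => avg μ g 1 Q) s) ^ p ∂(weighted μ a)) ^ (1 / p) ≤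
      weightConst cd cμ m c₀ C₀ L p * apChar d μ p a ^ max (1 / (p - 1)) 1 *
        (∫⁻ t, g t ^ p ∂(weighted μ a)) ^ (1 / p) := by
  have hp0 : 0 < p := by linarith
  have hp1 : 0 < p - 1 := by linarith
  have hcnt : ∀ j, Countable (D j).Idx := fun j => DyadicSystem.countable_idx H hc₀ hδ
  have hScnt : Countable 𝒮 := by
    have : 𝒮 ⊆ ⋃ j, range (D j).set := by
      intro Q hQS
      obtain ⟨j, k, l, h⟩ := hQ Q hQS
      exact mem_iUnion.2 ⟨j, ⟨k, l⟩, h.symm⟩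
    exact ((countable_iUnion fun j => countable_range _).mono this).to_subtype
  have hQm : ∀ Q : 𝒮, MeasurableSet (Q : Set S) := by
    rintro ⟨Q, hQS⟩
    obtain ⟨j, k, l, rfl⟩ := hQ Q hQS
    exact (D j).measurableSet_cube k l
  obtain ⟨E, hE, hEd⟩ := hS
  have ham := ha.measurable.coe_nnreal_ennreal
  have hbm := (ha.measurable_dualWeight (p := p)).coe_nnreal_ennreal
  set b : S → ℝ≥0∞ := fun s => (dualWeight p a s : ℝ≥0∞) with hb
  have hb0 : ∀ s, b s ≠ 0 := fun s => by
    have := (ha.dualWeight_pos (p := p) s).ne'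
    simpa [hb] using this
  have hbt : ∀ s, b s ≠ ∞ := fun s => ENNReal.coe_ne_top
  -- Dividing by the dual weight makes the problem symmetric: integrals of `g'` against `σ` are
  -- integrals of `g` against `μ`, while the `L^p(σ)` norm of `g'` equals the `L^p(w)` norm of `g`.
  set g' : S → ℝ≥0∞ := fun s => (b s)⁻¹ * g s with hg'
  have hg'm : Measurable g' := hbm.inv.mul hg
  have hbg : ∀ s, b s * g' s = g s := fun s => by
    rw [hg', ← mul_assoc, ENNReal.mul_inv_cancel (hb0 s) (hbt s), one_mul]
  have hint : ∀ Q : 𝒮, ∫⁻ t in (Q : Set S), g' t ∂(weighted μ (dualWeight p a)) =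
      ∫⁻ t in (Q : Set S), g t ∂μ := by
    intro Q
    rw [weighted, setLIntegral_withDensity_eq_setLIntegral_mul _ hbm hg'm (hQm Q)]
    exact lintegral_congr fun s => hbg s
  have hpow : ∫⁻ t, g' t ^ p ∂(weighted μ (dualWeight p a)) = ∫⁻ t, g t ^ p ∂(weighted μ a) := by
    rw [weighted, weighted, lintegral_withDensity_eq_lintegral_mul _ hbm (hg'm.pow_const p),
      lintegral_withDensity_eq_lintegral_mul _ ham (hg.pow_const p)]
    refine lintegral_congr fun s => ?_
    have hne := (ha.pos s).ne'
    have h1 : b s = (a s : ℝ≥0∞) ^ (-(1 / (p - 1))) := by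
      rw [hb]; exact ENNReal.coe_rpow_of_ne_zero hne _
    rw [Pi.mul_apply, Pi.mul_apply, hg', ENNReal.mul_rpow_of_nonneg _ _ hp0.le, ← mul_assoc]
    congr 1
    show b s * (b s)⁻¹ ^ p = _
    rw [h1, ← ENNReal.rpow_neg, ← ENNReal.rpow_mul, ← ENNReal.rpow_add _ _ (by exact_mod_cast hne)
      ENNReal.coe_ne_top, show -(1 / (p - 1)) + - -(1 / (p - 1)) * p = 1 by field_simp; ring,
      ENNReal.rpow_one]
  set Λ : S → ℝ≥0∞ := fun s => ∑' Q : 𝒮, (Q : Set S).indicator (fun _ => avg μ g 1 Q) s with hΛ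
  have hΛm : Measurable Λ := Measurable.tsum fun Q => measurable_const.indicator (hQm Q)
  set N := weightConst cd cμ m c₀ C₀ L p * apChar d μ p a ^ max (1 / (p - 1)) 1 *
        (∫⁻ t, g t ^ p ∂(weighted μ a)) ^ (1 / p) with hN
  have hdual : ∀ h : S → ℝ≥0∞, Measurable h → ∫⁻ s, Λ s * h s ∂(weighted μ a) ≤
      N * (∫⁻ t, h t ^ (p / (p - 1)) ∂(weighted μ a)) ^ (1 - 1 / p) := by
    intro h hh
    have h1 := bilinear_weighted_le H hcd hc₀ hC₀ hδ D hp ha hap (L := L) (Q := fun Q : 𝒮 => (Q : Set S))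
      (E := fun Q : 𝒮 => E Q) (fun Q => hQ Q Q.2) (fun Q => (hE Q Q.2).2.1) (fun Q => (hE Q Q.2).1)
      (fun Q Q' hne => hEd Q.2 Q'.2 (Subtype.coe_injective.ne hne)) (fun Q => by
        calc μ (Q : Set S) = L * (((L⁻¹ : ℝ≥0) : ℝ≥0∞) * μ (Q : Set S)) := by
              rw [← mul_assoc, ← ENNReal.coe_mul, mul_inv_cancel₀ hL0, ENNReal.coe_one, one_mul]
          _ ≤ _ := by gcongr; exact (hE Q Q.2).2.2) hg'm hh
    rw [hpow] at h1
    simp only [hint] at h1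
    refine le_trans (le_of_eq ?_) (h1.trans (le_of_eq ?_))
    · simp only [hΛ, ← ENNReal.tsum_mul_right]
      have h2 : ∀ (Q : 𝒮) s, (Q : Set S).indicator (fun _ => avg μ g 1 Q) s * h s =
          (Q : Set S).indicator (fun s => avg μ g 1 Q * h s) s := fun Q s => by
        by_cases hs : s ∈ (Q : Set S) <;> simp [hs]
      simp only [h2]
      rw [lintegral_tsum fun Q : 𝒮 => ((hh.const_mul _).indicator (hQm Q)).aemeasurable]
      refine tsum_congr fun Q => ?_
      rw [lintegral_indicator (hQm Q), lintegral_const_mul _ hh, avg_one, div_eq_mul_inv,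
        div_eq_mul_inv]
      ring
    · rw [hN]; ring
  -- truncation
  set Λn : ℕ → S → ℝ≥0∞ := fun n => (qball d z n).indicator fun s => min (Λ s) n with hΛn
  have hΛnm : ∀ n, Measurable (Λn n) := fun n =>
    (hΛm.min measurable_const).indicator (H.measurableSet_qball z n)
  have hΛnle : ∀ n s, Λn n s ≤ Λ s := fun n s =>
    (indicator_le_self' (fun _ _ => zero_le) s).trans (min_le_left _ _)
  have hbound : ∀ n, ∫⁻ s, Λn n s ^ p ∂(weighted μ a) ≤ N ^ p := by
    intro n
    set I := ∫⁻ s, Λn n s ^ p ∂(weighted μ a) with hI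
    -- The reason for truncating: testing with `Λn ^ (p - 1)` gives `I ≤ N * I ^ (1 - 1 / p)`, which
    -- yields a bound only if `I` is finite.
    have hIt : I ≠ ∞ := by
      have h1 : I ≤ ∫⁻ s, (qball d z n).indicator (fun _ => (n : ℝ≥0∞) ^ p) s ∂(weighted μ a) := by
        refine lintegral_mono fun s => ?_
        by_cases hs : s ∈ qball d z n
        · simp only [hΛn, indicator_of_mem hs]
          exact ENNReal.rpow_le_rpow (min_le_right _ _) hp0.le
        · simp [hΛn, indicator_of_notMem hs, hp0]
      rw [lintegral_indicator (H.measurableSet_qball z n), setLIntegral_const] at h1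
      exact ne_top_of_le_ne_top (ENNReal.mul_ne_top (ENNReal.rpow_ne_top_of_nonneg hp0.le (by simp))
        (ha.weighted_qball_ne_top H _ _)) h1
    rcases eq_or_ne I 0 with hI0 | hI0
    · rw [hI0]; exact zero_le
    have h1 := hdual (fun s => Λn n s ^ (p - 1)) ((hΛnm n).pow_const _)
    have h2 : ∀ s, (Λn n s ^ (p - 1)) ^ (p / (p - 1)) = Λn n s ^ p := fun s => by
      rw [← ENNReal.rpow_mul, mul_div_cancel₀ _ hp1.ne']
    simp only [h2] at h1
    have h3 : I ≤ N * I ^ (1 - 1 / p) := by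
      refine le_trans (lintegral_mono fun s => ?_) h1
      calc Λn n s ^ p = Λn n s * Λn n s ^ (p - 1) := by
            nth_rewrite 2 [← ENNReal.rpow_one (Λn n s)]
            rw [← ENNReal.rpow_add_of_nonneg _ _ zero_le_one hp1.le, add_sub_cancel]
        _ ≤ _ := by gcongr; exact hΛnle n s
    have h4 : I ^ (1 / p) * I ^ (1 - 1 / p) ≤ N * I ^ (1 - 1 / p) := by
      rw [← ENNReal.rpow_add _ _ hI0 hIt, add_sub_cancel, ENNReal.rpow_one]
      exact h3
    have hq0 : 0 ≤ 1 - 1 / p := by rw [sub_nonneg, div_le_one hp0]; linarith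
    have h5 : I ^ (1 / p) ≤ N := (ENNReal.mul_le_mul_iff_left
      (ENNReal.rpow_pos (pos_iff_ne_zero.2 hI0) hIt).ne'
      (ENNReal.rpow_ne_top_of_nonneg hq0 hIt)).1 h4
    calc I = (I ^ (1 / p)) ^ p := by
          rw [← ENNReal.rpow_mul, one_div, inv_mul_cancel₀ hp0.ne', ENNReal.rpow_one]
      _ ≤ _ := ENNReal.rpow_le_rpow h5 hp0.le
  have hlim : Filter.Tendsto (fun n => ∫⁻ s, Λn n s ^ p ∂(weighted μ a)) Filter.atTop
      (nhds (∫⁻ s, Λ s ^ p ∂(weighted μ a))) := by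
    refine lintegral_tendsto_of_tendsto_of_monotone (fun n => ((hΛnm n).pow_const p).aemeasurable)
      (Filter.Eventually.of_forall fun s => ?_) (Filter.Eventually.of_forall fun s => ?_)
    · intro n n' hnn
      refine ENNReal.rpow_le_rpow ?_ hp0.le
      have hnn' : (n : ℝ) ≤ n' := by exact_mod_cast hnn
      by_cases hs : s ∈ qball d z n
      · simp only [hΛn, indicator_of_mem hs, indicator_of_mem (qball_mono z hnn' hs)]
        exact min_le_min le_rfl (by exact_mod_cast hnn)
      · simp [hΛn, indicator_of_notMem hs]
    · refine (ENNReal.continuous_rpow_const.tendsto _).comp ?_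
      have h1 : Filter.Tendsto (fun n : ℕ => min (Λ s) n) Filter.atTop (nhds (min (Λ s) ∞)) :=
        tendsto_const_nhds.min ENNReal.tendsto_nat_nhds_top
      rw [min_eq_left le_top] at h1
      refine h1.congr' ?_
      obtain ⟨N, hN⟩ := exists_nat_gt (d z s)
      filter_upwards [Filter.eventually_ge_atTop N] with n hn
      have hn' : (N : ℝ) ≤ n := by exact_mod_cast hn
      simp only [hΛn]
      rw [indicator_of_mem]
      exact hN.trans_le hn'
  have hfin : ∫⁻ s, Λ s ^ p ∂(weighted μ a) ≤ N ^ p := le_of_tendsto' hlim hbound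
  calc _ ≤ (N ^ p) ^ (1 / p) := ENNReal.rpow_le_rpow hfin (by positivity)
    _ = N := by rw [← ENNReal.rpow_mul, mul_one_div_cancel hp0.ne', ENNReal.rpow_one]

end Weights

/-! ### Extension to weighted Bochner spaces -/

section WeightedExtension

variable {S : Type u} [MeasurableSpace S] {d : S → S → ℝ} {μ ν : Measure S} {cd : ℝ} {cμ : ℝ≥0}
  {X : Type v} [NormedAddCommGroup X] {Y : Type w} [NormedAddCommGroup Y]
  {𝕜 : Type x} [RCLike 𝕜] [NormedSpace 𝕜 X] [NormedSpace 𝕜 Y] {p : ℝ≥0}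

/-- Extension to `L^p(ν)` of an operator on `L^1(μ)` that is bounded in `L^p(ν)` on functions of
bounded support. -/
theorem exists_strong_extension [CompleteSpace Y] (H : IsHomogeneousType d μ cd cμ) (z : S)
    [hp : Fact (1 ≤ (p : ℝ≥0∞))] (hμν : μ ≪ ν) (hνμ : ν ≪ μ)
    (T₁ : Lp X ((1 : ℝ≥0) : ℝ≥0∞) μ →ₗ[𝕜] (S →ₘ[μ] Y)) {N : ℝ≥0}
    (hN : ∀ g : S → X, StronglyMeasurable g → MemLp g ((1 : ℝ≥0) : ℝ≥0∞) μ →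
      (∃ z ρ, support g ⊆ qball d z ρ) → eLpNorm (onFun T₁ g) p ν ≤ N * eLpNorm g p ν) :
    ∃ Tw : Lp X (p : ℝ≥0∞) ν →L[𝕜] Lp Y (p : ℝ≥0∞) ν,
      (∀ g, eLpNorm (Tw g) p ν ≤ N * eLpNorm g p ν) ∧
      ∀ (g : S → X) (hg : MemLp g p ν), MemLp g ((1 : ℝ≥0) : ℝ≥0∞) μ →
        (∃ ρ, support g ⊆ qball d z ρ) → Tw (hg.toLp g) =ᵐ[ν] onFun T₁ g := by
  have hp0 : p ≠ 0 := (zero_lt_one.trans_le (by exact_mod_cast hp.out)).ne'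
  let V := boundedSupport (X := X) 𝕜 d p ((1 : ℝ≥0) : ℝ≥0∞) hμν z
  have hV : DenseRange V.subtype := by
    rw [DenseRange, Submodule.coe_subtype, Subtype.range_coe]
    intro f
    obtain ⟨E, hEm, hElim, hEs, hEL⟩ :=
      H.exists_truncation z (f := f) (Lp.stronglyMeasurable f).aestronglyMeasurable
    have hEν : ∀ n, MemLp ((E n).indicator f) p ν := fun n => (Lp.memLp f).indicator (hEm n)
    refine mem_closure_of_tendsto (f := fun n => (hEν n).toLp _)
      (b := Filter.atTop) ?_ (Filter.Eventually.of_forall fun n => ?_)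
    · rw [tendsto_iff_edist_tendsto_0]
      refine (tendsto_eLpNorm_sub_indicator hp0 (Lp.memLp f) hEm hElim).congr fun n => ?_
      rw [edist_comm, Lp.edist_def]
      refine eLpNorm_congr_ae ?_
      filter_upwards [(hEν n).coeFn_toLp] with s hs
      rw [Pi.sub_apply, Pi.sub_apply, hs]
    · have h1 := hμν.ae_eq (hEν n).coeFn_toLp
      refine ⟨(hEL n _).ae_eq h1.symm, n, ?_⟩
      filter_upwards [h1] with s hs hs2
      rw [hs, indicator_of_notMem fun h => hs2 (hEs n h)]
  have hbound : ∀ v : V, eLpNorm (T₁ (v.2.1.toLp _)) p ν ≤ N * eLpNorm (v : Lp X (p : ℝ≥0∞) ν) p ν := by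
    intro v
    obtain ⟨hv, ρ, hρ⟩ := v.2
    have heq : (qball d z ρ).indicator (v : Lp X (p : ℝ≥0∞) ν) =ᵐ[μ] (v : Lp X (p : ℝ≥0∞) ν) := by
      filter_upwards [hρ] with s hs
      by_cases h : s ∈ qball d z ρ
      · rw [indicator_of_mem h]
      · rw [indicator_of_notMem h, hs h]
    have h := hN _ ((Lp.stronglyMeasurable (v : Lp X (p : ℝ≥0∞) ν)).indicator
      (H.measurableSet_qball z ρ)) (hv.ae_eq heq.symm) ⟨z, ρ, support_indicator_subset⟩
    rwa [onFun_eq T₁ (hv.ae_eq heq.symm), MemLp.toLp_congr _ hv heq,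
      eLpNorm_congr_ae (hνμ.ae_eq heq)] at h
  have hmem : ∀ v : V, MemLp (T₁ (v.2.1.toLp _)) p ν := fun v =>
    ⟨(AEEqFun.stronglyMeasurable _).aestronglyMeasurable,
      (hbound v).trans_lt (ENNReal.mul_lt_top ENNReal.coe_lt_top (Lp.memLp _).2)⟩
  let A : V →ₗ[𝕜] Lp Y (p : ℝ≥0∞) ν :=
    { toFun := fun v => (hmem v).toLp _
      map_add' := fun f g => by
        rw [← MemLp.toLp_add]
        refine MemLp.toLp_congr _ _ ?_
        have h : T₁ ((f + g).2.1.toLp _) = T₁ (f.2.1.toLp _) + T₁ (g.2.1.toLp _) := by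
          rw [← map_add, ← MemLp.toLp_add]
          exact congrArg T₁ (MemLp.toLp_congr _ _ (hμν.ae_eq (Lp.coeFn_add f.1 g.1)))
        rw [h]
        exact hνμ.ae_eq (AEEqFun.coeFn_add _ _)
      map_smul' := fun c f => by
        rw [RingHom.id_apply, ← MemLp.toLp_const_smul]
        refine MemLp.toLp_congr _ _ ?_
        have h : T₁ ((c • f).2.1.toLp _) = c • T₁ (f.2.1.toLp _) := by
          rw [← map_smul, ← MemLp.toLp_const_smul]
          exact congrArg T₁ (MemLp.toLp_congr _ _ (hμν.ae_eq (Lp.coeFn_smul c f.1)))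
        rw [h]
        exact hνμ.ae_eq (AEEqFun.coeFn_smul _ _) }
  have hnorm : ∀ v : V, ‖A v‖ ≤ N * ‖V.subtype v‖ := by
    intro v
    have h : ‖A v‖ₑ ≤ N * ‖V.subtype v‖ₑ := by
      rw [Lp.enorm_def, Lp.enorm_def]
      exact (eLpNorm_congr_ae (hmem v).coeFn_toLp).trans_le (hbound v)
    rw [enorm_eq_nnnorm, enorm_eq_nnnorm] at h
    have h' : ‖A v‖₊ ≤ N * ‖V.subtype v‖₊ := by exact_mod_cast h
    exact_mod_cast h'
  refine ⟨A.extendOfNorm V.subtype, fun g => ?_, fun g hg hg1 ⟨ρ, hρ⟩ => ?_⟩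
  · have h := A.norm_extendOfNorm_apply_le hV N hnorm g
    have h' : ‖A.extendOfNorm V.subtype g‖₊ ≤ N * ‖g‖₊ := by exact_mod_cast h
    rw [← Lp.enorm_def, ← Lp.enorm_def, enorm_eq_nnnorm, enorm_eq_nnnorm]
    exact_mod_cast h'
  · have hgc := hμν.ae_eq hg.coeFn_toLp
    have hmemV : hg.toLp g ∈ V := by
      refine ⟨hg1.ae_eq hgc.symm, ρ, ?_⟩
      filter_upwards [hgc] with s hs hs2
      rw [hs]
      by_contra hne
      exact hs2 (hρ hne)
    have h := A.extendOfNorm_eq hV ⟨N, hnorm⟩ ⟨hg.toLp g, hmemV⟩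
    have h2 : A.extendOfNorm V.subtype (hg.toLp g) = A ⟨hg.toLp g, hmemV⟩ := h
    rw [h2, onFun_eq T₁ hg1]
    refine (hmem ⟨hg.toLp g, hmemV⟩).coeFn_toLp.trans ?_
    have h3 : (MemLp.toLp _ (hg1.ae_eq hgc.symm) : Lp X ((1 : ℝ≥0) : ℝ≥0∞) μ) = hg1.toLp g :=
      MemLp.toLp_congr _ _ hgc
    exact Filter.EventuallyEq.of_eq (congrArg (fun f => (T₁ f : S → Y)) h3)

/-- The extension to `L^p(ν)` is compatible with an operator on `L^q(μ)` that agrees with it on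
functions of bounded support. -/
theorem strong_extension_ae_eq (H : IsHomogeneousType d μ cd cμ) (z : S)
    [hp : Fact (1 ≤ (p : ℝ≥0∞))] (hμν : μ ≪ ν) {q A : ℝ≥0} (hq : q ≠ 0) {U : (S → X) → S → Y}
    (hU : IsWeakOp μ q A U) (Tw : Lp X (p : ℝ≥0∞) ν →L[𝕜] Lp Y (p : ℝ≥0∞) ν)
    (h : ∀ (g : S → X) (hg : MemLp g p ν), MemLp g ((1 : ℝ≥0) : ℝ≥0∞) μ → MemLp g q μ →
        (∃ ρ, support g ⊆ qball d z ρ) → Tw (hg.toLp g) =ᵐ[ν] U g)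
    (g : Lp X (p : ℝ≥0∞) ν) (hg : MemLp g q μ) : Tw g =ᵐ[μ] U g := by
  have hp0 : p ≠ 0 := (zero_lt_one.trans_le (by exact_mod_cast hp.out)).ne'
  obtain ⟨E, hEm, hElim, hEs, hEL⟩ :=
    H.exists_truncation z (f := g) (Lp.stronglyMeasurable g).aestronglyMeasurable
  have hEν : ∀ n, MemLp ((E n).indicator g) p ν := fun n => (Lp.memLp g).indicator (hEm n)
  have hlim : Filter.Tendsto (fun n => (hEν n).toLp _) Filter.atTop (nhds g) := by
    rw [tendsto_iff_edist_tendsto_0]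
    refine (tendsto_eLpNorm_sub_indicator hp0 (Lp.memLp g) hEm hElim).congr fun n => ?_
    rw [edist_comm, Lp.edist_def]
    refine eLpNorm_congr_ae ?_
    filter_upwards [(hEν n).coeFn_toLp] with s hs
    rw [Pi.sub_apply, Pi.sub_apply, hs]
  -- Two successive subsequences: one along which `Tw` of the truncations converges almost
  -- everywhere, and a further one along which `U` does. The limits agree because the terms do.
  obtain ⟨ns, hns, hae⟩ := (tendstoInMeasure_of_tendsto_Lp
    ((Tw.continuous.tendsto g).comp hlim)).exists_seq_tendsto_ae
  have hlim₁ := fun t ht => hU.tendsto_measure hq (fun n => hEL n _) hg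
    (tendsto_eLpNorm_sub_indicator hq hg hEm hElim) (t := t) ht
  obtain ⟨ms, hms, hae₁⟩ := ((tendstoInMeasure_of_measure_lt hlim₁).comp
    hns.tendsto_atTop).exists_seq_tendsto_ae
  have heq : ∀ᵐ s ∂μ, ∀ n, Tw ((hEν n).toLp _) s = U ((E n).indicator g) s :=
    ae_all_iff.2 fun n => hμν.ae_eq
      (h _ (hEν n) (hEL n _) (hEL n _) ⟨n, support_indicator_subset.trans (hEs n)⟩)
  filter_upwards [hμν.ae_le hae, hae₁, heq] with s h1 h2 h3
  refine tendsto_nhds_unique (h1.comp hms.tendsto_atTop) (h2.congr fun n => ?_)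
  exact (h3 _).symm

end WeightedExtension

/-! ### Assembly of the constants and of the theorem -/

section Main

variable {S : Type u} [MeasurableSpace S] {d : S → S → ℝ} {μ : Measure S} {cd : ℝ} {cμ : ℝ≥0}
  {X : Type v} [NormedAddCommGroup X] {Y : Type w} [NormedAddCommGroup Y]
  {𝕜 : Type x} [RCLike 𝕜] [NormedSpace 𝕜 X] [NormedSpace 𝕜 Y]
  {c₀ C₀ δ γ : ℝ} {m : ℕ} {ω : ℝ → ℝ≥0} {K : S → S → X →L[𝕜] Y} {cK : ℝ} {p : ℝ≥0}

theorem weakNorm_le_weakOpNorm {T : Lp X (p : ℝ≥0∞) μ →ₗ[𝕜] (S →ₘ[μ] Y)} (htop : weakOpNorm T ≠ ∞)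
    (f : Lp X (p : ℝ≥0∞) μ) :
    weakNorm p μ (T f) ≤ weakOpNorm T * eLpNorm f p μ := by
  have ht : eLpNorm f p μ ≠ ∞ := (Lp.memLp f).2.ne
  rcases eq_or_ne (eLpNorm f p μ) 0 with h0 | h0
  · obtain ⟨C, hC, -⟩ := sInf_lt_iff.1 (lt_top_iff_ne_top.2 htop)
    refine (hC f).trans ?_
    rw [h0, mul_zero, mul_zero]
  · rw [← ENNReal.div_le_iff h0 ht]
    exact le_sInf fun C hC => (ENNReal.div_le_iff h0 ht).2 (hC f)

theorem eq_zero_of_weakOpNorm_eq_zero (hp : p ≠ 0) {T : Lp X (p : ℝ≥0∞) μ →ₗ[𝕜] (S →ₘ[μ] Y)}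
    (hT : weakOpNorm T = 0) : T = 0 := by
  refine LinearMap.ext fun f => AEEqFun.ext ?_
  have hp0 : (0 : ℝ) < 1 / p := by positivity
  have h : T f =ᵐ[μ] 0 := by
    refine ae_eq_zero_of_forall_measure fun t ht => ?_
    have h1 := weak_of_weakNorm_le hp (weakNorm_le_weakOpNorm (T := T) (by simp [hT]) f) t
    rw [hT, zero_mul, nonpos_iff_eq_zero, mul_eq_zero, or_iff_right ht] at h1
    exact (ENNReal.rpow_eq_zero_iff_of_pos hp0).1 h1
  exact h.trans AEEqFun.coeFn_zero.symm

/-- The dilation parameter in the sparse domination. -/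
noncomputable def dilation (cd cK δ : ℝ) : ℝ := 8 * cd ^ 2 * cK + (2 * cd + 3 * cd ^ 2 / δ)

/-- The ratio of the weak-type bounds on `L^1` and on `L^p`. -/
noncomputable def extConst (cd : ℝ) (cμ : ℝ≥0) (c₀ C₀ δ cK : ℝ) (p : ℝ≥0) : ℝ≥0 :=
  czConst cd cμ c₀ C₀ δ (8 * cd ^ 2 * cK) (dbl cd cμ (8 * cd ^ 2)) p + 1

/-- Besides the weak `(1,1)` bound, the extension keeps the oscillation estimate and agrees with `T`
on the intersection; sparse domination uses only the first two properties, never the kernel. -/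
theorem exists_lOne_extension [CompleteSpace X] [CompleteSpace Y] (H : IsHomogeneousType d μ cd cμ)
    (hcd : 1 ≤ cd) (hcμ : 1 ≤ cμ) (hc₀ : 0 < c₀) (hC₀ : c₀ ≤ C₀) (hδ : 0 < δ) (hδ' : δ < 1)
    (D : DyadicSystem d c₀ C₀ δ) (z : S) (hp : 1 ≤ p) (hK : IsDiniKernel d μ K ω cK)
    (T : Lp X (p : ℝ≥0∞) μ →ₗ[𝕜] (S →ₘ[μ] Y)) (hT : HasKernel d T K) {A : ℝ≥0} (hA : A ≠ 0)
    (hTA : weakOpNorm T < A) (hdini : diniNorm ω ≤ A) :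
    ∃ T₁ : Lp X ((1 : ℝ≥0) : ℝ≥0∞) μ →ₗ[𝕜] (S →ₘ[μ] Y),
      (∀ f, weakNorm 1 μ (T₁ f) ≤
        ((extConst cd cμ c₀ C₀ δ cK p * A : ℝ≥0) : ℝ≥0∞) * eLpNorm f ((1 : ℝ≥0) : ℝ≥0∞) μ) ∧
      HasOscillation d μ ω 1 (8 * cd ^ 2 * cK) (dbl cd cμ (8 * cd ^ 2)) (onFun T₁) ∧
      ∀ f : S → X, MemLp f p μ → MemLp f ((1 : ℝ≥0) : ℝ≥0∞) μ → onFun T₁ f =ᵐ[μ] onFun T f := by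
  let : NormedSpace ℝ X := NormedSpace.restrictScalars ℝ 𝕜 X
  have hp0 : p ≠ 0 := (zero_lt_one.trans_le hp).ne'
  have hM : 0 < 8 * cd ^ 2 * cK := by have := hK.two_le; positivity
  have hU := isWeakOp_onFun hp0 T (weakNorm_le_of_weakOpNorm_lt hTA)
  have hdecay := hasAtomDecay_of_hasKernel H hp hcd hcμ hK hT
  have hosc := hasOscillation_of_hasKernel H hcd hcμ hK hT
  have hw : ∀ f : S → X, MemLp f p μ → (∃ z ρ, support f ⊆ qball d z ρ) → ∀ t : ℝ≥0∞,
      t * μ {s | t < ‖onFun T f s‖ₑ} ≤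
        ((extConst cd cμ c₀ C₀ δ cK p * A : ℝ≥0) : ℝ≥0∞) * ∫⁻ s, ‖f s‖ₑ ∂μ := by
    rintro f hf ⟨x, R, hfs⟩ t
    refine (weak_one_of_atomDecay H hcd hcμ hc₀ hC₀ hδ hδ' D hp hU hdecay hK.monotoneOn hM hA hdini
      hf hfs t).trans ?_
    rw [← mul_assoc, extConst]
    push_cast
    gcongr
    exact le_self_add
  obtain ⟨T₁, hT₁, hcons⟩ := exists_extension_one H hcd z T hw
  have hU₁ := isWeakOp_onFun one_ne_zero T₁ hT₁
  exact ⟨T₁, hT₁, HasOscillation.of_bounded_support H hU₁ hcons hosc,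
    fun f hf hf1 => IsWeakOp.ae_eq_of_bounded_support H z hp0 one_ne_zero hU hU₁ hcons hf hf1⟩

theorem sparseOp_congr {f g : S → X} (h : f =ᵐ[μ] g) (𝒮 : Set (Set S)) (s : S) :
    sparseOp μ 𝒮 f s = sparseOp μ 𝒮 g s := by
  refine tsum_congr fun Q => ?_
  congr 1
  funext _
  rw [avg_one, avg_one]
  congr 1
  refine lintegral_congr_ae (ae_restrict_of_ae ?_)
  filter_upwards [h] with s hs
  rw [hs]

/-- The constant in the sparse domination. -/
noncomputable def sparseConst (cd : ℝ) (cμ : ℝ≥0) (m : ℕ) (c₀ C₀ δ γ cK : ℝ) : ℝ≥0 :=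
  stepConst cd cμ m c₀ C₀ δ γ (dilation cd cK δ) (dbl cd cμ (8 * cd ^ 2)) * dbl cd cμ (γ + 1) *
    sparsity cd cμ c₀ C₀ γ (dilation cd cK δ)

theorem exists_sparse_onFun (H : IsHomogeneousType d μ cd cμ) (hcd : 1 ≤ cd) (hcμ : 1 ≤ cμ)
    (hc₀ : 0 < c₀) (hC₀ : c₀ ≤ C₀) (hδ : 0 < δ) (hδcd : 2 * cd * δ ≤ 1) (hγ : 1 ≤ γ)
    {D : Fin m → DyadicSystem d c₀ C₀ δ} (hD : IsAdjacent D γ) (hcK : 2 ≤ cK)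
    {T₁ : Lp X ((1 : ℝ≥0) : ℝ≥0∞) μ →ₗ[𝕜] (S →ₘ[μ] Y)} {A : ℝ≥0} (hA : A ≠ 0)
    (hT₁ : ∀ f, weakNorm 1 μ (T₁ f) ≤ A * eLpNorm f ((1 : ℝ≥0) : ℝ≥0∞) μ)
    (hosc : HasOscillation d μ ω 1 (8 * cd ^ 2 * cK) (dbl cd cμ (8 * cd ^ 2)) (onFun T₁))
    (hω : MonotoneOn ω (Icc 0 1)) (hdini : diniNorm ω ≤ A)
    {f : S → X} (hf : MemLp f ((1 : ℝ≥0) : ℝ≥0∞) μ) {z : S} {ρ : ℝ} (hfs : support f ⊆ qball d z ρ) :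
    ∃ 𝒮 : Set (Set S), (∀ Q ∈ 𝒮, ∃ j, (D j).IsCube Q) ∧
      IsSparse μ (sparsity cd cμ c₀ C₀ γ (dilation cd cK δ))⁻¹ 𝒮 ∧
      ∀ᵐ s ∂μ, ‖onFun T₁ f s‖ₑ ≤ sparseConst cd cμ m c₀ C₀ δ γ cK * A * sparseOp μ 𝒮 f s := by
  have h1 : 0 ≤ 8 * cd ^ 2 * cK := by positivity
  have h2 : 0 ≤ 3 * cd ^ 2 / δ := by positivity
  exact exists_sparse_domination H hcd hcμ hc₀ hC₀ hδ hδcd hγ hD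
    (isWeakOp_onFun one_ne_zero T₁ hT₁) hosc hω hA hdini
    (by rw [dilation]; linarith) (by rw [dilation]; linarith) (by rw [dilation]; linarith) hf hfs

theorem sparsity_ne_zero (hcμ : 1 ≤ cμ) (c₀ C₀ γ α : ℝ) : sparsity cd cμ c₀ C₀ γ α ≠ 0 :=
  mul_ne_zero two_ne_zero (mul_ne_zero (zero_lt_one.trans_le (one_le_dbl hcμ _)).ne'
    (zero_lt_one.trans_le (one_le_dbl hcμ _)).ne')

theorem one_lt_sparsity (hcμ : 1 ≤ cμ) (c₀ C₀ γ α : ℝ) : 1 < sparsity cd cμ c₀ C₀ γ α := by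
  calc (1 : ℝ≥0) < 2 * (1 * 1) := by norm_num
    _ ≤ _ := by rw [sparsity]; gcongr <;> exact one_le_dbl hcμ _

theorem eLpNorm_onFun_le (H : IsHomogeneousType d μ cd cμ) (hcd : 1 ≤ cd) (hcμ : 1 ≤ cμ)
    (hc₀ : 0 < c₀) (hC₀ : c₀ ≤ C₀) (hδ : 0 < δ) (hδcd : 2 * cd * δ ≤ 1) (hγ : 1 ≤ γ)
    {D : Fin m → DyadicSystem d c₀ C₀ δ} (hD : IsAdjacent D γ) (hcK : 2 ≤ cK)
    {T₁ : Lp X ((1 : ℝ≥0) : ℝ≥0∞) μ →ₗ[𝕜] (S →ₘ[μ] Y)} {A : ℝ≥0} (hA : A ≠ 0)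
    (hT₁ : ∀ f, weakNorm 1 μ (T₁ f) ≤ A * eLpNorm f ((1 : ℝ≥0) : ℝ≥0∞) μ)
    (hosc : HasOscillation d μ ω 1 (8 * cd ^ 2 * cK) (dbl cd cμ (8 * cd ^ 2)) (onFun T₁))
    (hω : MonotoneOn ω (Icc 0 1)) (hdini : diniNorm ω ≤ A) (hp : 1 < p) {a : S → ℝ≥0}
    (ha : IsWeight d μ a) (hap : apChar d μ p a ≠ ∞)
    {f : S → X} (hfm : StronglyMeasurable f) (hf : MemLp f ((1 : ℝ≥0) : ℝ≥0∞) μ)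
    (hfs : ∃ z ρ, support f ⊆ qball d z ρ) :
    eLpNorm (onFun T₁ f) p (weighted μ a) ≤ sparseConst cd cμ m c₀ C₀ δ γ cK * A *
      (weightConst cd cμ m c₀ C₀ (sparsity cd cμ c₀ C₀ γ (dilation cd cK δ)) p *
        apChar d μ p a ^ max (1 / ((p : ℝ) - 1)) 1 * eLpNorm f p (weighted μ a)) := by
  obtain ⟨z, ρ, hfs⟩ := hfs
  have hp0 : p ≠ 0 := (zero_lt_one.trans hp).ne'
  have hp0' : (0 : ℝ) < p := by positivity
  obtain ⟨𝒮, hQ, hS, hle⟩ := exists_sparse_onFun H hcd hcμ hc₀ hC₀ hδ hδcd hγ hD hcK hA hT₁ hosc hω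
    hdini hf hfs
  have hw := lintegral_sparse_rpow_le H hcd hc₀ hC₀ hδ D z (by exact_mod_cast hp : (1 : ℝ) < p) ha hap
    (sparsity_ne_zero hcμ c₀ C₀ γ (dilation cd cK δ)) hQ hS hfm.enorm
  rw [eLpNorm_nnreal_eq_lintegral hp0, eLpNorm_nnreal_eq_lintegral hp0]
  set B : ℝ≥0∞ := sparseConst cd cμ m c₀ C₀ δ γ cK * A with hB
  have hBt : B ≠ ∞ := ENNReal.mul_ne_top ENNReal.coe_ne_top ENNReal.coe_ne_top
  calc (∫⁻ s, ‖onFun T₁ f s‖ₑ ^ (p : ℝ) ∂(weighted μ a)) ^ (1 / (p : ℝ))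
      ≤ (∫⁻ s, B ^ (p : ℝ) * sparseOp μ 𝒮 f s ^ (p : ℝ) ∂(weighted μ a)) ^ (1 / (p : ℝ)) := by
        refine ENNReal.rpow_le_rpow (lintegral_mono_ae ?_) (by positivity)
        filter_upwards [weighted_absolutelyContinuous.ae_le hle] with s hs
        rw [← ENNReal.mul_rpow_of_nonneg _ _ hp0'.le]
        exact ENNReal.rpow_le_rpow hs hp0'.le
    _ = B * (∫⁻ s, sparseOp μ 𝒮 f s ^ (p : ℝ) ∂(weighted μ a)) ^ (1 / (p : ℝ)) := by
        rw [lintegral_const_mul' _ _ (ENNReal.rpow_ne_top_of_nonneg hp0'.le hBt),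
          ENNReal.mul_rpow_of_nonneg _ _ (by positivity), ← ENNReal.rpow_mul,
          mul_one_div_cancel hp0'.ne', ENNReal.rpow_one]
    _ ≤ _ := by gcongr; exact hw

end Main

end SparseDini

open SparseDini
theorem theorem6p1 (cd : ℝ) (hcd : 1 ≤ cd) (cμ : ℝ≥0) (hcμ : 1 ≤ cμ) :
    -- parameters of adjacent dyadic systems, depending only on `cd` and `cμ`
    ∃ (m : ℕ) (c₀ C₀ δ γ : ℝ), 0 < c₀ ∧ c₀ ≤ C₀ ∧ 0 < δ ∧ δ < 1 ∧ 1 ≤ γ ∧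
      (∀ (S : Type u) [MeasurableSpace S] (d : S → S → ℝ) (μ : Measure S),
        IsHomogeneousType d μ cd cμ →
          ∃ D : Fin m → DyadicSystem d c₀ C₀ δ, IsAdjacent D γ) ∧
      ∀ cK : ℝ, 2 ≤ cK → ∃ η : ℝ≥0, 0 < η ∧ η < 1 ∧
      ∀ p₀ : ℝ≥0, 1 ≤ p₀ → ∃ (C : ℝ≥0) (Cw : ℝ≥0 → ℝ≥0),
      ∀ (S : Type u) [MeasurableSpace S] (d : S → S → ℝ) (μ : Measure S),
        IsHomogeneousType d μ cd cμ →
      ∀ (𝕜 : Type x) [RCLike 𝕜]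
        (X : Type v) [NormedAddCommGroup X] [NormedSpace 𝕜 X] [CompleteSpace X]
        (Y : Type w) [NormedAddCommGroup Y] [NormedSpace 𝕜 Y] [CompleteSpace Y]
        (K : S → S → X →L[𝕜] Y) (ω : ℝ → ℝ≥0), IsDiniKernel d μ K ω cK →
      ∀ T : Lp X (p₀ : ℝ≥0∞) μ →ₗ[𝕜] (S →ₘ[μ] Y), weakOpNorm T < ∞ → HasKernel d T K →
        -- `T` extends to `L^1(S;X)`, and the extension has pointwise sparse domination
        (∃ T₁ : Lp X ((1 : ℝ≥0) : ℝ≥0∞) μ →ₗ[𝕜] (S →ₘ[μ] Y),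
          weakOpNorm T₁ < ∞ ∧
          (∀ (f₁ : Lp X ((1 : ℝ≥0) : ℝ≥0∞) μ) (f : Lp X (p₀ : ℝ≥0∞) μ),
            f₁ =ᵐ[μ] f → T₁ f₁ = T f) ∧
          ∀ D : Fin m → DyadicSystem d c₀ C₀ δ, IsAdjacent D γ →
          ∀ f : Lp X ((1 : ℝ≥0) : ℝ≥0∞) μ, (∃ z ρ, ∀ᵐ s ∂μ, s ∉ qball d z ρ → f s = 0) →
            ∃ 𝒮 : Set (Set S), (∀ Q ∈ 𝒮, ∃ j, (D j).IsCube Q) ∧ IsSparse μ η 𝒮 ∧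
              ∀ᵐ s ∂μ, ‖T₁ f s‖ₑ ≤ C * (weakOpNorm T + diniNorm ω) * sparseOp μ 𝒮 f s) ∧
        -- `T` extends to `L^p(S,w;X)` with the sharp weighted bound
        (∀ p : ℝ≥0, 1 < p → ∀ a : S → ℝ≥0, IsWeight d μ a → apChar d μ p a < ∞ →
          ∃ Tw : Lp X (p : ℝ≥0∞) (weighted μ a) →ₗ[𝕜] Lp Y (p : ℝ≥0∞) (weighted μ a),
            (∀ (g : Lp X (p : ℝ≥0∞) (weighted μ a)) (f : Lp X (p₀ : ℝ≥0∞) μ),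
              g =ᵐ[μ] f → Tw g =ᵐ[μ] T f) ∧
            ∀ g : Lp X (p : ℝ≥0∞) (weighted μ a),
              eLpNorm (Tw g) p (weighted μ a) ≤
                Cw p * (weakOpNorm T + diniNorm ω) *
                  apChar d μ p a ^ max (1 / ((p : ℝ) - 1)) 1 *
                  eLpNorm g p (weighted μ a)) := by
  obtain ⟨m, c₀, C₀, δ, γ, hc₀, hC₀, hδ, hδcd, hγ, hex⟩ := exists_adjacent cd hcd cμ
  have hδ1 : δ < 1 := by nlinarith
  refine ⟨m, c₀, C₀, δ, γ, hc₀, hC₀, hδ, hδ1, hγ, hex, fun cK hcK => ?_⟩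
  set L := sparsity cd cμ c₀ C₀ γ (dilation cd cK δ) with hL
  have hL1 : 1 < L := one_lt_sparsity hcμ c₀ C₀ γ _
  refine ⟨L⁻¹, inv_pos.2 (zero_lt_one.trans hL1), inv_lt_one_of_one_lt₀ hL1, fun p₀ hp₀ => ?_⟩
  have hp₀0 : p₀ ≠ 0 := (zero_lt_one.trans_le hp₀).ne'
  set B := extConst cd cμ c₀ C₀ δ cK p₀ with hB
  have hB1 : 1 ≤ B := le_add_self
  set C₁ := sparseConst cd cμ m c₀ C₀ δ γ cK with hC₁
  refine ⟨C₁ * (B * 2), fun p => C₁ * (B * 2) * (weightConst cd cμ m c₀ C₀ L p).toNNReal, ?_⟩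
  intro S _ d μ H 𝕜 _ X _ _ _ Y _ _ _ K ω hK T hTtop hT
  have hacw : ∀ a : S → ℝ≥0, IsWeight d μ a → μ ≪ weighted μ a := fun a ha =>
    absolutelyContinuous_weighted ha.measurable ha.pos
  -- the zero operator
  have hzero : T = 0 → _ := fun h0 : T = 0 => And.intro
    (⟨0, by
        refine lt_of_le_of_lt (sInf_le fun f => ?_) (ENNReal.zero_lt_top)
        rw [LinearMap.zero_apply, zero_mul]
        refine iSup_le fun t => le_of_eq ?_
        have h1 : μ {s | (t : ℝ≥0∞) < ‖(0 : S →ₘ[μ] Y) s‖ₑ} = 0 := by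
          have h2 : ∀ᵐ s ∂μ, ¬ (t : ℝ≥0∞) < ‖(0 : S →ₘ[μ] Y) s‖ₑ := by
            filter_upwards [AEEqFun.coeFn_zero (μ := μ) (α := S) (β := Y)] with s hs
            simp [hs]
          simpa only [not_not] using ae_iff.1 h2
        rw [h1]; simp,
      fun f₁ f _ => by rw [h0]; rfl,
      fun D hD f hf => ⟨∅, by simp, ⟨fun _ => ∅, by simp, by simp⟩, by
        filter_upwards [AEEqFun.coeFn_zero (μ := μ) (α := S) (β := Y)] with s hs
        rw [LinearMap.zero_apply, hs]; simp⟩⟩ :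
      ∃ T₁ : Lp X ((1 : ℝ≥0) : ℝ≥0∞) μ →ₗ[𝕜] (S →ₘ[μ] Y),
          weakOpNorm T₁ < ∞ ∧
          (∀ (f₁ : Lp X ((1 : ℝ≥0) : ℝ≥0∞) μ) (f : Lp X (p₀ : ℝ≥0∞) μ),
            f₁ =ᵐ[μ] f → T₁ f₁ = T f) ∧
          ∀ D : Fin m → DyadicSystem d c₀ C₀ δ, IsAdjacent D γ →
          ∀ f : Lp X ((1 : ℝ≥0) : ℝ≥0∞) μ, (∃ z ρ, ∀ᵐ s ∂μ, s ∉ qball d z ρ → f s = 0) →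
            ∃ 𝒮 : Set (Set S), (∀ Q ∈ 𝒮, ∃ j, (D j).IsCube Q) ∧ IsSparse μ L⁻¹ 𝒮 ∧
              ∀ᵐ s ∂μ, ‖T₁ f s‖ₑ ≤ ((C₁ * (B * 2) : ℝ≥0) : ℝ≥0∞) * (weakOpNorm T + diniNorm ω) *
                sparseOp μ 𝒮 f s)
    (fun (p : ℝ≥0) (_ : 1 < p) (a : S → ℝ≥0) (ha : IsWeight d μ a) (_ : apChar d μ p a < ∞) =>
      (⟨0, fun g f _ => by
          rw [h0, LinearMap.zero_apply, LinearMap.zero_apply]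
          exact ((hacw a ha).ae_eq (Lp.coeFn_zero Y p _)).trans AEEqFun.coeFn_zero.symm,
        fun g => by
          rw [LinearMap.zero_apply, eLpNorm_congr_ae (Lp.coeFn_zero Y p _), eLpNorm_zero]
          exact zero_le⟩ :
        ∃ Tw : Lp X (p : ℝ≥0∞) (weighted μ a) →ₗ[𝕜] Lp Y (p : ℝ≥0∞) (weighted μ a),
            (∀ (g : Lp X (p : ℝ≥0∞) (weighted μ a)) (f : Lp X (p₀ : ℝ≥0∞) μ),
              g =ᵐ[μ] f → Tw g =ᵐ[μ] T f) ∧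
            ∀ g : Lp X (p : ℝ≥0∞) (weighted μ a),
              eLpNorm (Tw g) p (weighted μ a) ≤
                ((C₁ * (B * 2) * (weightConst cd cμ m c₀ C₀ L p).toNNReal : ℝ≥0) : ℝ≥0∞) *
                  (weakOpNorm T + diniNorm ω) *
                  apChar d μ p a ^ max (1 / ((p : ℝ) - 1)) 1 *
                  eLpNorm g p (weighted μ a)))
  -- The estimates need a positive constant `A`. If the norms vanish, or if `S` is empty, then `T =
  -- 0` and the empty sparse family serves.
  rcases eq_or_ne (weakOpNorm T + diniNorm ω) 0 with hCT | hCT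
  · exact hzero (eq_zero_of_weakOpNorm_eq_zero hp₀0 (add_eq_zero.1 hCT).1)
  rcases isEmpty_or_nonempty S with hS | ⟨⟨z⟩⟩
  · refine hzero (LinearMap.ext fun f => AEEqFun.ext ?_)
    exact Filter.Eventually.of_forall fun s => isEmptyElim s
  clear hzero
  have hCTt : weakOpNorm T + diniNorm ω ≠ ∞ := ENNReal.add_ne_top.2 ⟨hTtop.ne, hK.dini_lt_top.ne⟩
  obtain ⟨A₀, hA₀⟩ : ∃ A₀ : ℝ≥0, (A₀ : ℝ≥0∞) = weakOpNorm T + diniNorm ω :=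
    ⟨_, ENNReal.coe_toNNReal hCTt⟩
  have hA₀0 : A₀ ≠ 0 := by rintro rfl; exact hCT (by rw [← hA₀]; rfl)
  -- Doubling makes the bound strict, so that some admissible weak-type constant lies below it; this
  -- is the factor `2` in the final constants.
  have hlt : A₀ < 2 * A₀ := by
    rw [two_mul]; exact lt_add_of_pos_right _ (pos_iff_ne_zero.2 hA₀0)
  have hTA : weakOpNorm T < (2 * A₀ : ℝ≥0) := by
    refine lt_of_le_of_lt (le_self_add (b := diniNorm ω)) ?_
    rw [← hA₀]; exact_mod_cast hlt
  have hωA : diniNorm ω ≤ (2 * A₀ : ℝ≥0) := by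
    refine le_trans (le_add_self (b := weakOpNorm T)) ?_
    rw [← hA₀]; exact_mod_cast hlt.le
  -- The extension and the weighted bound do not mention dyadic systems, so any adjacent family can
  -- be used for them. In the sparse statement the given family `D` replaces it, for the same
  -- operator `T₁`.
  obtain ⟨D₀, hD₀⟩ := hex S d μ H
  obtain ⟨i₀, -⟩ := hD₀ z 1 one_pos
  obtain ⟨T₁, hT₁, hosc, hcons⟩ := exists_lOne_extension H hcd hcμ hc₀ hC₀ hδ hδ1 (D₀ i₀) z hp₀ hK T hT
    (mul_ne_zero two_ne_zero hA₀0) hTA hωA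
  set A := B * (2 * A₀) with hA
  have hA0 : A ≠ 0 := mul_ne_zero (zero_lt_one.trans_le hB1).ne' (mul_ne_zero two_ne_zero hA₀0)
  have hωA' : diniNorm ω ≤ A := by
    refine hωA.trans ?_
    exact_mod_cast le_mul_of_one_le_left zero_le hB1
  have hCA : ((C₁ * (B * 2) : ℝ≥0) : ℝ≥0∞) * (weakOpNorm T + diniNorm ω) = C₁ * A := by
    rw [← hA₀, hA]; push_cast; ring
  have hU := isWeakOp_onFun hp₀0 T (weakNorm_le_of_weakOpNorm_lt hTA)
  have hU₁ := isWeakOp_onFun one_ne_zero T₁ hT₁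
  refine ⟨⟨T₁, ?_, ?_, ?_⟩, ?_⟩
  · exact lt_of_le_of_lt (sInf_le fun f => hT₁ f) ENNReal.coe_lt_top
  · intro f₁ f hff
    have h1 : MemLp f₁ p₀ μ := (Lp.memLp f).ae_eq hff.symm
    have h2 := hcons f₁ h1 (Lp.memLp f₁)
    have h3 := hU.congr hp₀0 h1 hff
    rw [onFun_coe] at h2 h3
    exact AEEqFun.ext (h2.trans h3)
  · rintro D hD f ⟨x, ρ, hfρ⟩
    have heq : (qball d x ρ).indicator f =ᵐ[μ] f := by
      filter_upwards [hfρ] with s hs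
      by_cases h : s ∈ qball d x ρ
      · rw [indicator_of_mem h]
      · rw [indicator_of_notMem h, hs h]
    have hf1 := (Lp.memLp f).ae_eq heq.symm
    obtain ⟨𝒮, h1, h2, h3⟩ := exists_sparse_onFun H hcd hcμ hc₀ hC₀ hδ hδcd hγ hD hcK hA0 hT₁ hosc
      hK.monotoneOn hωA' hf1 support_indicator_subset
    refine ⟨𝒮, h1, h2, ?_⟩
    have h4 := hU₁.congr one_ne_zero hf1 heq
    rw [onFun_coe] at h4
    filter_upwards [h3, h4] with s hs1 hs2
    rw [hCA, ← hs2, ← sparseOp_congr heq]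
    exact hs1
  · intro p hp a ha hap
    have hfact : Fact (1 ≤ (p : ℝ≥0∞)) := ⟨by exact_mod_cast hp.le⟩
    have hp' : (1 : ℝ) < p := by exact_mod_cast hp
    have hWt := weightConst_ne_top cd cμ m c₀ C₀ L hp'
    have hat : apChar d μ p a ^ max (1 / ((p : ℝ) - 1)) 1 ≠ ∞ :=
      ENNReal.rpow_ne_top_of_nonneg (zero_le_one.trans (le_max_right _ _)) hap.ne
    have hN : ∀ g : S → X, StronglyMeasurable g → MemLp g ((1 : ℝ≥0) : ℝ≥0∞) μ →
        (∃ z ρ, support g ⊆ qball d z ρ) → eLpNorm (onFun T₁ g) p (weighted μ a) ≤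
          ((C₁ * A * ((weightConst cd cμ m c₀ C₀ L p).toNNReal *
            (apChar d μ p a ^ max (1 / ((p : ℝ) - 1)) 1).toNNReal) : ℝ≥0) : ℝ≥0∞) *
            eLpNorm g p (weighted μ a) := by
      intro g hgm hg hgs
      refine (eLpNorm_onFun_le H hcd hcμ hc₀ hC₀ hδ hδcd hγ hD₀ hcK hA0 hT₁ hosc hK.monotoneOn hωA' hp
        ha hap.ne hgm hg hgs).trans (le_of_eq ?_)
      push_cast
      rw [ENNReal.coe_toNNReal hWt, ENNReal.coe_toNNReal hat]
      ring
    obtain ⟨Tw, hTw, hTwc⟩ := exists_strong_extension H z (hacw a ha) weighted_absolutelyContinuous T₁ hN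
    refine ⟨Tw, fun g f hgf => ?_, fun g => ?_⟩
    · have hg : MemLp g p₀ μ := (Lp.memLp f).ae_eq hgf.symm
      have h1 := strong_extension_ae_eq H z (hacw a ha) hp₀0 hU Tw
        (fun g hg hg1 hgq hgs => (hTwc g hg hg1 hgs).trans
          (weighted_absolutelyContinuous.ae_eq (hcons g hgq hg1))) g hg
      have h2 := hU.congr hp₀0 hg hgf
      rw [onFun_coe] at h2
      exact h1.trans h2
    · refine (hTw g).trans (le_of_eq ?_)
      have h1 : ((C₁ * (B * 2) * (weightConst cd cμ m c₀ C₀ L p).toNNReal : ℝ≥0) : ℝ≥0∞) *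
          (weakOpNorm T + diniNorm ω) = C₁ * A * (weightConst cd cμ m c₀ C₀ L p).toNNReal := by
        rw [← hCA]; push_cast; ring
      rw [h1]
      push_cast
      rw [ENNReal.coe_toNNReal hat]
      ring
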